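/- Let $q,Q,T\in\mathbb{C}$ be non-zero, $T\neq 1$, and for $n\in\mathbb{Z}$ let $\mathcal{X}_n$ be the smooth projective surface obtained from $\mathbb{P}^1\times\mathbb{P}^1$ (with affine coordinates $x,y$) by blowing up successively the eight points $$q_1(x=1,y=1),\qquad q_2\left(x=T,y=\tfrac1T\right),$$ $$q_3\left(x=0,\tfrac1y=0\right)\leftarrow q_4\left(x=0,\tfrac1{xy}=0\right)\leftarrow q_5\left(x=0,\tfrac1{x^2y}=\tfrac{q^{-2n-1}}{QT}\right),$$ $$q_6\left(\tfrac1x=0,y=0\right)\leftarrow q_7\left(\tfrac1x=0,xy=1-q^nQ\right),\qquad q_8\left(\tfrac1x=0,y=q^n\right),$$ where an arrow means that the point lies on the exceptional curve of the blowup of the previous point. Let $\mathcal{H}_x,\mathcal{H}_y\in\operatorname{Pic}(\mathcal{X}_n)$ be the classes of the total transforms of the lines $x=\mathrm{const}$ and $y=\mathrm{const}$, and let $\mathcal{F}_i$ be the class of the total transform of the exceptional curve over $q_i$. Write $\overline{\mathcal{H}}_x,\overline{\mathcal{H}}_y,\overline{\mathcal{F}}_i$ for the corresponding classes on $\mathcal{X}_{n+1}$,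 and $\mathcal{F}_{i\cdots j}=\mathcal{F}_i+\cdots+\mathcal{F}_j$. Consider the birational maps $\varphi_1^{(n)}:(x_n,y_n)\mapsto(x_n,y_{n+1})$ and $\varphi_2^{(n)}:(x_n,y_n)\mapsto(x_{n-1},y_n)$ given by $$y_{n+1}=\frac{q^{2n+1}Q(T-x_n)(x_n-1)+x_n(x_ny_n-1)}{x_n^2(x_ny_n-1)},\qquad x_{n-1}=\frac{(y_n-q^n)(x_ny_n-1)-q^{2n}Q(Ty_n-1)(y_n-1)}{y_n(y_n-q^n)(x_ny_n-1)},$$ and let $\varphi=\varphi^{(n)}=\bigl(\varphi_2^{(n+1)}\bigr)^{-1}\circ\varphi_1^{(n)}:(x_n,y_n)\mapsto(x_{n+1},y_{n+1})$. **Lemma.** For all $m\in\mathbb{Z}$, the classes $\mathcal{H}_x,\mathcal{H}_y,\mathcal{F}_1,\dots,\mathcal{F}_8$ form a $\mathbb{Z}$-basis of $\operatorname{Pic}(\mathcal{X}_m)$. Let $n\in\mathbb{Z}$ be such that $q^{n+1}\ne1$, $q^{n+1}T\neq1$ and $q^{n+1}Q\neq1$. Then $\varphi$ lifts to an isomorphism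 $\mathcal{X}_n\to\mathcal{X}_{n+1}$ (so the parameters evolve by $(T,Q,q,n)\mapsto(T,Q,q,n+1)$), and the induced linear isomorphism $\varphi_*:\operatorname{Pic}(\mathcal{X}_n)\to\operatorname{Pic}(\mathcal{X}_{n+1})$ is $$\begin{aligned} \mathcal{H}_x&\mapsto\overline{\mathcal{H}}_x+3\overline{\mathcal{H}}_y-\overline{\mathcal{F}}_{123678},& \mathcal{H}_y&\mapsto3\overline{\mathcal{H}}_x+6\overline{\mathcal{H}}_y-2\overline{\mathcal{F}}_{1237}-\overline{\mathcal{F}}_{45}-3\overline{\mathcal{F}}_{68},\\ \mathcal{F}_1&\mapsto\overline{\mathcal{H}}_x+2\overline{\mathcal{H}}_y-\overline{\mathcal{F}}_{23678},& \mathcal{F}_2&\mapsto\overline{\mathcal{H}}_x+2\overline{\mathcal{H}}_y-\overline{\mathcal{F}}_{13678},\\ \mathcal{F}_3&\mapsto\overline{\mathcal{H}}_x+3\overline{\mathcal{H}}_y-\overline{\mathcal{F}}_{1235678},& \mathcal{F}_4&\mapsto\overline{\mathcal{H}}_x+3\overline{\mathcal{H}}_y-\overline{\mathcal{F}}_{1234678},\\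 \mathcal{F}_5&\mapsto\overline{\mathcal{H}}_x+2\overline{\mathcal{H}}_y-\overline{\mathcal{F}}_{12678},& \mathcal{F}_6&\mapsto\overline{\mathcal{H}}_x+2\overline{\mathcal{H}}_y-\overline{\mathcal{F}}_{12368},\\ \mathcal{F}_7&\mapsto\overline{\mathcal{H}}_y-\overline{\mathcal{F}}_8,& \mathcal{F}_8&\mapsto\overline{\mathcal{H}}_y-\overline{\mathcal{F}}_6. \end{aligned}$$ -/

import Mathlib

noncomputable section

namespace QLaguerre

/-! ### Surfaces as models of the rational function field

An integral separated scheme of finite type over `ℂ` with function field `K` is described, in the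
classical manner of Zariski, by the set of the local rings of its (scheme-theoretic) points, all of
them local subrings of `K`. All surfaces below are birational to `ℙ¹ × ℙ¹`, so `K = ℂ(x, y)`. -/

/-- The field `ℂ(x, y)` of rational functions on `ℙ¹ × ℙ¹`. -/
abbrev K : Type := FractionRing (MvPolynomial (Fin 2) ℂ)

/-- The coordinate function `x`. -/
def x : K := algebraMap (MvPolynomial (Fin 2) ℂ) K (MvPolynomial.X 0)

/-- The coordinate function `y`. -/
def y : K := algebraMap (MvPolynomial (Fin 2) ℂ) K (MvPolynomial.X 1)

/-- A complex number as a constant rational function. -/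
def c (a : ℂ) : K := algebraMap ℂ K a

/-- A model of `K`: the set of the local rings of all points of a variety with function
field `K`. -/
abbrev Model : Type := Set (LocalSubring K)

/-- The rational function `f` is regular at the point with local ring `R`, and vanishes there. -/
def Vanishes (R : LocalSubring K) (f : K) : Prop :=
  ∃ h : f ∈ R.toSubring, (⟨f, h⟩ : R.toSubring) ∈ IsLocalRing.maximalIdeal R.toSubring

/-- The coordinate ring `ℂ[u, v] ⊆ K` of the affine chart with coordinates `u, v`. -/
def chartRing (u v : K) : Subring K := (Algebra.adjoin ℂ {u, v}).toSubring

/-- The points of the affine chart with coordinates `u, v`: the localizations of `ℂ[u, v]` at all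
its prime ideals. -/
def chart (u v : K) : Model :=
  {R | ∃ (P : Ideal (chartRing u v)) (_ : P.IsPrime), R = LocalSubring.ofPrime (chartRing u v) P}

/-- `R` is the local ring of the point `u = v = 0` of the chart with coordinates `u, v`. -/
def IsOrigin (u v : K) (R : LocalSubring K) : Prop :=
  R ∈ chart u v ∧ Vanishes R u ∧ Vanishes R v

/-- The surface `ℙ¹ × ℙ¹`, covered by its four standard affine charts. -/
def P1P1 : Model := chart x y ∪ chart x⁻¹ y ∪ chart x y⁻¹ ∪ chart x⁻¹ y⁻¹

/-- The blowup of the surface `X` at its point that is the origin `u = v = 0` of a chart with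
coordinates `u, v`. This point is removed; the points of the exceptional curve are put in its place:
they are the points of the chart `(u, v / u)` with `u = 0`, and those of the chart `(u / v, v)`
with `v = 0`. -/
def blowUp (X : Model) (u v : K) : Model :=
  {R | R ∈ X ∧ ¬ IsOrigin u v R} ∪
    {R | R ∈ chart u (v / u) ∧ Vanishes R u} ∪
    {R | R ∈ chart (u / v) v ∧ Vanishes R v}

/-! ### Divisors and the Picard group -/

/-- A prime divisor (irreducible curve) of `X`, given by its generic point, which is a point of
`X` of codimension one, that is, one whose local ring is a discrete valuation ring (of `K`). -/
structure PrimeDivisor (X : Model) where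
  /-- the local ring of the generic point of the curve -/
  ring : LocalSubring K
  mem : ring ∈ X
  dvr : IsDiscreteValuationRing ring.toSubring
  frac : IsFractionRing ring.toSubring K

attribute [instance] PrimeDivisor.dvr PrimeDivisor.frac

/-- The order of vanishing of the rational function `f ≠ 0` along the prime divisor `P`. -/
def PrimeDivisor.ord {X : Model} (P : PrimeDivisor X) (f : K) : ℤ :=
  -WithZero.log ((IsDiscreteValuationRing.maximalIdeal P.ring.toSubring).valuation K f)

/-- Divisors on `X`: finite formal integral combinations of prime divisors. -/
abbrev Div (X : Model) : Type := PrimeDivisor X →₀ ℤ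

/-- The subgroup of principal divisors. -/
def principal (X : Model) : AddSubgroup (Div X) :=
  AddSubgroup.closure {D | ∃ f : K, f ≠ 0 ∧ ∀ P : PrimeDivisor X, D P = P.ord f}

/-- The Picard group of the smooth surface `X`: divisors modulo linear equivalence. -/
abbrev Pic (X : Model) : Type := Div X ⧸ principal X

/-- The class of a divisor. -/
def cls {X : Model} (D : Div X) : Pic X := QuotientAddGroup.mk D

open Classical in
/-- The divisor with prescribed multiplicities; it is only used where these vanish for all but
finitely many prime divisors. -/
def divisorOf {X : Model} (m : PrimeDivisor X → ℤ) : Div X :=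
  if h : (Function.support m).Finite then Finsupp.ofSupportFinite m h else 0

/-- The class of the pole divisor of `f`. If `f` is a morphism from `X` to `ℙ¹`, this is the pullback
of the point `∞`, hence the class of every fibre of `f`. -/
def fibreClass (X : Model) (f : K) : Pic X :=
  cls (divisorOf fun P => max 0 (-P.ord f))

/-- The class on `X` of the total transform of the exceptional curve of the blowup at the
point `u = v = 0`. Its multiplicity along a prime divisor `P` is the order along `P` of the ideal
`(u, v)` if `P` lies over that point (that is, if `u` and `v` both vanish along `P`), and zero
otherwise. -/
def exceptionalClass (X : Model) (u v : K) : Pic X :=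
  cls (divisorOf fun P => max 0 (min (P.ord u) (P.ord v)))

/-! ### The family of `q`-Laguerre surfaces -/

/-- Coordinates `(u, v)` of a chart centred at the base point `q_i`, for `1 ≤ i ≤ 8`. -/
def center (q Q T : ℂ) (n : ℤ) : ℕ → K × K
  | 1 => (x - 1, y - 1)
  | 2 => (x - c T, y - c (1 / T))
  | 3 => (x, 1 / y)
  | 4 => (x, 1 / (x * y))
  | 5 => (x, 1 / (x ^ 2 * y) - c (q ^ (-2 * n - 1) / (Q * T)))
  | 6 => (1 / x, y)
  | 7 => (1 / x, x * y - c (1 - q ^ n * Q))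
  | 8 => (1 / x, y - c (q ^ n))
  | _ => (1, 1)

/-- The surface obtained from `ℙ¹ × ℙ¹` by blowing up `q_1, …, q_k` one after the other. -/
def stage (q Q T : ℂ) (n : ℤ) : ℕ → Model
  | 0 => P1P1
  | k + 1 => blowUp (stage q Q T n k) (center q Q T n (k + 1)).1 (center q Q T n (k + 1)).2

/-- The surface `X_n` with parameters `q, Q, T, n`: the blowup of `ℙ¹ × ℙ¹` at `q_1, …, q_8`. -/
def surface (q Q T : ℂ) (n : ℤ) : Model := stage q Q T n 8

/-- The class `H_x` of the (total transform of the) lines `x = const`. -/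
def Hx (q Q T : ℂ) (n : ℤ) : Pic (surface q Q T n) := fibreClass _ x

/-- The class `H_y` of the (total transform of the) lines `y = const`. -/
def Hy (q Q T : ℂ) (n : ℤ) : Pic (surface q Q T n) := fibreClass _ y

/-- The class `F_i`, for `1 ≤ i ≤ 8`. -/
def F (q Q T : ℂ) (n : ℤ) (i : ℕ) : Pic (surface q Q T n) :=
  exceptionalClass _ (center q Q T n i).1 (center q Q T n i).2

/-- The sum `F_{i⋯j} = F_i + ⋯ + F_j` over a set of indices. -/
def FF (q Q T : ℂ) (n : ℤ) (s : Finset ℕ) : Pic (surface q Q T n) := ∑ i ∈ s, F q Q T n i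

/-- The family `H_x, H_y, F_1, …, F_8`. -/
def generators (q Q T : ℂ) (n : ℤ) : Fin 2 ⊕ Fin 8 → Pic (surface q Q T n) :=
  Sum.elim ![Hx q Q T n, Hy q Q T n] fun i => F q Q T n ((i : ℕ) + 1)

/-! ### The `q`-Laguerre map

A birational map of surfaces with function field `K` is given by its comorphism, an automorphism
of `K` over `ℂ`. The comorphism sends the coordinate functions of the target to their expressions
in the coordinates of the source. -/

/-- `φ` is the comorphism of the forward half-step `(x_n, y_n) ↦ (x_n, y_{n+1})`. -/
def IsForwardHalfStep (q Q T : ℂ) (n : ℤ) (φ : K ≃ₐ[ℂ] K) : Prop :=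
  φ x = x ∧
  φ y = (c (q ^ (2 * n + 1) * Q) * (c T - x) * (x - 1) + x * (x * y - 1)) /
    (x ^ 2 * (x * y - 1))

/-- `φ` is the comorphism of the backward half-step `(x_n, y_n) ↦ (x_{n-1}, y_n)`. -/
def IsBackwardHalfStep (q Q T : ℂ) (n : ℤ) (φ : K ≃ₐ[ℂ] K) : Prop :=
  φ x = ((y - c (q ^ n)) * (x * y - 1) - c (q ^ (2 * n) * Q) * (c T * y - 1) * (y - 1)) /
    (y * (y - c (q ^ n)) * (x * y - 1)) ∧
  φ y = y

/-- `φ` is the comorphism of the full step `(x_n, y_n) ↦ (x_{n+1}, y_{n+1})`, the composition of the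
forward half-step with index `n`, followed by the inverse of the backward half-step with
index `n + 1` (comorphisms compose in the opposite order). -/
def IsFullStep (q Q T : ℂ) (n : ℤ) (φ : K ≃ₐ[ℂ] K) : Prop :=
  ∃ φ₁ φ₂ : K ≃ₐ[ℂ] K, IsForwardHalfStep q Q T n φ₁ ∧ IsBackwardHalfStep q Q T (n + 1) φ₂ ∧
    ∀ f, φ f = φ₁ (φ₂.symm f)

/-- The birational map `X ⇢ X'` with comorphism `φ` is an isomorphism: `φ` matches the local rings of
the points of `X'` with those of the points of `X`. -/
def IsIsomorphism (X X' : Model) (φ : K ≃ₐ[ℂ] K) : Prop :=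
  LocalSubring.map (φ : K →+* K) '' X' = X

/-- `Φ` is the pushforward of divisor classes under the isomorphism `X → X'` with comorphism `φ`: it
sends the class of every curve on `X` to the class of its image on `X'`. -/
def IsPushforward {X X' : Model} (φ : K ≃ₐ[ℂ] K) (Φ : Pic X ≃ₗ[ℤ] Pic X') : Prop :=
  ∀ P : PrimeDivisor X, ∃ P' : PrimeDivisor X',
    LocalSubring.map (φ : K →+* K) P'.ring = P.ring ∧
    Φ (cls (Finsupp.single P 1)) = cls (Finsupp.single P' 1)

end QLaguerre

end

open QLaguerre

/-! With `w = x y - 1` and `W` its counterpart after the half-step, both half-steps are fibrewise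
inversions. For fixed `x` the forward one is `w W = -C (x - 1)(x - T) / x`. For fixed `y` the
backward one is `w W = -l m (y - 1)(T y - 1) / (y - l)`. The full step factors through an
intermediate surface `middle`, a blowup of the same shape as the two given ones. The shape has
parameters `κ`, `l`, `m`, which locate the last point over `(0, ∞)`, the point `(∞, l)` and the
second point over `(∞, 0)`. The forward half-step replaces `l = q ^ n`, `m = q ^ n * Q` by their
values for `n + 1`; the inverse of the backward one then does the same for `κ`. Both relations are
symmetric in source and target, so for each it is enough to see in one direction that points go to
points.

A point is a local subring of `K`. The predicate `Gen R u v` says that `R` is a localization of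
`ℂ[u, v]` at a prime without naming the prime: `R` is generated by constants, `u`, `v` and the
inverses of its units. By `Gen.change`, passing to another chart at `R` only requires writing each
pair of coordinates as fractions in the other, with denominators that are units of `R`. The points
of the surfaces are listed chart by chart in `Pt` (`mem_surface_iff`), and the relation is solved in
every chart (`Flip1.pt`, `Flip2.pt`). Geometrically the forward inversion exchanges the sections `y
= ∞` and `x y = 1`, the backward one exchanges `x = ∞` and `x y = 1`, and each exchanges degenerate
fibres with exceptional curves. For the isomorphisms, the three inequalities on `q ^ (n + 1)` are
needed in the backward half-step only: two keep the line `y = l` away from the base points `(1, 1)`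
and `(T, 1 / T)`, and one keeps the point infinitely near to `(∞, 0)` off the line `y = 0`.

For the Picard group, take the ten special curves: `x = ∞`, `y = ∞` and the strict transforms of the
eight exceptional curves. Every other curve meets the affine plane. As `ℂ[x, y]` is factorial with
only constant units, the classes of the special curves form a basis (`Surf.span_curveClass`,
`Surf.linearIndependent_curveClass`). The classes `H_x, H_y, F_1, …, F_8` arise from it by the
unimodular matrix `multTable`. A half-step sends each special curve to a special curve or to one of
eight curves `f = 0` of the plane, and the class of `f = 0` is minus the sum of the orders of `f`
along the special curves (`orderTable`). Both half-steps thus become integer matrices with values in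
the Picard group of the intermediate surface, and the formula for the pushforward is the matrix
identity `stepTable_eq`. -/

noncomputable section

namespace QLaguerre

/-! ### Local subrings of a field, values of functions, and points of a chart -/

section LocalRings
variable {F : Type} [Field F]

/-! ### Membership in subrings, found by instance search -/

/-- The element `f` belongs to the subring `T`. -/
class Mem (T : Subring F) (f : F) : Prop where
  mem : f ∈ T

section Mem
variable {T : Subring F} {f g : F}

instance : Mem T 1 := ⟨T.one_mem⟩
instance (n : ℕ) [n.AtLeastTwo] : Mem T ofNat(n) := ⟨ofNat_mem T n⟩
instance [Mem T f] [Mem T g] : Mem T (f + g) := ⟨T.add_mem Mem.mem Mem.mem⟩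
instance [Mem T f] [Mem T g] : Mem T (f - g) := ⟨T.sub_mem Mem.mem Mem.mem⟩
instance [Mem T f] [Mem T g] : Mem T (f * g) := ⟨T.mul_mem Mem.mem Mem.mem⟩
instance [Mem T f] : Mem T (-f) := ⟨T.neg_mem Mem.mem⟩
instance (n : ℕ) [Mem T f] : Mem T (f ^ n) := ⟨T.pow_mem Mem.mem n⟩

end Mem

/-! ### Values of rational functions at a point -/

/-- The function `f` is regular at the point with local ring `R`, and vanishes there. -/
def Van (R : LocalSubring F) (f : F) : Prop :=
  ∃ h : f ∈ R.toSubring, (⟨f, h⟩ : R.toSubring) ∈ IsLocalRing.maximalIdeal R.toSubring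

/-- The function `f` is invertible at the point with local ring `R`. -/
def Unt (R : LocalSubring F) (f : F) : Prop := f ∈ R.toSubring ∧ f⁻¹ ∈ R.toSubring ∧ f ≠ 0

open Classical in
/-- The value of `f` at the point with local ring `R`, if `f` is regular there. -/
def res (R : LocalSubring F) (f : F) : IsLocalRing.ResidueField R.toSubring :=
  -- The value is 0 also where `f` is not regular, so vanishing and invertibility always need
  -- membership in `R` besides a condition on the value.
  if h : f ∈ R.toSubring then IsLocalRing.residue _ ⟨f, h⟩ else 0

section Res
variable {R : LocalSubring F} {f g : F}

lemma res_of_mem (h : f ∈ R.toSubring) : res R f = IsLocalRing.residue _ ⟨f, h⟩ := dif_pos h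

lemma van_iff_res : Van R f ↔ f ∈ R.toSubring ∧ res R f = 0 := by
  constructor
  · rintro ⟨h, hm⟩
    exact ⟨h, by rw [res_of_mem h, IsLocalRing.residue_eq_zero_iff]; exact hm⟩
  · rintro ⟨h, h0⟩
    refine ⟨h, ?_⟩
    rwa [res_of_mem h, IsLocalRing.residue_eq_zero_iff] at h0

lemma isUnit_iff_inv_mem (h : f ∈ R.toSubring) :
    IsUnit (⟨f, h⟩ : R.toSubring) ↔ f⁻¹ ∈ R.toSubring ∧ f ≠ 0 := by
  constructor
  · intro hu
    obtain ⟨g, hg⟩ := hu.exists_right_inv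
    have hg' : f * (g : F) = 1 := congrArg Subtype.val hg
    have h0 : f ≠ 0 := left_ne_zero_of_mul_eq_one hg'
    exact ⟨by rw [← eq_inv_of_mul_eq_one_right hg']; exact g.2, h0⟩
  · rintro ⟨hi, h0⟩
    exact IsUnit.of_mul_eq_one ⟨f⁻¹, hi⟩ (Subtype.ext (mul_inv_cancel₀ h0))

lemma unt_iff_res : Unt R f ↔ f ∈ R.toSubring ∧ res R f ≠ 0 := by
  constructor
  · rintro ⟨h, hi⟩
    refine ⟨h, ?_⟩
    rw [res_of_mem h]
    exact ((isUnit_iff_inv_mem h).2 hi).map (IsLocalRing.residue _) |>.ne_zero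
  · rintro ⟨h, h0⟩
    refine ⟨h, (isUnit_iff_inv_mem h).1 ?_⟩
    rw [res_of_mem h, Ne, IsLocalRing.residue_eq_zero_iff] at h0
    simpa using h0

/-- `R` is local, so a non-unit lies in the maximal ideal. All later case distinctions along curves
of a chart are instances of this dichotomy. -/
lemma van_or_unt (h : f ∈ R.toSubring) : Van R f ∨ Unt R f := by
  rw [van_iff_res, unt_iff_res]
  by_cases h0 : res R f = 0 <;> simp [h, h0]

lemma Van.mem (h : Van R f) : f ∈ R.toSubring := h.1
lemma Unt.mem (h : Unt R f) : f ∈ R.toSubring := h.1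
lemma Unt.inv_mem (h : Unt R f) : f⁻¹ ∈ R.toSubring := h.2.1
lemma Unt.ne_zero (h : Unt R f) : f ≠ 0 := h.2.2
lemma Van.res (h : Van R f) : res R f = 0 := (van_iff_res.1 h).2
lemma Unt.res (h : Unt R f) : QLaguerre.res R f ≠ 0 := (unt_iff_res.1 h).2
lemma Van.not_unt (h : Van R f) : ¬ Unt R f := fun hu => hu.res h.res
lemma Unt.not_van (h : Unt R f) : ¬ Van R f := fun hu => h.res hu.res
lemma Van.of_res [Mem R.toSubring f] (h : QLaguerre.res R f = 0) : Van R f :=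
  van_iff_res.2 ⟨Mem.mem, h⟩
lemma Unt.of_res [Mem R.toSubring f] (h : QLaguerre.res R f ≠ 0) : Unt R f :=
  unt_iff_res.2 ⟨Mem.mem, h⟩

lemma Unt.inv (h : Unt R f) : Unt R f⁻¹ := ⟨h.2.1, by simpa using h.1, inv_ne_zero h.2.2⟩
lemma Unt.mul (h : Unt R f) (h' : Unt R g) : Unt R (f * g) :=
  ⟨mul_mem h.1 h'.1, by rw [mul_inv]; exact mul_mem h.2.1 h'.2.1, mul_ne_zero h.2.2 h'.2.2⟩
lemma Unt.div (h : Unt R f) (h' : Unt R g) : Unt R (f / g) := div_eq_mul_inv f g ▸ h.mul h'.inv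
lemma Unt.neg (h : Unt R f) : Unt R (-f) :=
  ⟨neg_mem h.1, by rw [inv_neg]; exact neg_mem h.2.1, neg_ne_zero.2 h.2.2⟩
lemma Unt.pow (h : Unt R f) (n : ℕ) : Unt R (f ^ n) :=
  ⟨pow_mem h.1 n, by rw [← inv_pow]; exact pow_mem h.2.1 n, pow_ne_zero n h.2.2⟩

@[simp] lemma res_zero : res R 0 = 0 := by
  rw [res_of_mem (zero_mem _)]; exact map_zero (IsLocalRing.residue R.toSubring)
@[simp] lemma res_one : res R 1 = 1 := by
  rw [res_of_mem (one_mem _)]; exact map_one (IsLocalRing.residue R.toSubring)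
@[simp] lemma res_add [Mem R.toSubring f] [Mem R.toSubring g] :
    res R (f + g) = res R f + res R g := by
  rw [res_of_mem (Mem.mem : f ∈ R.toSubring), res_of_mem (Mem.mem : g ∈ R.toSubring),
    res_of_mem (add_mem Mem.mem Mem.mem), ← map_add]; rfl
@[simp] lemma res_sub [Mem R.toSubring f] [Mem R.toSubring g] :
    res R (f - g) = res R f - res R g := by
  rw [res_of_mem (Mem.mem : f ∈ R.toSubring), res_of_mem (Mem.mem : g ∈ R.toSubring),
    res_of_mem (sub_mem Mem.mem Mem.mem), ← map_sub]; rfl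
@[simp] lemma res_mul [Mem R.toSubring f] [Mem R.toSubring g] :
    res R (f * g) = res R f * res R g := by
  rw [res_of_mem (Mem.mem : f ∈ R.toSubring), res_of_mem (Mem.mem : g ∈ R.toSubring),
    res_of_mem (mul_mem Mem.mem Mem.mem), ← map_mul]; rfl
@[simp] lemma res_neg [Mem R.toSubring f] : res R (-f) = -res R f := by
  rw [res_of_mem (Mem.mem : f ∈ R.toSubring), res_of_mem (neg_mem Mem.mem), ← map_neg]; rfl
@[simp] lemma res_pow [Mem R.toSubring f] (n : ℕ) : res R (f ^ n) = res R f ^ n := by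
  rw [res_of_mem (Mem.mem : f ∈ R.toSubring), res_of_mem (pow_mem Mem.mem n), ← map_pow]; rfl

lemma Unt.one : Unt R 1 := ⟨one_mem _, by simp, one_ne_zero⟩

lemma Van.div (hf : Van R f) (hg : Unt R g) : Van R (f / g) := by
  have : Mem R.toSubring f := ⟨hf.mem⟩
  have : Mem R.toSubring g⁻¹ := ⟨hg.inv_mem⟩
  rw [div_eq_mul_inv]
  exact .of_res (by simp [hf.res])

lemma mem_ofPrime_iff (A : Subring F) (P : Ideal A) [P.IsPrime] (f : F) :
    f ∈ (LocalSubring.ofPrime A P).toSubring ↔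
      ∃ a b : A, b ∉ P ∧ f = (a : F) / (b : F) := by
  constructor
  · intro hf
    obtain ⟨⟨a, b⟩, hab⟩ := IsLocalization.surj (M := P.primeCompl)
      (⟨f, hf⟩ : (LocalSubring.ofPrime A P).toSubring)
    refine ⟨a, b, b.2, ?_⟩
    have hb : (b : A) ≠ 0 := fun h => b.2 (h ▸ P.zero_mem)
    have hb' : ((b : A) : F) ≠ 0 := by simpa using hb
    rw [eq_div_iff hb']
    exact congrArg Subtype.val hab
  · rintro ⟨a, b, hb, rfl⟩
    have hu := IsLocalization.map_units (LocalSubring.ofPrime A P).toSubring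
      (⟨b, hb⟩ : P.primeCompl)
    have h2 := (isUnit_iff_inv_mem (R := LocalSubring.ofPrime A P)
      (LocalSubring.le_ofPrime A P b.2)).1 hu
    rw [div_eq_mul_inv]
    exact mul_mem (LocalSubring.le_ofPrime A P a.2) h2.1

lemma van_ofPrime_iff (A : Subring F) (P : Ideal A) [P.IsPrime] (f : A) :
    Van (LocalSubring.ofPrime A P) (f : F) ↔ f ∈ P := by
  have h := IsLocalization.AtPrime.to_map_mem_maximal_iff (LocalSubring.ofPrime A P).toSubring P f
  exact ⟨fun ⟨_, h1⟩ => h.1 h1, fun h1 => ⟨LocalSubring.le_ofPrime A P f.2, h.2 h1⟩⟩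

lemma unt_ofPrime_iff (A : Subring F) (P : Ideal A) [P.IsPrime] (f : A) :
    Unt (LocalSubring.ofPrime A P) (f : F) ↔ f ∉ P := by
  rw [← van_ofPrime_iff A P]
  have := van_or_unt (LocalSubring.le_ofPrime A P f.2)
  exact ⟨fun h => h.not_van, fun h => this.resolve_left h⟩

/-- The ideal of a chart of the functions that vanish at the point with local ring `R`. -/
def centerIdeal (R : LocalSubring F) (A : Subring F) (h : A ≤ R.toSubring) : Ideal A :=
  (IsLocalRing.maximalIdeal R.toSubring).comap (Subring.inclusion h)

instance (A : Subring F) (h : A ≤ R.toSubring) : (centerIdeal R A h).IsPrime :=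
  Ideal.comap_isPrime _ _

lemma mem_centerIdeal {A : Subring F} {h : A ≤ R.toSubring} {f : A} :
    f ∈ centerIdeal R A h ↔ Van R (f : F) :=
  ⟨fun h1 => ⟨h f.2, h1⟩, fun ⟨_, h1⟩ => h1⟩

variable [Algebra ℂ F]

/-! ### Constants -/

/-- A complex number as an element of an extension field of `ℂ`. -/
def con (a : ℂ) : F := algebraMap ℂ F a

@[simp] lemma con_zero : (con 0 : F) = 0 := map_zero _
@[simp] lemma con_one : (con 1 : F) = 1 := map_one _
lemma con_sub (a b : ℂ) : (con (a - b) : F) = con a - con b := map_sub _ _ _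
lemma con_neg (a : ℂ) : (con (-a) : F) = -con a := map_neg _ _
lemma con_mul (a b : ℂ) : (con (a * b) : F) = con a * con b := map_mul _ _ _
lemma con_inv (a : ℂ) : (con a⁻¹ : F) = (con a)⁻¹ := map_inv₀ _ _
lemma con_pow (a : ℂ) (n : ℕ) : (con (a ^ n) : F) = con a ^ n := map_pow _ _ _
@[simp] lemma con_eq_zero {a : ℂ} : (con a : F) = 0 ↔ a = 0 := map_eq_zero _
lemma con_ne_zero {a : ℂ} (h : a ≠ 0) : (con a : F) ≠ 0 := by simpa using h

/-- The subring `T` contains the constants. -/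
class HasConst (T : Subring F) : Prop where
  mem : ∀ a : ℂ, con a ∈ T

instance {T : Subring F} [HasConst T] (a : ℂ) : Mem T (con a) := ⟨HasConst.mem a⟩

lemma Unt.con [HasConst R.toSubring] {a : ℂ} (h : a ≠ 0) : Unt R (QLaguerre.con a) :=
  ⟨HasConst.mem a, by rw [← con_inv]; exact HasConst.mem _, con_ne_zero h⟩

@[simp] lemma res_con_eq_zero [HasConst R.toSubring] {a : ℂ} : res R (con a) = 0 ↔ a = 0 := by
  constructor
  · intro h
    by_contra ha
    exact (Unt.con ha).res h
  · rintro rfl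
    simp

/-- A subring `T` of `R` containing the constants, and with any function that is invertible at `R`, also
its inverse. -/
structure Sub (R : LocalSubring F) (T : Subring F) : Prop where
  le : T ≤ R.toSubring
  const : ∀ a : ℂ, con a ∈ T
  inv : ∀ f ∈ T, f⁻¹ ∈ R.toSubring → f⁻¹ ∈ T

lemma Sub.hasConst {T : Subring F} (h : Sub R T) : HasConst T ∧ HasConst R.toSubring :=
  ⟨⟨h.const⟩, ⟨fun a => h.le (h.const a)⟩⟩
lemma Sub.mem {T : Subring F} (h : Sub R T) (hf : f ∈ T) : Mem T f ∧ Mem R.toSubring f :=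
  ⟨⟨hf⟩, ⟨h.le hf⟩⟩
lemma Sub.self [h : HasConst R.toSubring] : Sub R R.toSubring := ⟨le_rfl, h.mem, fun _ _ h => h⟩
lemma Sub.div {T : Subring F} (h : Sub R T) (hg : Unt R g) [Mem T f] [Mem T g] : f / g ∈ T :=
  div_eq_mul_inv f g ▸ mul_mem Mem.mem (h.inv g Mem.mem hg.2.1)

/-- `R` is generated by the constants, `u`, `v` and inverses of units. -/
structure Gen (R : LocalSubring F) (u v : F) : Prop where
  const : HasConst R.toSubring
  left : u ∈ R.toSubring
  right : v ∈ R.toSubring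
  min : ∀ T : Subring F, Sub R T → u ∈ T → v ∈ T → R.toSubring ≤ T

lemma Gen.sub {u v : F} (h : Gen R u v) : Sub R R.toSubring := have := h.const; .self

/-- The key to all changes of chart. The two pairs lie in the same subrings `T` closed under the
inverses available in `R`, so one pair generates `R` if the other does. Arbitrary `T` are needed:
with `T = R` alone one would get regularity of the new coordinates, not generation. -/
lemma Gen.change {u v p q : F} (h : Gen R p q)
    (h₁ : ∀ T, Sub R T → p ∈ T → q ∈ T → u ∈ T ∧ v ∈ T)
    (h₂ : ∀ T, Sub R T → u ∈ T → v ∈ T → p ∈ T ∧ q ∈ T) : Gen R u v := by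
  have h0 := h₁ _ h.sub h.left h.right
  exact ⟨h.const, h0.1, h0.2, fun T hT hu hv => h.min T hT (h₂ T hT hu hv).1 (h₂ T hT hu hv).2⟩

lemma Gen.swap {u v : F} (h : Gen R u v) : Gen R v u :=
  h.change (fun _ _ hp hq => ⟨hq, hp⟩) (fun _ _ hp hq => ⟨hq, hp⟩)

/-- The coordinate ring `ℂ[u, v]` of the chart with coordinates `u, v`. -/
def chartSubring (u v : F) : Subring F := (Algebra.adjoin ℂ {u, v}).toSubring

lemma mem_chartSubring_const (u v : F) (a : ℂ) : con a ∈ chartSubring u v :=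
  (Algebra.adjoin ℂ {u, v}).algebraMap_mem a
lemma left_mem_chartSubring (u v : F) : u ∈ chartSubring u v :=
  Algebra.subset_adjoin (by simp)
lemma right_mem_chartSubring (u v : F) : v ∈ chartSubring u v :=
  Algebra.subset_adjoin (by simp)
lemma chartSubring_le {u v : F} {T : Subring F} (hc : ∀ a, con a ∈ T) (hu : u ∈ T) (hv : v ∈ T) :
    chartSubring u v ≤ T := by
  intro f hf
  change f ∈ Algebra.adjoin ℂ {u, v} at hf
  induction hf using Algebra.adjoin_induction with
  | mem z hz => rcases hz with rfl | rfl <;> assumption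
  | algebraMap r => exact hc r
  | add _ _ _ _ h1 h2 => exact add_mem h1 h2
  | mul _ _ _ _ h1 h2 => exact mul_mem h1 h2

lemma gen_ofPrime (u v : F) (P : Ideal (chartSubring u v)) [P.IsPrime] :
    Gen (LocalSubring.ofPrime (chartSubring u v) P) u v := by
  have hle := LocalSubring.le_ofPrime (chartSubring u v) P
  refine ⟨⟨fun a => hle (mem_chartSubring_const u v a)⟩, hle (left_mem_chartSubring u v),
    hle (right_mem_chartSubring u v), fun T hT hu hv f hf => ?_⟩
  obtain ⟨a, b, hb, rfl⟩ := (mem_ofPrime_iff _ _ _).1 hf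
  have hA := chartSubring_le hT.const hu hv
  rw [div_eq_mul_inv]
  exact mul_mem (hA a.2) (hT.inv _ (hA b.2) ((unt_ofPrime_iff _ _ b).2 hb).2.1)

lemma Gen.chartSubring_le {u v : F} (h : Gen R u v) : chartSubring u v ≤ R.toSubring :=
  QLaguerre.chartSubring_le h.const.mem h.left h.right

/-- The prime is the centre of `R` on the chart. Elements outside the centre are units of `R`, so
the localization is contained in `R`; the localization satisfies `Sub`, so minimality of `R` gives
the other inclusion. -/
lemma Gen.eq_ofPrime {u v : F} (h : Gen R u v) :
    R = LocalSubring.ofPrime (chartSubring u v) (centerIdeal R _ h.chartSubring_le) := by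
  apply LocalSubring.toSubring_injective
  set P := centerIdeal R _ h.chartSubring_le
  have hg := gen_ofPrime u v P
  have hnv : ∀ a : chartSubring u v, a ∉ P → Unt R (a : F) := fun a ha =>
    (van_or_unt (h.chartSubring_le a.2)).resolve_left fun h' => ha (mem_centerIdeal.2 h')
  have hle : (LocalSubring.ofPrime (chartSubring u v) P).toSubring ≤ R.toSubring := by
    intro f hf
    obtain ⟨a, b, hb, rfl⟩ := (mem_ofPrime_iff _ _ _).1 hf
    rw [div_eq_mul_inv]
    exact mul_mem (h.chartSubring_le a.2) (hnv b hb).2.1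
  refine le_antisymm ?_ hle
  -- Closure under inverses: if the inverse of `a / b` is in `R`, then `a` is a unit of `R`, hence
  -- outside the centre, and `b / a` is again a fraction of the localization.
  · refine h.min _ ⟨hle, hg.const.mem, fun f hf hfi => ?_⟩ hg.left hg.right
    obtain ⟨a, b, hb, rfl⟩ := (mem_ofPrime_iff _ _ _).1 hf
    rcases eq_or_ne (a : F) 0 with h0 | h0
    · simp [h0, zero_mem]
    refine (mem_ofPrime_iff _ _ _).2 ⟨b, a, fun ha => ?_, by rw [inv_div]⟩
    have hu : Unt R (a : F) := by
      refine ⟨h.chartSubring_le a.2, ?_, h0⟩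
      have hbu := hnv b hb
      have : (a : F)⁻¹ = ((a : F) / b)⁻¹ * (b : F)⁻¹ := by
        have := hbu.ne_zero
        field_simp
      rw [this]
      exact mul_mem hfi hbu.2.1
    exact hu.not_van (mem_centerIdeal.1 ha)

lemma exists_prime_iff_gen {u v : F} : (∃ (P : Ideal (chartSubring u v)) (_ : P.IsPrime),
    R = LocalSubring.ofPrime (chartSubring u v) P) ↔ Gen R u v := by
  constructor
  · rintro ⟨P, hP, rfl⟩
    exact gen_ofPrime u v P
  · intro h
    exact ⟨_, inferInstance, h.eq_ofPrime⟩

end Res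

end LocalRings

lemma mem_chart_iff {u v : K} {R : LocalSubring K} : R ∈ chart u v ↔ Gen R u v :=
  exists_prime_iff_gen

lemma vanishes_iff {R : LocalSubring K} {f : K} : Vanishes R f ↔ Van R f := Iff.rfl

/-! ### The forward half-step: changes of chart over finite `x` and over `(0, ∞)` -/

section Flip1
variable {F : Type} [Field F] [Algebra ℂ F]

/-- The relation between `(x, y)` and `(x, Y)` of the forward half-step, and that between the
parameters of the source and the target. -/
structure Flip1 (C κ l m L M a b : ℂ) (x y Y : F) : Prop where
  -- These three constraints make the inversion respect the remaining base points. At `x = 0` with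
  -- `Y` finite the relation gives `x² y = C a b = 1 / κ`. At `x = ∞` it exchanges `Y = L` with `x y
  -- = 1 - m`, and `y = l` with `x Y = 1 - M`.
  hκ : C * κ * a * b = 1
  hm : m * L = C
  hM : M * l = C
  hab : a ≠ b
  x0 : x ≠ 0
  y0 : y ≠ 0
  Y0 : Y ≠ 0
  w0 : x * y - 1 ≠ 0
  W0 : x * Y - 1 ≠ 0
  xa : x - con a ≠ 0
  xb : x - con b ≠ 0
  ya : y - con a⁻¹ ≠ 0
  Ya : Y - con a⁻¹ ≠ 0
  yb : y - con b⁻¹ ≠ 0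
  Yb : Y - con b⁻¹ ≠ 0
  s0 : (x ^ 2 * y)⁻¹ - con κ ≠ 0
  S0 : (x ^ 2 * Y)⁻¹ - con κ ≠ 0
  m0 : x * y - 1 + con m ≠ 0
  M0 : x * Y - 1 + con M ≠ 0
  l0 : y - con l ≠ 0
  L0 : Y - con L ≠ 0
  rel : x * (x * y - 1) * (x * Y - 1) = -con C * (x - con a) * (x - con b)

namespace Flip1
variable {C κ l m L M a b : ℂ} {x y Y : F} {R : LocalSubring F} {T : Subring F}

lemma con_rel (h : Flip1 C κ l m L M a b x y Y) : (con C * con κ * con a * con b : F) = 1 := by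
  rw [← con_mul, ← con_mul, ← con_mul, h.hκ, con_one]
lemma con_m (h : Flip1 C κ l m L M a b x y Y) : (con m * con L : F) = con C := by
  rw [← con_mul, h.hm]
lemma con_M (h : Flip1 C κ l m L M a b x y Y) : (con M * con l : F) = con C := by
  rw [← con_mul, h.hM]
lemma con_ne (h : Flip1 C κ l m L M a b x y Y) :
    a ≠ 0 ∧ b ≠ 0 ∧ C ≠ 0 ∧ κ ≠ 0 ∧ l ≠ 0 ∧ m ≠ 0 ∧ L ≠ 0 ∧ M ≠ 0 := by
  have := h.hκ; have := h.hm; have := h.hM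
  grind
lemma con_a (h : Flip1 C κ l m L M a b x y Y) : (con a * con a⁻¹ : F) = 1 := by
  rw [← con_mul, mul_inv_cancel₀ h.con_ne.1, con_one]

/-- At `x = 0` the relation forces `1 / (x² y) = κ`, so the fibre `x = 0` turns into the last
exceptional curve over `(0, ∞)`; the constant terms cancel by `C κ a b = 1`, which allows the
division by `x`. In names of this kind the chart after `of` is the one of `(x, Y)` around the point,
and the chart before it the one of `(x, y)`. -/
lemma e5_of_affine (h : Flip1 C κ l m L M a b x y Y) (hT : Sub R T) (hx : x ∈ T) (hY : Y ∈ T)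
    (vx : Van R x) : ((x ^ 2 * y)⁻¹ - con κ) / x ∈ T := by
  obtain ⟨_, _⟩ := hT.hasConst
  obtain ⟨_, _⟩ := hT.mem hx
  obtain ⟨_, _⟩ := hT.mem hY
  have u : Unt R (-con C * (x - con a) * (x - con b) + x * (x * Y - 1)) :=
    .of_res (by simp [vx.res, h.con_ne])
  have := h.x0; have := h.y0; have := h.rel; have := h.con_rel
  have u0 := u.ne_zero
  have hs : (x ^ 2 * y)⁻¹ * (x ^ 2 * y) = 1 := inv_mul_cancel₀ (by positivity)
  have e : ((x ^ 2 * y)⁻¹ - con κ) / x = (Y - con κ * con C * (con a + con b) + con κ * con C * x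
      - con κ * (x * Y - 1)) / (-con C * (x - con a) * (x - con b) + x * (x * Y - 1)) := by
    rw [div_eq_div_iff h.x0 u0]
    generalize (x ^ 2 * y)⁻¹ = s at *
    grind
  rw [e]
  exact hT.div u

lemma affine_of_e5 (h : Flip1 C κ l m L M a b x y Y) (hT : Sub R T) (hx : x ∈ T)
    (hG : ((x ^ 2 * Y)⁻¹ - con κ) / x ∈ T) (vx : Van R x) : y ∈ T := by
  have := h.x0; have := h.Y0; have := h.rel; have := h.con_rel
  have hs : (x ^ 2 * Y)⁻¹ * (x ^ 2 * Y) = 1 := inv_mul_cancel₀ (by positivity)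
  generalize (x ^ 2 * Y)⁻¹ = S at *
  obtain ⟨G, rfl⟩ : ∃ G, S = con κ + x * G := ⟨(S - con κ) / x, by field_simp; ring⟩
  have hG' : G ∈ T := by convert hG using 1; field_simp; ring
  obtain ⟨_, _⟩ := hT.hasConst
  obtain ⟨_, _⟩ := hT.mem hx
  obtain ⟨_, _⟩ := hT.mem hG'
  have u : Unt R (1 - x * (con κ + x * G)) := .of_res (by simp [vx.res])
  have e : y = (-(con κ + x * G) - con C * con a * con b * G
      + con C * (con a + con b - x) * (con κ + x * G)) / (1 - x * (con κ + x * G)) := by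
    rw [eq_div_iff u.ne_zero]
    apply mul_left_cancel₀ h.x0
    grind
  rw [e]
  exact hT.div u

/-- On `x = a` the right-hand side of the relation vanishes. Away from the base point `x Y - 1` is a
unit, so `x y - 1` vanishes, and the fibre `x = a` turns into the exceptional curve over `(a, 1 /
a)`. For the slope `p` one has `x y - 1 = (x - a)(x p + 1 / a)`; the second conclusion says that the
point is off the strict transform of `x y = 1`, which is the domain of the inverse change of chart.
-/
lemma e1_of_affine (h : Flip1 C κ l m L M a b x y Y) (hT : Sub R T) (hx : x ∈ T) (hY : Y ∈ T)
    (vx : Van R (x - con a)) (uw : Unt R (Y - con a⁻¹)) :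
    (y - con a⁻¹) / (x - con a) ∈ T ∧
      Unt R (x * ((y - con a⁻¹) / (x - con a)) + con a⁻¹) := by
  have := h.x0; have := h.xa; have := h.rel; have := h.con_a; have hab := h.hab
  obtain ⟨_, _⟩ := hT.hasConst
  obtain ⟨_, _⟩ := hT.mem hx
  obtain ⟨_, _⟩ := hT.mem hY
  have hxr : res R x = res R (con a) := sub_eq_zero.1 (by simpa using vx.res)
  have u1 : Unt R x := .of_res (by simp [hxr, h.con_ne])
  have u2 : Unt R (x * Y - 1) := by
    have e : x * Y - 1 = con a * (Y - con a⁻¹) + (x - con a) * Y := by grind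
    rw [e]
    exact .of_res (by simpa [hxr, h.con_ne] using uw.res)
  have u := (u1.pow 2).mul u2
  have u0 := u.ne_zero
  have e : (y - con a⁻¹) / (x - con a) =
      (-con C * (x - con b) - con a⁻¹ * x * (x * Y - 1)) / (x ^ 2 * (x * Y - 1)) := by
    rw [div_eq_div_iff h.xa u0]
    grind
  have e' : x * ((y - con a⁻¹) / (x - con a)) + con a⁻¹ = -con C * (x - con b) /
      (x * (x * Y - 1)) := by
    have := u1.ne_zero; have := u2.ne_zero
    rw [e]
    field_simp
    ring
  have hne : res R (con a) - res R (con b) ≠ 0 := by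
    rw [← res_sub, ← con_sub, Ne, res_con_eq_zero]
    exact sub_ne_zero.2 hab
  rw [e', e]
  exact ⟨hT.div u, Unt.div (.of_res (by simp [hxr, h.con_ne, hne])) (u1.mul u2)⟩

/-- The relation is symmetric in `y` and `Y`, with `(l, m)` and `(L, M)` exchanged. Every change of
chart therefore also yields one in the opposite direction, as `Gen.change` requires. -/
lemma symm (h : Flip1 C κ l m L M a b x y Y) : Flip1 C κ L M l m a b x Y y where
  __ := h
  y0 := h.Y0
  Y0 := h.y0
  w0 := h.W0
  W0 := h.w0
  ya := h.Ya
  Ya := h.ya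
  yb := h.Yb
  Yb := h.yb
  s0 := h.S0
  S0 := h.s0
  m0 := h.M0
  M0 := h.m0
  l0 := h.L0
  L0 := h.l0
  hm := h.hM
  hM := h.hm
  rel := by rw [← h.rel]; ring

lemma swap (h : Flip1 C κ l m L M a b x y Y) : Flip1 C κ l m L M b a x y Y where
  __ := h
  hκ := by rw [← h.hκ]; ring
  hab := h.hab.symm
  xa := h.xb
  xb := h.xa
  ya := h.yb
  yb := h.ya
  Ya := h.Yb
  Yb := h.Ya
  rel := by rw [h.rel]; ring

lemma affine_of_e1 (h : Flip1 C κ l m L M a b x y Y) (hT : Sub R T) (hx : x - con a ∈ T)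
    (hP : (Y - con a⁻¹) / (x - con a) ∈ T) (vx : Van R (x - con a))
    (up : Unt R (x * ((Y - con a⁻¹) / (x - con a)) + con a⁻¹)) :
    x ∈ T ∧ y ∈ T ∧ Unt R (y - con a⁻¹) := by
  have := h.x0; have hxa := h.xa; have := h.rel; have := h.con_a; have hab := h.hab
  have hP' : Y = con a⁻¹ + (x - con a) * ((Y - con a⁻¹) / (x - con a)) := by field_simp; ring
  generalize (Y - con a⁻¹) / (x - con a) = P at *
  obtain ⟨_, _⟩ := hT.hasConst
  obtain ⟨_, _⟩ := hT.mem hP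
  have hx' : x ∈ T := by simpa using add_mem hx (hT.const a)
  obtain ⟨_, _⟩ := hT.mem hx'
  have hxr : res R x = res R (con a) := sub_eq_zero.1 (by simpa using vx.res)
  have u1 : Unt R x := .of_res (by simp [hxr, h.con_ne])
  have u := (u1.pow 2).mul up
  have u0 := u.ne_zero
  have e : y = (x * (x * P + con a⁻¹) - con C * (x - con b)) / (x ^ 2 * (x * P + con a⁻¹)) := by
    rw [eq_div_iff u0]
    apply mul_left_cancel₀ hxa
    grind
  have e' : y - con a⁻¹ = (-con C * (x - con b) - con a⁻¹ * (x - con a) * x * (x * P + con a⁻¹)) /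
      (x ^ 2 * (x * P + con a⁻¹)) := by
    rw [eq_div_iff u0]
    apply mul_left_cancel₀ hxa
    grind
  refine ⟨hx', by rw [e]; exact hT.div u, ?_⟩
  rw [e']
  have hne : res R (con a) - res R (con b) ≠ 0 := by
    rw [← res_sub, ← con_sub, Ne, res_con_eq_zero]
    exact sub_ne_zero.2 hab
  exact Unt.div (.of_res (by simp [hxr, h.con_ne, hne])) u

/-- The vanishing function cuts out the strict transform of `x Y = 1` on the exceptional curve. The
inversion exchanges the sections `x Y = 1` and `y = ∞`, so this point goes to the point of `y = ∞`
over `x = a`. -/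
lemma inftyY_of_e1 (h : Flip1 C κ l m L M a b x y Y) (hT : Sub R T) (hx : x - con a ∈ T)
    (hP : (Y - con a⁻¹) / (x - con a) ∈ T) (vx : Van R (x - con a))
    (vp : Van R (x * ((Y - con a⁻¹) / (x - con a)) + con a⁻¹)) :
    x ∈ T ∧ y⁻¹ ∈ T ∧ Van R y⁻¹ ∧ Unt R x := by
  have := h.x0; have hy := h.y0; have hxa := h.xa; have := h.rel; have := h.con_a; have hab := h.hab
  have hP' : Y = con a⁻¹ + (x - con a) * ((Y - con a⁻¹) / (x - con a)) := by field_simp; ring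
  generalize (Y - con a⁻¹) / (x - con a) = P at *
  obtain ⟨_, _⟩ := hT.hasConst
  obtain ⟨_, _⟩ := hT.mem hP
  have hx' : x ∈ T := by simpa using add_mem hx (hT.const a)
  obtain ⟨_, _⟩ := hT.mem hx'
  have hxr : res R x = res R (con a) := sub_eq_zero.1 (by simpa using vx.res)
  have u1 : Unt R x := .of_res (by simp [hxr, h.con_ne])
  have hne : res R (con a) - res R (con b) ≠ 0 := by
    rw [← res_sub, ← con_sub, Ne, res_con_eq_zero]
    exact sub_ne_zero.2 hab
  have hpr : res R x * res R P + res R (con a⁻¹) = 0 := by simpa using vp.res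
  have u : Unt R (x * (x * P + con a⁻¹) - con C * (x - con b)) :=
    .of_res (by simp [hpr]; simp [hxr, h.con_ne, hne])
  have e : y⁻¹ = x ^ 2 * (x * P + con a⁻¹) / (x * (x * P + con a⁻¹) - con C * (x - con b)) := by
    rw [inv_eq_one_div, div_eq_div_iff hy u.ne_zero]
    apply mul_left_cancel₀ hxa
    grind
  refine ⟨hx', by rw [e]; exact hT.div u, ?_, u1⟩
  rw [e]
  exact Van.div (.of_res (by simp [hpr])) u

lemma e1_of_inftyY (h : Flip1 C κ l m L M a b x y Y) (hT : Sub R T) (hx : x ∈ T) (hY : Y⁻¹ ∈ T)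
    (vx : Van R (x - con a)) (vy : Van R Y⁻¹) : (y - con a⁻¹) / (x - con a) ∈ T ∧
      Van R (x * ((y - con a⁻¹) / (x - con a)) + con a⁻¹) := by
  have := h.x0; have := h.xa; have := h.rel; have := h.con_a
  have hη : Y * Y⁻¹ = 1 := mul_inv_cancel₀ h.Y0
  generalize Y⁻¹ = η at *
  obtain ⟨_, _⟩ := hT.hasConst
  obtain ⟨_, _⟩ := hT.mem hx
  obtain ⟨_, _⟩ := hT.mem hY
  have hxr : res R x = res R (con a) := sub_eq_zero.1 (by simpa using vx.res)
  have u1 : Unt R x := .of_res (by simp [hxr, h.con_ne])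
  have u2 : Unt R (x - η) := .of_res (by simpa [vy.res] using u1.res)
  have u := (u1.pow 2).mul u2
  have e : (y - con a⁻¹) / (x - con a) =
      (-con C * (x - con b) * η - con a⁻¹ * x * (x - η)) / (x ^ 2 * (x - η)) := by
    rw [div_eq_div_iff h.xa u.ne_zero]
    grind
  have e' : x * ((y - con a⁻¹) / (x - con a)) + con a⁻¹ = -con C * (x - con b) * η /
      (x * (x - η)) := by
    have := u1.ne_zero; have := u2.ne_zero
    rw [e]
    field_simp
    ring
  rw [e', e]
  exact ⟨hT.div u, Van.div (.of_res (by simp [vy.res])) (u1.mul u2)⟩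

lemma affine_of_inftyY (h : Flip1 C κ l m L M a b x y Y) (hT : Sub R T) (hx : x ∈ T)
    (hY : Y⁻¹ ∈ T) (ux : Unt R x) (vy : Van R Y⁻¹) : y ∈ T ∧ Van R (x * y - 1) := by
  have := h.rel
  have hη : Y * Y⁻¹ = 1 := mul_inv_cancel₀ h.Y0
  generalize Y⁻¹ = η at *
  obtain ⟨_, _⟩ := hT.hasConst
  obtain ⟨_, _⟩ := hT.mem hx
  obtain ⟨_, _⟩ := hT.mem hY
  have u2 : Unt R (x - η) := .of_res (by simpa [vy.res] using ux.res)
  have u := (ux.pow 2).mul u2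
  have u0 := u.ne_zero
  have e : y = (-con C * (x - con a) * (x - con b) * η + x * (x - η)) / (x ^ 2 * (x - η)) := by
    rw [eq_div_iff u0]
    grind
  have e' : x * y - 1 = -con C * (x - con a) * (x - con b) * η / (x * (x - η)) := by
    have := ux.ne_zero; have := u2.ne_zero
    rw [e]
    field_simp
    ring
  refine ⟨by rw [e]; exact hT.div u, ?_⟩
  rw [e']
  exact Van.div (.of_res (by simp [vy.res])) (ux.mul u2)

lemma affine_of_affine (h : Flip1 C κ l m L M a b x y Y) (hT : Sub R T) (hx : x ∈ T)
    (hY : Y ∈ T) (ux : Unt R x) (ua : Unt R (x - con a)) (ub : Unt R (x - con b))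
    (uw : Unt R (x * Y - 1)) : y ∈ T ∧ Unt R (x * y - 1) := by
  have := h.rel
  obtain ⟨_, _⟩ := hT.hasConst
  obtain ⟨_, _⟩ := hT.mem hx
  obtain ⟨_, _⟩ := hT.mem hY
  have u := (ux.pow 2).mul uw
  have u0 := u.ne_zero
  have e : y = (-con C * (x - con a) * (x - con b) + x * (x * Y - 1)) / (x ^ 2 * (x * Y - 1)) := by
    rw [eq_div_iff u0]
    grind
  have e' : x * y - 1 = -con C * (x - con a) * (x - con b) / (x * (x * Y - 1)) := by
    rw [eq_div_iff (ux.mul uw).ne_zero, ← h.rel]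
    ring
  refine ⟨by rw [e]; exact hT.div u, ?_⟩
  rw [e']
  exact (((Unt.con h.con_ne.2.2.1).neg.mul ua).mul ub).div (ux.mul uw)

lemma inftyY_of_affine (h : Flip1 C κ l m L M a b x y Y) (hT : Sub R T) (hx : x ∈ T)
    (hY : Y ∈ T) (ua : Unt R (x - con a)) (ub : Unt R (x - con b))
    (vw : Van R (x * Y - 1)) : y⁻¹ ∈ T ∧ Van R y⁻¹ := by
  have := h.rel; have hy := h.y0
  obtain ⟨_, _⟩ := hT.hasConst
  obtain ⟨_, _⟩ := hT.mem hx
  obtain ⟨_, _⟩ := hT.mem hY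
  have ha := ua.res
  have hb := ub.res
  have hw := vw.res
  simp only [res_sub, res_mul, res_one] at ha hb hw
  have u : Unt R (-con C * (x - con a) * (x - con b) + x * (x * Y - 1)) :=
    .of_res (by simp [ha, hb, hw, h.con_ne])
  have e : y⁻¹ = x ^ 2 * (x * Y - 1) /
      (-con C * (x - con a) * (x - con b) + x * (x * Y - 1)) := by
    rw [inv_eq_one_div, div_eq_div_iff hy u.ne_zero]
    grind
  rw [e]
  exact ⟨hT.div u, Van.div (.of_res (by simp [hw])) u⟩

/-- The point where the exceptional curve meets the strict transform of the fibre `x = a`. The two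
curves are exchanged, so their intersection is kept. -/
lemma e1'_of_e1' (h : Flip1 C κ l m L M a b x y Y) (hT : Sub R T)
    (hr : (x - con a) / (Y - con a⁻¹) ∈ T) (hY : Y - con a⁻¹ ∈ T)
    (vr : Van R ((x - con a) / (Y - con a⁻¹))) (vY : Van R (Y - con a⁻¹)) :
    (x - con a) / (y - con a⁻¹) ∈ T ∧ y - con a⁻¹ ∈ T ∧
      Van R ((x - con a) / (y - con a⁻¹)) ∧ Van R (y - con a⁻¹) := by
  have hx := h.x0; have hxa := h.xa; have := h.rel; have := h.con_a; have hab := h.hab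
  have hY0 := h.Ya; have hy0 := h.ya
  have hr' : x = con a + (x - con a) / (Y - con a⁻¹) * (Y - con a⁻¹) := by
    rw [div_mul_cancel₀ _ hY0]; ring
  have hY' : Y = Y - con a⁻¹ + con a⁻¹ := by ring
  generalize (x - con a) / (Y - con a⁻¹) = r at *
  generalize Y - con a⁻¹ = σ at *
  obtain ⟨_, _⟩ := hT.hasConst
  obtain ⟨_, _⟩ := hT.mem hr
  obtain ⟨_, _⟩ := hT.mem hY
  have hx' : x ∈ T := by rw [hr']; exact Mem.mem
  obtain ⟨_, _⟩ := hT.mem hx'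
  have hne : res R (con a) - res R (con b) ≠ 0 := by
    rw [← res_sub, ← con_sub, Ne, res_con_eq_zero]
    exact sub_ne_zero.2 hab
  have hxr : res R x = res R (con a) := by rw [hr']; simp [vY.res]
  have u1 : Unt R x := .of_res (by simp [hxr, h.con_ne])
  have u2 : Unt R (x + r * con a⁻¹) := .of_res (by simp [hxr, vr.res, h.con_ne])
  have u3 : Unt R (-con C * (x - con b)) := .of_res (by simp [hxr, h.con_ne, hne])
  have e1 : y - con a⁻¹ = (-con C * (x - con b) * r - x * (x - con a) * con a⁻¹ * (x + r * con a⁻¹))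
      / (x ^ 2 * (x + r * con a⁻¹)) := by
    rw [eq_div_iff ((u1.pow 2).mul u2).ne_zero]
    apply mul_left_cancel₀ hY0
    grind
  have u4 : Unt R (-con C * (x - con b) - x * (x * Y - 1) * con a⁻¹) := by
    have : Mem R.toSubring Y := by rw [hY']; infer_instance
    refine .of_res ?_
    have : res R Y = res R (con a⁻¹) := by rw [hY']; simp [vY.res]
    have h2 : res R (con a) * res R (con a⁻¹) = 1 := by rw [← res_mul, h.con_a, res_one]
    simp [hxr, h.con_ne, hne, this, h2]
  have : Mem T Y := by rw [hY']; infer_instance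
  have e2 : (x - con a) / (y - con a⁻¹) = x ^ 2 * (x * Y - 1) /
      (-con C * (x - con b) - x * (x * Y - 1) * con a⁻¹) := by
    rw [div_eq_div_iff hy0 u4.ne_zero]
    grind
  rw [e2, e1]
  refine ⟨hT.div u4, hT.div ((u1.pow 2).mul u2), Van.div ?_ u4,
    Van.div (.of_res (by simp [vr.res, hxr])) ((u1.pow 2).mul u2)⟩
  have e3 : x ^ 2 * (x * Y - 1) = x ^ 2 * (σ * (x + r * con a⁻¹)) := by grind
  rw [e3]
  exact .of_res (by simp [vY.res])

/-- The first two exceptional curves over `(0, ∞)` are exchanged. With `g = x Y` and `x = 0` the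
relation gives `1 / (x² y) = κ (1 - g)`, because `C κ a b = 1`; so the next base point `1 / (x² y) =
κ` corresponds to `g = 0`. -/
lemma e4_of_e3 (h : Flip1 C κ l m L M a b x y Y) (hT : Sub R T) (hg : x * Y ∈ T) (hY : Y⁻¹ ∈ T)
    (vy : Van R Y⁻¹) : x ∈ T ∧ (x ^ 2 * y)⁻¹ ∈ T ∧ Van R x ∧
      (Unt R (x * Y) → Unt R ((x ^ 2 * y)⁻¹ - con κ)) := by
  have hx := h.x0; have hy := h.y0; have := h.rel; have := h.con_rel
  have hη : Y * Y⁻¹ = 1 := mul_inv_cancel₀ h.Y0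
  have hs : (x ^ 2 * y)⁻¹ * (x ^ 2 * y) = 1 := inv_mul_cancel₀ (by positivity)
  have hxg : x = x * Y * Y⁻¹ := by rw [mul_assoc, hη, mul_one]
  generalize hg' : x * Y = g at *
  generalize Y⁻¹ = η at *
  generalize (x ^ 2 * y)⁻¹ = s at *
  obtain ⟨_, _⟩ := hT.hasConst
  obtain ⟨_, _⟩ := hT.mem hg
  obtain ⟨_, _⟩ := hT.mem hY
  have hx' : x ∈ T := by rw [hxg]; exact Mem.mem
  obtain ⟨_, _⟩ := hT.mem hx'
  have vx : Van R x := by rw [hxg]; exact .of_res (by simp [vy.res])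
  have u : Unt R (-con C * (x - con a) * (x - con b) + x * (g - 1)) :=
    .of_res (by simp [vx.res, h.con_ne])
  have e : s = (g - 1) / (-con C * (x - con a) * (x - con b) + x * (g - 1)) := by
    rw [eq_div_iff u.ne_zero]
    grind
  have e' : s - con κ = (g - 1 - con κ * (-con C * (x - con a) * (x - con b)) -
      con κ * x * (g - 1)) / (-con C * (x - con a) * (x - con b) + x * (g - 1)) := by
    rw [e, eq_div_iff u.ne_zero, sub_mul, div_mul_cancel₀ _ u.ne_zero]
    ring
  refine ⟨hx', by rw [e]; exact hT.div u, vx, fun ug => ?_⟩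
  rw [e']
  refine Unt.div (.of_res ?_) u
  have hc := congrArg (res R) h.con_rel
  simp only [res_mul, res_one] at hc
  have := ug.res
  simp only [res_sub, res_mul, res_one, res_neg, vx.res]
  intro h0
  apply this
  linear_combination h0 - hc

lemma e3_of_e4 (h : Flip1 C κ l m L M a b x y Y) (hT : Sub R T) (hx : x ∈ T)
    (hS : (x ^ 2 * Y)⁻¹ ∈ T) (vx : Van R x) (uS : Unt R ((x ^ 2 * Y)⁻¹ - con κ)) :
    x * y ∈ T ∧ y⁻¹ ∈ T ∧ Van R y⁻¹ ∧ Unt R (x * y) := by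
  have hx0 := h.x0; have hy0 := h.y0; have := h.Y0; have := h.rel; have := h.con_rel
  have hs : (x ^ 2 * Y)⁻¹ * (x ^ 2 * Y) = 1 := inv_mul_cancel₀ (by positivity)
  generalize (x ^ 2 * Y)⁻¹ = S at *
  obtain ⟨_, _⟩ := hT.hasConst
  obtain ⟨_, _⟩ := hT.mem hx
  obtain ⟨_, _⟩ := hT.mem hS
  have u1 : Unt R (1 - x * S) := .of_res (by simp [vx.res])
  have u2 : Unt R (1 - x * S - con C * (x - con a) * (x - con b) * S) := by
    refine .of_res ?_
    have hc := congrArg (res R) h.con_rel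
    simp only [res_mul, res_one] at hc
    have := uS.res
    simp only [res_sub, res_mul, res_one, vx.res] at this ⊢
    intro h0
    apply this
    linear_combination -res R (con κ) * h0 - res R S * hc
  have e1 : x * y = (1 - x * S - con C * (x - con a) * (x - con b) * S) / (1 - x * S) := by
    rw [eq_div_iff u1.ne_zero]
    grind
  have e2 : y⁻¹ = x * (1 - x * S) / (1 - x * S - con C * (x - con a) * (x - con b) * S) := by
    rw [inv_eq_one_div, div_eq_div_iff hy0 u2.ne_zero]
    grind
  rw [e1, e2]
  exact ⟨hT.div u1, hT.div u2, Van.div (.of_res (by simp [vx.res])) u2, u2.div u1⟩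

/-- Here `x Y = 0`: the first exceptional curve meets the strict transform of the fibre `x = 0`.
These two curves become the second and the third exceptional curve, so the image is the point where
those meet, in the second chart of the last blowup over `(0, ∞)`. -/
lemma e5'_of_e3 (h : Flip1 C κ l m L M a b x y Y) (hT : Sub R T) (hg : x * Y ∈ T) (hY : Y⁻¹ ∈ T)
    (vg : Van R (x * Y)) (vy : Van R Y⁻¹) :
    x / ((x ^ 2 * y)⁻¹ - con κ) ∈ T ∧ (x ^ 2 * y)⁻¹ - con κ ∈ T ∧
      Van R (x / ((x ^ 2 * y)⁻¹ - con κ)) ∧ Van R ((x ^ 2 * y)⁻¹ - con κ) := by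
  have hx := h.x0; have hy := h.y0; have := h.rel; have := h.con_rel
  have hs0 := h.s0
  have hη : Y * Y⁻¹ = 1 := mul_inv_cancel₀ h.Y0
  have hs : (x ^ 2 * y)⁻¹ * (x ^ 2 * y) = 1 := inv_mul_cancel₀ (by positivity)
  have hxg : x = x * Y * Y⁻¹ := by rw [mul_assoc, hη, mul_one]
  generalize hg' : x * Y = g at *
  generalize Y⁻¹ = η at *
  generalize (x ^ 2 * y)⁻¹ = s at *
  obtain ⟨_, _⟩ := hT.hasConst
  obtain ⟨_, _⟩ := hT.mem hg
  obtain ⟨_, _⟩ := hT.mem hY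
  have hx' : x ∈ T := by rw [hxg]; exact Mem.mem
  obtain ⟨_, _⟩ := hT.mem hx'
  have vx : Van R x := by rw [hxg]; exact .of_res (by simp [vy.res])
  have u : Unt R (-con C * (x - con a) * (x - con b) + x * (g - 1)) :=
    .of_res (by simp [vx.res, h.con_ne])
  have u' : Unt R (1 + η * (con κ * con C * (x - con a - con b) - con κ * (g - 1))) :=
    .of_res (by simp [vy.res])
  have e : s - con κ = g * (1 + η * (con κ * con C * (x - con a - con b) - con κ * (g - 1))) /
      (-con C * (x - con a) * (x - con b) + x * (g - 1)) := by
    rw [eq_div_iff u.ne_zero]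
    grind
  have e' : x / (s - con κ) = η * (-con C * (x - con a) * (x - con b) + x * (g - 1)) /
      (1 + η * (con κ * con C * (x - con a - con b) - con κ * (g - 1))) := by
    rw [div_eq_div_iff hs0 u'.ne_zero]
    rw [eq_div_iff u.ne_zero] at e
    linear_combination (1 + η * (con κ * con C * (x - con a - con b) - con κ * (g - 1))) * hxg - η * e
  rw [e', e]
  exact ⟨hT.div u', hT.div u, Van.div (.of_res (by simp [vy.res])) u',
    Van.div (.of_res (by simp [vg.res])) u⟩

lemma e3_of_e5' (h : Flip1 C κ l m L M a b x y Y) (hT : Sub R T)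
    (hr : x / ((x ^ 2 * Y)⁻¹ - con κ) ∈ T) (hS : (x ^ 2 * Y)⁻¹ - con κ ∈ T)
    (vr : Van R (x / ((x ^ 2 * Y)⁻¹ - con κ))) (vS : Van R ((x ^ 2 * Y)⁻¹ - con κ)) :
    x * y ∈ T ∧ y⁻¹ ∈ T ∧ Van R (x * y) ∧ Van R y⁻¹ := by
  have hx := h.x0; have hy := h.y0; have := h.Y0; have := h.rel; have := h.con_rel
  have hS0 := h.S0
  have hs : (x ^ 2 * Y)⁻¹ * (x ^ 2 * Y) = 1 := inv_mul_cancel₀ (by positivity)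
  generalize (x ^ 2 * Y)⁻¹ = S at *
  have hxr : x = x / (S - con κ) * (S - con κ) := by rw [div_mul_cancel₀ _ hS0]
  have hSσ : S = (S - con κ) + con κ := by ring
  generalize x / (S - con κ) = r at *
  generalize S - con κ = σ at *
  obtain ⟨_, _⟩ := hT.hasConst
  obtain ⟨_, _⟩ := hT.mem hr
  obtain ⟨_, _⟩ := hT.mem hS
  have hx' : x ∈ T := by rw [hxr]; exact Mem.mem
  obtain ⟨_, _⟩ := hT.mem hx'
  have hS' : S ∈ T := by rw [hSσ]; exact Mem.mem
  obtain ⟨_, _⟩ := hT.mem hS'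
  have vx : Van R x := by rw [hxr]; exact .of_res (by simp [vS.res])
  have u1 : Unt R (1 - x * S) := .of_res (by simp [vx.res])
  have u2 : Unt R (-con C * con a * con b + r * S * (con C * (con a + con b - x) - 1)) :=
    .of_res (by simp [vr.res, h.con_ne])
  have e1 : x * y = (-con C * con a * con b * σ + x * S * (con C * (con a + con b - x) - 1)) /
      (1 - x * S) := by
    rw [eq_div_iff u1.ne_zero]
    grind
  have e2 : y⁻¹ = r * (1 - x * S) /
      (-con C * con a * con b + r * S * (con C * (con a + con b - x) - 1)) := by
    rw [inv_eq_one_div, div_eq_div_iff hy u2.ne_zero]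
    rw [eq_div_iff u1.ne_zero] at e1
    apply mul_left_cancel₀ hS0
    grind
  rw [e1, e2]
  exact ⟨hT.div u1, hT.div u2, Van.div (.of_res (by simp [vx.res, vS.res])) u1,
    Van.div (.of_res (by simp [vr.res])) u2⟩

/-- The intersection of the first two exceptional curves over `(0, ∞)`, which are exchanged. -/
lemma e4'_of_e4' (h : Flip1 C κ l m L M a b x y Y) (hT : Sub R T) (ht : x ^ 2 * Y ∈ T)
    (hz : (x * Y)⁻¹ ∈ T) (vt : Van R (x ^ 2 * Y)) (vz : Van R (x * Y)⁻¹) :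
    x ^ 2 * y ∈ T ∧ (x * y)⁻¹ ∈ T ∧ Van R (x ^ 2 * y) ∧ Van R (x * y)⁻¹ := by
  have hx := h.x0; have hy := h.y0; have hY := h.Y0; have := h.rel
  have hzx : (x * Y)⁻¹ * (x * Y) = 1 := inv_mul_cancel₀ (by positivity)
  have hxt : x = x ^ 2 * Y * (x * Y)⁻¹ := by field_simp
  have ht0 : x ^ 2 * Y ≠ 0 := by positivity
  generalize ht' : x ^ 2 * Y = t at *
  generalize (x * Y)⁻¹ = z at *
  obtain ⟨_, _⟩ := hT.hasConst
  obtain ⟨_, _⟩ := hT.mem ht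
  obtain ⟨_, _⟩ := hT.mem hz
  have hx' : x ∈ T := by rw [hxt]; exact Mem.mem
  obtain ⟨_, _⟩ := hT.mem hx'
  have vx : Van R x := by rw [hxt]; exact .of_res (by simp [vz.res])
  have u1 : Unt R (1 - z) := .of_res (by simp [vz.res])
  have u2 : Unt R (t * (1 - z) - con C * (x - con a) * (x - con b)) :=
    .of_res (by simp [vt.res, vx.res, h.con_ne])
  have e1 : x ^ 2 * y = z * (t * (1 - z) - con C * (x - con a) * (x - con b)) / (1 - z) := by
    rw [eq_div_iff u1.ne_zero]
    apply mul_left_cancel₀ ht0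
    grind
  have e2 : (x * y)⁻¹ = t * (1 - z) / (t * (1 - z) - con C * (x - con a) * (x - con b)) := by
    rw [inv_eq_one_div, div_eq_div_iff (by positivity) u2.ne_zero]
    grind
  rw [e1, e2]
  exact ⟨hT.div u1, hT.div u2, Van.div (.of_res (by simp [vz.res])) u1,
    Van.div (.of_res (by simp [vt.res])) u2⟩

end Flip1
end Flip1

/-! ### The forward half-step: changes of chart over `x = ∞` -/

section Flip1Infinity
variable {F : Type} [Field F] [Algebra ℂ F]

namespace Flip1
variable {C κ l m L M a b : ℂ} {x y Y : F} {R : LocalSubring F} {T : Subring F}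

/-- The relation divided by `x²`, hence regular at `x = ∞`, where it reads `(x y - 1) Y = -C`. It
thus exchanges the fibre at infinity, with coordinate `Y`, and the first exceptional curve over `(∞,
0)`, with coordinate `x y`. -/
lemma rel_inv (h : Flip1 C κ l m L M a b x y Y) : (x * y - 1) * (Y - x⁻¹) =
    -con C * (1 - con a * x⁻¹) * (1 - con b * x⁻¹) := by
  have hx := h.x0
  have := h.rel
  have hi : x * x⁻¹ = 1 := mul_inv_cancel₀ hx
  generalize x⁻¹ = ξ at *
  linear_combination ξ ^ 2 * this + (-(x * y - 1) * (x * Y - 1) * ξ - (x * y - 1) * Y + con C *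
    (con a * ξ + con b * ξ - x * ξ - 1)) * hi

lemma e6_of_inftyX (h : Flip1 C κ l m L M a b x y Y) (hT : Sub R T) (hx : x⁻¹ ∈ T)
    (hY : Y ∈ T) (vx : Van R x⁻¹) (uY : Unt R Y) (uL : Unt R (Y - con L)) :
    x * y ∈ T ∧ Unt R (x * y - 1) ∧ Unt R (x * y - 1 + con m) := by
  have := h.rel_inv
  generalize x⁻¹ = ξ at *
  obtain ⟨_, _⟩ := hT.hasConst
  obtain ⟨_, _⟩ := hT.mem hx
  obtain ⟨_, _⟩ := hT.mem hY
  have u : Unt R (Y - ξ) := .of_res (by simpa [vx.res] using uY.res)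
  have e : x * y - 1 = -con C * (1 - con a * ξ) * (1 - con b * ξ) / (Y - ξ) := by
    rw [eq_div_iff u.ne_zero, this]
  have e1 : x * y = (Y - ξ - con C * (1 - con a * ξ) * (1 - con b * ξ)) / (Y - ξ) := by
    rw [eq_div_iff u.ne_zero]
    linear_combination this
  have e2 : x * y - 1 + con m = (con m * (Y - ξ) - con C * (1 - con a * ξ) * (1 - con b * ξ)) /
      (Y - ξ) := by
    rw [eq_div_iff u.ne_zero]
    linear_combination this
  refine ⟨by rw [e1]; exact hT.div u, ?_, ?_⟩
  · rw [e]
    exact Unt.div (.of_res (by simp [vx.res, h.con_ne])) u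
  · rw [e2]
    refine Unt.div (.of_res ?_) u
    -- At `x = ∞` the numerator is `m Y - C = m (Y - L)`, which is not zero because `Y ≠ L`.
    have hc := congrArg (res R) h.con_m
    have := uL.res
    have hm : res R (con m) ≠ 0 := by simp [h.con_ne]
    simp only [res_mul, res_sub, res_one, vx.res] at hc this ⊢
    intro h0
    apply this
    apply mul_left_cancel₀ hm
    linear_combination h0 - hc

lemma inftyX_of_e6 (h : Flip1 C κ l m L M a b x y Y) (hT : Sub R T) (hx : x⁻¹ ∈ T)
    (hY : x * Y ∈ T) (vx : Van R x⁻¹) (uW : Unt R (x * Y - 1)) (uM : Unt R (x * Y - 1 + con M)) :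
    y ∈ T ∧ Unt R y ∧ Unt R (y - con l) := by
  have hr := h.symm.rel_inv
  generalize x⁻¹ = ξ at *
  generalize x * Y = g at *
  obtain ⟨_, _⟩ := hT.hasConst
  obtain ⟨_, _⟩ := hT.mem hx
  obtain ⟨_, _⟩ := hT.mem hY
  have e : y = (ξ * (g - 1) - con C * (1 - con a * ξ) * (1 - con b * ξ)) / (g - 1) := by
    rw [eq_div_iff uW.ne_zero]
    linear_combination hr
  have e' : y - con l = (ξ * (g - 1) - con C * (1 - con a * ξ) * (1 - con b * ξ) -
      con l * (g - 1)) / (g - 1) := by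
    rw [eq_div_iff uW.ne_zero]
    linear_combination hr
  refine ⟨by rw [e]; exact hT.div uW, ?_, ?_⟩
  · rw [e]
    exact Unt.div (.of_res (by simp [vx.res, h.con_ne])) uW
  · rw [e']
    refine Unt.div (.of_res ?_) uW
    have hc := congrArg (res R) h.con_M
    have := uM.res
    have hm : res R (con l) ≠ 0 := by simp [h.con_ne]
    simp only [res_mul, res_sub, res_one, res_add, vx.res] at hc this ⊢
    intro h0
    apply this
    apply mul_left_cancel₀ hm
    linear_combination -h0 + hc

lemma corner_of_e6 (h : Flip1 C κ l m L M a b x y Y) (hT : Sub R T) (hx : x⁻¹ ∈ T)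
    (hY : x * Y ∈ T) (vx : Van R x⁻¹) (vW : Van R (x * Y - 1)) : y⁻¹ ∈ T ∧ Van R y⁻¹ := by
  have hr := h.symm.rel_inv; have hy := h.y0
  generalize x⁻¹ = ξ at *
  generalize x * Y = g at *
  obtain ⟨_, _⟩ := hT.hasConst
  obtain ⟨_, _⟩ := hT.mem hx
  obtain ⟨_, _⟩ := hT.mem hY
  have u : Unt R (ξ * (g - 1) - con C * (1 - con a * ξ) * (1 - con b * ξ)) :=
    .of_res (by simp [vx.res, h.con_ne])
  have e : y⁻¹ = (g - 1) / (ξ * (g - 1) - con C * (1 - con a * ξ) * (1 - con b * ξ)) := by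
    rw [inv_eq_one_div, div_eq_div_iff hy u.ne_zero]
    linear_combination -hr
  rw [e]
  exact ⟨hT.div u, vW.div u⟩

lemma e6_of_corner (h : Flip1 C κ l m L M a b x y Y) (hT : Sub R T) (hx : x⁻¹ ∈ T)
    (hY : Y⁻¹ ∈ T) (vx : Van R x⁻¹) (vY : Van R Y⁻¹) :
    x * y ∈ T ∧ Van R (x * y - 1) ∧ Unt R (x * y - 1 + con m) := by
  have hr := h.rel_inv
  have hi : Y * Y⁻¹ = 1 := mul_inv_cancel₀ h.Y0
  generalize x⁻¹ = ξ at *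
  generalize Y⁻¹ = η at *
  obtain ⟨_, _⟩ := hT.hasConst
  obtain ⟨_, _⟩ := hT.mem hx
  obtain ⟨_, _⟩ := hT.mem hY
  have u : Unt R (1 - ξ * η) := .of_res (by simp [vx.res])
  have e : x * y - 1 = -con C * (1 - con a * ξ) * (1 - con b * ξ) * η / (1 - ξ * η) := by
    rw [eq_div_iff u.ne_zero]
    linear_combination η * hr - (x * y - 1) * hi
  have e1 : x * y = (x * y - 1) + 1 := by ring
  have hw : x * y - 1 ∈ T := by rw [e]; exact hT.div u
  have vw : Van R (x * y - 1) := by rw [e]; exact Van.div (.of_res (by simp [vY.res])) u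
  generalize x * y - 1 = w at *
  obtain ⟨_, _⟩ := hT.mem hw
  rw [e1]
  exact ⟨Mem.mem, vw, .of_res (by simp [vw.res, h.con_ne])⟩

/-- The intersection of the fibre `x = ∞` with the first exceptional curve over `(∞, 0)`; these are
exchanged. -/
lemma e6'_of_e6' (h : Flip1 C κ l m L M a b x y Y) (hT : Sub R T) (hz : (x * Y)⁻¹ ∈ T)
    (hY : Y ∈ T) (vz : Van R (x * Y)⁻¹) (vY : Van R Y) :
    (x * y)⁻¹ ∈ T ∧ y ∈ T ∧ Van R (x * y)⁻¹ ∧ Van R y := by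
  have hr := h.rel_inv; have hx := h.x0; have hy := h.y0; have hY0 := h.Y0
  have hi : x * x⁻¹ = 1 := mul_inv_cancel₀ h.x0
  have hxz : x⁻¹ = (x * Y)⁻¹ * Y := by field_simp
  generalize x⁻¹ = ξ at *
  generalize (x * Y)⁻¹ = z at *
  obtain ⟨_, _⟩ := hT.hasConst
  obtain ⟨_, _⟩ := hT.mem hz
  obtain ⟨_, _⟩ := hT.mem hY
  have hξ : ξ ∈ T := by rw [hxz]; exact Mem.mem
  obtain ⟨_, _⟩ := hT.mem hξ
  have vξ : Van R ξ := by rw [hxz]; exact .of_res (by simp [vY.res])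
  have u1 : Unt R (1 - z) := .of_res (by simp [vz.res])
  have u2 : Unt R (Y * (1 - z) - con C * (1 - con a * ξ) * (1 - con b * ξ)) :=
    .of_res (by simp [vY.res, vξ.res, h.con_ne])
  have e1 : (x * y)⁻¹ = Y * (1 - z) /
      (Y * (1 - z) - con C * (1 - con a * ξ) * (1 - con b * ξ)) := by
    rw [inv_eq_one_div, div_eq_div_iff (by positivity) u2.ne_zero]
    linear_combination -hr - (x * y - 1) * hxz
  have e2 : y = (ξ * (1 - z) - con C * (1 - con a * ξ) * (1 - con b * ξ) * z) / (1 - z) := by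
    rw [eq_div_iff u1.ne_zero]
    apply mul_left_cancel₀ hY0
    linear_combination ξ * hr - y * (Y - ξ) * hi +
      (-ξ - con C * (1 - con a * ξ) * (1 - con b * ξ) + y) * hxz
  rw [e1, e2]
  exact ⟨hT.div u2, hT.div u1, Van.div (.of_res (by simp [vY.res])) u2,
    Van.div (.of_res (by simp [vz.res, vξ.res])) u1⟩

/-- The last exceptional curves over `(∞, 0)` and over `(∞, l)` correspond to each other. In the
expansion of the relation in `1 / x` the constant terms cancel by `M l = C`, so first-order terms
correspond to first-order terms. -/
lemma e8_of_e7 (h : Flip1 C κ l m L M a b x y Y) (hT : Sub R T) (hx : x⁻¹ ∈ T)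
    (hg : x * (x * Y - 1 + con M) ∈ T) (vx : Van R x⁻¹) : x * (y - con l) ∈ T := by
  have hr := h.symm.rel_inv; have hc := h.con_M
  have hi : x * x⁻¹ = 1 := mul_inv_cancel₀ h.x0
  generalize x⁻¹ = ξ at *
  obtain ⟨g, hg'⟩ : ∃ g, x * (x * Y - 1 + con M) = g := ⟨_, rfl⟩
  have hW : x * Y - 1 = ξ * g - con M := by rw [← hg']; linear_combination -(x * Y - 1 + con M) * hi
  rw [hg'] at hg
  rw [hW] at hr
  obtain ⟨_, _⟩ := hT.hasConst
  obtain ⟨_, _⟩ := hT.mem hx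
  obtain ⟨_, _⟩ := hT.mem hg
  have u : Unt R (ξ * g - con M) := .of_res (by simp [vx.res, h.con_ne])
  have e : x * (y - con l) = (ξ * g - con M - con C * (con a * con b * ξ - con a - con b) -
      con l * g) / (ξ * g - con M) := by
    rw [eq_div_iff u.ne_zero]
    linear_combination x * hr + (ξ * g - con M) * hi - con l * g * hi -
      con C * (con a * con b * ξ - con a - con b) * hi + x * hc
  rw [e]
  exact hT.div u

lemma e7_of_e8 (h : Flip1 C κ l m L M a b x y Y) (hT : Sub R T) (hx : x⁻¹ ∈ T)
    (hg : x * (Y - con L) ∈ T) (vx : Van R x⁻¹) : x * (x * y - 1 + con m) ∈ T := by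
  have hr := h.rel_inv; have hc := h.con_m
  have hi : x * x⁻¹ = 1 := mul_inv_cancel₀ h.x0
  generalize x⁻¹ = ξ at *
  obtain ⟨g, hg'⟩ : ∃ g, x * (Y - con L) = g := ⟨_, rfl⟩
  have hY : Y = ξ * g + con L := by rw [← hg']; linear_combination -(Y - con L) * hi
  rw [hg'] at hg
  rw [hY] at hr
  obtain ⟨_, _⟩ := hT.hasConst
  obtain ⟨_, _⟩ := hT.mem hx
  obtain ⟨_, _⟩ := hT.mem hg
  have u : Unt R (ξ * g + con L - ξ) := .of_res (by simp [vx.res, h.con_ne])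
  have e : x * (x * y - 1 + con m) = (con m * g - con m -
      con C * (con a * con b * ξ - con a - con b)) / (ξ * g + con L - ξ) := by
    rw [eq_div_iff u.ne_zero]
    linear_combination x * hr + (con m * g - con m) * hi -
      con C * (con a * con b * ξ - con a - con b) * hi + x * hc
  rw [e]
  exact hT.div u

lemma e8'_of_e7' (h : Flip1 C κ l m L M a b x y Y) (hT : Sub R T)
    (hg : (x * (x * Y - 1 + con M))⁻¹ ∈ T) (hσ : x * Y - 1 + con M ∈ T)
    (vg : Van R (x * (x * Y - 1 + con M))⁻¹) (vσ : Van R (x * Y - 1 + con M)) :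
    (x * (y - con l))⁻¹ ∈ T ∧ y - con l ∈ T ∧ Van R (x * (y - con l))⁻¹ ∧ Van R (y - con l) := by
  have hr := h.symm.rel_inv; have hc := h.con_M; have hM := h.M0; have hl := h.l0; have hx := h.x0
  have hi : x * x⁻¹ = 1 := mul_inv_cancel₀ h.x0
  have hξ : x⁻¹ = (x * (x * Y - 1 + con M))⁻¹ * (x * Y - 1 + con M) := by field_simp
  have hW : x * Y - 1 = x * Y - 1 + con M - con M := by ring
  generalize (x * (x * Y - 1 + con M))⁻¹ = g at *
  generalize x⁻¹ = ξ at *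
  generalize x * Y - 1 + con M = σ at *
  rw [hW] at hr
  obtain ⟨_, _⟩ := hT.hasConst
  obtain ⟨_, _⟩ := hT.mem hg
  obtain ⟨_, _⟩ := hT.mem hσ
  have hξ' : ξ ∈ T := by rw [hξ]; exact Mem.mem
  obtain ⟨_, _⟩ := hT.mem hξ'
  have vξ : Van R ξ := by rw [hξ]; exact .of_res (by simp [vσ.res])
  have u1 : Unt R (σ - con M) := .of_res (by simp [vσ.res, h.con_ne])
  have u2 : Unt R (g * (σ - con M) - con C * g * (con a * con b * ξ - con a - con b) - con l) :=
    .of_res (by simp [vg.res, h.con_ne])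
  have e1 : y - con l = σ * (g * (σ - con M) -
      con C * g * (con a * con b * ξ - con a - con b) - con l) / (σ - con M) := by
    rw [eq_div_iff u1.ne_zero]
    linear_combination hr + hc + ((σ - con M) - con C * (con a * con b * ξ - con a - con b)) * hξ
  have e2 : (x * (y - con l))⁻¹ = g * (σ - con M) /
      (g * (σ - con M) - con C * g * (con a * con b * ξ - con a - con b) - con l) := by
    rw [inv_eq_one_div, div_eq_div_iff (by positivity) u2.ne_zero]
    rw [eq_div_iff u1.ne_zero] at e1
    apply mul_left_cancel₀ hM
    linear_combination -(x * g * σ) * e1 - (σ * (g * (σ - con M) -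
      con C * g * (con a * con b * ξ - con a - con b) - con l)) * hi + (σ * (g * (σ - con M) -
      con C * g * (con a * con b * ξ - con a - con b) - con l)) * x * hξ
  rw [e2, e1]
  exact ⟨hT.div u2, hT.div u1, Van.div (.of_res (by simp [vg.res])) u2,
    Van.div (.of_res (by simp [vσ.res])) u1⟩

lemma e7'_of_e8' (h : Flip1 C κ l m L M a b x y Y) (hT : Sub R T)
    (hg : (x * (Y - con L))⁻¹ ∈ T) (hσ : Y - con L ∈ T)
    (vg : Van R (x * (Y - con L))⁻¹) (vσ : Van R (Y - con L)) :
    (x * (x * y - 1 + con m))⁻¹ ∈ T ∧ x * y - 1 + con m ∈ T ∧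
      Van R (x * (x * y - 1 + con m))⁻¹ ∧ Van R (x * y - 1 + con m) := by
  have hr := h.rel_inv; have hc := h.con_m; have hL := h.L0; have hm := h.m0; have hx := h.x0
  have hi : x * x⁻¹ = 1 := mul_inv_cancel₀ h.x0
  have hξ : x⁻¹ = (x * (Y - con L))⁻¹ * (Y - con L) := by field_simp
  have hY : Y = Y - con L + con L := by ring
  generalize (x * (Y - con L))⁻¹ = g at *
  generalize x⁻¹ = ξ at *
  generalize Y - con L = σ at *
  rw [hY] at hr
  obtain ⟨_, _⟩ := hT.hasConst
  obtain ⟨_, _⟩ := hT.mem hg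
  obtain ⟨_, _⟩ := hT.mem hσ
  have hξ' : ξ ∈ T := by rw [hξ]; exact Mem.mem
  obtain ⟨_, _⟩ := hT.mem hξ'
  have vξ : Van R ξ := by rw [hξ]; exact .of_res (by simp [vσ.res])
  have u1 : Unt R (σ + con L - ξ) := .of_res (by simp [vσ.res, vξ.res, h.con_ne])
  have u2 : Unt R (con m - con m * g - con C * g * (con a * con b * ξ - con a - con b)) :=
    .of_res (by simp [vg.res, h.con_ne])
  have e1 : x * y - 1 + con m = σ * (con m - con m * g -
      con C * g * (con a * con b * ξ - con a - con b)) / (σ + con L - ξ) := by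
    rw [eq_div_iff u1.ne_zero]
    linear_combination hr + hc + (-con m - con C * (con a * con b * ξ - con a - con b)) * hξ
  have e2 : (x * (x * y - 1 + con m))⁻¹ = g * (σ + con L - ξ) /
      (con m - con m * g - con C * g * (con a * con b * ξ - con a - con b)) := by
    rw [inv_eq_one_div, div_eq_div_iff (by positivity) u2.ne_zero]
    rw [eq_div_iff u1.ne_zero] at e1
    apply mul_left_cancel₀ hL
    linear_combination -(x * g * σ) * e1 - (σ * (con m - con m * g -
      con C * g * (con a * con b * ξ - con a - con b))) * hi + (σ * (con m - con m * g -
      con C * g * (con a * con b * ξ - con a - con b))) * x * hξ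
  rw [e2, e1]
  exact ⟨hT.div u2, hT.div u1, Van.div (.of_res (by simp [vg.res])) u2,
    Van.div (.of_res (by simp [vσ.res])) u1⟩

end Flip1
end Flip1Infinity

/-! ### The points of the blown-up surface -/

section Points
variable {F : Type} [Field F] [Algebra ℂ F]

/-- The local rings of the points of the blowup of `ℙ¹ × ℙ¹` at the points `(a, 1 / a)`,
`(b, 1 / b)`, `(0, ∞)`, `x * y = ∞` and `1 / (x ^ 2 * y) = κ` infinitely near to it, `(∞, 0)`,
`x * y = 1 - m` infinitely near to it, and `(∞, l)`, chart by chart. -/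
inductive Pt (κ l m a b : ℂ) (x y : F) (R : LocalSubring F) : Prop
  -- The side conditions remove the points that get blown up and confine the other charts to the
  -- curves at infinity and the exceptional curves. The charts `corner`, `e4'` and `e6'` contribute
  -- just one closed point each.
  | affine (h : Gen R x y) (ha : Van R (x - con a) → Unt R (y - con a⁻¹))
      (hb : Van R (x - con b) → Unt R (y - con b⁻¹))
  | inftyY (h : Gen R x y⁻¹) (hy : Van R y⁻¹) (hx : Unt R x)
  | inftyX (h : Gen R x⁻¹ y) (hx : Van R x⁻¹) (hy : Unt R y) (hy' : Unt R (y - con l))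
  | corner (h : Gen R x⁻¹ y⁻¹) (hx : Van R x⁻¹) (hy : Van R y⁻¹)
  | e1 (h : Gen R (x - con a) ((y - con a⁻¹) / (x - con a))) (hx : Van R (x - con a))
  | e1' (h : Gen R ((x - con a) / (y - con a⁻¹)) (y - con a⁻¹)) (hy : Van R (y - con a⁻¹))
  | e2 (h : Gen R (x - con b) ((y - con b⁻¹) / (x - con b))) (hx : Van R (x - con b))
  | e2' (h : Gen R ((x - con b) / (y - con b⁻¹)) (y - con b⁻¹)) (hy : Van R (y - con b⁻¹))
  | e3 (h : Gen R (x * y) y⁻¹) (hy : Van R y⁻¹)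
  | e4 (h : Gen R x (x ^ 2 * y)⁻¹) (hx : Van R x) (hs : Unt R ((x ^ 2 * y)⁻¹ - con κ))
  | e4' (h : Gen R (x ^ 2 * y) (x * y)⁻¹) (ht : Van R (x ^ 2 * y)) (hz : Van R (x * y)⁻¹)
  | e5 (h : Gen R x (((x ^ 2 * y)⁻¹ - con κ) / x)) (hx : Van R x)
  | e5' (h : Gen R (x / ((x ^ 2 * y)⁻¹ - con κ)) ((x ^ 2 * y)⁻¹ - con κ))
      (hs : Van R ((x ^ 2 * y)⁻¹ - con κ))
  | e6 (h : Gen R x⁻¹ (x * y)) (hx : Van R x⁻¹) (hw : Unt R (x * y - 1 + con m))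
  | e6' (h : Gen R (x * y)⁻¹ y) (hz : Van R (x * y)⁻¹) (hy : Van R y)
  | e7 (h : Gen R x⁻¹ (x * (x * y - 1 + con m))) (hx : Van R x⁻¹)
  | e7' (h : Gen R (x * (x * y - 1 + con m))⁻¹ (x * y - 1 + con m))
      (hw : Van R (x * y - 1 + con m))
  | e8 (h : Gen R x⁻¹ (x * (y - con l))) (hx : Van R x⁻¹)
  | e8' (h : Gen R (x * (y - con l))⁻¹ (y - con l)) (hy : Van R (y - con l))

lemma Pt.swap {κ l m a b : ℂ} {x y : F} {R : LocalSubring F} (h : Pt κ l m a b x y R) :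
    Pt κ l m b a x y R := by
  cases h with
  | affine h ha hb => exact .affine h hb ha
  | inftyY h hy hx => exact .inftyY h hy hx
  | inftyX h hx hy hy' => exact .inftyX h hx hy hy'
  | corner h hx hy => exact .corner h hx hy
  | e1 h hx => exact .e2 h hx
  | e1' h hx => exact .e2' h hx
  | e2 h hx => exact .e1 h hx
  | e2' h hx => exact .e1' h hx
  | e3 h hy => exact .e3 h hy
  | e4 h hx hs => exact .e4 h hx hs
  | e4' h hx hs => exact .e4' h hx hs
  | e5 h hx => exact .e5 h hx
  | e5' h hx => exact .e5' h hx
  | e6 h hx hw => exact .e6 h hx hw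
  | e6' h hx hw => exact .e6' h hx hw
  | e7 h hx => exact .e7 h hx
  | e7' h hx => exact .e7' h hx
  | e8 h hx => exact .e8 h hx
  | e8' h hx => exact .e8' h hx

/-- Only the origin of the second chart of a blowup is new: elsewhere on the exceptional curve `p /
q` is a unit, and the first chart applies. -/
lemma Gen.div_van_or {R : LocalSubring F} {p q : F} (h : Gen R (p / q) q) (hq : Van R q)
    (hp0 : p ≠ 0) (hq0 : q ≠ 0) :
    Van R (p / q) ∨ (Gen R p (q / p) ∧ Van R p ∧ Unt R (q / p)) := by
  refine (van_or_unt h.left).imp_right fun u => ⟨?_, ?_, ?_⟩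
  · refine h.change (fun T hT hp hq => ⟨?_, ?_⟩) (fun T hT hp hq => ⟨?_, ?_⟩)
    · convert mul_mem hp hq using 1
      field_simp
    · rw [← inv_div]
      exact hT.inv _ hp u.2.1
    · rw [← inv_div]
      exact hT.inv _ hq (by simpa using u.1)
    · convert mul_mem hp hq using 1
      field_simp
  · obtain ⟨_, _⟩ := h.sub.mem hq.mem
    obtain ⟨_, _⟩ := h.sub.mem h.left
    have e : p = p / q * q := by field_simp
    rw [e]
    exact .of_res (by simp [hq.res])
  · rw [← inv_div]
    exact u.inv

lemma Gen.inv_van_or {R : LocalSubring F} {x q : F} (h : Gen R (x * q)⁻¹ q) (hq : Van R q)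
    (hx0 : x ≠ 0) (hq0 : q ≠ 0) :
    Van R (x * q)⁻¹ ∨ (Gen R x⁻¹ (x * q) ∧ Van R x⁻¹ ∧ Unt R (x * q)) := by
  have e : (x * q)⁻¹ = x⁻¹ / q := by field_simp
  have e' : x * q = q / x⁻¹ := by field_simp
  rw [e] at h
  rw [e, e']
  exact h.div_van_or hq (inv_ne_zero hx0) hq0

lemma Gen.sub_const {R : LocalSubring F} {x v : F} (a : ℂ) (h : Gen R x v) :
    Gen R (x - con a) v :=
  h.change (fun T hT hp hq => ⟨sub_mem hp (hT.const a), hq⟩)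
    (fun T hT hp hq => ⟨by simpa using add_mem hp (hT.const a), hq⟩)

end Points

/-! ### The forward half-step maps points to points -/

section Flip1Points
variable {F : Type} [Field F] [Algebra ℂ F]

namespace Flip1
variable {C κ l m L M a b : ℂ} {x y Y : F} {R : LocalSubring F}

lemma not_van_b (h : Flip1 C κ l m L M a b x y Y) [HasConst R.toSubring]
    (hx : Van R (x - con a)) : ¬ Van R (x - con b) := by
  intro hb
  obtain h1 : Mem R.toSubring (x - con a) := ⟨hx.mem⟩
  obtain h2 : Mem R.toSubring (x - con b) := ⟨hb.mem⟩
  have e : (con (b - a) : F) = (x - con a) - (x - con b) := by rw [con_sub]; ring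
  have : res R (con (b - a)) = 0 := by rw [e, res_sub, hx.res, hb.res, sub_zero]
  rw [res_con_eq_zero] at this
  exact h.hab (sub_eq_zero.1 this).symm

lemma pt_of_e1 (h : Flip1 C κ l m L M a b x y Y)
    (hG : Gen R (x - con a) ((Y - con a⁻¹) / (x - con a))) (vx : Van R (x - con a)) :
    Pt κ l m a b x y R := by
  have := hG.const
  obtain ⟨_, _⟩ := hG.sub.mem hG.right
  have hx : x ∈ R.toSubring := by simpa using add_mem hG.left (hG.const.mem a)
  obtain ⟨_, _⟩ := hG.sub.mem hx
  rcases van_or_unt (Mem.mem : x * ((Y - con a⁻¹) / (x - con a)) + con a⁻¹ ∈ R.toSubring)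
    with v | u
  · obtain ⟨h1, h2, h3, h4⟩ := h.inftyY_of_e1 hG.sub hG.left hG.right vx v
    refine .inftyY (hG.change (fun T hT p q => ?_) (fun T hT p q => ⟨sub_mem p (hT.const a), ?_⟩))
      h3 h4
    · obtain ⟨h1, h2, h3, h4⟩ := h.inftyY_of_e1 hT p q vx v
      exact ⟨h1, h2⟩
    · exact (h.symm.e1_of_inftyY hT p q vx h3).1
  · obtain ⟨h1, h2, h3⟩ := h.affine_of_e1 hG.sub hG.left hG.right vx u
    refine .affine (hG.change (fun T hT p q => ?_) (fun T hT p q => ⟨sub_mem p (hT.const a), ?_⟩))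
      (fun _ => h3) (fun hb => (h.not_van_b vx hb).elim)
    · obtain ⟨h1, h2, h3⟩ := h.affine_of_e1 hT p q vx u
      exact ⟨h1, h2⟩
    · exact (h.symm.e1_of_affine hT p q vx h3).1

lemma pt_of_e1' (h : Flip1 C κ l m L M a b x y Y)
    (hG : Gen R ((x - con a) / (Y - con a⁻¹)) (Y - con a⁻¹)) (vy : Van R (Y - con a⁻¹)) :
    Pt κ l m a b x y R := by
  rcases hG.div_van_or vy h.xa h.Ya with v | ⟨hG', v, -⟩
  · obtain ⟨-, -, h3, h4⟩ := h.e1'_of_e1' hG.sub hG.left hG.right v vy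
    refine .e1' (hG.change (fun T hT p q => ?_) (fun T hT p q => ?_)) h4
    · obtain ⟨h1, h2, -⟩ := h.e1'_of_e1' hT p q v vy
      exact ⟨h1, h2⟩
    · obtain ⟨h1, h2, -⟩ := h.symm.e1'_of_e1' hT p q h3 h4
      exact ⟨h1, h2⟩
  · exact h.pt_of_e1 hG' v

lemma e1_of_affine_gen (h : Flip1 C κ l m L M a b x y Y) (hG : Gen R x Y)
    (vx : Van R (x - con a)) (uY : Unt R (Y - con a⁻¹)) :
    Gen R (x - con a) ((y - con a⁻¹) / (x - con a)) := by
  have h1 := h.e1_of_affine hG.sub hG.left hG.right vx uY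
  exact hG.change
    (fun T hT p q => ⟨sub_mem p (hT.const a), (h.e1_of_affine hT p q vx uY).1⟩)
    (fun T hT p q => ⟨by simpa using add_mem p (hT.const a),
      (h.symm.affine_of_e1 hT p q vx h1.2).2.1⟩)

lemma e1_of_inftyY_gen (h : Flip1 C κ l m L M a b x y Y) (hG : Gen R x Y⁻¹)
    (vx : Van R (x - con a)) (vY : Van R Y⁻¹) :
    Gen R (x - con a) ((y - con a⁻¹) / (x - con a)) := by
  have h1 := h.e1_of_inftyY hG.sub hG.left hG.right vx vY
  exact hG.change
    (fun T hT p q => ⟨sub_mem p (hT.const a), (h.e1_of_inftyY hT p q vx vY).1⟩)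
    (fun T hT p q => ⟨by simpa using add_mem p (hT.const a),
      (h.symm.inftyY_of_e1 hT p q vx h1.2).2.1⟩)

/-- In the plane, the fibres `x = 0`, `x = a`, `x = b` become exceptional curves and the curve `x Y
= 1` becomes `y = ∞`; off these four curves the inversion is regular with values in the plane. -/
lemma pt_of_affine (h : Flip1 C κ l m L M a b x y Y) (hG : Gen R x Y)
    (ha : Van R (x - con a) → Unt R (Y - con a⁻¹)) (hb : Van R (x - con b) → Unt R (Y - con b⁻¹)) :
    Pt κ l m a b x y R := by
  have hT := hG.sub
  have := hG.const
  obtain ⟨_, _⟩ := hT.mem hG.left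
  obtain ⟨_, _⟩ := hT.mem hG.right
  rcases van_or_unt hG.left with vx | ux
  · exact .e5 (hG.change (fun _ hT p q => ⟨p, h.e5_of_affine hT p q vx⟩)
      (fun _ hT p q => ⟨p, h.symm.affine_of_e5 hT p q vx⟩)) vx
  rcases van_or_unt (Mem.mem : x - con a ∈ R.toSubring) with va | ua
  · exact .e1 (h.e1_of_affine_gen hG va (ha va)) va
  rcases van_or_unt (Mem.mem : x - con b ∈ R.toSubring) with vb | ub
  · exact .e2 (h.swap.e1_of_affine_gen hG vb (hb vb)) vb
  rcases van_or_unt (Mem.mem : x * Y - 1 ∈ R.toSubring) with vw | uw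
  · have h1 := h.inftyY_of_affine hT hG.left hG.right ua ub vw
    exact .inftyY (hG.change (fun T hT p q => ⟨p, (h.inftyY_of_affine hT p q ua ub vw).1⟩)
      (fun T hT p q => ⟨p, (h.symm.affine_of_inftyY hT p q ux h1.2).1⟩)) h1.2 ux
  · have h1 := h.affine_of_affine hT hG.left hG.right ux ua ub uw
    exact .affine (hG.change (fun T hT p q => ⟨p, (h.affine_of_affine hT p q ux ua ub uw).1⟩)
      (fun T hT p q => ⟨p, (h.symm.affine_of_affine hT p q ux ua ub h1.2).1⟩))
      (fun v => (v.not_unt ua).elim) (fun v => (v.not_unt ub).elim)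

lemma pt_of_inftyY (h : Flip1 C κ l m L M a b x y Y) (hG : Gen R x Y⁻¹) (vY : Van R Y⁻¹)
    (ux : Unt R x) : Pt κ l m a b x y R := by
  have hT := hG.sub
  have := hG.const
  obtain ⟨_, _⟩ := hT.mem hG.left
  rcases van_or_unt (Mem.mem : x - con a ∈ R.toSubring) with va | ua
  · exact .e1 (h.e1_of_inftyY_gen hG va vY) va
  rcases van_or_unt (Mem.mem : x - con b ∈ R.toSubring) with vb | ub
  · exact .e2 (h.swap.e1_of_inftyY_gen hG vb vY) vb
  have h1 := h.affine_of_inftyY hT hG.left hG.right ux vY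
  exact .affine (hG.change (fun T hT p q => ⟨p, (h.affine_of_inftyY hT p q ux vY).1⟩)
    (fun T hT p q => ⟨p, (h.symm.inftyY_of_affine hT p q ua ub h1.2).1⟩))
    (fun v => (v.not_unt ua).elim) (fun v => (v.not_unt ub).elim)

lemma e4_of_e3_gen (h : Flip1 C κ l m L M a b x y Y) (hG : Gen R (x * Y) Y⁻¹) (vY : Van R Y⁻¹)
    (ug : Unt R (x * Y)) : Gen R x (x ^ 2 * y)⁻¹ ∧ Van R x ∧ Unt R ((x ^ 2 * y)⁻¹ - con κ) := by
  obtain ⟨-, -, h3, h4⟩ := h.e4_of_e3 hG.sub hG.left hG.right vY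
  refine ⟨hG.change (fun T hT p q => ?_) (fun T hT p q => ?_), h3, h4 ug⟩
  · obtain ⟨h1, h2, -⟩ := h.e4_of_e3 hT p q vY
    exact ⟨h1, h2⟩
  · obtain ⟨h1, h2, -⟩ := h.symm.e3_of_e4 hT p q h3 (h4 ug)
    exact ⟨h1, h2⟩

lemma pt_of_e3 (h : Flip1 C κ l m L M a b x y Y) (hG : Gen R (x * Y) Y⁻¹) (vY : Van R Y⁻¹) :
    Pt κ l m a b x y R := by
  rcases van_or_unt hG.left with vg | ug
  · obtain ⟨-, -, h3, h4⟩ := h.e5'_of_e3 hG.sub hG.left hG.right vg vY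
    refine .e5' (hG.change (fun T hT p q => ?_) (fun T hT p q => ?_)) h4
    · obtain ⟨h1, h2, -⟩ := h.e5'_of_e3 hT p q vg vY
      exact ⟨h1, h2⟩
    · obtain ⟨h1, h2, -⟩ := h.symm.e3_of_e5' hT p q h3 h4
      exact ⟨h1, h2⟩
  · obtain ⟨h1, h2, h3⟩ := h.e4_of_e3_gen hG vY ug
    exact .e4 h1 h2 h3

lemma e3_of_e4_gen (h : Flip1 C κ l m L M a b x y Y) (hG : Gen R x (x ^ 2 * Y)⁻¹) (vx : Van R x)
    (uS : Unt R ((x ^ 2 * Y)⁻¹ - con κ)) : Gen R (x * y) y⁻¹ ∧ Van R y⁻¹ := by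
  obtain ⟨-, -, h3, h4⟩ := h.e3_of_e4 hG.sub hG.left hG.right vx uS
  refine ⟨hG.change (fun T hT p q => ?_) (fun T hT p q => ?_), h3⟩
  · obtain ⟨h1, h2, -⟩ := h.e3_of_e4 hT p q vx uS
    exact ⟨h1, h2⟩
  · obtain ⟨h1, h2, -⟩ := h.symm.e4_of_e3 hT p q h3
    exact ⟨h1, h2⟩

lemma affine_of_e5_gen (h : Flip1 C κ l m L M a b x y Y)
    (hG : Gen R x (((x ^ 2 * Y)⁻¹ - con κ) / x)) (vx : Van R x) : Gen R x y :=
  hG.change (fun _ hT p q => ⟨p, h.affine_of_e5 hT p q vx⟩)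
    (fun _ hT p q => ⟨p, h.symm.e5_of_affine hT p q vx⟩)

lemma pt_of_e5 (h : Flip1 C κ l m L M a b x y Y)
    (hG : Gen R x (((x ^ 2 * Y)⁻¹ - con κ) / x)) (vx : Van R x) : Pt κ l m a b x y R := by
  have := hG.const
  have hT := hG.sub
  obtain ⟨_, _⟩ := hT.mem hG.left
  have ua : Unt R (x - con a) := .of_res (by simp [vx.res, h.con_ne])
  have ub : Unt R (x - con b) := .of_res (by simp [vx.res, h.con_ne])
  exact .affine (h.affine_of_e5_gen hG vx) (fun v => (v.not_unt ua).elim)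
    (fun v => (v.not_unt ub).elim)

lemma pt_of_e5' (h : Flip1 C κ l m L M a b x y Y)
    (hG : Gen R (x / ((x ^ 2 * Y)⁻¹ - con κ)) ((x ^ 2 * Y)⁻¹ - con κ))
    (vS : Van R ((x ^ 2 * Y)⁻¹ - con κ)) : Pt κ l m a b x y R := by
  rcases hG.div_van_or vS h.x0 h.S0 with v | ⟨hG', v, -⟩
  · obtain ⟨-, -, h3, h4⟩ := h.e3_of_e5' hG.sub hG.left hG.right v vS
    refine .e3 (hG.change (fun T hT p q => ?_) (fun T hT p q => ?_)) h4
    · obtain ⟨h1, h2, -⟩ := h.e3_of_e5' hT p q v vS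
      exact ⟨h1, h2⟩
    · obtain ⟨h1, h2, -⟩ := h.symm.e5'_of_e3 hT p q h3 h4
      exact ⟨h1, h2⟩
  · exact h.pt_of_e5 hG' v

lemma e6_of_inftyX_gen (h : Flip1 C κ l m L M a b x y Y) (hG : Gen R x⁻¹ Y) (vx : Van R x⁻¹)
    (uY : Unt R Y) (uL : Unt R (Y - con L)) :
    Gen R x⁻¹ (x * y) ∧ Unt R (x * y - 1 + con m) := by
  obtain ⟨-, h2, h3⟩ := h.e6_of_inftyX hG.sub hG.left hG.right vx uY uL
  exact ⟨hG.change (fun T hT p q => ⟨p, (h.e6_of_inftyX hT p q vx uY uL).1⟩)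
    (fun T hT p q => ⟨p, (h.symm.inftyX_of_e6 hT p q vx h2 h3).1⟩), h3⟩

lemma inftyX_of_e6_gen (h : Flip1 C κ l m L M a b x y Y) (hG : Gen R x⁻¹ (x * Y))
    (vx : Van R x⁻¹) (uw : Unt R (x * Y - 1)) (uM : Unt R (x * Y - 1 + con M)) :
    Gen R x⁻¹ y ∧ Unt R y ∧ Unt R (y - con l) := by
  obtain ⟨-, h2, h3⟩ := h.inftyX_of_e6 hG.sub hG.left hG.right vx uw uM
  exact ⟨hG.change (fun T hT p q => ⟨p, (h.inftyX_of_e6 hT p q vx uw uM).1⟩)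
      (fun T hT p q => ⟨p, (h.symm.e6_of_inftyX hT p q vx h2 h3).1⟩), h2, h3⟩

lemma pt_of_e6 (h : Flip1 C κ l m L M a b x y Y) (hG : Gen R x⁻¹ (x * Y)) (vx : Van R x⁻¹)
    (uM : Unt R (x * Y - 1 + con M)) : Pt κ l m a b x y R := by
  have := hG.const
  have hT := hG.sub
  obtain ⟨_, _⟩ := hT.mem hG.right
  rcases van_or_unt (Mem.mem : x * Y - 1 ∈ R.toSubring) with vw | uw
  · have h1 := h.corner_of_e6 hT hG.left hG.right vx vw
    exact .corner (hG.change (fun T hT p q => ⟨p, (h.corner_of_e6 hT p q vx vw).1⟩)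
      (fun T hT p q => ⟨p, (h.symm.e6_of_corner hT p q vx h1.2).1⟩)) vx h1.2
  · obtain ⟨h1, h2, h3⟩ := h.inftyX_of_e6_gen hG vx uw uM
    exact .inftyX h1 vx h2 h3

lemma pt_of_corner (h : Flip1 C κ l m L M a b x y Y) (hG : Gen R x⁻¹ Y⁻¹) (vx : Van R x⁻¹)
    (vY : Van R Y⁻¹) : Pt κ l m a b x y R := by
  obtain ⟨-, h2, h3⟩ := h.e6_of_corner hG.sub hG.left hG.right vx vY
  exact .e6 (hG.change (fun T hT p q => ⟨p, (h.e6_of_corner hT p q vx vY).1⟩)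
    (fun T hT p q => ⟨p, (h.symm.corner_of_e6 hT p q vx h2).1⟩)) vx h3

lemma pt_of_e6' (h : Flip1 C κ l m L M a b x y Y) (hG : Gen R (x * Y)⁻¹ Y)
    (vz : Van R (x * Y)⁻¹) (vY : Van R Y) : Pt κ l m a b x y R := by
  obtain ⟨-, -, h3, h4⟩ := h.e6'_of_e6' hG.sub hG.left hG.right vz vY
  refine .e6' (hG.change (fun T hT p q => ?_) (fun T hT p q => ?_)) h3 h4
  · obtain ⟨h1, h2, -⟩ := h.e6'_of_e6' hT p q vz vY
    exact ⟨h1, h2⟩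
  · obtain ⟨h1, h2, -⟩ := h.symm.e6'_of_e6' hT p q h3 h4
    exact ⟨h1, h2⟩

lemma e8_of_e7_gen (h : Flip1 C κ l m L M a b x y Y)
    (hG : Gen R x⁻¹ (x * (x * Y - 1 + con M))) (vx : Van R x⁻¹) :
    Gen R x⁻¹ (x * (y - con l)) :=
  hG.change (fun _ hT p q => ⟨p, h.e8_of_e7 hT p q vx⟩)
    (fun _ hT p q => ⟨p, h.symm.e7_of_e8 hT p q vx⟩)

lemma e7_of_e8_gen (h : Flip1 C κ l m L M a b x y Y)
    (hG : Gen R x⁻¹ (x * (Y - con L))) (vx : Van R x⁻¹) :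
    Gen R x⁻¹ (x * (x * y - 1 + con m)) :=
  hG.change (fun _ hT p q => ⟨p, h.e7_of_e8 hT p q vx⟩)
    (fun _ hT p q => ⟨p, h.symm.e8_of_e7 hT p q vx⟩)

lemma pt_of_e7' (h : Flip1 C κ l m L M a b x y Y)
    (hG : Gen R (x * (x * Y - 1 + con M))⁻¹ (x * Y - 1 + con M))
    (vw : Van R (x * Y - 1 + con M)) : Pt κ l m a b x y R := by
  rcases hG.inv_van_or vw h.x0 h.M0 with v | ⟨hG', v, -⟩
  · obtain ⟨-, -, h3, h4⟩ := h.e8'_of_e7' hG.sub hG.left hG.right v vw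
    refine .e8' (hG.change (fun T hT p q => ?_) (fun T hT p q => ?_)) h4
    · obtain ⟨h1, h2, -⟩ := h.e8'_of_e7' hT p q v vw
      exact ⟨h1, h2⟩
    · obtain ⟨h1, h2, -⟩ := h.symm.e7'_of_e8' hT p q h3 h4
      exact ⟨h1, h2⟩
  · exact .e8 (h.e8_of_e7_gen hG' v) v

lemma pt_of_e8' (h : Flip1 C κ l m L M a b x y Y)
    (hG : Gen R (x * (Y - con L))⁻¹ (Y - con L)) (vw : Van R (Y - con L)) :
    Pt κ l m a b x y R := by
  rcases hG.inv_van_or vw h.x0 h.L0 with v | ⟨hG', v, -⟩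
  · obtain ⟨-, -, h3, h4⟩ := h.e7'_of_e8' hG.sub hG.left hG.right v vw
    refine .e7' (hG.change (fun T hT p q => ?_) (fun T hT p q => ?_)) h4
    · obtain ⟨h1, h2, -⟩ := h.e7'_of_e8' hT p q v vw
      exact ⟨h1, h2⟩
    · obtain ⟨h1, h2, -⟩ := h.symm.e8'_of_e7' hT p q h3 h4
      exact ⟨h1, h2⟩
  · exact .e7 (h.e7_of_e8_gen hG' v) v

/-- The forward half-step maps points to points. -/
theorem pt (h : Flip1 C κ l m L M a b x y Y) (hP : Pt κ L M a b x Y R) : Pt κ l m a b x y R := by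
  cases hP with
  | affine hG ha hb => exact h.pt_of_affine hG ha hb
  | inftyY hG hy hx => exact h.pt_of_inftyY hG hy hx
  | inftyX hG hx hy hy' =>
    obtain ⟨h1, h2⟩ := h.e6_of_inftyX_gen hG hx hy hy'
    exact .e6 h1 hx h2
  | corner hG hx hy => exact h.pt_of_corner hG hx hy
  | e1 hG hx => exact h.pt_of_e1 hG hx
  | e1' hG hy => exact h.pt_of_e1' hG hy
  | e2 hG hx => exact (h.swap.pt_of_e1 hG hx).swap
  | e2' hG hy => exact (h.swap.pt_of_e1' hG hy).swap
  | e3 hG hy => exact h.pt_of_e3 hG hy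
  | e4 hG hx hs =>
    obtain ⟨h1, h2⟩ := h.e3_of_e4_gen hG hx hs
    exact .e3 h1 h2
  | e4' hG ht hz =>
    obtain ⟨-, -, h3, h4⟩ := h.e4'_of_e4' hG.sub hG.left hG.right ht hz
    refine .e4' (hG.change (fun T hT p q => ?_) (fun T hT p q => ?_)) h3 h4
    · obtain ⟨h1, h2, -⟩ := h.e4'_of_e4' hT p q ht hz
      exact ⟨h1, h2⟩
    · obtain ⟨h1, h2, -⟩ := h.symm.e4'_of_e4' hT p q h3 h4
      exact ⟨h1, h2⟩
  | e5 hG hx => exact h.pt_of_e5 hG hx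
  | e5' hG hs => exact h.pt_of_e5' hG hs
  | e6 hG hx hw => exact h.pt_of_e6 hG hx hw
  | e6' hG hz hy => exact h.pt_of_e6' hG hz hy
  | e7 hG hx => exact .e8 (h.e8_of_e7_gen hG hx) hx
  | e7' hG hw => exact h.pt_of_e7' hG hw
  | e8 hG hx => exact .e7 (h.e7_of_e8_gen hG hx) hx
  | e8' hG hy => exact h.pt_of_e8' hG hy

end Flip1
end Flip1Points

/-! ### The backward half-step: changes of chart near the lines `y = 0` and `y = l` -/

section Flip2
variable {F : Type} [Field F] [Algebra ℂ F]

/-- The relation between `(x, y)` and `(X, y)` of the backward half-step, and that between the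
parameters of the source and the target. -/
structure Flip2 (κ K l m a b : ℂ) (x X y : F) : Prop where
  -- The first constraint matches the last base points over `(0, ∞)`: on the second exceptional
  -- curve there the inversion multiplies the values of `1 / (x² y)` and `1 / (X² y)` to `1 / (l m a
  -- b)²`. The inequalities keep `y = l` off the base points `(a, 1 / a)`, `(b, 1 / b)`, and the
  -- point `x y = 1 - m` off the strict transform of `y = 0`.
  hκ : κ * K * (l * m * a * b) ^ 2 = 1
  hab : a ≠ b
  hla : l * a ≠ 1
  hlb : l * b ≠ 1
  hm : m ≠ 1
  x0 : x ≠ 0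
  X0 : X ≠ 0
  y0 : y ≠ 0
  w0 : x * y - 1 ≠ 0
  W0 : X * y - 1 ≠ 0
  xa : x - con a ≠ 0
  Xa : X - con a ≠ 0
  xb : x - con b ≠ 0
  Xb : X - con b ≠ 0
  ya : y - con a⁻¹ ≠ 0
  yb : y - con b⁻¹ ≠ 0
  s0 : (x ^ 2 * y)⁻¹ - con κ ≠ 0
  S0 : (X ^ 2 * y)⁻¹ - con K ≠ 0
  m0 : x * y - 1 + con m ≠ 0
  M0 : X * y - 1 + con m ≠ 0
  l0 : y - con l ≠ 0
  rel : (y - con l) * (x * y - 1) * (X * y - 1) =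
    -con l * con m * (con a * con b * y ^ 2 - (con a + con b) * y + 1)

namespace Flip2
variable {κ K l m a b : ℂ} {x X y : F} {R : LocalSubring F} {T : Subring F}

lemma symm (h : Flip2 κ K l m a b x X y) : Flip2 K κ l m a b X x y where
  hκ := by rw [← h.hκ]; ring
  hab := h.hab
  hla := h.hla
  hlb := h.hlb
  hm := h.hm
  x0 := h.X0
  X0 := h.x0
  y0 := h.y0
  w0 := h.W0
  W0 := h.w0
  xa := h.Xa
  Xa := h.xa
  xb := h.Xb
  Xb := h.xb
  ya := h.ya
  yb := h.yb
  s0 := h.S0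
  S0 := h.s0
  m0 := h.M0
  M0 := h.m0
  l0 := h.l0
  rel := by rw [← h.rel]; ring

lemma swap (h : Flip2 κ K l m a b x X y) : Flip2 κ K l m b a x X y where
  hκ := by rw [← h.hκ]; ring
  hab := h.hab.symm
  hla := h.hlb
  hlb := h.hla
  hm := h.hm
  x0 := h.x0
  X0 := h.X0
  y0 := h.y0
  w0 := h.w0
  W0 := h.W0
  xa := h.xb
  Xa := h.Xb
  xb := h.xa
  Xb := h.Xa
  ya := h.yb
  yb := h.ya
  s0 := h.s0
  S0 := h.S0
  m0 := h.m0
  M0 := h.M0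
  l0 := h.l0
  rel := by rw [h.rel]; ring

lemma con_ne (h : Flip2 κ K l m a b x X y) :
    a ≠ 0 ∧ b ≠ 0 ∧ κ ≠ 0 ∧ K ≠ 0 ∧ l ≠ 0 ∧ m ≠ 0 := by
  have := h.hκ
  refine ⟨?_, ?_, ?_, ?_, ?_, ?_⟩ <;> rintro rfl <;> simp at this
lemma con_a (h : Flip2 κ K l m a b x X y) : (con a * con a⁻¹ : F) = 1 := by
  rw [← con_mul, mul_inv_cancel₀ h.con_ne.1, con_one]
lemma con_κ (h : Flip2 κ K l m a b x X y) :
    (con κ * con K * (con l * con m * con a * con b) ^ 2 : F) = 1 := by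
  rw [← con_mul, ← con_mul, ← con_mul, ← con_mul, ← con_pow, ← con_mul, h.hκ, con_one]

/-- The right-hand side of the relation. -/
lemma exists_rhs (h : Flip2 κ K l m a b x X y) (hT : Sub R T) (hy : y ∈ T) : ∃ β : F,
    Mem T β ∧ Mem R.toSubring β ∧
    β = -con l * con m * (con a * con b * y ^ 2 - (con a + con b) * y + 1) ∧
    (y - con l) * (x * y - 1) * (X * y - 1) = β ∧
    res R β = -res R (con l) * res R (con m) *
      (res R (con a) * res R (con b) * res R y ^ 2 - (res R (con a) + res R (con b)) * res R y
        + 1) := by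
  obtain ⟨_, _⟩ := hT.hasConst
  obtain ⟨_, _⟩ := hT.mem hy
  -- The right-hand side is handed over as an opaque element together with its value, so that later
  -- identities are linear in it.
  exact ⟨_, inferInstance, inferInstance, rfl, h.rel, by simp⟩

/-- At `y = 0` with `X` finite the relation gives `x y = 1 - m`, which is not zero. So `x` is
infinite there, and the line `y = 0` turns into the second exceptional curve over `(∞, 0)`. -/
lemma e7_of_affine (h : Flip2 κ K l m a b x X y) (hT : Sub R T) (hX : X ∈ T) (hy : y ∈ T)
    (vy : Van R y) : x⁻¹ ∈ T ∧ x * (x * y - 1 + con m) ∈ T ∧ Van R x⁻¹ := by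
  obtain ⟨β, _, _, hβ, rel, hr⟩ := h.exists_rhs hT hy
  obtain ⟨_, _⟩ := hT.hasConst
  obtain ⟨_, _⟩ := hT.mem hX
  obtain ⟨_, _⟩ := hT.mem hy
  have := h.x0; have := h.y0
  have u1 : Unt R ((y - con l) * (X * y - 1)) := .of_res (by simp [vy.res, h.con_ne])
  have u2 : Unt R (β + (y - con l) * (X * y - 1)) := by
    refine .of_res ?_
    have : res R (con (1 - m)) ≠ 0 := by simp [sub_eq_zero, h.hm.symm]
    have hl : res R (con l) ≠ 0 := by simp [h.con_ne]
    simp only [con_sub, con_one, res_sub, res_one] at this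
    simp only [res_add, res_mul, res_sub, hr, vy.res, res_one]
    convert mul_ne_zero hl this using 1
    ring
  have u10 := u1.ne_zero
  have u20 := u2.ne_zero
  have e1 : x⁻¹ = y * ((y - con l) * (X * y - 1)) / (β + (y - con l) * (X * y - 1)) := by
    rw [eq_div_iff u20, inv_mul_eq_iff_eq_mul₀ h.x0]
    linear_combination -rel
  have e2 : x * (x * y - 1 + con m) = (β + (y - con l) * (X * y - 1)) *
      (-con l * con m * con a * con b * y + con l * con m * (con a + con b)
        + con m * (X * y - 1) - con l * con m * X) / ((y - con l) * (X * y - 1)) ^ 2 := by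
    rw [eq_div_iff (by positivity)]
    apply mul_left_cancel₀ h.y0
    linear_combination ((x * y - 1 + con m) * ((y - con l) * (X * y - 1)) +
      (β + (y - con l) * (X * y - 1))) * rel + (β + (y - con l) * (X * y - 1)) * hβ
  rw [e2, e1]
  refine ⟨hT.div u2, hT.div (u1.pow 2), ?_⟩
  refine Van.div ?_ u2
  exact .of_res (by simp [vy.res])

lemma affine_of_e7 (h : Flip2 κ K l m a b x X y) (hT : Sub R T) (hX : X⁻¹ ∈ T)
    (hg : X * (X * y - 1 + con m) ∈ T) (vX : Van R X⁻¹) : x ∈ T ∧ y ∈ T ∧ Van R y := by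
  obtain ⟨ξ, hξ⟩ : ∃ ξ, ξ = X⁻¹ := ⟨_, rfl⟩
  obtain ⟨g, hg'⟩ : ∃ g, g = X * (X * y - 1 + con m) := ⟨_, rfl⟩
  have hξX : ξ * X = 1 := by rw [hξ, inv_mul_cancel₀ h.X0]
  rw [← hξ] at hX vX
  rw [← hg'] at hg
  obtain ⟨_, _⟩ := hT.hasConst
  obtain ⟨_, _⟩ := hT.mem hX
  obtain ⟨_, _⟩ := hT.mem hg
  have hW : X * y - 1 = -con m + ξ * g := by grind
  have hy : y = ξ * (1 - con m + ξ * g) := by grind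
  have hyT : y ∈ T := by rw [hy]; exact Mem.mem
  have vy : Van R y := by rw [hy]; exact .of_res (by simp [vX.res])
  obtain ⟨β, _, _, hβ, rel, hr⟩ := h.exists_rhs hT hyT
  obtain ⟨_, _⟩ := hT.mem hyT
  have u1 : Unt R (1 - con m + ξ * g) := by
    refine .of_res ?_
    have : res R (con (1 - m)) ≠ 0 := by simp [sub_eq_zero, h.hm.symm]
    simpa [con_sub, vX.res] using this
  have u2 : Unt R ((y - con l) * (-con m + ξ * g) * (1 - con m + ξ * g)) := by
    refine Unt.mul (.of_res ?_) u1
    simp [vX.res, vy.res, h.con_ne]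
  refine ⟨?_, hyT, vy⟩
  have e : x = ((-con l * con m * con a * con b * y + con l * con m * (con a + con b)
        + (-con m + ξ * g)) * (1 - con m + ξ * g) - con l * g) /
        ((y - con l) * (-con m + ξ * g) * (1 - con m + ξ * g)) := by
    rw [eq_div_iff u2.ne_zero]
    apply mul_left_cancel₀ h.y0
    rw [hW] at rel
    rw [hβ] at rel
    linear_combination (1 - con m + ξ * g) * rel + con l * g * hy
  rw [e]
  exact hT.div u2

/-- At `y = l` the quadratic factors as `(l a - 1)(l b - 1)`, which is where the genericity of `l`
enters. -/
lemma unt_rhs_of_l (h : Flip2 κ K l m a b x X y) (hT : Sub R T) (vl : Van R (y - con l))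
    (hy : y ∈ T) :
    Unt R y ∧ Unt R (-con l * con m * (con a * con b * y ^ 2 - (con a + con b) * y + 1)) := by
  obtain ⟨_, _⟩ := hT.hasConst
  obtain ⟨_, _⟩ := hT.mem hy
  have hyr : res R y = res R (con l) := sub_eq_zero.1 (by simpa using vl.res)
  refine ⟨.of_res (by simp [hyr, h.con_ne]), ?_⟩
  have h1 : res R (con (-l * m * (l * a - 1) * (l * b - 1))) ≠ 0 := by
    simp [h.con_ne, sub_eq_zero, h.hla, h.hlb]
  refine .of_res ?_
  simp only [con_mul, con_sub, con_neg, con_one, res_mul, res_sub, res_neg, res_one] at h1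
  simp only [res_mul, res_sub, res_neg, res_add, res_one, res_pow, hyr]
  convert h1 using 1
  ring

/-- Where `y = l`, the right-hand side is a unit, so `x` has a pole exactly compensated by `y - l`
if `X y ≠ 1`. The line `y = l` turns into the exceptional curve over `(∞, l)`, with slope `x (y -
l)`. -/
lemma e8_of_affine (h : Flip2 κ K l m a b x X y) (hT : Sub R T) (hX : X ∈ T) (hy : y ∈ T)
    (vl : Van R (y - con l)) (uW : Unt R (X * y - 1)) :
    x⁻¹ ∈ T ∧ x * (y - con l) ∈ T ∧ Van R x⁻¹ ∧ Unt R (x * (y - con l)) := by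
  obtain ⟨uy, uβ⟩ := h.unt_rhs_of_l hT vl hy
  obtain ⟨β, _, _, hβ, rel, hr⟩ := h.exists_rhs hT hy
  rw [← hβ] at uβ
  obtain ⟨_, _⟩ := hT.hasConst
  obtain ⟨_, _⟩ := hT.mem hX
  obtain ⟨_, _⟩ := hT.mem hy
  obtain ⟨_, _⟩ := hT.mem (Mem.mem : y - con l ∈ T)
  have u1 : Unt R (β + (y - con l) * (X * y - 1)) := by
    refine .of_res ?_
    rw [res_add, res_mul, vl.res]
    simpa using uβ.res
  have u2 := uy.mul uW
  have e1 : x⁻¹ = y * ((y - con l) * (X * y - 1)) / (β + (y - con l) * (X * y - 1)) := by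
    rw [eq_div_iff u1.ne_zero, inv_mul_eq_iff_eq_mul₀ h.x0]
    linear_combination -rel
  have e2 : x * (y - con l) = (β + (y - con l) * (X * y - 1)) / (y * (X * y - 1)) := by
    rw [eq_div_iff u2.ne_zero]
    linear_combination rel
  rw [e1, e2]
  refine ⟨hT.div u1, hT.div u2, Van.div (.of_res ?_) u1, u1.div u2⟩
  rw [res_mul, res_mul, vl.res, zero_mul, mul_zero]

lemma e8'_of_affine (h : Flip2 κ K l m a b x X y) (hT : Sub R T) (hX : X ∈ T) (hy : y ∈ T)
    (vl : Van R (y - con l)) (vW : Van R (X * y - 1)) :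
    (x * (y - con l))⁻¹ ∈ T ∧ Van R (x * (y - con l))⁻¹ := by
  obtain ⟨uy, uβ⟩ := h.unt_rhs_of_l hT vl hy
  obtain ⟨β, _, _, hβ, rel, hr⟩ := h.exists_rhs hT hy
  rw [← hβ] at uβ
  obtain ⟨_, _⟩ := hT.hasConst
  obtain ⟨_, _⟩ := hT.mem hX
  obtain ⟨_, _⟩ := hT.mem hy
  have u1 : Unt R (β + (y - con l) * (X * y - 1)) := by
    refine .of_res ?_
    rw [res_add, res_mul, vl.res]
    simpa using uβ.res
  have := h.x0; have := h.l0
  have e1 : (x * (y - con l))⁻¹ = y * (X * y - 1) / (β + (y - con l) * (X * y - 1)) := by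
    rw [eq_div_iff u1.ne_zero, inv_mul_eq_iff_eq_mul₀ (by positivity)]
    linear_combination -rel
  rw [e1]
  refine ⟨hT.div u1, Van.div (.of_res ?_) u1⟩
  rw [res_mul, vW.res, mul_zero]

lemma of_e8 (h : Flip2 κ K l m a b x X y) (hT : Sub R T) (hX : X⁻¹ ∈ T)
    (hg : X * (y - con l) ∈ T) (vX : Van R X⁻¹) : y ∈ T ∧ Van R (y - con l) := by
  obtain ⟨_, _⟩ := hT.hasConst
  obtain ⟨_, _⟩ := hT.mem hX
  obtain ⟨_, _⟩ := hT.mem hg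
  have e : y - con l = X⁻¹ * (X * (y - con l)) := by rw [inv_mul_cancel_left₀ h.X0]
  have h1 : y - con l ∈ T := by rw [e]; exact mul_mem hX hg
  refine ⟨by simpa using add_mem h1 (hT.const l), ?_⟩
  rw [e]
  exact .of_res (by rw [res_mul, vX.res, zero_mul])

lemma affine_of_e8 (h : Flip2 κ K l m a b x X y) (hT : Sub R T) (hX : X⁻¹ ∈ T)
    (hg : X * (y - con l) ∈ T) (vX : Van R X⁻¹) (ug : Unt R (X * (y - con l))) :
    x ∈ T ∧ Unt R (x * y - 1) := by
  obtain ⟨hy, vl⟩ := h.of_e8 hT hX hg vX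
  obtain ⟨uy, uβ⟩ := h.unt_rhs_of_l hT vl hy
  obtain ⟨β, _, _, hβ, rel, hr⟩ := h.exists_rhs hT hy
  rw [← hβ] at uβ
  obtain ⟨_, _⟩ := hT.hasConst
  obtain ⟨_, _⟩ := hT.mem hX
  obtain ⟨_, _⟩ := hT.mem hy
  obtain ⟨_, _⟩ := hT.mem hg
  have u1 : Unt R (y - X⁻¹) := .of_res (by simpa [vX.res] using uy.res)
  have := h.X0
  have e1 : x * y - 1 = β / (X * (y - con l) * (y - X⁻¹)) := by
    rw [eq_div_iff (ug.mul u1).ne_zero]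
    field_simp
    linear_combination rel
  have e2 : x = (β + X * (y - con l) * (y - X⁻¹)) / (X * (y - con l) * (y - X⁻¹) * y) := by
    rw [eq_div_iff ((ug.mul u1).mul uy).ne_zero]
    field_simp
    linear_combination rel
  constructor
  · rw [e2]
    exact hT.div ((ug.mul u1).mul uy)
  · rw [e1]
    exact uβ.div (ug.mul u1)

/-- Slope zero: the exceptional curve meets the strict transform of the line `y = l`. The two are
exchanged, so their intersection is kept. -/
lemma e8_of_e8 (h : Flip2 κ K l m a b x X y) (hT : Sub R T) (hX : X⁻¹ ∈ T)
    (hg : X * (y - con l) ∈ T) (vX : Van R X⁻¹) (vg : Van R (X * (y - con l))) :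
    x⁻¹ ∈ T ∧ x * (y - con l) ∈ T ∧ Van R x⁻¹ ∧ Van R (x * (y - con l)) := by
  obtain ⟨hy, vl⟩ := h.of_e8 hT hX hg vX
  obtain ⟨uy, uβ⟩ := h.unt_rhs_of_l hT vl hy
  obtain ⟨β, _, _, hβ, rel, hr⟩ := h.exists_rhs hT hy
  rw [← hβ] at uβ
  obtain ⟨_, _⟩ := hT.hasConst
  obtain ⟨_, _⟩ := hT.mem hX
  obtain ⟨_, _⟩ := hT.mem hy
  obtain ⟨_, _⟩ := hT.mem hg
  have u1 : Unt R (y - X⁻¹) := .of_res (by simpa [vX.res] using uy.res)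
  have u2 : Unt R (β + X * (y - con l) * (y - X⁻¹)) :=
    .of_res (by rw [res_add, res_mul, vg.res]; simpa using uβ.res)
  have := h.X0; have := h.x0
  have e1 : x⁻¹ = y * (X * (y - con l)) * (y - X⁻¹) / (β + X * (y - con l) * (y - X⁻¹)) := by
    rw [eq_div_iff u2.ne_zero, inv_mul_eq_iff_eq_mul₀ h.x0]
    field_simp
    linear_combination -rel
  have e2 : x * (y - con l) = (β + X * (y - con l) * (y - X⁻¹)) * X⁻¹ / (y * (y - X⁻¹)) := by
    rw [eq_div_iff (uy.mul u1).ne_zero]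
    field_simp
    linear_combination rel
  rw [e1, e2]
  refine ⟨hT.div u2, hT.div (uy.mul u1), Van.div (.of_res ?_) u2,
    Van.div (.of_res ?_) (uy.mul u1)⟩
  · simp only [res_mul, vg.res, zero_mul, mul_zero]
  · rw [res_mul, vX.res, mul_zero]

lemma affine_of_e8' (h : Flip2 κ K l m a b x X y) (hT : Sub R T)
    (hg : (X * (y - con l))⁻¹ ∈ T) (hs : y - con l ∈ T) (vg : Van R (X * (y - con l))⁻¹)
    (vl : Van R (y - con l)) :
    x ∈ T ∧ y ∈ T ∧ Van R (x * y - 1) := by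
  have hy : y ∈ T := by simpa using add_mem hs (hT.const l)
  obtain ⟨uy, uβ⟩ := h.unt_rhs_of_l hT vl hy
  obtain ⟨β, _, _, hβ, rel, hr⟩ := h.exists_rhs hT hy
  obtain ⟨_, _⟩ := hT.hasConst
  obtain ⟨_, _⟩ := hT.mem hy
  obtain ⟨_, _⟩ := hT.mem hg
  have := h.X0; have := h.l0; have := h.y0
  obtain ⟨_, _⟩ := hT.mem (hs)
  have u1 : Unt R (y - (X * (y - con l))⁻¹ * (y - con l)) := .of_res (by
    rw [res_sub, res_mul, vl.res, mul_zero, sub_zero]; exact uy.res)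
  have e1 : x * y - 1 = β * (X * (y - con l))⁻¹ / (y - (X * (y - con l))⁻¹ * (y - con l)) := by
    rw [eq_div_iff u1.ne_zero]
    field_simp
    linear_combination rel
  have e2 : x = (β * (X * (y - con l))⁻¹ + (y - (X * (y - con l))⁻¹ * (y - con l))) /
      ((y - (X * (y - con l))⁻¹ * (y - con l)) * y) := by
    rw [eq_div_iff (u1.mul uy).ne_zero]
    field_simp
    linear_combination rel
  refine ⟨?_, hy, ?_⟩
  · rw [e2]
    exact hT.div (u1.mul uy)
  · rw [e1]
    exact Van.div (.of_res (by rw [res_mul, vg.res, mul_zero])) u1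

end Flip2
end Flip2

/-! ### The backward half-step: changes of chart near `y = 1 / a` and off the degenerate lines -/

section Flip2
variable {F : Type} [Field F] [Algebra ℂ F]
namespace Flip2
variable {κ K l m a b : ℂ} {x X y : F} {R : LocalSubring F} {T : Subring F}

lemma rel_a (h : Flip2 κ K l m a b x X y) : (y - con l) * (x * y - 1) * (X * y - 1) =
    -con l * con m * con a * con b * (y - con a⁻¹) * (y - con b⁻¹) := by
  have h1 : (con a * con a⁻¹ : F) = 1 := h.con_a
  have h2 : (con b * con b⁻¹ : F) = 1 := h.swap.con_a
  rw [h.rel]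
  linear_combination (con l * con m * con b * (con b⁻¹ - y)) * h1 +
    con l * con m * (1 - con a * y) * h2

lemma units_of_a (h : Flip2 κ K l m a b x X y) (hT : Sub R T) (va : Van R (y - con a⁻¹))
    (hy : y ∈ T) : Unt R y ∧ Unt R (y - con l) ∧
      Unt R (-con l * con m * con a * con b * (y - con b⁻¹)) := by
  obtain ⟨_, _⟩ := hT.hasConst
  obtain ⟨_, _⟩ := hT.mem hy
  have hyr : res R y = res R (con a⁻¹) := sub_eq_zero.1 (by simpa using va.res)
  refine ⟨.of_res (by simp [hyr, h.con_ne]), .of_res ?_, ?_⟩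
  · have : res R (con (a⁻¹ - l)) ≠ 0 := by
      simp only [Ne, res_con_eq_zero, sub_eq_zero]
      intro e
      exact h.hla (by rw [← e, inv_mul_cancel₀ h.con_ne.1])
    simpa [con_sub, hyr] using this
  · have h1 := h.con_ne
    have : res R (con (-l * m * a * b * (a⁻¹ - b⁻¹))) ≠ 0 := by
      have := h.hab
      simpa [sub_eq_zero, h1] using this
    refine .of_res ?_
    simpa [con_sub, con_mul, con_neg, hyr] using this

/-- The line `y = 1 / a` turns into the exceptional curve over `(a, 1 / a)`. With `r = (x - a) / (y
- 1 / a)` one has `x y - 1 = (y - 1 / a)(y r + a)`, so the unit in the conclusion says that the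
point is off the strict transform of `x y = 1`. -/
lemma e1'_of_affine (h : Flip2 κ K l m a b x X y) (hT : Sub R T) (hX : X ∈ T) (hy : y ∈ T)
    (va : Van R (y - con a⁻¹)) (ua : Unt R (X - con a)) : (x - con a) / (y - con a⁻¹) ∈ T ∧
      Unt R (y * ((x - con a) / (y - con a⁻¹)) + con a) := by
  obtain ⟨uy, ul, ub⟩ := h.units_of_a hT va hy
  obtain ⟨_, _⟩ := hT.hasConst
  obtain ⟨_, _⟩ := hT.mem hX
  obtain ⟨_, _⟩ := hT.mem hy
  have rel := h.rel_a; have ha : (con a * con a⁻¹ : F) = 1 := h.con_a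
  have := h.ya; have := h.y0
  have uW : Unt R (X * y - 1) := by
    have e : X * y - 1 = (X - con a) * y + con a * (y - con a⁻¹) := by linear_combination ha
    rw [e]
    refine .of_res ?_
    rw [res_add, res_mul, res_mul, va.res, mul_zero, add_zero]
    exact mul_ne_zero ua.res uy.res
  have u := ul.mul uW
  have e : y * ((x - con a) / (y - con a⁻¹)) + con a =
      -con l * con m * con a * con b * (y - con b⁻¹) / ((y - con l) * (X * y - 1)) := by
    rw [eq_div_iff u.ne_zero]
    apply mul_left_cancel₀ h.ya
    have hd : (x - con a) / (y - con a⁻¹) * (y - con a⁻¹) = x - con a := div_mul_cancel₀ _ h.ya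
    linear_combination rel + (y - con l) * (X * y - 1) * (y * hd - ha)
  have e' : (x - con a) / (y - con a⁻¹) =
      (-con l * con m * con a * con b * (y - con b⁻¹) - con a * ((y - con l) * (X * y - 1))) /
        ((y - con l) * (X * y - 1) * y) := by
    rw [eq_div_iff (u.mul uy).ne_zero]
    rw [eq_div_iff u.ne_zero] at e
    linear_combination e
  constructor
  · rw [e']
    exact hT.div (u.mul uy)
  · rw [e]
    exact ub.div u

lemma affine_of_e1' (h : Flip2 κ K l m a b x X y) (hT : Sub R T)
    (hr : (X - con a) / (y - con a⁻¹) ∈ T) (hs : y - con a⁻¹ ∈ T) (va : Van R (y - con a⁻¹))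
    (u : Unt R (y * ((X - con a) / (y - con a⁻¹)) + con a)) :
    x ∈ T ∧ y ∈ T ∧ Unt R (x - con a) := by
  have hy : y ∈ T := by simpa using add_mem hs (hT.const a⁻¹)
  obtain ⟨uy, ul, ub⟩ := h.units_of_a hT va hy
  obtain ⟨_, _⟩ := hT.hasConst
  obtain ⟨_, _⟩ := hT.mem hy
  obtain ⟨_, _⟩ := hT.mem hr
  have rel := h.rel_a; have ha : (con a * con a⁻¹ : F) = 1 := h.con_a
  have := h.ya; have := h.y0
  have eW : (y - con a⁻¹) * (y * ((X - con a) / (y - con a⁻¹)) + con a) = X * y - 1 := by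
    have hd : (X - con a) / (y - con a⁻¹) * (y - con a⁻¹) = X - con a := div_mul_cancel₀ _ h.ya
    linear_combination y * hd - ha
  have ew : x * y - 1 = -con l * con m * con a * con b * (y - con b⁻¹) /
      ((y - con l) * (y * ((X - con a) / (y - con a⁻¹)) + con a)) := by
    rw [eq_div_iff (ul.mul u).ne_zero]
    apply mul_left_cancel₀ h.ya
    rw [← eW] at rel
    linear_combination rel
  have uw : Unt R (x * y - 1) := by
    rw [ew]
    exact ub.div (ul.mul u)
  have ex : x = (-con l * con m * con a * con b * (y - con b⁻¹) +
      (y - con l) * (y * ((X - con a) / (y - con a⁻¹)) + con a)) /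
      ((y - con l) * (y * ((X - con a) / (y - con a⁻¹)) + con a) * y) := by
    rw [eq_div_iff ((ul.mul u).mul uy).ne_zero]
    rw [eq_div_iff (ul.mul u).ne_zero] at ew
    linear_combination ew
  have exa : x - con a = ((x * y - 1) - con a * (y - con a⁻¹)) / y := by
    rw [eq_div_iff h.y0]
    linear_combination -ha
  have hx : x ∈ T := by
    rw [ex]
    exact hT.div ((ul.mul u).mul uy)
  obtain ⟨_, _⟩ := hT.mem hx
  refine ⟨hx, hy, ?_⟩
  rw [exa]
  refine Unt.div (.of_res ?_) uy
  rw [res_sub, res_mul (f := con a), va.res, mul_zero, sub_zero]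
  exact uw.res

lemma inftyX_of_e1' (h : Flip2 κ K l m a b x X y) (hT : Sub R T)
    (hr : (X - con a) / (y - con a⁻¹) ∈ T) (hs : y - con a⁻¹ ∈ T) (va : Van R (y - con a⁻¹))
    (v : Van R (y * ((X - con a) / (y - con a⁻¹)) + con a)) :
    x⁻¹ ∈ T ∧ y ∈ T ∧ Van R x⁻¹ := by
  have hy : y ∈ T := by simpa using add_mem hs (hT.const a⁻¹)
  obtain ⟨uy, ul, ub⟩ := h.units_of_a hT va hy
  obtain ⟨_, _⟩ := hT.hasConst
  obtain ⟨_, _⟩ := hT.mem hy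
  obtain ⟨_, _⟩ := hT.mem hr
  have rel := h.rel_a; have ha : (con a * con a⁻¹ : F) = 1 := h.con_a
  have := h.ya; have := h.y0
  have eW : (y - con a⁻¹) * (y * ((X - con a) / (y - con a⁻¹)) + con a) = X * y - 1 := by
    have hd : (X - con a) / (y - con a⁻¹) * (y - con a⁻¹) = X - con a := div_mul_cancel₀ _ h.ya
    linear_combination y * hd - ha
  have u : Unt R ((y - con l) * (y * ((X - con a) / (y - con a⁻¹)) + con a) +
      -con l * con m * con a * con b * (y - con b⁻¹)) := by
    refine .of_res ?_
    rw [res_add, res_mul, v.res, mul_zero, zero_add]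
    exact ub.res
  have e : x⁻¹ = y * (y - con l) * (y * ((X - con a) / (y - con a⁻¹)) + con a) /
      ((y - con l) * (y * ((X - con a) / (y - con a⁻¹)) + con a) +
      -con l * con m * con a * con b * (y - con b⁻¹)) := by
    rw [eq_div_iff u.ne_zero, inv_mul_eq_iff_eq_mul₀ h.x0]
    apply mul_left_cancel₀ h.ya
    rw [← eW] at rel
    linear_combination -rel
  rw [e]
  refine ⟨hT.div u, hy, Van.div (.of_res ?_) u⟩
  rw [res_mul, v.res, mul_zero]

lemma e1'_of_inftyX (h : Flip2 κ K l m a b x X y) (hT : Sub R T)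
    (hX : X⁻¹ ∈ T) (hy : y ∈ T) (vX : Van R X⁻¹) (va : Van R (y - con a⁻¹)) :
    (x - con a) / (y - con a⁻¹) ∈ T ∧ Van R (y * ((x - con a) / (y - con a⁻¹)) + con a) := by
  obtain ⟨uy, ul, ub⟩ := h.units_of_a hT va hy
  obtain ⟨_, _⟩ := hT.hasConst
  obtain ⟨_, _⟩ := hT.mem hX
  obtain ⟨_, _⟩ := hT.mem hy
  have rel := h.rel_a; have ha : (con a * con a⁻¹ : F) = 1 := h.con_a
  have := h.ya; have := h.y0; have := h.X0
  have u : Unt R ((y - con l) * (y - X⁻¹)) := by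
    refine ul.mul (.of_res ?_)
    simpa [vX.res] using uy.res
  have e : y * ((x - con a) / (y - con a⁻¹)) + con a =
      -con l * con m * con a * con b * (y - con b⁻¹) * X⁻¹ / ((y - con l) * (y - X⁻¹)) := by
    rw [eq_div_iff u.ne_zero]
    apply mul_left_cancel₀ (mul_ne_zero h.ya h.X0)
    have hd : (x - con a) / (y - con a⁻¹) * (y - con a⁻¹) = x - con a := div_mul_cancel₀ _ h.ya
    have hi : X⁻¹ * X = 1 := inv_mul_cancel₀ h.X0
    linear_combination rel + (y - con l) * (X * y - 1) * (y * hd - ha)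
      - (y * ((x - con a) / (y - con a⁻¹)) + con a) * (y - con a⁻¹) * (y - con l) * hi
      - (-con l * con m * con a * con b * (y - con b⁻¹)) * (y - con a⁻¹) * hi
  have e' : (x - con a) / (y - con a⁻¹) =
      (-con l * con m * con a * con b * (y - con b⁻¹) * X⁻¹ - con a * ((y - con l) * (y - X⁻¹))) /
        ((y - con l) * (y - X⁻¹) * y) := by
    rw [eq_div_iff (u.mul uy).ne_zero]
    rw [eq_div_iff u.ne_zero] at e
    linear_combination e
  constructor
  · rw [e']
    exact hT.div (u.mul uy)
  · rw [e]
    refine Van.div (.of_res ?_) u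
    rw [res_mul, vX.res, mul_zero]

lemma affine_of_inftyX (h : Flip2 κ K l m a b x X y) (hT : Sub R T)
    (hX : X⁻¹ ∈ T) (hy : y ∈ T) (vX : Van R X⁻¹) (uy : Unt R y) (ul : Unt R (y - con l)) :
    x ∈ T ∧ Van R (x * y - 1) := by
  obtain ⟨β, _, _, hβ, rel, hr⟩ := h.exists_rhs hT hy
  obtain ⟨_, _⟩ := hT.hasConst
  obtain ⟨_, _⟩ := hT.mem hX
  obtain ⟨_, _⟩ := hT.mem hy
  have := h.X0
  have u : Unt R ((y - con l) * (y - X⁻¹)) := by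
    refine ul.mul (.of_res ?_)
    simpa [vX.res] using uy.res
  have e : x * y - 1 = β * X⁻¹ / ((y - con l) * (y - X⁻¹)) := by
    rw [eq_div_iff u.ne_zero]
    field_simp
    linear_combination rel
  have e' : x = (β * X⁻¹ + (y - con l) * (y - X⁻¹)) / ((y - con l) * (y - X⁻¹) * y) := by
    rw [eq_div_iff (u.mul uy).ne_zero]
    rw [eq_div_iff u.ne_zero] at e
    linear_combination e
  constructor
  · rw [e']
    exact hT.div (u.mul uy)
  · rw [e]
    refine Van.div (.of_res ?_) u
    rw [res_mul, vX.res, mul_zero]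

lemma affine_of_affine (h : Flip2 κ K l m a b x X y) (hT : Sub R T)
    (hX : X ∈ T) (hy : y ∈ T) (uy : Unt R y) (ul : Unt R (y - con l)) (uW : Unt R (X * y - 1))
    (ua : Unt R (y - con a⁻¹)) (ub : Unt R (y - con b⁻¹)) :
    x ∈ T ∧ Unt R (x * y - 1) := by
  obtain ⟨_, _⟩ := hT.hasConst
  obtain ⟨_, _⟩ := hT.mem hX
  obtain ⟨_, _⟩ := hT.mem hy
  have rel := h.rel_a
  have u := ul.mul uW
  have uc : Unt R (-con l * con m * con a * con b) := .of_res (by simp [h.con_ne])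
  have e : x * y - 1 = -con l * con m * con a * con b * (y - con a⁻¹) * (y - con b⁻¹) /
      ((y - con l) * (X * y - 1)) := by
    rw [eq_div_iff u.ne_zero]
    linear_combination rel
  have e' : x = (-con l * con m * con a * con b * (y - con a⁻¹) * (y - con b⁻¹) +
      (y - con l) * (X * y - 1)) / ((y - con l) * (X * y - 1) * y) := by
    rw [eq_div_iff (u.mul uy).ne_zero]
    linear_combination rel
  constructor
  · rw [e']
    exact hT.div (u.mul uy)
  · rw [e]
    exact ((uc.mul ua).mul ub).div u

lemma inftyX_of_affine (h : Flip2 κ K l m a b x X y) (hT : Sub R T)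
    (hX : X ∈ T) (hy : y ∈ T) (vW : Van R (X * y - 1))
    (ua : Unt R (y - con a⁻¹)) (ub : Unt R (y - con b⁻¹)) :
    x⁻¹ ∈ T ∧ Van R x⁻¹ := by
  obtain ⟨_, _⟩ := hT.hasConst
  obtain ⟨_, _⟩ := hT.mem hX
  obtain ⟨_, _⟩ := hT.mem hy
  have rel := h.rel_a
  have uc : Unt R (-con l * con m * con a * con b) := .of_res (by simp [h.con_ne])
  have u : Unt R (-con l * con m * con a * con b * (y - con a⁻¹) * (y - con b⁻¹) +
      (y - con l) * (X * y - 1)) := by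
    refine .of_res ?_
    rw [res_add, res_mul (f := y - con l), vW.res, mul_zero, add_zero]
    exact ((uc.mul ua).mul ub).res
  have e : x⁻¹ = y * (y - con l) * (X * y - 1) /
      (-con l * con m * con a * con b * (y - con a⁻¹) * (y - con b⁻¹) +
        (y - con l) * (X * y - 1)) := by
    rw [eq_div_iff u.ne_zero, inv_mul_eq_iff_eq_mul₀ h.x0]
    linear_combination -rel
  rw [e]
  refine ⟨hT.div u, Van.div (.of_res ?_) u⟩
  rw [res_mul, vW.res, mul_zero]

/-- The horizontal direction, where the exceptional curve meets the strict transform of `y = 1 / a`.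
The two curves are exchanged. -/
lemma e1_of_e1 (h : Flip2 κ K l m a b x X y) (hT : Sub R T) (hX : X - con a ∈ T)
    (hp : (y - con a⁻¹) / (X - con a) ∈ T) (vX : Van R (X - con a))
    (vp : Van R ((y - con a⁻¹) / (X - con a))) :
    x - con a ∈ T ∧ (y - con a⁻¹) / (x - con a) ∈ T ∧ Van R (x - con a) ∧
      Van R ((y - con a⁻¹) / (x - con a)) := by
  obtain ⟨_, _⟩ := hT.hasConst
  have := h.Xa; have := h.xa; have := h.y0
  have rel := h.rel_a; have ha : (con a * con a⁻¹ : F) = 1 := h.con_a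
  have hyp : y - con a⁻¹ = (y - con a⁻¹) / (X - con a) * (X - con a) := by field_simp
  obtain ⟨_, _⟩ := hT.mem hX
  obtain ⟨p, hp'⟩ : ∃ p, p = (y - con a⁻¹) / (X - con a) := ⟨_, rfl⟩
  rw [← hp'] at vp hp hyp
  obtain ⟨_, _⟩ := hT.mem hp
  have hs : y - con a⁻¹ ∈ T := by rw [hyp]; exact Mem.mem
  have va : Van R (y - con a⁻¹) := by rw [hyp]; exact .of_res (by rw [res_mul, vp.res, zero_mul])
  have hy : y ∈ T := by simpa using add_mem hs (hT.const a⁻¹)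
  obtain ⟨uy, ul, ub⟩ := h.units_of_a hT va hy
  obtain ⟨_, _⟩ := hT.mem hy
  have eW : X * y - 1 = (X - con a) * (y + con a * p) := by linear_combination ha + con a * hyp
  have u1 : Unt R (y + con a * p) := .of_res (by
    rw [res_add, res_mul, vp.res, mul_zero, add_zero]; exact uy.res)
  have ew : (y - con l) * (x * y - 1) * (y + con a * p) =
      -con l * con m * con a * con b * (y - con b⁻¹) * p := by
    apply mul_left_cancel₀ h.Xa
    rw [eW] at rel
    linear_combination rel + (-con l * con m * con a * con b * (y - con b⁻¹)) * hyp
  have exa : x - con a = (-con l * con m * con a * con b * (y - con b⁻¹) * p -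
      con a * (X - con a) * p * ((y - con l) * (y + con a * p))) /
      ((y - con l) * (y + con a * p) * y) := by
    rw [eq_div_iff ((ul.mul u1).mul uy).ne_zero]
    linear_combination ew + (-(y - con l) * (y + con a * p)) * ha -
      con a * ((y - con l) * (y + con a * p)) * hyp
  have u2 : Unt R (-con l * con m * con a * con b * (y - con b⁻¹) -
      con a * (X - con a) * ((y - con l) * (y + con a * p))) := by
    refine .of_res ?_
    rw [res_sub, res_mul (f := con a * (X - con a)), res_mul (f := con a), vX.res, mul_zero,
      zero_mul, sub_zero]
    exact ub.res
  have ep : (y - con a⁻¹) / (x - con a) = (X - con a) * ((y - con l) * (y + con a * p) * y) /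
      (-con l * con m * con a * con b * (y - con b⁻¹) -
      con a * (X - con a) * ((y - con l) * (y + con a * p))) := by
    rw [div_eq_div_iff h.xa u2.ne_zero, hyp]
    rw [eq_div_iff ((ul.mul u1).mul uy).ne_zero] at exa
    linear_combination -(X - con a) * exa
  rw [ep, exa]
  refine ⟨hT.div ((ul.mul u1).mul uy), hT.div u2, Van.div (.of_res ?_) ((ul.mul u1).mul uy),
    Van.div (.of_res ?_) u2⟩
  · simp only [res_sub, res_mul, vp.res, mul_zero, zero_mul, sub_zero]
  · rw [res_mul, vX.res, zero_mul]

end Flip2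
end Flip2

/-! ### The backward half-step: changes of chart over `y = ∞`, and formulas over `(∞, 0)` -/

section Flip2
variable {F : Type} [Field F] [Algebra ℂ F]
namespace Flip2
variable {κ K l m a b : ℂ} {x X y : F} {R : LocalSubring F} {T : Subring F}

/-- The relation divided by `y²`, hence regular at `y = ∞`, where it reads `(x y - 1) X = -l m a b`.
So `y = ∞`, with coordinate `X`, is exchanged with the first exceptional curve over `(0, ∞)`, with
coordinate `x y`. -/
lemma rel_inv (h : Flip2 κ K l m a b x X y) :
    (1 - con l * y⁻¹) * (x * y - 1) * (X - y⁻¹) =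
      -con l * con m * ((con a - y⁻¹) * (con b - y⁻¹)) := by
  have hy : y⁻¹ * y = 1 := inv_mul_cancel₀ h.y0
  have h0 := h.y0
  have e1 : (1 - con l * y⁻¹) = (y - con l) * y⁻¹ := by linear_combination -hy
  have e2 : X - y⁻¹ = (X * y - 1) * y⁻¹ := by linear_combination -X * hy
  have e3 : con a - y⁻¹ = (con a * y - 1) * y⁻¹ := by linear_combination -con a * hy
  have e4 : con b - y⁻¹ = (con b * y - 1) * y⁻¹ := by linear_combination -con b * hy
  rw [e1, e2, e3, e4]
  linear_combination y⁻¹ ^ 2 * h.rel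

lemma e3_of_inftyY (h : Flip2 κ K l m a b x X y) (hT : Sub R T) (hX : X ∈ T) (hy : y⁻¹ ∈ T)
    (vy : Van R y⁻¹) (uX : Unt R X) : x * y ∈ T ∧ Unt R (x * y - 1) := by
  obtain ⟨_, _⟩ := hT.hasConst
  obtain ⟨_, _⟩ := hT.mem hX
  obtain ⟨_, _⟩ := hT.mem hy
  have u : Unt R ((1 - con l * y⁻¹) * (X - y⁻¹)) :=
    .mul (.of_res (by simp [vy.res])) (.of_res (by simpa [vy.res] using uX.res))
  have u' : Unt R (-con l * con m * ((con a - y⁻¹) * (con b - y⁻¹))) :=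
    .of_res (by simp [vy.res, h.con_ne])
  have e : x * y - 1 = -con l * con m * ((con a - y⁻¹) * (con b - y⁻¹)) /
      ((1 - con l * y⁻¹) * (X - y⁻¹)) := by
    rw [eq_div_iff u.ne_zero]
    linear_combination h.rel_inv
  constructor
  · have h1 : x * y - 1 ∈ T := by
      rw [e]
      exact hT.div u
    simpa using add_mem h1 T.one_mem
  · rw [e]
    exact u'.div u

lemma inftyY_of_e3 (h : Flip2 κ K l m a b x X y) (hT : Sub R T) (hg : X * y ∈ T) (hy : y⁻¹ ∈ T)
    (vy : Van R y⁻¹) (uW : Unt R (X * y - 1)) : x ∈ T ∧ Unt R x := by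
  obtain ⟨_, _⟩ := hT.hasConst
  obtain ⟨_, _⟩ := hT.mem hg
  obtain ⟨_, _⟩ := hT.mem hy
  have u : Unt R ((1 - con l * y⁻¹) * (X * y - 1)) := .mul (.of_res (by simp [vy.res])) uW
  have u' : Unt R (y⁻¹ * ((1 - con l * y⁻¹) * (X * y - 1)) -
      con l * con m * ((con a - y⁻¹) * (con b - y⁻¹))) :=
    .of_res (by simp [vy.res, h.con_ne])
  have e : x = (y⁻¹ * ((1 - con l * y⁻¹) * (X * y - 1)) -
      con l * con m * ((con a - y⁻¹) * (con b - y⁻¹))) / ((1 - con l * y⁻¹) * (X * y - 1)) := by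
    rw [eq_div_iff u.ne_zero]
    linear_combination h.symm.rel_inv
  constructor
  · rw [e]
    exact hT.div u
  · rw [e]
    exact u'.div u

lemma corner_of_e3 (h : Flip2 κ K l m a b x X y) (hT : Sub R T) (hg : X * y ∈ T) (hy : y⁻¹ ∈ T)
    (vy : Van R y⁻¹) (vW : Van R (X * y - 1)) : x⁻¹ ∈ T ∧ Van R x⁻¹ := by
  obtain ⟨_, _⟩ := hT.hasConst
  obtain ⟨_, _⟩ := hT.mem hg
  obtain ⟨_, _⟩ := hT.mem hy
  have u : Unt R (y⁻¹ * ((1 - con l * y⁻¹) * (X * y - 1)) -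
      con l * con m * ((con a - y⁻¹) * (con b - y⁻¹))) :=
    .of_res (by simp [vy.res, h.con_ne])
  have e : x⁻¹ = (1 - con l * y⁻¹) * (X * y - 1) / (y⁻¹ * ((1 - con l * y⁻¹) * (X * y - 1)) -
      con l * con m * ((con a - y⁻¹) * (con b - y⁻¹))) := by
    rw [eq_div_iff u.ne_zero, inv_mul_eq_iff_eq_mul₀ h.x0]
    linear_combination -h.symm.rel_inv
  rw [e]
  exact ⟨hT.div u, Van.div (.of_res (by rw [res_mul, vW.res, mul_zero])) u⟩

lemma e3_of_corner (h : Flip2 κ K l m a b x X y) (hT : Sub R T) (hX : X⁻¹ ∈ T) (hy : y⁻¹ ∈ T)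
    (vX : Van R X⁻¹) (vy : Van R y⁻¹) : x * y ∈ T ∧ Van R (x * y - 1) := by
  obtain ⟨_, _⟩ := hT.hasConst
  obtain ⟨_, _⟩ := hT.mem hX
  obtain ⟨_, _⟩ := hT.mem hy
  have hXi : X⁻¹ * X = 1 := inv_mul_cancel₀ h.X0
  have u : Unt R ((1 - con l * y⁻¹) * (1 - X⁻¹ * y⁻¹)) := .of_res (by simp [vy.res])
  have e : x * y - 1 = -con l * con m * ((con a - y⁻¹) * (con b - y⁻¹)) * X⁻¹ /
      ((1 - con l * y⁻¹) * (1 - X⁻¹ * y⁻¹)) := by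
    rw [eq_div_iff u.ne_zero]
    linear_combination X⁻¹ * h.rel_inv - (1 - con l * y⁻¹) * (x * y - 1) * hXi
  have v : Van R (x * y - 1) := by
    rw [e]
    exact Van.div (.of_res (by rw [res_mul, vX.res, mul_zero])) u
  refine ⟨?_, v⟩
  have h1 : x * y - 1 ∈ T := by
    rw [e]
    exact hT.div u
  simpa using add_mem h1 T.one_mem

/-- With `S = 1 / (X² y)` and `η = 1 / y = X² S` the relation becomes polynomial in `X` and `S`. At
`X = 0` one has `U = 1` and `N = -l m a b`, so the second exceptional curve over `(0, ∞)` is kept,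
with its coordinate `S` going to `1 / (S (l m a b)²)`. In particular `S = K` goes to `κ`. -/
lemma e4_formulas (h : Flip2 κ K l m a b x X y) {S η U N : F} (hS : S * (X ^ 2 * y) = 1)
    (hη : η = X ^ 2 * S) (hU : U = (1 - con l * η) * (1 - X * S))
    (hN : N = X * U - con l * con m * ((con a - η) * (con b - η))) :
    y⁻¹ = η ∧ x * U = X * S * N ∧ (U ≠ 0 → N ≠ 0 → (x ^ 2 * y)⁻¹ = U ^ 2 / (S * N ^ 2)) := by
  have e1 : y⁻¹ = η := by
    rw [inv_eq_iff_eq_inv]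
    refine (inv_eq_of_mul_eq_one_left ?_).symm
    rw [hη]
    linear_combination hS
  have h1 := h.symm.rel_inv
  have hx := h.x0; have hX := h.X0; have hy := h.y0
  rw [e1] at h1
  have e2 : x * U = X * S * N := by
    have e3 : X * S * (X * y - 1) = 1 - X * S := by linear_combination hS
    rw [hN]
    linear_combination X * S * h1 - (x - η) * (1 - con l * η) * e3 + (x - η) * hU + U * hη
  refine ⟨e1, e2, fun hU0 hN0 => ?_⟩
  have hS0 : S ≠ 0 := left_ne_zero_of_mul_eq_one hS
  rw [eq_div_iff (by positivity), inv_mul_eq_iff_eq_mul₀ (by positivity)]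
  apply mul_left_cancel₀ hS0
  apply mul_left_cancel₀ (pow_ne_zero 2 hX)
  linear_combination -(x * U + X * S * N) * e2 - x ^ 2 * U ^ 2 * hS

lemma e4_of_e4 (h : Flip2 κ K l m a b x X y) (hT : Sub R T) (hX : X ∈ T)
    (hS : (X ^ 2 * y)⁻¹ ∈ T) (vX : Van R X) (uS : Unt R (X ^ 2 * y)⁻¹)
    (uK : Unt R ((X ^ 2 * y)⁻¹ - con K)) :
    x ∈ T ∧ (x ^ 2 * y)⁻¹ ∈ T ∧ Van R x ∧ Unt R (x ^ 2 * y)⁻¹ ∧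
      Unt R ((x ^ 2 * y)⁻¹ - con κ) := by
  have h0 : (X ^ 2 * y)⁻¹ * (X ^ 2 * y) = 1 :=
    inv_mul_cancel₀ (mul_ne_zero (pow_ne_zero 2 h.X0) h.y0)
  obtain ⟨S, hS'⟩ : ∃ S, S = (X ^ 2 * y)⁻¹ := ⟨_, rfl⟩
  rw [← hS'] at hS uS uK h0
  obtain ⟨_, _⟩ := hT.hasConst
  obtain ⟨_, _⟩ := hT.mem hX
  obtain ⟨_, _⟩ := hT.mem hS
  obtain ⟨U, hU, _, _, rU⟩ : ∃ U : F, U = (1 - con l * (X ^ 2 * S)) * (1 - X * S) ∧ Mem T U ∧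
      Mem R.toSubring U ∧ res R U = 1 :=
    ⟨_, rfl, inferInstance, inferInstance, by simp [vX.res]⟩
  obtain ⟨N, hN, _, _, rN⟩ : ∃ N : F,
      N = X * U - con l * con m * ((con a - X ^ 2 * S) * (con b - X ^ 2 * S)) ∧ Mem T N ∧
      Mem R.toSubring N ∧ res R N = -(res R (con l * con m * con a * con b)) :=
    ⟨_, rfl, inferInstance, inferInstance, by simp [vX.res]; ring⟩
  have uU : Unt R U := .of_res (by simp [rU])
  have uN : Unt R N := .of_res (by simp [rN, h.con_ne])
  obtain ⟨-, ex, es⟩ := h.e4_formulas h0 rfl hU hN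
  rw [← eq_div_iff uU.ne_zero] at ex
  specialize es uU.ne_zero uN.ne_zero
  have uSN := uS.mul (uN.pow 2)
  have u2 : Unt R (U ^ 2 - con κ * S * N ^ 2) := by
    refine .of_res fun h1 => uK.res ?_
    have h2 : res R (con κ * con K * (con l * con m * con a * con b) ^ 2 : F) = 1 := by
      rw [h.con_κ, res_one]
    simp only [res_mul, res_pow, res_sub, rU, rN] at h1 h2 ⊢
    linear_combination (-res R S) * h2 - res R (con K) * h1
  have e2 : (x ^ 2 * y)⁻¹ - con κ = (U ^ 2 - con κ * S * N ^ 2) / (S * N ^ 2) := by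
    rw [es, eq_div_iff uSN.ne_zero, sub_mul, div_mul_cancel₀ _ uSN.ne_zero]
    ring
  rw [e2, es, ex]
  exact ⟨hT.div uU, hT.div uSN, Van.div (.of_res (by simp [vX.res])) uU, (uU.pow 2).div uSN,
    u2.div uSN⟩

/-- The second exceptional curve over `(0, ∞)` is kept, while `y = ∞` and the first one are
exchanged. So its intersection with the strict transform of `y = ∞`, where `S = 0`, goes to its
intersection with the first one. -/
lemma e4'_of_e4 (h : Flip2 κ K l m a b x X y) (hT : Sub R T) (hX : X ∈ T)
    (hS : (X ^ 2 * y)⁻¹ ∈ T) (vX : Van R X) (vS : Van R (X ^ 2 * y)⁻¹) :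
    x ^ 2 * y ∈ T ∧ (x * y)⁻¹ ∈ T ∧ Van R (x ^ 2 * y) ∧ Van R (x * y)⁻¹ := by
  have h0 : (X ^ 2 * y)⁻¹ * (X ^ 2 * y) = 1 :=
    inv_mul_cancel₀ (mul_ne_zero (pow_ne_zero 2 h.X0) h.y0)
  obtain ⟨S, hS'⟩ : ∃ S, S = (X ^ 2 * y)⁻¹ := ⟨_, rfl⟩
  rw [← hS'] at hS vS h0
  obtain ⟨_, _⟩ := hT.hasConst
  obtain ⟨_, _⟩ := hT.mem hX
  obtain ⟨_, _⟩ := hT.mem hS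
  obtain ⟨U, hU, _, _, rU⟩ : ∃ U : F, U = (1 - con l * (X ^ 2 * S)) * (1 - X * S) ∧ Mem T U ∧
      Mem R.toSubring U ∧ res R U = 1 :=
    ⟨_, rfl, inferInstance, inferInstance, by simp [vX.res]⟩
  obtain ⟨N, hN, _, _, rN⟩ : ∃ N : F,
      N = X * U - con l * con m * ((con a - X ^ 2 * S) * (con b - X ^ 2 * S)) ∧ Mem T N ∧
      Mem R.toSubring N ∧ res R N = -(res R (con l * con m * con a * con b)) :=
    ⟨_, rfl, inferInstance, inferInstance, by simp [vX.res]; ring⟩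
  have uU : Unt R U := .of_res (by simp [rU])
  have uN : Unt R N := .of_res (by simp [rN, h.con_ne])
  obtain ⟨ey, ex, es⟩ := h.e4_formulas h0 rfl hU hN
  rw [← eq_div_iff uU.ne_zero] at ex
  specialize es uU.ne_zero uN.ne_zero
  have := uU.ne_zero; have := uN.ne_zero
  have hS0 : S ≠ 0 := left_ne_zero_of_mul_eq_one h0
  have hX0 := h.X0
  have e1 : x ^ 2 * y = S * N ^ 2 / U ^ 2 := by rw [← inv_inj, es, inv_div]
  have e2 : (x * y)⁻¹ = X * U / N := by
    rw [mul_inv, ey, ex]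
    field_simp
  rw [e1, e2]
  exact ⟨hT.div (uU.pow 2), hT.div uN, Van.div (.of_res (by rw [res_mul, vS.res, zero_mul]))
    (uU.pow 2), Van.div (.of_res (by rw [res_mul, vX.res, zero_mul])) uN⟩

lemma e4_of_e4' (h : Flip2 κ K l m a b x X y) (hT : Sub R T) (ht : X ^ 2 * y ∈ T)
    (hz : (X * y)⁻¹ ∈ T) (vt : Van R (X ^ 2 * y)) (vz : Van R (X * y)⁻¹) :
    x ∈ T ∧ (x ^ 2 * y)⁻¹ ∈ T ∧ Van R x ∧ Van R (x ^ 2 * y)⁻¹ := by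
  have hX0 := h.X0; have hy0 := h.y0
  obtain ⟨t, ht'⟩ : ∃ t, t = X ^ 2 * y := ⟨_, rfl⟩
  obtain ⟨z, hz'⟩ : ∃ z, z = (X * y)⁻¹ := ⟨_, rfl⟩
  have hX : X = t * z := by rw [ht', hz']; field_simp
  have ht0 : t ≠ 0 := by rw [ht']; positivity
  have hz0 : z ≠ 0 := by rw [hz']; positivity
  have h0 : t⁻¹ * (X ^ 2 * y) = 1 := by rw [← ht', inv_mul_cancel₀ ht0]
  rw [← ht'] at ht vt
  rw [← hz'] at hz vz
  have e1 : X ^ 2 * t⁻¹ = z ^ 2 * t := by rw [hX]; field_simp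
  have e2 : X * t⁻¹ = z := by rw [hX]; field_simp
  obtain ⟨_, _⟩ := hT.hasConst
  obtain ⟨_, _⟩ := hT.mem ht
  obtain ⟨_, _⟩ := hT.mem hz
  obtain ⟨U, hU, _, _, rU⟩ : ∃ U : F, U = (1 - con l * (z ^ 2 * t)) * (1 - z) ∧ Mem T U ∧
      Mem R.toSubring U ∧ res R U = 1 :=
    ⟨_, rfl, inferInstance, inferInstance, by simp [vz.res]⟩
  obtain ⟨N, hN, _, _, rN⟩ : ∃ N : F,
      N = t * z * U - con l * con m * ((con a - z ^ 2 * t) * (con b - z ^ 2 * t)) ∧ Mem T N ∧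
      Mem R.toSubring N ∧ res R N = -(res R (con l * con m * con a * con b)) :=
    ⟨_, rfl, inferInstance, inferInstance, by simp [vz.res]; ring⟩
  have uU : Unt R U := .of_res (by simp [rU])
  have uN : Unt R N := .of_res (by simp [rN, h.con_ne])
  obtain ⟨-, ex, es⟩ := h.e4_formulas (U := U) (N := N) h0 e1.symm (by rw [e2]; exact hU) (by rw [hX]; exact hN)
  rw [e2, ← eq_div_iff uU.ne_zero] at ex
  specialize es uU.ne_zero uN.ne_zero
  have := uU.ne_zero; have := uN.ne_zero
  have es' : (x ^ 2 * y)⁻¹ = t * U ^ 2 / N ^ 2 := by rw [es]; field_simp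
  rw [es', ex]
  exact ⟨hT.div uU, hT.div (uN.pow 2), Van.div (.of_res (by rw [res_mul, vz.res, zero_mul])) uU,
    Van.div (.of_res (by rw [res_mul, vt.res, zero_mul])) (uN.pow 2)⟩

/-- The last exceptional curve over `(0, ∞)` is kept. The slopes are compared by expanding `S`, `U`
and `N` to first order in `X`, with exact remainders `G`, `u₁` and `n₁`. -/
lemma e5_of_e5 (h : Flip2 κ K l m a b x X y) (hT : Sub R T) (hX : X ∈ T)
    (hG : ((X ^ 2 * y)⁻¹ - con K) / X ∈ T) (vX : Van R X) :
    x ∈ T ∧ ((x ^ 2 * y)⁻¹ - con κ) / x ∈ T ∧ Van R x := by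
  have h0 : (X ^ 2 * y)⁻¹ * (X ^ 2 * y) = 1 :=
    inv_mul_cancel₀ (mul_ne_zero (pow_ne_zero 2 h.X0) h.y0)
  have hX0 := h.X0; have hx0 := h.x0
  obtain ⟨G, hG'⟩ : ∃ G, G = ((X ^ 2 * y)⁻¹ - con K) / X := ⟨_, rfl⟩
  have hSG : (X ^ 2 * y)⁻¹ = con K + X * G := by
    rw [hG', mul_div_cancel₀ _ hX0]; ring
  rw [← hG'] at hG
  rw [hSG] at h0
  obtain ⟨_, _⟩ := hT.hasConst
  obtain ⟨_, _⟩ := hT.mem hX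
  obtain ⟨_, _⟩ := hT.mem hG
  obtain ⟨S, hS, _, _, rS⟩ : ∃ S : F, S = con K + X * G ∧ Mem T S ∧ Mem R.toSubring S ∧
      res R S = res R (con K) := ⟨_, rfl, inferInstance, inferInstance, by simp [vX.res]⟩
  rw [← hS] at h0
  obtain ⟨u₁, hu₁, _, _⟩ : ∃ u₁ : F, u₁ = S + con l * X * S - con l * X ^ 2 * S ^ 2 ∧ Mem T u₁ ∧
      Mem R.toSubring u₁ := ⟨_, rfl, inferInstance, inferInstance⟩
  obtain ⟨U, hU, _, _, rU⟩ : ∃ U : F, U = 1 - X * u₁ ∧ Mem T U ∧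
      Mem R.toSubring U ∧ res R U = 1 :=
    ⟨_, rfl, inferInstance, inferInstance, by simp [vX.res]⟩
  obtain ⟨n₁, hn₁, _, _⟩ : ∃ n₁ : F,
      n₁ = U + con l * con m * X * S * (con a + con b - X ^ 2 * S) ∧ Mem T n₁ ∧
      Mem R.toSubring n₁ := ⟨_, rfl, inferInstance, inferInstance⟩
  obtain ⟨N, hN, _, _, rN⟩ : ∃ N : F,
      N = -(con l * con m * con a * con b) + X * n₁ ∧ Mem T N ∧
      Mem R.toSubring N ∧ res R N = -(res R (con l * con m * con a * con b)) :=
    ⟨_, rfl, inferInstance, inferInstance, by simp [vX.res]⟩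
  obtain ⟨-, ex, es⟩ := h.e4_formulas (U := U) (N := N) h0 rfl
    (by rw [hU, hu₁]; ring) (by rw [hN, hn₁]; ring)
  have uS : Unt R S := .of_res (by simp [rS, h.con_ne])
  have uU : Unt R U := .of_res (by simp [rU])
  have uN : Unt R N := .of_res (by simp [rN, h.con_ne])
  have u3 := (uS.pow 2).mul (uN.pow 3)
  rw [← eq_div_iff uU.ne_zero] at ex
  specialize es uU.ne_zero uN.ne_zero
  have := uU.ne_zero; have := uN.ne_zero; have := uS.ne_zero
  have hκ : (con κ * con K * (con l * con m * con a * con b) ^ 2 : F) = 1 := h.con_κ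
  have e : ((x ^ 2 * y)⁻¹ - con κ) / x =
      (-2 * u₁ + X * u₁ ^ 2 - con κ * G * N ^ 2 - con κ * con K * (X * n₁ ^ 2 -
        2 * (con l * con m * con a * con b) * n₁)) * U / (S ^ 2 * N ^ 3) := by
    -- The constant term is `1 - κ K (l m a b)² = 0`, so a factor `X` splits off.
    have key : U ^ 2 - con κ * S * N ^ 2 = X * (-2 * u₁ + X * u₁ ^ 2 - con κ * G * N ^ 2 -
        con κ * con K * (X * n₁ ^ 2 - 2 * (con l * con m * con a * con b) * n₁)) := by
      rw [hS, hU]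
      linear_combination -hκ - con κ * con K *
        (N - (con l * con m * con a * con b) + X * n₁) * hN
    rw [es, ex, div_sub' (by positivity), div_div_div_eq, div_eq_div_iff (by positivity) u3.ne_zero]
    linear_combination U * S ^ 2 * N ^ 3 * key
  rw [e, ex]
  exact ⟨hT.div uU, hT.div u3, Van.div (.of_res (by rw [res_mul, res_mul, vX.res]; simp)) uU⟩

/-- The intersection of the last two exceptional curves over `(0, ∞)`. The first-order expansion is
the same, except that both `X` and `S - K` are now multiples of `σ = S - K`, and the quotient of the
two vanishes. -/
lemma e5'_of_e5' (h : Flip2 κ K l m a b x X y) (hT : Sub R T)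
    (hh : X / ((X ^ 2 * y)⁻¹ - con K) ∈ T) (hs : (X ^ 2 * y)⁻¹ - con K ∈ T)
    (vh : Van R (X / ((X ^ 2 * y)⁻¹ - con K))) (vs : Van R ((X ^ 2 * y)⁻¹ - con K)) :
    x / ((x ^ 2 * y)⁻¹ - con κ) ∈ T ∧ (x ^ 2 * y)⁻¹ - con κ ∈ T ∧
      Van R (x / ((x ^ 2 * y)⁻¹ - con κ)) ∧ Van R ((x ^ 2 * y)⁻¹ - con κ) := by
  have h0 : (X ^ 2 * y)⁻¹ * (X ^ 2 * y) = 1 :=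
    inv_mul_cancel₀ (mul_ne_zero (pow_ne_zero 2 h.X0) h.y0)
  have hX0 := h.X0; have hx0 := h.x0; have hσ0 := h.S0
  obtain ⟨σ, hσ⟩ : ∃ σ, σ = (X ^ 2 * y)⁻¹ - con K := ⟨_, rfl⟩
  have hSσ : (X ^ 2 * y)⁻¹ = con K + σ := by rw [hσ]; ring
  rw [← hσ] at hs vs hh vh hσ0
  obtain ⟨g, hg⟩ : ∃ g, g = X / σ := ⟨_, rfl⟩
  have hXg : X = g * σ := by rw [hg, div_mul_cancel₀ _ hσ0]
  rw [← hg] at hh vh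
  rw [hSσ] at h0
  obtain ⟨_, _⟩ := hT.hasConst
  obtain ⟨_, _⟩ := hT.mem hs
  obtain ⟨_, _⟩ := hT.mem hh
  have hX : X ∈ T := by rw [hXg]; exact Mem.mem
  obtain ⟨_, _⟩ := hT.mem hX
  have vX : Van R X := by rw [hXg]; exact .of_res (by rw [res_mul, vh.res, zero_mul])
  obtain ⟨S, hS, _, _, rS⟩ : ∃ S : F, S = con K + σ ∧ Mem T S ∧ Mem R.toSubring S ∧
      res R S = res R (con K) := ⟨_, rfl, inferInstance, inferInstance, by simp [vs.res]⟩
  rw [← hS] at h0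
  obtain ⟨u₁, hu₁, _, _⟩ : ∃ u₁ : F, u₁ = S + con l * X * S - con l * X ^ 2 * S ^ 2 ∧ Mem T u₁ ∧
      Mem R.toSubring u₁ := ⟨_, rfl, inferInstance, inferInstance⟩
  obtain ⟨U, hU, _, _, rU⟩ : ∃ U : F, U = 1 - X * u₁ ∧ Mem T U ∧
      Mem R.toSubring U ∧ res R U = 1 :=
    ⟨_, rfl, inferInstance, inferInstance, by simp [vX.res]⟩
  obtain ⟨n₁, hn₁, _, _⟩ : ∃ n₁ : F,
      n₁ = U + con l * con m * X * S * (con a + con b - X ^ 2 * S) ∧ Mem T n₁ ∧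
      Mem R.toSubring n₁ := ⟨_, rfl, inferInstance, inferInstance⟩
  obtain ⟨N, hN, _, _, rN⟩ : ∃ N : F,
      N = -(con l * con m * con a * con b) + X * n₁ ∧ Mem T N ∧
      Mem R.toSubring N ∧ res R N = -(res R (con l * con m * con a * con b)) :=
    ⟨_, rfl, inferInstance, inferInstance, by simp [vX.res]⟩
  obtain ⟨-, ex, es⟩ := h.e4_formulas (U := U) (N := N) h0 rfl
    (by rw [hU, hu₁]; ring) (by rw [hN, hn₁]; ring)
  have uS : Unt R S := .of_res (by simp [rS, h.con_ne])
  have uU : Unt R U := .of_res (by simp [rU])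
  have uN : Unt R N := .of_res (by simp [rN, h.con_ne])
  rw [← eq_div_iff uU.ne_zero] at ex
  specialize es uU.ne_zero uN.ne_zero
  have := uU.ne_zero; have := uN.ne_zero; have := uS.ne_zero
  have hκ : (con κ * con K * (con l * con m * con a * con b) ^ 2 : F) = 1 := h.con_κ
  obtain ⟨E, hE, _, _⟩ : ∃ E : F, E = -2 * u₁ + X * u₁ ^ 2 - con κ * con K * (X * n₁ ^ 2 -
        2 * (con l * con m * con a * con b) * n₁) ∧ Mem T E ∧ Mem R.toSubring E :=
    ⟨_, rfl, inferInstance, inferInstance⟩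
  have uE : Unt R (g * E - con κ * N ^ 2) := .of_res (by simp [vh.res, rN, h.con_ne])
  have key : U ^ 2 - con κ * S * N ^ 2 = σ * (g * E - con κ * N ^ 2) := by
    rw [hS, hU, hE]
    linear_combination -hκ - con κ * con K *
      (N - (con l * con m * con a * con b) + X * n₁) * hN +
      (-2 * u₁ + X * u₁ ^ 2 - con κ * con K * (X * n₁ ^ 2 -
        2 * (con l * con m * con a * con b) * n₁)) * hXg
  have e1 : (x ^ 2 * y)⁻¹ - con κ = σ * (g * E - con κ * N ^ 2) / (S * N ^ 2) := by
    rw [es, ← key, eq_div_iff (by positivity), sub_mul, div_mul_cancel₀ _ (by positivity)]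
    ring
  have uSN := uS.mul (uN.pow 2)
  have uUE := uU.mul uE
  have e2 : x / ((x ^ 2 * y)⁻¹ - con κ) = g * S ^ 2 * N ^ 3 / (U * (g * E - con κ * N ^ 2)) := by
    have := uE.ne_zero
    rw [e1, ex, hXg, div_div_div_eq, div_eq_div_iff (by positivity) uUE.ne_zero]
    ring
  rw [e2, e1]
  exact ⟨hT.div uUE, hT.div uSN,
    Van.div (.of_res (by rw [res_mul, res_mul, vh.res, zero_mul, zero_mul])) uUE,
    Van.div (.of_res (by rw [res_mul, vs.res, zero_mul])) uSN⟩

/-- On the first exceptional curve over `(∞, 0)`, where `y = 0`, the relation is `(x y - 1)(X y - 1)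
= m`. This is an isomorphism of that curve that matches `X y = 0` with `x y = 1 - m`, as the factor
`X y` in the last formula shows, and `X y = 1` with `x y = ∞`. -/
lemma e6_formulas (h : Flip2 κ K l m a b x X y) {β : F}
    (hβ : (y - con l) * (x * y - 1) * (X * y - 1) = β)
    (h0 : β + (y - con l) * (X * y - 1) ≠ 0) (h1 : (y - con l) * (X * y - 1) ≠ 0) :
    x⁻¹ = y * ((y - con l) * (X * y - 1)) / (β + (y - con l) * (X * y - 1)) ∧
    x * y = (β + (y - con l) * (X * y - 1)) / ((y - con l) * (X * y - 1)) ∧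
    x * y - 1 = β / ((y - con l) * (X * y - 1)) ∧
    x * y - 1 + con m = X * y * (-con l * con m + X⁻¹ * (-con l * con m * con a * con b * y +
      con l * con m * (con a + con b) + con m * (X * y - 1))) / ((y - con l) * (X * y - 1)) := by
  refine ⟨?_, ?_, ?_, ?_⟩
  · rw [eq_div_iff h0, inv_mul_eq_iff_eq_mul₀ h.x0]
    linear_combination -hβ
  · rw [eq_div_iff h1]
    linear_combination hβ
  · rw [eq_div_iff h1]
    linear_combination hβ
  · rw [eq_div_iff h1]
    have hX : X⁻¹ * X = 1 := inv_mul_cancel₀ h.X0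
    linear_combination h.rel - y * (-con l * con m * con a * con b * y +
      con l * con m * (con a + con b) + con m * (X * y - 1)) * hX

end Flip2
end Flip2

/-! ### The backward half-step: changes of chart over `(∞, 0)` -/

section Flip2
variable {F : Type} [Field F] [Algebra ℂ F]
namespace Flip2
variable {κ K l m a b : ℂ} {x X y : F} {R : LocalSubring F} {T : Subring F}

lemma res_ne (h : Flip2 κ K l m a b x X y) [HasConst R.toSubring] :
    res R (con l : F) ≠ 0 ∧ res R (con m : F) ≠ 0 ∧ 1 - res R (con m : F) ≠ 0 := by
  have : res R (con (1 - m) : F) ≠ 0 := by simp [sub_eq_zero, h.hm.symm]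
  rw [con_sub, con_one, res_sub, res_one] at this
  exact ⟨by simp [h.con_ne], by simp [h.con_ne], this⟩

lemma y_of_e6 (h : Flip2 κ K l m a b x X y) (hT : Sub R T) (hX : X⁻¹ ∈ T) (hg : X * y ∈ T)
    (vX : Van R X⁻¹) : y ∈ T ∧ Van R y := by
  obtain ⟨_, _⟩ := hT.mem hX
  obtain ⟨_, _⟩ := hT.mem hg
  have e : y = X⁻¹ * (X * y) := by rw [inv_mul_cancel_left₀ h.X0]
  constructor
  · rw [e]
    exact mul_mem hX hg
  · rw [e]
    exact .of_res (by rw [res_mul, vX.res, zero_mul])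

lemma e6_of_e6 (h : Flip2 κ K l m a b x X y) (hT : Sub R T) (hX : X⁻¹ ∈ T) (hg : X * y ∈ T)
    (vX : Van R X⁻¹) (uW : Unt R (X * y - 1)) (uM : Unt R (X * y - 1 + con m))
    (ug : Unt R (X * y)) :
    x⁻¹ ∈ T ∧ x * y ∈ T ∧ Van R x⁻¹ ∧ Unt R (x * y - 1) ∧ Unt R (x * y - 1 + con m) ∧
      Unt R (x * y) := by
  obtain ⟨hy, vy⟩ := h.y_of_e6 hT hX hg vX
  obtain ⟨β, _, _, hβ, rel, hr⟩ := h.exists_rhs hT hy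
  obtain ⟨_, _⟩ := hT.hasConst
  obtain ⟨_, _⟩ := hT.mem hX
  obtain ⟨_, _⟩ := hT.mem hg
  obtain ⟨_, _⟩ := hT.mem hy
  obtain ⟨hl, hm, hm1⟩ := h.res_ne (R := R)
  have u1 : Unt R ((y - con l) * (X * y - 1)) := .mul (.of_res (by simp [vy.res, h.con_ne])) uW
  have uβ : Unt R β := .of_res (by simp [hr, vy.res, h.con_ne])
  have u2 : Unt R (β + (y - con l) * (X * y - 1)) := by
    refine .of_res ?_
    have h2 := mul_ne_zero hl uM.res
    rw [res_add] at h2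
    rw [res_add, res_mul, res_sub, hr, vy.res]
    intro h1
    apply h2
    linear_combination -h1
  have u3 : Unt R (-con l * con m + X⁻¹ * (-con l * con m * con a * con b * y +
      con l * con m * (con a + con b) + con m * (X * y - 1))) := by
    refine .of_res ?_
    rw [res_add, res_mul (f := X⁻¹), vX.res]
    simp [h.con_ne]
  obtain ⟨e1, e2, e3, e4⟩ := h.e6_formulas rel u2.ne_zero u1.ne_zero
  refine ⟨?_, ?_, ?_, ?_, ?_, ?_⟩
  · rw [e1]
    exact hT.div u2
  · rw [e2]
    exact hT.div u1
  · rw [e1]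
    exact Van.div (.of_res (by rw [res_mul, vy.res, zero_mul])) u2
  · rw [e3]
    exact uβ.div u1
  · rw [e4]
    exact (ug.mul u3).div u1
  · rw [e2]
    exact u2.div u1

/-- At `X y = 0` the first exceptional curve over `(∞, 0)` meets the strict transform of `y = 0`.
The former is kept and the latter becomes the second exceptional curve, so the image is the
intersection of the two exceptional curves. -/
lemma e7'_of_e6 (h : Flip2 κ K l m a b x X y) (hT : Sub R T) (hX : X⁻¹ ∈ T) (hg : X * y ∈ T)
    (vX : Van R X⁻¹) (vg : Van R (X * y)) :
    (x * (x * y - 1 + con m))⁻¹ ∈ T ∧ x * y - 1 + con m ∈ T ∧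
      Van R (x * (x * y - 1 + con m))⁻¹ ∧ Van R (x * y - 1 + con m) := by
  obtain ⟨hy, vy⟩ := h.y_of_e6 hT hX hg vX
  obtain ⟨β, _, _, hβ, rel, hr⟩ := h.exists_rhs hT hy
  obtain ⟨_, _⟩ := hT.hasConst
  obtain ⟨_, _⟩ := hT.mem hX
  obtain ⟨_, _⟩ := hT.mem hg
  obtain ⟨_, _⟩ := hT.mem hy
  obtain ⟨hl, hm, hm1⟩ := h.res_ne (R := R)
  have u1 : Unt R ((y - con l) * (X * y - 1)) :=
    .of_res (by rw [res_mul, res_sub, res_sub (f := X * y), vg.res, vy.res]; simp [h.con_ne])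
  have u2 : Unt R (β + (y - con l) * (X * y - 1)) := by
    refine .of_res ?_
    have h2 := mul_ne_zero hl hm1
    rw [res_add, res_mul, res_sub, hr, res_sub (f := X * y), vg.res, vy.res, res_one]
    intro h1
    apply h2
    linear_combination h1
  obtain ⟨J, hJ, _, _, rJ⟩ : ∃ J : F, J = -con l * con m + X⁻¹ * (-con l * con m * con a * con b * y +
      con l * con m * (con a + con b) + con m * (X * y - 1)) ∧ Mem T J ∧ Mem R.toSubring J ∧
      res R J = -res R (con l) * res R (con m) := ⟨_, rfl, inferInstance, inferInstance, by
    rw [res_add, res_mul (f := X⁻¹), vX.res]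
    simp⟩
  have u3 : Unt R J := .of_res (by simp [rJ, h.con_ne])
  obtain ⟨e1, e2, e3, e4⟩ := h.e6_formulas rel u2.ne_zero u1.ne_zero
  rw [← hJ] at e4
  have e5 : (x * (x * y - 1 + con m))⁻¹ = X⁻¹ * ((y - con l) * (X * y - 1)) ^ 2 /
      ((β + (y - con l) * (X * y - 1)) * J) := by
    have hX0 := h.X0; have hy0 := h.y0
    have := u1.ne_zero; have := u2.ne_zero; have := u3.ne_zero
    rw [mul_inv, e1, e4, inv_div, div_mul_div_comm, div_eq_div_iff (by positivity) (by positivity)]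
    field_simp
  rw [e5, e4]
  exact ⟨hT.div (u2.mul u3), hT.div u1,
    Van.div (.of_res (by rw [res_mul, vX.res, zero_mul])) (u2.mul u3),
    Van.div (.of_res (by rw [res_mul, vg.res, zero_mul])) u1⟩

/-- The curves `X y = 1` and `x = ∞` correspond, so the point with `X y = 1` goes to the
intersection with the fibre at infinity. -/
lemma e6'_of_e6 (h : Flip2 κ K l m a b x X y) (hT : Sub R T) (hX : X⁻¹ ∈ T) (hg : X * y ∈ T)
    (vX : Van R X⁻¹) (vW : Van R (X * y - 1)) :
    (x * y)⁻¹ ∈ T ∧ y ∈ T ∧ Van R (x * y)⁻¹ ∧ Van R y := by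
  obtain ⟨hy, vy⟩ := h.y_of_e6 hT hX hg vX
  obtain ⟨β, _, _, hβ, rel, hr⟩ := h.exists_rhs hT hy
  obtain ⟨_, _⟩ := hT.hasConst
  obtain ⟨_, _⟩ := hT.mem hX
  obtain ⟨_, _⟩ := hT.mem hg
  obtain ⟨_, _⟩ := hT.mem hy
  have u2 : Unt R (β + (y - con l) * (X * y - 1)) := by
    refine .of_res ?_
    rw [res_add, res_mul, hr, vW.res, vy.res]
    simp [h.con_ne]
  have hx0 := h.x0; have hy0 := h.y0
  have e2 : (x * y)⁻¹ = (y - con l) * (X * y - 1) / (β + (y - con l) * (X * y - 1)) := by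
    rw [eq_div_iff u2.ne_zero, inv_mul_eq_iff_eq_mul₀ (by positivity)]
    linear_combination -rel
  refine ⟨?_, hy, ?_, vy⟩
  · rw [e2]
    exact hT.div u2
  · rw [e2]
    exact Van.div (.of_res (by rw [res_mul, vW.res, mul_zero])) u2

lemma e6_of_e6' (h : Flip2 κ K l m a b x X y) (hT : Sub R T) (hz : (X * y)⁻¹ ∈ T) (hy : y ∈ T)
    (vz : Van R (X * y)⁻¹) (vy : Van R y) :
    x⁻¹ ∈ T ∧ x * y ∈ T ∧ Van R x⁻¹ ∧ Van R (x * y - 1) := by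
  obtain ⟨β, _, _, hβ, rel, hr⟩ := h.exists_rhs hT hy
  obtain ⟨_, _⟩ := hT.hasConst
  obtain ⟨_, _⟩ := hT.mem hz
  obtain ⟨_, _⟩ := hT.mem hy
  obtain ⟨z, hz'⟩ : ∃ z, z = (X * y)⁻¹ := ⟨_, rfl⟩
  have hx0 := h.x0; have hy0 := h.y0; have hX0 := h.X0
  have h0 : z * (X * y) = 1 := by rw [hz']; exact inv_mul_cancel₀ (by positivity)
  have hz0 : z ≠ 0 := left_ne_zero_of_mul_eq_one h0
  rw [← hz'] at hz vz
  obtain ⟨_, _⟩ := hT.mem hz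
  have u1 : Unt R ((y - con l) * (1 - z)) := .of_res (by simp [vz.res, vy.res, h.con_ne])
  have u2 : Unt R (β * z + (y - con l) * (1 - z)) :=
    .of_res (by simp [vz.res, vy.res, h.con_ne])
  have ew : x * y - 1 = β * z / ((y - con l) * (1 - z)) := by
    rw [eq_div_iff u1.ne_zero]
    linear_combination z * rel - (y - con l) * (x * y - 1) * h0
  have e1 : x * y = (β * z + (y - con l) * (1 - z)) / ((y - con l) * (1 - z)) := by
    rw [eq_div_iff u1.ne_zero]
    rw [eq_div_iff u1.ne_zero] at ew
    linear_combination ew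
  have e2 : x⁻¹ = y * ((y - con l) * (1 - z)) / (β * z + (y - con l) * (1 - z)) := by
    rw [eq_div_iff u2.ne_zero, inv_mul_eq_iff_eq_mul₀ hx0]
    rw [eq_div_iff u1.ne_zero] at ew
    linear_combination -ew
  refine ⟨?_, ?_, ?_, ?_⟩
  · rw [e2]
    exact hT.div u2
  · rw [e1]
    exact hT.div u1
  · rw [e2]
    exact Van.div (.of_res (by rw [res_mul, vy.res, zero_mul])) u2
  · rw [ew]
    exact Van.div (.of_res (by rw [res_mul, vz.res, mul_zero])) u1

lemma e6_of_e7' (h : Flip2 κ K l m a b x X y) (hT : Sub R T)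
    (hg : (X * (X * y - 1 + con m))⁻¹ ∈ T) (hs : X * y - 1 + con m ∈ T)
    (vg : Van R (X * (X * y - 1 + con m))⁻¹) (vs : Van R (X * y - 1 + con m)) :
    x⁻¹ ∈ T ∧ x * y ∈ T ∧ Van R x⁻¹ ∧ Van R (x * y) := by
  obtain ⟨σ, hσ⟩ : ∃ σ, σ = X * y - 1 + con m := ⟨_, rfl⟩
  obtain ⟨g, hg'⟩ : ∃ g, g = (X * σ)⁻¹ := ⟨_, rfl⟩
  have hx0 := h.x0; have hy0 := h.y0; have hX0 := h.X0; have hσ0 := h.M0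
  rw [← hσ] at hg hs vg vs hσ0
  rw [← hg'] at hg vg
  have h0 : g * (X * σ) = 1 := by rw [hg']; exact inv_mul_cancel₀ (by positivity)
  obtain ⟨_, _⟩ := hT.hasConst
  obtain ⟨_, _⟩ := hT.mem hg
  obtain ⟨_, _⟩ := hT.mem hs
  obtain ⟨hl, hm, hm1⟩ := h.res_ne (R := R)
  have ey : y = g * σ * (σ + 1 - con m) := by linear_combination y * (-h0) - g * σ * hσ
  have hy : y ∈ T := by rw [ey]; exact Mem.mem
  have vy : Van R y := by rw [ey]; exact .of_res (by rw [res_mul, res_mul, vg.res]; simp)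
  obtain ⟨β, _, _, hβ, rel, hr⟩ := h.exists_rhs hT hy
  obtain ⟨_, _⟩ := hT.mem hy
  have eW : X * y - 1 = σ - con m := by rw [hσ]; ring
  rw [eW] at rel
  have u1 : Unt R ((y - con l) * (σ - con m)) := .of_res (by simp [vs.res, vy.res, h.con_ne])
  have u2 : Unt R (σ + 1 - con m) := .of_res (by simpa [vs.res] using hm1)
  obtain ⟨J, hJ, _, _, rJ⟩ : ∃ J : F, J = g * (σ + 1 - con m) * (-con l * con m * con a * con b * y +
      con l * con m * (con a + con b) + (σ - con m)) - con l ∧ Mem T J ∧ Mem R.toSubring J ∧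
      res R J = -res R (con l) := ⟨_, rfl, inferInstance, inferInstance, by
    rw [res_sub, res_mul, res_mul, vg.res]
    simp⟩
  have uJ : Unt R J := .of_res (by simp [rJ, h.con_ne])
  have e0 : x * y * ((y - con l) * (σ - con m)) = σ * J := by
    rw [hJ]
    linear_combination rel + hβ + (-con l * con m * con a * con b * y +
      con l * con m * (con a + con b) + (σ - con m)) * ey
  have e1 : x * y = σ * J / ((y - con l) * (σ - con m)) := by
    rw [eq_div_iff u1.ne_zero, e0]
  have e2 : x⁻¹ = g * (σ + 1 - con m) * ((y - con l) * (σ - con m)) / J := by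
    rw [eq_div_iff uJ.ne_zero, inv_mul_eq_iff_eq_mul₀ hx0]
    apply mul_left_cancel₀ hσ0
    linear_combination -e0 + x * ((y - con l) * (σ - con m)) * ey
  refine ⟨?_, ?_, ?_, ?_⟩
  · rw [e2]
    exact hT.div uJ
  · rw [e1]
    exact hT.div u1
  · rw [e2]
    exact Van.div (.of_res (by rw [res_mul, res_mul, vg.res, zero_mul, zero_mul])) uJ
  · rw [e1]
    exact Van.div (.of_res (by rw [res_mul, vs.res, zero_mul])) u1

end Flip2
end Flip2

/-! ### The backward half-step maps points to points -/

section Flip2Points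
variable {F : Type} [Field F] [Algebra ℂ F]
namespace Flip2
variable {κ K l m a b : ℂ} {x X y : F} {R : LocalSubring F}

lemma unt_of_van (h : Flip2 κ K l m a b x X y) [HasConst R.toSubring] (hy : y ∈ R.toSubring)
    (v : Van R y ∨ Van R (y - con l)) : Unt R (y - con a⁻¹) ∧ Unt R (y - con b⁻¹) := by
  obtain h1 : Mem R.toSubring y := ⟨hy⟩
  rcases v with v | v
  · exact ⟨.of_res (by simp [v.res, h.con_ne]), .of_res (by simp [v.res, h.con_ne])⟩
  · have hT : Sub R R.toSubring := .self
    constructor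
    · by_contra hu
      have := (van_or_unt (Mem.mem : y - con a⁻¹ ∈ R.toSubring)).resolve_right hu
      exact v.not_unt (h.units_of_a hT this hy).2.1
    · by_contra hu
      have := (van_or_unt (Mem.mem : y - con b⁻¹ ∈ R.toSubring)).resolve_right hu
      exact v.not_unt (h.swap.units_of_a hT this hy).2.1

lemma e7_of_affine_gen (h : Flip2 κ K l m a b x X y) (hG : Gen R X y) (vy : Van R y) :
    Gen R x⁻¹ (x * (x * y - 1 + con m)) ∧ Van R x⁻¹ := by
  obtain ⟨h1, h2, h3⟩ := h.e7_of_affine hG.sub hG.left hG.right vy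
  refine ⟨hG.change (fun T hT p q => ?_) (fun T hT p q => ?_), h3⟩
  · exact ⟨(h.e7_of_affine hT p q vy).1, (h.e7_of_affine hT p q vy).2.1⟩
  · exact ⟨(h.symm.affine_of_e7 hT p q h3).1, (h.symm.affine_of_e7 hT p q h3).2.1⟩

lemma affine_of_e7_gen (h : Flip2 κ K l m a b x X y) (hG : Gen R X⁻¹ (X * (X * y - 1 + con m)))
    (vX : Van R X⁻¹) : Gen R x y ∧ Van R y := by
  obtain ⟨h1, h2, h3⟩ := h.affine_of_e7 hG.sub hG.left hG.right vX
  refine ⟨hG.change (fun T hT p q => ?_) (fun T hT p q => ?_), h3⟩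
  · exact ⟨(h.affine_of_e7 hT p q vX).1, (h.affine_of_e7 hT p q vX).2.1⟩
  · exact ⟨(h.symm.e7_of_affine hT p q h3).1, (h.symm.e7_of_affine hT p q h3).2.1⟩

lemma e8_of_affine_gen (h : Flip2 κ K l m a b x X y) (hG : Gen R X y) (vl : Van R (y - con l))
    (uW : Unt R (X * y - 1)) : Gen R x⁻¹ (x * (y - con l)) ∧ Van R x⁻¹ ∧
      Unt R (x * (y - con l)) := by
  obtain ⟨h1, h2, h3, h4⟩ := h.e8_of_affine hG.sub hG.left hG.right vl uW
  refine ⟨hG.change (fun T hT p q => ?_) (fun T hT p q => ?_), h3, h4⟩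
  · obtain ⟨h1, h2, -⟩ := h.e8_of_affine hT p q vl uW
    exact ⟨h1, h2⟩
  · exact ⟨(h.symm.affine_of_e8 hT p q h3 h4).1, (h.symm.of_e8 hT p q h3).1⟩

lemma affine_of_e8_gen (h : Flip2 κ K l m a b x X y) (hG : Gen R X⁻¹ (X * (y - con l)))
    (vX : Van R X⁻¹) (ug : Unt R (X * (y - con l))) :
    Gen R x y ∧ Van R (y - con l) ∧ Unt R (x * y - 1) := by
  obtain ⟨h1, h2⟩ := h.affine_of_e8 hG.sub hG.left hG.right vX ug
  obtain ⟨h3, h4⟩ := h.of_e8 hG.sub hG.left hG.right vX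
  refine ⟨hG.change (fun T hT p q => ?_) (fun T hT p q => ?_), h4, h2⟩
  · exact ⟨(h.affine_of_e8 hT p q vX ug).1, (h.of_e8 hT p q vX).1⟩
  · obtain ⟨h5, h6, -⟩ := h.symm.e8_of_affine hT p q h4 h2
    exact ⟨h5, h6⟩

lemma e1'_of_affine_gen (h : Flip2 κ K l m a b x X y) (hG : Gen R X y) (va : Van R (y - con a⁻¹))
    (ua : Unt R (X - con a)) : Gen R ((x - con a) / (y - con a⁻¹)) (y - con a⁻¹) ∧
      Unt R (y * ((x - con a) / (y - con a⁻¹)) + con a) := by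
  obtain ⟨-, h2⟩ := h.e1'_of_affine hG.sub hG.left hG.right va ua
  refine ⟨hG.change (fun T hT p q => ?_) (fun T hT p q => ?_), h2⟩
  · exact ⟨(h.e1'_of_affine hT p q va ua).1, sub_mem q (hT.const _)⟩
  · obtain ⟨h5, h6, -⟩ := h.symm.affine_of_e1' hT p q va h2
    exact ⟨h5, h6⟩

lemma affine_of_e1'_gen (h : Flip2 κ K l m a b x X y)
    (hG : Gen R ((X - con a) / (y - con a⁻¹)) (y - con a⁻¹)) (va : Van R (y - con a⁻¹))
    (u : Unt R (y * ((X - con a) / (y - con a⁻¹)) + con a)) :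
    Gen R x y ∧ Unt R (x - con a) := by
  obtain ⟨-, -, h2⟩ := h.affine_of_e1' hG.sub hG.left hG.right va u
  refine ⟨hG.change (fun T hT p q => ?_) (fun T hT p q => ?_), h2⟩
  · obtain ⟨h5, h6, -⟩ := h.affine_of_e1' hT p q va u
    exact ⟨h5, h6⟩
  · exact ⟨(h.symm.e1'_of_affine hT p q va h2).1, sub_mem q (hT.const _)⟩

lemma inftyX_of_affine_gen (h : Flip2 κ K l m a b x X y) (hG : Gen R X y)
    (uy : Unt R y) (ul : Unt R (y - con l)) (vW : Van R (X * y - 1))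
    (ua : Unt R (y - con a⁻¹)) (ub : Unt R (y - con b⁻¹)) : Gen R x⁻¹ y ∧ Van R x⁻¹ := by
  obtain ⟨-, h2⟩ := h.inftyX_of_affine hG.sub hG.left hG.right vW ua ub
  exact ⟨hG.change (fun T hT p q => ⟨(h.inftyX_of_affine hT p q vW ua ub).1, q⟩)
    (fun T hT p q => ⟨(h.symm.affine_of_inftyX hT p q h2 uy ul).1, q⟩), h2⟩

lemma affine_of_inftyX_gen (h : Flip2 κ K l m a b x X y) (hG : Gen R X⁻¹ y) (vX : Van R X⁻¹)
    (uy : Unt R y) (ul : Unt R (y - con l)) (ua : Unt R (y - con a⁻¹))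
    (ub : Unt R (y - con b⁻¹)) : Gen R x y ∧ Van R (x * y - 1) := by
  obtain ⟨-, h2⟩ := h.affine_of_inftyX hG.sub hG.left hG.right vX uy ul
  exact ⟨hG.change (fun T hT p q => ⟨(h.affine_of_inftyX hT p q vX uy ul).1, q⟩)
    (fun T hT p q => ⟨(h.symm.inftyX_of_affine hT p q h2 ua ub).1, q⟩), h2⟩

lemma e3_of_inftyY_gen (h : Flip2 κ K l m a b x X y) (hG : Gen R X y⁻¹) (vy : Van R y⁻¹)
    (uX : Unt R X) : Gen R (x * y) y⁻¹ := by
  obtain ⟨-, h2⟩ := h.e3_of_inftyY hG.sub hG.left hG.right vy uX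
  exact hG.change (fun T hT p q => ⟨(h.e3_of_inftyY hT p q vy uX).1, q⟩)
    (fun T hT p q => ⟨(h.symm.inftyY_of_e3 hT p q vy h2).1, q⟩)

lemma inftyY_of_e3_gen (h : Flip2 κ K l m a b x X y) (hG : Gen R (X * y) y⁻¹) (vy : Van R y⁻¹)
    (uW : Unt R (X * y - 1)) : Gen R x y⁻¹ ∧ Unt R x := by
  obtain ⟨-, h2⟩ := h.inftyY_of_e3 hG.sub hG.left hG.right vy uW
  exact ⟨hG.change (fun T hT p q => ⟨(h.inftyY_of_e3 hT p q vy uW).1, q⟩)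
    (fun T hT p q => ⟨(h.symm.e3_of_inftyY hT p q vy h2).1, q⟩), h2⟩

lemma e4_of_e4_gen (h : Flip2 κ K l m a b x X y) (hG : Gen R X (X ^ 2 * y)⁻¹) (vX : Van R X)
    (uS : Unt R (X ^ 2 * y)⁻¹) (uK : Unt R ((X ^ 2 * y)⁻¹ - con K)) :
    Gen R x (x ^ 2 * y)⁻¹ ∧ Van R x ∧ Unt R ((x ^ 2 * y)⁻¹ - con κ) := by
  obtain ⟨-, -, h3, h4, h5⟩ := h.e4_of_e4 hG.sub hG.left hG.right vX uS uK
  refine ⟨hG.change (fun T hT p q => ?_) (fun T hT p q => ?_), h3, h5⟩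
  · obtain ⟨h1, h2, -⟩ := h.e4_of_e4 hT p q vX uS uK
    exact ⟨h1, h2⟩
  · obtain ⟨h1, h2, -⟩ := h.symm.e4_of_e4 hT p q h3 h4 h5
    exact ⟨h1, h2⟩

lemma e5_of_e5_gen (h : Flip2 κ K l m a b x X y) (hG : Gen R X (((X ^ 2 * y)⁻¹ - con K) / X))
    (vX : Van R X) : Gen R x (((x ^ 2 * y)⁻¹ - con κ) / x) ∧ Van R x := by
  obtain ⟨-, -, h3⟩ := h.e5_of_e5 hG.sub hG.left hG.right vX
  refine ⟨hG.change (fun T hT p q => ?_) (fun T hT p q => ?_), h3⟩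
  · obtain ⟨h1, h2, -⟩ := h.e5_of_e5 hT p q vX
    exact ⟨h1, h2⟩
  · obtain ⟨h1, h2, -⟩ := h.symm.e5_of_e5 hT p q h3
    exact ⟨h1, h2⟩

lemma e6_of_e6_gen (h : Flip2 κ K l m a b x X y) (hG : Gen R X⁻¹ (X * y)) (vX : Van R X⁻¹)
    (uW : Unt R (X * y - 1)) (uM : Unt R (X * y - 1 + con m)) (ug : Unt R (X * y)) :
    Gen R x⁻¹ (x * y) ∧ Van R x⁻¹ ∧ Unt R (x * y - 1 + con m) := by
  obtain ⟨-, -, h3, h4, h5, h6⟩ := h.e6_of_e6 hG.sub hG.left hG.right vX uW uM ug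
  refine ⟨hG.change (fun T hT p q => ?_) (fun T hT p q => ?_), h3, h5⟩
  · obtain ⟨h1, h2, -⟩ := h.e6_of_e6 hT p q vX uW uM ug
    exact ⟨h1, h2⟩
  · obtain ⟨h1, h2, -⟩ := h.symm.e6_of_e6 hT p q h3 h4 h5 h6
    exact ⟨h1, h2⟩

/-- In the plane, the lines `y = 0`, `y = l`, `y = 1 / a`, `y = 1 / b` become exceptional curves and
the curve `X y = 1` becomes `x = ∞`; elsewhere the inversion is regular with values in the plane. -/
lemma pt_of_affine (h : Flip2 κ K l m a b x X y) (hG : Gen R X y)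
    (ha : Van R (X - con a) → Unt R (y - con a⁻¹)) (hb : Van R (X - con b) → Unt R (y - con b⁻¹)) :
    Pt κ l m a b x y R := by
  have hT := hG.sub
  have := hG.const
  obtain ⟨_, _⟩ := hT.mem hG.left
  obtain ⟨_, _⟩ := hT.mem hG.right
  rcases van_or_unt hG.right with vy | uy
  · obtain ⟨h1, h2⟩ := h.e7_of_affine_gen hG vy
    exact .e7 h1 h2
  rcases van_or_unt (Mem.mem : y - con l ∈ R.toSubring) with vl | ul
  · rcases van_or_unt (Mem.mem : X * y - 1 ∈ R.toSubring) with vW | uW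
    · obtain ⟨-, h2⟩ := h.e8'_of_affine hT hG.left hG.right vl vW
      refine .e8' (hG.change (fun T hT p q => ?_) (fun T hT p q => ?_)) vl
      · exact ⟨(h.e8'_of_affine hT p q vl vW).1, sub_mem q (hT.const l)⟩
      · obtain ⟨h3, h4, -⟩ := h.symm.affine_of_e8' hT p q h2 vl
        exact ⟨h3, h4⟩
    · obtain ⟨h1, h2, -⟩ := h.e8_of_affine_gen hG vl uW
      exact .e8 h1 h2
  rcases van_or_unt (Mem.mem : y - con a⁻¹ ∈ R.toSubring) with va | ua
  · have ua := (van_or_unt (Mem.mem : X - con a ∈ R.toSubring)).resolve_left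
      fun h => va.not_unt (ha h)
    exact .e1' (h.e1'_of_affine_gen hG va ua).1 va
  rcases van_or_unt (Mem.mem : y - con b⁻¹ ∈ R.toSubring) with vb | ub
  · have ub := (van_or_unt (Mem.mem : X - con b ∈ R.toSubring)).resolve_left
      fun h => vb.not_unt (hb h)
    exact .e2' (h.swap.e1'_of_affine_gen hG vb ub).1 vb
  rcases van_or_unt (Mem.mem : X * y - 1 ∈ R.toSubring) with vW | uW
  · obtain ⟨h1, h2⟩ := h.inftyX_of_affine_gen hG uy ul vW ua ub
    exact .inftyX h1 h2 uy ul
  · obtain ⟨-, h2⟩ := h.affine_of_affine hT hG.left hG.right uy ul uW ua ub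
    exact .affine (hG.change
      (fun T hT p q => ⟨(h.affine_of_affine hT p q uy ul uW ua ub).1, q⟩)
      (fun T hT p q => ⟨(h.symm.affine_of_affine hT p q uy ul h2 ua ub).1, q⟩))
      (fun _ => ua) (fun _ => ub)

lemma pt_of_inftyX (h : Flip2 κ K l m a b x X y) (hG : Gen R X⁻¹ y) (vX : Van R X⁻¹)
    (uy : Unt R y) (ul : Unt R (y - con l)) : Pt κ l m a b x y R := by
  have hT := hG.sub
  have := hG.const
  obtain ⟨_, _⟩ := hT.mem hG.right
  have aux : ∀ {a b : ℂ}, Flip2 κ K l m a b x X y → Van R (y - con a⁻¹) →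
      Pt κ l m a b x y R := by
    intro a b h va
    obtain ⟨-, h2⟩ := h.e1'_of_inftyX hT hG.left hG.right vX va
    refine .e1' (hG.change (fun T hT p q => ?_) (fun T hT p q => ?_)) va
    · exact ⟨(h.e1'_of_inftyX hT p q vX va).1, sub_mem q (hT.const _)⟩
    · obtain ⟨h3, h4, -⟩ := h.symm.inftyX_of_e1' hT p q va h2
      exact ⟨h3, h4⟩
  rcases van_or_unt (Mem.mem : y - con a⁻¹ ∈ R.toSubring) with va | ua
  · exact aux h va
  rcases van_or_unt (Mem.mem : y - con b⁻¹ ∈ R.toSubring) with vb | ub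
  · exact (aux h.swap vb).swap
  obtain ⟨h1, h2⟩ := h.affine_of_inftyX_gen hG vX uy ul ua ub
  exact .affine h1 (fun _ => ua) (fun _ => ub)

lemma pt_of_e1' (h : Flip2 κ K l m a b x X y)
    (hG : Gen R ((X - con a) / (y - con a⁻¹)) (y - con a⁻¹)) (va : Van R (y - con a⁻¹)) :
    Pt κ l m a b x y R := by
  have hT := hG.sub
  have := hG.const
  have hy : y ∈ R.toSubring := by simpa using add_mem hG.right (hT.const a⁻¹)
  obtain ⟨_, _⟩ := hT.mem hy
  obtain ⟨_, _⟩ := hT.mem hG.left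
  obtain ⟨uy, ul, ub⟩ := h.units_of_a hT va hy
  rcases van_or_unt (Mem.mem : y * ((X - con a) / (y - con a⁻¹)) + con a ∈ R.toSubring) with v | u
  · obtain ⟨-, -, h3⟩ := h.inftyX_of_e1' hT hG.left hG.right va v
    refine .inftyX (hG.change (fun T hT p q => ?_) (fun T hT p q => ?_)) h3 uy ul
    · obtain ⟨h1, h2, -⟩ := h.inftyX_of_e1' hT p q va v
      exact ⟨h1, h2⟩
    · exact ⟨(h.symm.e1'_of_inftyX hT p q h3 va).1, sub_mem q (hT.const _)⟩
  · obtain ⟨h1, h2⟩ := h.affine_of_e1'_gen hG va u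
    refine .affine h1 (fun v => (v.not_unt h2).elim) (fun _ => ?_)
    rcases van_or_unt (Mem.mem : y - con b⁻¹ ∈ R.toSubring) with v | u
    · exact absurd (by rw [res_mul, v.res, mul_zero]) ub.res
    · exact u

lemma pt_of_e1 (h : Flip2 κ K l m a b x X y)
    (hG : Gen R (X - con a) ((y - con a⁻¹) / (X - con a))) (vX : Van R (X - con a)) :
    Pt κ l m a b x y R := by
  rcases hG.swap.div_van_or vX h.ya h.Xa with v | ⟨hG', v, -⟩
  · obtain ⟨-, -, h3, h4⟩ := h.e1_of_e1 hG.sub hG.left hG.right vX v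
    refine .e1 (hG.change (fun T hT p q => ?_) (fun T hT p q => ?_)) h3
    · obtain ⟨h1, h2, -⟩ := h.e1_of_e1 hT p q vX v
      exact ⟨h1, h2⟩
    · obtain ⟨h1, h2, -⟩ := h.symm.e1_of_e1 hT p q h3 h4
      exact ⟨h1, h2⟩
  · exact h.pt_of_e1' hG'.swap v

lemma pt_of_e3 (h : Flip2 κ K l m a b x X y) (hG : Gen R (X * y) y⁻¹) (vy : Van R y⁻¹) :
    Pt κ l m a b x y R := by
  have hT := hG.sub
  obtain ⟨_, _⟩ := hT.mem hG.left
  rcases van_or_unt (Mem.mem : X * y - 1 ∈ R.toSubring) with v | u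
  · obtain ⟨-, h2⟩ := h.corner_of_e3 hT hG.left hG.right vy v
    exact .corner (hG.change (fun T hT p q => ⟨(h.corner_of_e3 hT p q vy v).1, q⟩)
      (fun T hT p q => ⟨(h.symm.e3_of_corner hT p q h2 vy).1, q⟩)) h2 vy
  · obtain ⟨h1, h2⟩ := h.inftyY_of_e3_gen hG vy u
    exact .inftyY h1 vy h2

lemma pt_of_corner (h : Flip2 κ K l m a b x X y) (hG : Gen R X⁻¹ y⁻¹) (vX : Van R X⁻¹)
    (vy : Van R y⁻¹) : Pt κ l m a b x y R := by
  obtain ⟨-, h2⟩ := h.e3_of_corner hG.sub hG.left hG.right vX vy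
  exact .e3 (hG.change (fun T hT p q => ⟨(h.e3_of_corner hT p q vX vy).1, q⟩)
    (fun T hT p q => ⟨(h.symm.corner_of_e3 hT p q vy h2).1, q⟩)) vy

lemma pt_of_e4 (h : Flip2 κ K l m a b x X y) (hG : Gen R X (X ^ 2 * y)⁻¹) (vX : Van R X)
    (uK : Unt R ((X ^ 2 * y)⁻¹ - con K)) : Pt κ l m a b x y R := by
  rcases van_or_unt hG.right with vS | uS
  · obtain ⟨-, -, h3, h4⟩ := h.e4'_of_e4 hG.sub hG.left hG.right vX vS
    refine .e4' (hG.change (fun T hT p q => ?_) (fun T hT p q => ?_)) h3 h4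
    · obtain ⟨h1, h2, -⟩ := h.e4'_of_e4 hT p q vX vS
      exact ⟨h1, h2⟩
    · obtain ⟨h1, h2, -⟩ := h.symm.e4_of_e4' hT p q h3 h4
      exact ⟨h1, h2⟩
  · obtain ⟨h1, h2, h3⟩ := h.e4_of_e4_gen hG vX uS uK
    exact .e4 h1 h2 h3

lemma pt_of_e4' (h : Flip2 κ K l m a b x X y) (hG : Gen R (X ^ 2 * y) (X * y)⁻¹)
    (vt : Van R (X ^ 2 * y)) (vz : Van R (X * y)⁻¹) : Pt κ l m a b x y R := by
  have := hG.const
  obtain ⟨-, h2, h3, h4⟩ := h.e4_of_e4' hG.sub hG.left hG.right vt vz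
  obtain ⟨_, _⟩ := hG.sub.mem h2
  refine .e4 (hG.change (fun T hT p q => ?_) (fun T hT p q => ?_)) h3
    (.of_res (by rw [res_sub, h4.res]; simp [h.con_ne]))
  · obtain ⟨h1, h2, -⟩ := h.e4_of_e4' hT p q vt vz
    exact ⟨h1, h2⟩
  · obtain ⟨h1, h2, -⟩ := h.symm.e4'_of_e4 hT p q h3 h4
    exact ⟨h1, h2⟩

lemma pt_of_e5' (h : Flip2 κ K l m a b x X y)
    (hG : Gen R (X / ((X ^ 2 * y)⁻¹ - con K)) ((X ^ 2 * y)⁻¹ - con K))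
    (vS : Van R ((X ^ 2 * y)⁻¹ - con K)) : Pt κ l m a b x y R := by
  rcases hG.div_van_or vS h.X0 h.S0 with v | ⟨hG', v, -⟩
  · obtain ⟨-, -, h3, h4⟩ := h.e5'_of_e5' hG.sub hG.left hG.right v vS
    refine .e5' (hG.change (fun T hT p q => ?_) (fun T hT p q => ?_)) h4
    · obtain ⟨h1, h2, -⟩ := h.e5'_of_e5' hT p q v vS
      exact ⟨h1, h2⟩
    · obtain ⟨h1, h2, -⟩ := h.symm.e5'_of_e5' hT p q h3 h4
      exact ⟨h1, h2⟩
  · obtain ⟨h1, h2⟩ := h.e5_of_e5_gen hG' v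
    exact .e5 h1 h2

lemma pt_of_e6 (h : Flip2 κ K l m a b x X y) (hG : Gen R X⁻¹ (X * y)) (vX : Van R X⁻¹)
    (uM : Unt R (X * y - 1 + con m)) : Pt κ l m a b x y R := by
  have hT := hG.sub
  obtain ⟨_, _⟩ := hT.mem hG.right
  rcases van_or_unt (Mem.mem : X * y - 1 ∈ R.toSubring) with vW | uW
  · obtain ⟨-, -, h3, h4⟩ := h.e6'_of_e6 hT hG.left hG.right vX vW
    refine .e6' (hG.change (fun T hT p q => ?_) (fun T hT p q => ?_)) h3 h4
    · obtain ⟨h1, h2, -⟩ := h.e6'_of_e6 hT p q vX vW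
      exact ⟨h1, h2⟩
    · obtain ⟨h1, h2, -⟩ := h.symm.e6_of_e6' hT p q h3 h4
      exact ⟨h1, h2⟩
  rcases van_or_unt hG.right with vg | ug
  · obtain ⟨-, -, h3, h4⟩ := h.e7'_of_e6 hT hG.left hG.right vX vg
    refine .e7' (hG.change (fun T hT p q => ?_) (fun T hT p q => ?_)) h4
    · obtain ⟨h1, h2, -⟩ := h.e7'_of_e6 hT p q vX vg
      exact ⟨h1, h2⟩
    · obtain ⟨h1, h2, -⟩ := h.symm.e6_of_e7' hT p q h3 h4
      exact ⟨h1, h2⟩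
  · obtain ⟨h1, h2, h3⟩ := h.e6_of_e6_gen hG vX uW uM ug
    exact .e6 h1 h2 h3

lemma pt_of_e6' (h : Flip2 κ K l m a b x X y) (hG : Gen R (X * y)⁻¹ y) (vz : Van R (X * y)⁻¹)
    (vy : Van R y) : Pt κ l m a b x y R := by
  have := hG.const
  obtain ⟨-, h2, h3, h4⟩ := h.e6_of_e6' hG.sub hG.left hG.right vz vy
  obtain ⟨_, _⟩ := hG.sub.mem h2
  refine .e6 (hG.change (fun T hT p q => ?_) (fun T hT p q => ?_)) h3
    (.of_res (by rw [res_add, h4.res]; simp [h.con_ne]))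
  · obtain ⟨h1, h2, -⟩ := h.e6_of_e6' hT p q vz vy
    exact ⟨h1, h2⟩
  · obtain ⟨h1, h2, -⟩ := h.symm.e6'_of_e6 hT p q h3 h4
    exact ⟨h1, h2⟩

lemma pt_of_e7 (h : Flip2 κ K l m a b x X y) (hG : Gen R X⁻¹ (X * (X * y - 1 + con m)))
    (vX : Van R X⁻¹) : Pt κ l m a b x y R := by
  have := hG.const
  obtain ⟨h1, h2⟩ := h.affine_of_e7_gen hG vX
  obtain ⟨ua, ub⟩ := h.unt_of_van h1.right (.inl h2)
  exact .affine h1 (fun _ => ua) (fun _ => ub)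

lemma pt_of_e7' (h : Flip2 κ K l m a b x X y)
    (hG : Gen R (X * (X * y - 1 + con m))⁻¹ (X * y - 1 + con m))
    (vW : Van R (X * y - 1 + con m)) : Pt κ l m a b x y R := by
  have := hG.const
  rcases hG.inv_van_or vW h.X0 h.M0 with v | ⟨hG', v, -⟩
  · obtain ⟨-, h2, h3, h4⟩ := h.e6_of_e7' hG.sub hG.left hG.right v vW
    obtain ⟨_, _⟩ := hG.sub.mem h2
    refine .e6 (hG.change (fun T hT p q => ?_) (fun T hT p q => ?_)) h3 ?_
    · obtain ⟨h1, h2, -⟩ := h.e6_of_e7' hT p q v vW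
      exact ⟨h1, h2⟩
    · obtain ⟨h1, h2, -⟩ := h.symm.e7'_of_e6 hT p q h3 h4
      exact ⟨h1, h2⟩
    · refine .of_res fun h5 => (h.res_ne (R := R)).2.2 ?_
      rw [res_add, res_sub, h4.res, res_one] at h5
      linear_combination -h5
  · exact h.pt_of_e7 hG' v

lemma pt_of_e8 (h : Flip2 κ K l m a b x X y) (hG : Gen R X⁻¹ (X * (y - con l)))
    (vX : Van R X⁻¹) : Pt κ l m a b x y R := by
  have := hG.const
  rcases van_or_unt hG.right with vg | ug
  · obtain ⟨-, -, h3, h4⟩ := h.e8_of_e8 hG.sub hG.left hG.right vX vg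
    refine .e8 (hG.change (fun T hT p q => ?_) (fun T hT p q => ?_)) h3
    · obtain ⟨h1, h2, -⟩ := h.e8_of_e8 hT p q vX vg
      exact ⟨h1, h2⟩
    · obtain ⟨h1, h2, -⟩ := h.symm.e8_of_e8 hT p q h3 h4
      exact ⟨h1, h2⟩
  · obtain ⟨h1, h2, -⟩ := h.affine_of_e8_gen hG vX ug
    obtain ⟨ua, ub⟩ := h.unt_of_van h1.right (.inr h2)
    exact .affine h1 (fun _ => ua) (fun _ => ub)

lemma pt_of_e8' (h : Flip2 κ K l m a b x X y)
    (hG : Gen R (X * (y - con l))⁻¹ (y - con l)) (vl : Van R (y - con l)) :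
    Pt κ l m a b x y R := by
  have := hG.const
  rcases hG.inv_van_or vl h.X0 h.l0 with v | ⟨hG', v, -⟩
  · obtain ⟨-, h2, h3⟩ := h.affine_of_e8' hG.sub hG.left hG.right v vl
    obtain ⟨ua, ub⟩ := h.unt_of_van h2 (.inr vl)
    refine .affine (hG.change (fun T hT p q => ?_) (fun T hT p q => ?_))
      (fun _ => ua) (fun _ => ub)
    · obtain ⟨h1, h2, -⟩ := h.affine_of_e8' hT p q v vl
      exact ⟨h1, h2⟩
    · exact ⟨(h.symm.e8'_of_affine hT p q vl h3).1, sub_mem q (hT.const l)⟩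
  · exact h.pt_of_e8 hG' v

/-- The backward half-step maps points to points. -/
theorem pt (h : Flip2 κ K l m a b x X y) (hP : Pt K l m a b X y R) : Pt κ l m a b x y R := by
  cases hP with
  | affine hG ha hb => exact h.pt_of_affine hG ha hb
  | inftyY hG hy hx => exact .e3 (h.e3_of_inftyY_gen hG hy hx) hy
  | inftyX hG hx hy hy' => exact h.pt_of_inftyX hG hx hy hy'
  | corner hG hx hy => exact h.pt_of_corner hG hx hy
  | e1 hG hx => exact h.pt_of_e1 hG hx
  | e1' hG hy => exact h.pt_of_e1' hG hy
  | e2 hG hx => exact (h.swap.pt_of_e1 hG hx).swap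
  | e2' hG hy => exact (h.swap.pt_of_e1' hG hy).swap
  | e3 hG hy => exact h.pt_of_e3 hG hy
  | e4 hG hx hs => exact h.pt_of_e4 hG hx hs
  | e4' hG ht hz => exact h.pt_of_e4' hG ht hz
  | e5 hG hx =>
    obtain ⟨h1, h2⟩ := h.e5_of_e5_gen hG hx
    exact .e5 h1 h2
  | e5' hG hs => exact h.pt_of_e5' hG hs
  | e6 hG hx hw => exact h.pt_of_e6 hG hx hw
  | e6' hG hz hy => exact h.pt_of_e6' hG hz hy
  | e7 hG hx => exact h.pt_of_e7 hG hx
  | e7' hG hw => exact h.pt_of_e7' hG hw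
  | e8 hG hx => exact h.pt_of_e8 hG hx
  | e8' hG hy => exact h.pt_of_e8' hG hy

end Flip2
end Flip2Points

/-! ### Discrete valuation rings and orders of vanishing -/

section Uniformizer
variable {F : Type} [Field F] {R : LocalSubring F} {ϖ f g : F}

/-- The local ring `R` is a discrete valuation ring of the field `F`, with uniformizer `ϖ`. -/
structure Unif (R : LocalSubring F) (ϖ : F) : Prop where
  van : Van R ϖ
  ne_zero : ϖ ≠ 0
  fac : ∀ f : F, f ≠ 0 → ∃ (n : ℤ) (g : F), Unt R g ∧ f = ϖ ^ n * g

lemma van_iff_not_unt : Van R f ↔ f ∈ R.toSubring ∧ ¬ Unt R f :=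
  ⟨fun h => ⟨h.mem, h.not_unt⟩, fun h => (van_or_unt h.1).resolve_right h.2⟩

lemma Van.mul_mem (hf : Van R f) (hg : g ∈ R.toSubring) : Van R (f * g) := by
  obtain h1 : Mem R.toSubring f := ⟨hf.mem⟩
  obtain h2 : Mem R.toSubring g := ⟨hg⟩
  exact .of_res (by rw [res_mul, hf.res, zero_mul])

lemma Van.inv_not_mem {f : F} (h : Van R f) (h0 : f ≠ 0) : f⁻¹ ∉ R.toSubring :=
  fun hi => h.not_unt ⟨h.mem, hi, h0⟩

lemma Van.not_mem {f : F} (h : Van R f⁻¹) (h0 : f ≠ 0) : f ∉ R.toSubring :=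
  fun hi => h.inv_not_mem (inv_ne_zero h0) (by simpa using hi)

lemma Van.mul_mem' {f g : F} (hg : Van R g) (hf : f ∈ R.toSubring) : Van R (f * g) :=
  mul_comm g f ▸ hg.mul_mem hf

lemma Van.pow_mul (hf : Van R f) (hg : g ∈ R.toSubring) {n : ℕ} (hn : n ≠ 0) :
    Van R (f ^ n * g) := by
  obtain ⟨n, rfl⟩ := Nat.exists_eq_succ_of_ne_zero hn
  rw [Nat.succ_eq_add_one, pow_succ', mul_assoc]
  exact hf.mul_mem (Subring.mul_mem _ (pow_mem hf.mem n) hg)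

namespace Unif

lemma van_zpow_iff (h : Unif R ϖ) (hg : Unt R g) (n : ℤ) : Van R (ϖ ^ n * g) ↔ 0 < n := by
  constructor
  · intro hv
    by_contra hn
    obtain ⟨k, rfl⟩ : ∃ k : ℕ, n = -k := ⟨n.natAbs, by omega⟩
    have hu : Unt R (ϖ ^ (-(k : ℤ)) * g) := by
      refine ⟨hv.mem, ?_, mul_ne_zero (zpow_ne_zero _ h.ne_zero) hg.ne_zero⟩
      rw [mul_inv, zpow_neg, inv_inv, zpow_natCast]
      exact mul_mem (pow_mem h.van.mem k) hg.inv_mem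
    exact hv.not_unt hu
  · intro hn
    obtain ⟨k, rfl⟩ : ∃ k : ℕ, n = k := ⟨n.natAbs, by omega⟩
    rw [zpow_natCast]
    exact h.van.pow_mul hg.mem (by omega)

lemma mem_iff (h : Unif R ϖ) (hg : Unt R g) (n : ℤ) :
    ϖ ^ n * g ∈ R.toSubring ↔ 0 ≤ n := by
  constructor
  · intro hm
    rcases van_or_unt hm with hv | hu
    · exact ((h.van_zpow_iff hg n).1 hv).le
    · by_contra hn
      have h1 := (h.van_zpow_iff hg.inv (-n)).2 (by omega)
      rw [zpow_neg, ← mul_inv] at h1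
      exact h1.not_unt hu.inv
  · intro hn
    obtain ⟨k, rfl⟩ : ∃ k : ℕ, n = k := ⟨n.natAbs, by omega⟩
    rw [zpow_natCast]
    exact mul_mem (pow_mem h.van.mem k) hg.mem

lemma exists_nat (h : Unif R ϖ) (hf : f ∈ R.toSubring) (h0 : f ≠ 0) :
    ∃ (n : ℕ) (g : F), Unt R g ∧ f = ϖ ^ n * g := by
  obtain ⟨n, g, hg, rfl⟩ := h.fac f h0
  obtain ⟨k, rfl⟩ := Int.eq_ofNat_of_zero_le ((h.mem_iff hg n).1 hf)
  exact ⟨k, g, hg, by rw [zpow_natCast]⟩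

lemma irreducible (h : Unif R ϖ) : Irreducible (⟨ϖ, h.van.mem⟩ : R.toSubring) := by
  rw [irreducible_iff]
  have huv : ∀ f : R.toSubring, ¬ IsUnit f → Van R (f : F) := fun f hf => ⟨f.2, hf⟩
  refine ⟨fun hu => h.van.not_unt ⟨h.van.mem, (isUnit_iff_inv_mem _).1 hu⟩, fun a b hab => ?_⟩
  by_contra! hu
  have ha := huv a hu.1
  have hb := huv b hu.2
  have hab' : ϖ = (a : F) * b := congrArg Subtype.val hab
  have h0 : (a : F) * b ≠ 0 := hab' ▸ h.ne_zero
  obtain ⟨n, g, hg, ea⟩ := h.exists_nat a.2 (left_ne_zero_of_mul h0)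
  obtain ⟨m, g', hg', eb⟩ := h.exists_nat b.2 (right_ne_zero_of_mul h0)
  rw [ea, ← zpow_natCast, h.van_zpow_iff hg] at ha
  rw [eb, ← zpow_natCast, h.van_zpow_iff hg'] at hb
  -- If both factors vanished, their exponents would add up to at least two, and cancelling one `ϖ`
  -- would make 1 vanish.
  have e : (1 : F) = ϖ ^ (n + m - 1) * (g * g') := by
    apply mul_left_cancel₀ h.ne_zero
    rw [mul_one, ← mul_assoc, ← pow_succ', Nat.sub_add_cancel (by omega)]
    conv_lhs => rw [hab', ea, eb]
    ring
  have h1 : Van R (1 : F) := by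
    rw [e]
    exact h.van.pow_mul (hg.mul hg').mem (by omega)
  exact h1.not_unt .one

lemma isDiscreteValuationRing (h : Unif R ϖ) : IsDiscreteValuationRing R.toSubring := by
  apply IsDiscreteValuationRing.ofHasUnitMulPowIrreducibleFactorization
  refine ⟨_, h.irreducible, fun {f} hf => ?_⟩
  obtain ⟨n, g, hg, e⟩ := h.exists_nat f.2 (by simpa using hf)
  exact ⟨n, ((isUnit_iff_inv_mem hg.mem).2 hg.2).unit, Subtype.ext (by simpa using e.symm)⟩

lemma isFractionRing (h : Unif R ϖ) : IsFractionRing R.toSubring F := by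
  apply IsFractionRing.of_field
  intro z
  by_cases hz : z ∈ R.toSubring
  · exact ⟨⟨z, hz⟩, 1, by simp; rfl⟩
  · have h0 : z ≠ 0 := by
      rintro rfl
      exact hz (zero_mem _)
    obtain ⟨n, g, hg, rfl⟩ := h.fac z h0
    rw [h.mem_iff hg] at hz
    refine ⟨1, ⟨ϖ ^ (-n) * g⁻¹, (h.mem_iff hg.inv _).2 (by omega)⟩, ?_⟩
    have e : ϖ ^ n * g = 1 / (ϖ ^ (-n) * g⁻¹) := by
      rw [one_div, mul_inv, inv_inv, zpow_neg, inv_inv]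
    rw [e, map_one]
    rfl

end Unif

section Order
variable (R) [IsDiscreteValuationRing R.toSubring] [IsFractionRing R.toSubring F]

/-- The order of vanishing of a rational function at a discrete valuation ring. -/
def vord (f : F) : ℤ :=
  -WithZero.log ((IsDiscreteValuationRing.maximalIdeal R.toSubring).valuation F f)

lemma exists_unif : ∃ ϖ, Unif R ϖ := by
  obtain ⟨π, hπ⟩ := IsDiscreteValuationRing.exists_irreducible R.toSubring
  have h0 : (π : F) ≠ 0 := by simpa using hπ.ne_zero
  refine ⟨π, ⟨π.2, hπ.1⟩, h0, fun f hf => ?_⟩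
  obtain ⟨a, b, hb, rfl⟩ := IsFractionRing.div_surjective R.toSubring f
  have hb0 : b ≠ 0 := nonZeroDivisors.ne_zero hb
  have ha0 : a ≠ 0 := by
    rintro rfl
    simp at hf
  obtain ⟨n, u, rfl⟩ := IsDiscreteValuationRing.eq_unit_mul_pow_irreducible ha0 hπ
  obtain ⟨m, v, rfl⟩ := IsDiscreteValuationRing.eq_unit_mul_pow_irreducible hb0 hπ
  have hu : Unt R (u : R.toSubring).1 := ⟨u.1.2, (isUnit_iff_inv_mem _).1 u.isUnit⟩
  have hv : Unt R (v : R.toSubring).1 := ⟨v.1.2, (isUnit_iff_inv_mem _).1 v.isUnit⟩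
  refine ⟨n - m, _, hu.div hv, ?_⟩
  have := hv.ne_zero
  change (u : R.toSubring).1 * (π : F) ^ n / ((v : R.toSubring).1 * (π : F) ^ m) = _
  rw [zpow_sub₀ h0, zpow_natCast, zpow_natCast]
  field_simp

variable {R}

/-- The adic valuation is read off from a factorization: `g` is a unit, hence of valuation one, and
`ϖ` generates the maximal ideal. Everything below uses exponents of a uniformizer only. -/
lemma Unif.vord_eq (h : Unif R ϖ) (hg : Unt R g) (n : ℤ) : vord R (ϖ ^ n * g) = n := by
  set v := IsDiscreteValuationRing.maximalIdeal R.toSubring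
  have hmem : ∀ z : R.toSubring, z ∈ v.asIdeal ↔ Van R (z : F) :=
    fun z => ⟨fun hz => ⟨z.2, hz⟩, fun ⟨_, hz⟩ => hz⟩
  have h1 : v.valuation F g = 1 := by
    have : v.valuation F (algebraMap R.toSubring F ⟨g, hg.mem⟩) = 1 := by
      rw [IsDedekindDomain.HeightOneSpectrum.valuation_eq_one_iff_notMem, hmem]
      exact hg.not_van
    exact this
  have hspan : v.asIdeal = Ideal.span {⟨ϖ, h.van.mem⟩} := by
    apply le_antisymm
    · intro z hz
      rw [hmem] at hz
      rw [Ideal.mem_span_singleton]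
      rcases eq_or_ne z 0 with rfl | h0
      · exact dvd_zero _
      obtain ⟨n, g, hg, e⟩ := h.exists_nat z.2 (by simpa using h0)
      rw [e, ← zpow_natCast, h.van_zpow_iff hg] at hz
      refine ⟨⟨ϖ ^ (n - 1) * g, mul_mem (pow_mem h.van.mem _) hg.mem⟩, Subtype.ext ?_⟩
      change (z : F) = ϖ * (ϖ ^ (n - 1) * g)
      rw [e, ← mul_assoc, ← pow_succ', Nat.sub_add_cancel (by omega)]
    · rw [Ideal.span_singleton_le_iff_mem, hmem]
      exact h.van
  have h2 : v.valuation F ϖ = WithZero.exp (-1 : ℤ) := by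
    have : v.valuation F (algebraMap R.toSubring F ⟨ϖ, h.van.mem⟩) = WithZero.exp (-1 : ℤ) := by
      rw [IsDedekindDomain.HeightOneSpectrum.valuation_of_algebraMap]
      exact v.intValuation_singleton (by simpa using h.ne_zero) hspan
    exact this
  rw [vord, map_mul, map_zpow₀, h1, h2, mul_one, WithZero.log_zpow, WithZero.log_exp]
  simp

lemma vord_mul (hf : f ≠ 0) (hg : g ≠ 0) : vord R (f * g) = vord R f + vord R g := by
  obtain ⟨ϖ, h⟩ := exists_unif R
  obtain ⟨n, f, uf, rfl⟩ := h.fac f hf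
  obtain ⟨m, g, ug, rfl⟩ := h.fac g hg
  have e : ϖ ^ n * f * (ϖ ^ m * g) = ϖ ^ (n + m) * (f * g) := by
    rw [zpow_add₀ h.ne_zero]
    ring
  rw [e, h.vord_eq (uf.mul ug), h.vord_eq uf, h.vord_eq ug]

lemma Unt.vord (hf : Unt R f) : vord R f = 0 := by
  obtain ⟨ϖ, h⟩ := exists_unif R
  simpa using h.vord_eq hf 0

lemma Unif.vord (h : Unif R ϖ) : vord R ϖ = 1 := by
  simpa using h.vord_eq Unt.one 1

lemma vord_inv (hf : f ≠ 0) : vord R f⁻¹ = -vord R f := by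
  have := vord_mul (R := R) hf (inv_ne_zero hf)
  rw [mul_inv_cancel₀ hf, Unt.one.vord] at this
  omega

lemma vord_pow (hf : f ≠ 0) (n : ℕ) : vord R (f ^ n) = n * vord R f := by
  induction n with
  | zero => simpa using Unt.one.vord
  | succ n ih =>
    rw [pow_succ, vord_mul (pow_ne_zero n hf) hf, ih]
    push_cast
    ring

lemma vord_div (hf : f ≠ 0) (hg : g ≠ 0) : vord R (f / g) = vord R f - vord R g := by
  rw [div_eq_mul_inv, vord_mul hf (inv_ne_zero hg), vord_inv hg, sub_eq_add_neg]

/-- A convention inherited from `WithZero.log`, and not the infinite order of zero; this is why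
multiplicativity is stated for nonzero functions. -/
lemma vord_zero : vord R (0 : F) = 0 := by simp [QLaguerre.vord]

lemma van_iff_vord (hf : f ≠ 0) : Van R f ↔ 0 < vord R f := by
  obtain ⟨ϖ, h⟩ := exists_unif R
  obtain ⟨n, f, uf, rfl⟩ := h.fac f hf
  rw [h.vord_eq uf, h.van_zpow_iff uf]

lemma mem_iff_vord (hf : f ≠ 0) : f ∈ R.toSubring ↔ 0 ≤ vord R f := by
  obtain ⟨ϖ, h⟩ := exists_unif R
  obtain ⟨n, f, uf, rfl⟩ := h.fac f hf
  rw [h.vord_eq uf, h.mem_iff uf]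

lemma vord_nonneg (hf : f ∈ R.toSubring) : 0 ≤ vord R f := by
  rcases eq_or_ne f 0 with rfl | h
  · rw [vord_zero]
  · exact (mem_iff_vord h).1 hf

lemma vord_add_of_lt (hf : f ≠ 0) (h : vord R f < vord R g) :
    vord R (f + g) = vord R f := by
  rcases eq_or_ne g 0 with rfl | hg
  · rw [add_zero]
  have hv : Van R (g / f) := by
    rw [van_iff_vord (div_ne_zero hg hf), vord_div hg hf]
    omega
  obtain h1 : Mem R.toSubring (g / f) := ⟨hv.mem⟩
  have hu : Unt R (1 + g / f) := .of_res (by simp [hv.res])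
  have e : f + g = f * (1 + g / f) := by field_simp
  rw [e, vord_mul hf hu.ne_zero, hu.vord, add_zero]

end Order
end Uniformizer

section
open MvPolynomial
-- Curves in an affine plane
section Coordinates
variable {F : Type} [Field F] [Algebra ℂ F] {R R' : LocalSubring F} {u v : F}

/-- The rational function given by a polynomial in the coordinates `u, v`. -/
def ev (u v : F) : MvPolynomial (Fin 2) ℂ →ₐ[ℂ] F := aeval ![u, v]

@[simp] lemma ev_X_zero : ev u v (X 0) = u := by simp [ev]
@[simp] lemma ev_X_one : ev u v (X 1) = v := by simp [ev]
@[simp] lemma ev_C (a : ℂ) : ev u v (C a) = con a := by simp [ev, con]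

lemma mem_chartSubring {f : F} : f ∈ chartSubring u v ↔ ∃ p, ev u v p = f := by
  have h : Algebra.adjoin ℂ {u, v} = (ev u v).range := by
    rw [ev, ← Algebra.adjoin_range_eq_range_aeval, Matrix.range_cons, Matrix.range_cons,
      Matrix.range_empty, Set.union_empty, Set.singleton_union]
  change f ∈ Algebra.adjoin ℂ {u, v} ↔ _
  rw [h]
  rfl

/-- The functions `u, v` are coordinates of a plane with function field `F`. -/
structure Coord (u v : F) : Prop where
  inj : Function.Injective (ev u v)
  frac : ∀ f : F, ∃ p q, q ≠ 0 ∧ f = ev u v p / ev u v q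

lemma Coord.ev_ne_zero (h : Coord u v) {p : MvPolynomial (Fin 2) ℂ} (hp : p ≠ 0) :
    ev u v p ≠ 0 := (map_ne_zero_iff _ h.inj).2 hp

lemma Gen.ev_mem (h : Gen R u v) (p : MvPolynomial (Fin 2) ℂ) : ev u v p ∈ R.toSubring :=
  h.chartSubring_le (mem_chartSubring.2 ⟨p, rfl⟩)

/-- A point of a chart is determined by its centre, that is, by the polynomials that vanish at it.
-/
lemma Gen.eq_of_van (h : Gen R u v) (h' : Gen R' u v)
    (hv : ∀ p, Van R (ev u v p) ↔ Van R' (ev u v p)) : R = R' := by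
  rw [h.eq_ofPrime, h'.eq_ofPrime]
  congr 1
  ext f
  obtain ⟨p, hp⟩ := mem_chartSubring.1 f.2
  rw [mem_centerIdeal, mem_centerIdeal, ← hp]
  exact hv p

lemma Gen.exists_div (h : Gen R u v) {f : F} (hf : f ∈ R.toSubring) :
    ∃ p q, Unt R (ev u v q) ∧ f = ev u v p / ev u v q := by
  have h1 := h.eq_ofPrime
  rw [h1] at hf
  obtain ⟨a, b, hb, rfl⟩ := (mem_ofPrime_iff _ _ _).1 hf
  obtain ⟨p, hp⟩ := mem_chartSubring.1 a.2
  obtain ⟨q, hq⟩ := mem_chartSubring.1 b.2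
  refine ⟨p, q, ?_, by rw [hp, hq]⟩
  rw [hq]
  exact (van_or_unt (h.chartSubring_le b.2)).resolve_left fun hv => hb (mem_centerIdeal.2 hv)

/-- The centre of a discrete valuation ring of the chart is a nonzero prime ideal, so by
factoriality it contains a prime `p`. It is generated by `p`: for `g` in the centre, suitable powers
of `g` and `p` have equal order, their quotient is a unit `a / b`, and `p` must divide `g` or the
unit `b`. -/
lemma Unif.van_ev_iff {ϖ : F} (hϖ : Unif R ϖ) (hc : Coord u v) (h : Gen R u v) :
    ∃ p : MvPolynomial (Fin 2) ℂ, Prime p ∧ ∀ g, Van R (ev u v g) ↔ p ∣ g := by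
  let I : Ideal (MvPolynomial (Fin 2) ℂ) :=
    (centerIdeal R _ h.chartSubring_le).comap
      ((ev u v).toRingHom.codRestrict (chartSubring u v) fun p => mem_chartSubring.2 ⟨p, rfl⟩)
  have hI : ∀ g, g ∈ I ↔ Van R (ev u v g) := fun g => mem_centerIdeal
  have hprime : I.IsPrime := Ideal.comap_isPrime _ _
  have hne : I ≠ ⊥ := by
    obtain ⟨p, q, hq, e⟩ := h.exists_div hϖ.van.mem
    intro hbot
    have hp : p ∈ I := by
      rw [hI]
      have : ev u v p = ϖ * ev u v q := by rw [e, div_mul_cancel₀ _ hq.ne_zero]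
      rw [this]
      exact hϖ.van.mul_mem hq.mem
    rw [hbot, Ideal.mem_bot] at hp
    rw [hp, map_zero, zero_div] at e
    exact hϖ.ne_zero e
  obtain ⟨p, hpI, hp⟩ := hprime.exists_mem_prime_of_ne_bot hne
  refine ⟨p, hp, fun g => ?_⟩
  rw [← hI]
  refine ⟨fun hg => ?_, fun hg => I.mem_of_dvd hg hpI⟩
  rcases eq_or_ne g 0 with rfl | hg0
  · exact dvd_zero _
  rw [hI] at hg hpI
  obtain ⟨m, f, hf, ep⟩ := hϖ.exists_nat hpI.mem (hc.ev_ne_zero hp.ne_zero)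
  obtain ⟨n, f', hf', eg⟩ := hϖ.exists_nat hg.mem (hc.ev_ne_zero hg0)
  have hn : 0 < n := by
    rw [eg, ← zpow_natCast, hϖ.van_zpow_iff hf'] at hg
    exact_mod_cast hg
  -- The powers `g ^ m` and `p ^ n` both have order `m * n`, so their quotient is a unit of `R`.
  obtain ⟨a, b, hb, e⟩ := h.exists_div ((hf'.pow m).div (hf.pow n)).mem
  have key : ev u v (g ^ m * b) = ev u v (p ^ n * a) := by
    rw [div_eq_div_iff (hf.pow n).ne_zero hb.ne_zero] at e
    rw [map_mul, map_mul, map_pow, map_pow, ep, eg]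
    linear_combination (ϖ ^ (n * m)) * e
  have hdvd : p ∣ g ^ m * b := by
    rw [hc.inj key]
    exact (dvd_pow_self p hn.ne').mul_right a
  rcases hp.dvd_or_dvd hdvd with hd | hd
  · exact hp.dvd_of_dvd_pow hd
  · obtain ⟨c, rfl⟩ := hd
    refine absurd hb (Van.not_unt ?_)
    rw [map_mul]
    exact hpI.mul_mem (h.ev_mem c)

lemma Coord.exists_unif (hc : Coord u v) {p : MvPolynomial (Fin 2) ℂ} (hp : Prime p) :
    ∃ R : LocalSubring F, Gen R u v ∧ Unif R (ev u v p) ∧ ∀ g, Van R (ev u v g) ↔ p ∣ g := by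
  let e : MvPolynomial (Fin 2) ℂ →+* chartSubring u v :=
    (ev u v).toRingHom.codRestrict (chartSubring u v) fun p => mem_chartSubring.2 ⟨p, rfl⟩
  have he : Function.Bijective e :=
    ⟨fun a b hab => hc.inj (congrArg Subtype.val hab), fun ⟨f, hf⟩ => by
      obtain ⟨p, rfl⟩ := mem_chartSubring.1 hf
      exact ⟨p, rfl⟩⟩
  let E := RingEquiv.ofBijective e he
  have hpI : (Ideal.span {p}).IsPrime := (Ideal.span_singleton_prime hp.ne_zero).2 hp
  let P : Ideal (chartSubring u v) := (Ideal.span {p}).comap (E.symm : chartSubring u v →+* _)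
  have hPp : P.IsPrime := Ideal.comap_isPrime _ _
  set R := LocalSubring.ofPrime (chartSubring u v) P
  have hG : Gen R u v := gen_ofPrime u v P
  have hV : ∀ g, Van R (ev u v g) ↔ p ∣ g := by
    intro g
    refine (van_ofPrime_iff _ P (e g)).trans ?_
    rw [Ideal.mem_comap, Ideal.mem_span_singleton]
    have : E.symm (e g) = g := E.symm_apply_apply g
    exact iff_of_eq (congrArg (p ∣ ·) this)
  have hfac : ∀ g, g ≠ 0 → ∃ (n : ℕ) (f : F), Unt R f ∧ ev u v g = ev u v p ^ n * f := by
    intro g hg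
    obtain ⟨c, hc, hc'⟩ := (FiniteMultiplicity.of_prime_left hp hg).exists_eq_pow_mul_and_not_dvd
    refine ⟨multiplicity p g, ev u v c, ?_, by rw [← map_pow, ← map_mul, ← hc]⟩
    exact (van_or_unt (hG.ev_mem c)).resolve_left fun h => hc' ((hV c).1 h)
  refine ⟨R, hG, ⟨(hV p).2 dvd_rfl, hc.ev_ne_zero hp.ne_zero, fun f hf => ?_⟩, hV⟩
  obtain ⟨a, b, hb, rfl⟩ := hc.frac f
  have ha : a ≠ 0 := by
    rintro rfl
    simp at hf
  obtain ⟨n, f, hf', ea⟩ := hfac a ha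
  obtain ⟨m, f', hf'', eb⟩ := hfac b hb
  refine ⟨n - m, _, hf'.div hf'', ?_⟩
  have h0 := hc.ev_ne_zero hp.ne_zero
  have := hf''.ne_zero
  rw [ea, eb, zpow_sub₀ h0, zpow_natCast, zpow_natCast]
  field_simp

/-- Both centres are generated by a prime dividing `p`, hence by `p` itself, and a point of a chart
is determined by its centre. -/
lemma Coord.unique (hc : Coord u v) {p : MvPolynomial (Fin 2) ℂ} (hp : Prime p) {ϖ ϖ' : F}
    (h : Gen R u v) (hu : Unif R ϖ) (hv : Van R (ev u v p))
    (h' : Gen R' u v) (hu' : Unif R' ϖ') (hv' : Van R' (ev u v p)) : R = R' := by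
  have aux : ∀ {R : LocalSubring F} {ϖ : F}, Gen R u v → Unif R ϖ → Van R (ev u v p) →
      ∀ g, Van R (ev u v g) ↔ p ∣ g := by
    intro R ϖ h hu hv g
    obtain ⟨q, hq, hR⟩ := hu.van_ev_iff hc h
    have := hq.associated_of_dvd hp ((hR p).1 hv)
    rw [hR, this.dvd_iff_dvd_left]
  exact h.eq_of_van h' fun g => (aux h hu hv g).trans (aux h' hu' hv' g).symm

/-- `R` is the local ring of the generic point of the curve `u = 0` of the plane with
coordinates `u, v`. -/
structure Curve (u v : F) (R : LocalSubring F) : Prop where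
  gen : Gen R u v
  van : Van R u
  unif : ∃ ϖ, Unif R ϖ

lemma Coord.exists_curve (hc : Coord u v) : ∃ R, Curve u v R := by
  obtain ⟨R, h1, h2, h3⟩ := hc.exists_unif (X_prime (i := (0 : Fin 2)))
  exact ⟨R, h1, by simpa using h2.van, _, h2⟩

lemma Curve.eq (h : Curve u v R) (h' : Curve u v R') (hc : Coord u v) : R = R' := by
  obtain ⟨ϖ, hu⟩ := h.unif
  obtain ⟨ϖ', hu'⟩ := h'.unif
  exact hc.unique (X_prime (i := (0 : Fin 2))) h.gen hu (by simpa using h.van) h'.gen hu'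
    (by simpa using h'.van)

lemma Curve.uniformizer (h : Curve u v R) (hc : Coord u v) : Unif R u := by
  obtain ⟨R', h1, h2, h3⟩ := hc.exists_unif (X_prime (i := (0 : Fin 2)))
  have h4 : Curve u v R' := ⟨h1, by simpa using h2.van, _, h2⟩
  rw [h.eq h4 hc]
  simpa using h2

/-- A polynomial in `v` is not zero on the curve `u = 0`. -/
lemma Curve.unt (h : Curve u v R) (hc : Coord u v) (a : ℂ) : Unt R (v - con a) := by
  obtain ⟨ϖ, hu⟩ := h.unif
  obtain ⟨p, hp, hR⟩ := hu.van_ev_iff hc h.gen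
  have h0 : p ∣ X 0 := by
    rw [← hR]
    simpa using h.van
  have := h.gen.const
  obtain ⟨_, _⟩ := h.gen.sub.mem h.gen.right
  refine (van_or_unt (Mem.mem : v - con a ∈ R.toSubring)).resolve_left fun hv => ?_
  have h1 : p ∣ X 1 - C a := by
    rwa [← hR, map_sub, ev_X_one, ev_C]
  have h2 := hp.associated_of_dvd X_prime h0
  rw [h2.dvd_iff_dvd_left] at h1
  obtain ⟨c, hc⟩ := h1
  -- The point `(0, a + 1)` lies on `u = 0`, and `v - a` takes the value 1 there.
  have h3 := congrArg (MvPolynomial.eval ![0, a + 1]) hc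
  simp at h3

lemma Curve.unt_self (h : Curve u v R) (hc : Coord u v) : Unt R v := by
  simpa using h.unt hc 0

end Coordinates

end

section
open MvPolynomial
-- Birational changes of coordinates
section Change
variable {F : Type} [Field F] [Algebra ℂ F] {x y u v : F}

lemma ev_mem_of_mem {S : Subfield F} (hc : ∀ a, con a ∈ S) (hu : u ∈ S) (hv : v ∈ S)
    (p : MvPolynomial (Fin 2) ℂ) : ev u v p ∈ S :=
  chartSubring_le (T := S.toSubring) hc hu hv (mem_chartSubring.2 ⟨p, rfl⟩)

-- Two functions that generate a field of transcendence degree two are algebraically independent. It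
-- is therefore enough that `x` and `y` can be expressed through `u` and `v`.
open Cardinal in
lemma Coord.change (h : Coord x y) (hS : ∀ S : Subfield F, (∀ a, con a ∈ S) → u ∈ S → v ∈ S →
    x ∈ S ∧ y ∈ S) : Coord u v := by
  have hfrac : ∀ f : F, ∃ p q, q ≠ 0 ∧ f = ev u v p / ev u v q := by
    intro f
    have hmem : f ∈ IntermediateField.adjoin ℂ (Set.range ![u, v]) := by
      have h1 := hS (IntermediateField.adjoin ℂ (Set.range ![u, v])).toSubfield
        (fun a => IntermediateField.algebraMap_mem _ a)
        (IntermediateField.subset_adjoin _ _ ⟨0, rfl⟩)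
        (IntermediateField.subset_adjoin _ _ ⟨1, rfl⟩)
      obtain ⟨p, q, -, rfl⟩ := h.frac f
      have h2 := ev_mem_of_mem (fun a => IntermediateField.algebraMap_mem
        (IntermediateField.adjoin ℂ (Set.range ![u, v])) a) h1.1 h1.2
      exact div_mem (h2 p) (h2 q)
    obtain ⟨p, q, e⟩ := (IntermediateField.mem_adjoin_range_iff _ _ _).1 hmem
    rcases eq_or_ne q 0 with rfl | hq
    · exact ⟨0, 1, one_ne_zero, by simpa using e⟩
    · exact ⟨p, q, hq, e⟩
  have halg : ∀ (u v : F), (∀ f : F, ∃ p q, q ≠ 0 ∧ f = ev u v p / ev u v q) →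
      Algebra.IsAlgebraic (Algebra.adjoin ℂ (Set.range ![u, v])) F := by
    intro u v hf
    refine ⟨fun f => ?_⟩
    obtain ⟨p, q, -, rfl⟩ := hf f
    have hm : ∀ p, ev u v p ∈ Algebra.adjoin ℂ (Set.range ![u, v]) := by
      intro p
      rw [Algebra.adjoin_range_eq_range_aeval]
      exact ⟨p, rfl⟩
    rw [div_eq_mul_inv]
    exact (isAlgebraic_algebraMap (A := F)
        (⟨_, hm p⟩ : Algebra.adjoin ℂ (Set.range ![u, v]))).mul
      (isAlgebraic_algebraMap (A := F) (⟨_, hm q⟩ : Algebra.adjoin ℂ (Set.range ![u, v]))).inv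
  have hxy : IsTranscendenceBasis ℂ ![x, y] :=
    isTranscendenceBasis_iff_algebraicIndependent_isAlgebraic.2 ⟨h.inj, halg x y h.frac⟩
  have hcard := hxy.cardinalMk_eq_trdeg
  have := halg u v hfrac
  exact ⟨(Algebra.IsAlgebraic.isTranscendenceBasis_of_le_trdeg_of_finite ℂ ![u, v] hcard.le).1,
    hfrac⟩

end Change

/-! ### Transport of local rings by automorphisms of the function field -/

section Transport
variable {F : Type} [Field F] [Algebra ℂ F] {R : LocalSubring F} {x y u v f : F}
variable (φ : F ≃ₐ[ℂ] F)

/-- The local ring corresponding to `R` under an automorphism of the function field. -/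
abbrev mapRing (R : LocalSubring F) : LocalSubring F := LocalSubring.map (φ : F →+* F) R

lemma mem_mapRing : φ f ∈ (mapRing φ R).toSubring ↔ f ∈ R.toSubring := by
  constructor
  · rintro ⟨g, hg, e⟩
    rwa [← φ.injective e]
  · exact fun h => ⟨f, h, rfl⟩

lemma mem_mapRing' : f ∈ (mapRing φ R).toSubring ↔ φ.symm f ∈ R.toSubring := by
  rw [← mem_mapRing φ (R := R), φ.apply_symm_apply]

lemma unt_mapRing : Unt (mapRing φ R) (φ f) ↔ Unt R f := by
  rw [Unt, Unt, ← map_inv₀, mem_mapRing, mem_mapRing, map_ne_zero]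

lemma van_mapRing : Van (mapRing φ R) (φ f) ↔ Van R f := by
  rw [van_iff_not_unt, van_iff_not_unt, unt_mapRing, mem_mapRing]

lemma map_con (a : ℂ) : φ (con a) = con a := φ.commutes a

variable {φ}

lemma Gen.map (h : Gen R u v) : Gen (mapRing φ R) (φ u) (φ v) := by
  refine ⟨⟨fun a => ?_⟩, (mem_mapRing φ).2 h.left, (mem_mapRing φ).2 h.right, fun T hT hu hv => ?_⟩
  · rw [← map_con φ, mem_mapRing]
    exact h.const.mem a
  · have h1 : R.toSubring ≤ T.comap (φ : F →+* F) := by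
      refine h.min _ ⟨fun f hf => ?_, fun a => ?_, fun f hf hi => ?_⟩ hu hv
      · exact (mem_mapRing φ).1 (hT.le hf)
      · change φ (con a) ∈ T
        rw [map_con]
        exact hT.const a
      · change φ f⁻¹ ∈ T
        rw [map_inv₀]
        exact hT.inv _ hf (by rw [← map_inv₀, mem_mapRing]; exact hi)
    rintro _ ⟨f, hf, rfl⟩
    exact h1 hf

lemma Unif.map {ϖ : F} (h : Unif R ϖ) : Unif (mapRing φ R) (φ ϖ) := by
  refine ⟨(van_mapRing φ).2 h.van, (map_ne_zero φ).2 h.ne_zero, fun f hf => ?_⟩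
  obtain ⟨n, g, hg, e⟩ := h.fac (φ.symm f) ((map_ne_zero φ.symm).2 hf)
  refine ⟨n, φ g, (unt_mapRing φ).2 hg, ?_⟩
  rw [← map_zpow₀, ← map_mul, ← e, φ.apply_symm_apply]

lemma Curve.map (h : Curve u v R) : Curve (φ u) (φ v) (mapRing φ R) := by
  obtain ⟨ϖ, hu⟩ := h.unif
  exact ⟨h.gen.map, (van_mapRing φ).2 h.van, _, hu.map⟩

lemma mapRing_symm (R : LocalSubring F) : mapRing φ (mapRing φ.symm R) = R := by
  apply LocalSubring.toSubring_injective
  ext f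
  rw [mem_mapRing', mem_mapRing']
  simp

lemma mapRing_trans (φ ψ : F ≃ₐ[ℂ] F) (R : LocalSubring F) :
    mapRing (φ.trans ψ) R = mapRing ψ (mapRing φ R) := by
  apply LocalSubring.toSubring_injective
  ext f
  rw [mem_mapRing', mem_mapRing', mem_mapRing']
  rfl

lemma Pt.map {κ l m a b : ℂ} (h : Pt κ l m a b x y R) :
    Pt κ l m a b (φ x) (φ y) (mapRing φ R) := by
  cases h with
  | affine h ha hb =>
    refine .affine h.map (fun v => ?_) (fun v => ?_)
    · rw [← map_con φ, ← map_sub, van_mapRing] at v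
      rw [← map_con φ, ← map_sub, unt_mapRing]
      exact ha v
    · rw [← map_con φ, ← map_sub, van_mapRing] at v
      rw [← map_con φ, ← map_sub, unt_mapRing]
      exact hb v
  | inftyY h hy hx =>
    exact .inftyY (by simpa using h.map (φ := φ)) (by simpa using (van_mapRing φ).2 hy)
      ((unt_mapRing φ).2 hx)
  | inftyX h hx hy hy' =>
    exact .inftyX (by simpa using h.map (φ := φ)) (by simpa using (van_mapRing φ).2 hx)
      ((unt_mapRing φ).2 hy) (by simpa [map_con] using (unt_mapRing φ).2 hy')
  | corner h hx hy =>
    exact .corner (by simpa using h.map (φ := φ)) (by simpa using (van_mapRing φ).2 hx)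
      (by simpa using (van_mapRing φ).2 hy)
  | e1 h hx =>
    exact .e1 (by simpa [map_con] using h.map (φ := φ))
      (by simpa [map_con] using (van_mapRing φ).2 hx)
  | e1' h hx =>
    exact .e1' (by simpa [map_con] using h.map (φ := φ))
      (by simpa [map_con] using (van_mapRing φ).2 hx)
  | e2 h hx =>
    exact .e2 (by simpa [map_con] using h.map (φ := φ))
      (by simpa [map_con] using (van_mapRing φ).2 hx)
  | e2' h hx =>
    exact .e2' (by simpa [map_con] using h.map (φ := φ))
      (by simpa [map_con] using (van_mapRing φ).2 hx)
  | e3 h hy =>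
    exact .e3 (by simpa using h.map (φ := φ)) (by simpa using (van_mapRing φ).2 hy)
  | e4 h hx hs =>
    exact .e4 (by simpa using h.map (φ := φ)) ((van_mapRing φ).2 hx)
      (by simpa [map_con] using (unt_mapRing φ).2 hs)
  | e4' h hx hs =>
    exact .e4' (by simpa using h.map (φ := φ)) (by simpa using (van_mapRing φ).2 hx)
      (by simpa [map_con] using (van_mapRing φ).2 hs)
  | e5 h hx =>
    exact .e5 (by simpa [map_con] using h.map (φ := φ)) ((van_mapRing φ).2 hx)
  | e5' h hx =>
    exact .e5' (by simpa [map_con] using h.map (φ := φ))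
      (by simpa [map_con] using (van_mapRing φ).2 hx)
  | e6 h hx hw =>
    exact .e6 (by simpa using h.map (φ := φ)) (by simpa using (van_mapRing φ).2 hx)
      (by simpa [map_con] using (unt_mapRing φ).2 hw)
  | e6' h hx hw =>
    exact .e6' (by simpa using h.map (φ := φ)) (by simpa using (van_mapRing φ).2 hx)
      ((van_mapRing φ).2 hw)
  | e7 h hx =>
    exact .e7 (by simpa [map_con] using h.map (φ := φ)) (by simpa using (van_mapRing φ).2 hx)
  | e7' h hx =>
    exact .e7' (by simpa [map_con] using h.map (φ := φ))
      (by simpa [map_con] using (van_mapRing φ).2 hx)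
  | e8 h hx =>
    exact .e8 (by simpa [map_con] using h.map (φ := φ)) (by simpa using (van_mapRing φ).2 hx)
  | e8' h hx =>
    exact .e8' (by simpa [map_con] using h.map (φ := φ))
      (by simpa [map_con] using (van_mapRing φ).2 hx)

lemma vord_map [IsDiscreteValuationRing R.toSubring] [IsFractionRing R.toSubring F]
    [IsDiscreteValuationRing (mapRing φ R).toSubring]
    [IsFractionRing (mapRing φ R).toSubring F] (f : F) :
    vord (mapRing φ R) (φ f) = vord R f := by
  obtain ⟨ϖ, h⟩ := exists_unif R
  rcases eq_or_ne f 0 with rfl | h0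
  · rw [map_zero, vord_zero, vord_zero]
  obtain ⟨n, g, hg, rfl⟩ := h.fac f h0
  rw [h.vord_eq hg, map_mul, map_zpow₀, h.map.vord_eq ((unt_mapRing φ).2 hg)]

end Transport

end

/-! ### From iterated blowups to the list of points -/

section Blowup
variable {F : Type} [Field F] [Algebra ℂ F] {R : LocalSubring F} {x y : F} {κ l m a b : ℂ}

/-- The local rings of the points of the blowup at the origin of the chart `u, v`, those of the
points before the blowup being described by `X`. -/
def Blow (X : LocalSubring F → Prop) (u v : F) (R : LocalSubring F) : Prop :=
  ((X R ∧ ¬ (Gen R u v ∧ Van R u ∧ Van R v)) ∨ (Gen R u (v / u) ∧ Van R u)) ∨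
    (Gen R (u / v) v ∧ Van R v)

/-- The local rings of the points of `ℙ¹ × ℙ¹`. -/
def ProdPt (x y : F) (R : LocalSubring F) : Prop :=
  ((Gen R x y ∨ Gen R x⁻¹ y) ∨ Gen R x y⁻¹) ∨ Gen R x⁻¹ y⁻¹

lemma Gen.inv_left {u v : F} (h : Gen R u v) (hu : Unt R u) : Gen R u⁻¹ v :=
  h.change (fun _ hT p q => ⟨hT.inv _ p hu.2.1, q⟩)
    (fun _ hT p q => ⟨by simpa using hT.inv _ p (by simpa using hu.1), q⟩)

lemma Gen.inv_right {u v : F} (h : Gen R u v) (hv : Unt R v) : Gen R u v⁻¹ :=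
  (h.swap.inv_left hv).swap

lemma Gen.mem_of_sub {f v : F} {a : ℂ} (h : Gen R (f - con a) v) : f ∈ R.toSubring := by
  simpa using add_mem h.left (h.const.mem a)

lemma Gen.mem_of_sub' {f v : F} {a : ℂ} (h : Gen R v (f - con a)) : f ∈ R.toSubring :=
  h.swap.mem_of_sub

/-- The conditions for the eight base points, of which the latter two lie over `(0, ∞)`, `(∞, 0)`. -/
structure General (κ l m a b : ℂ) (x y : F) : Prop where
  l0 : l ≠ 0
  hab : a ≠ b
  x0 : x ≠ 0
  y0 : y ≠ 0
  s0 : (x ^ 2 * y)⁻¹ - con κ ≠ 0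
  m0 : x * y - 1 + con m ≠ 0
  xa : x - con a ≠ 0
  xb : x - con b ≠ 0
  ya : y - con a⁻¹ ≠ 0
  yb : y - con b⁻¹ ≠ 0

/-- The blowup of `ℙ¹ × ℙ¹` in the eight base points. -/
def Blow8 (κ l m a b : ℂ) (x y : F) : LocalSubring F → Prop :=
  Blow (Blow (Blow (Blow (Blow (Blow (Blow (Blow (ProdPt x y)
    (x - con a) (y - con a⁻¹)) (x - con b) (y - con b⁻¹)) x y⁻¹) x (x * y)⁻¹)
    x ((x ^ 2 * y)⁻¹ - con κ)) x⁻¹ y) x⁻¹ (x * y - 1 + con m)) x⁻¹ (y - con l)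

/-- Of the eight base points only the first, second, third, sixth and eighth lie on `ℙ¹ × ℙ¹`
itself; the other three are infinitely near. The hypotheses, numbered accordingly, exclude exactly
these five. -/
lemma pt_of_prodPt (h : ProdPt x y R)
    (n1 : ¬ (Gen R (x - con a) (y - con a⁻¹) ∧ Van R (x - con a) ∧ Van R (y - con a⁻¹)))
    (n2 : ¬ (Gen R (x - con b) (y - con b⁻¹) ∧ Van R (x - con b) ∧ Van R (y - con b⁻¹)))
    (n3 : ¬ (Gen R x y⁻¹ ∧ Van R x ∧ Van R y⁻¹)) (n6 : ¬ (Gen R x⁻¹ y ∧ Van R x⁻¹ ∧ Van R y))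
    (n8 : ¬ (Gen R x⁻¹ (y - con l) ∧ Van R x⁻¹ ∧ Van R (y - con l))) :
    Pt κ l m a b x y R := by
  have h00 : Gen R x y → Pt κ l m a b x y R := by
    intro h
    have := h.const
    obtain ⟨_, _⟩ := h.sub.mem h.right
    refine .affine h (fun hx => ?_) (fun hx => ?_)
    · exact (van_or_unt Mem.mem).resolve_left
        fun hy => n1 ⟨((h.sub_const a).swap.sub_const a⁻¹).swap, hx, hy⟩
    · exact (van_or_unt Mem.mem).resolve_left
        fun hy => n2 ⟨((h.sub_const b).swap.sub_const b⁻¹).swap, hx, hy⟩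
  have h10 : Gen R x⁻¹ y → Pt κ l m a b x y R := by
    intro h
    have := h.const
    obtain ⟨_, _⟩ := h.sub.mem h.right
    rcases van_or_unt h.left with hv | hu
    · exact .inftyX h hv ((van_or_unt h.right).resolve_left fun hy => n6 ⟨h, hv, hy⟩)
        ((van_or_unt Mem.mem).resolve_left fun hy => n8 ⟨(h.swap.sub_const l).swap, hv, hy⟩)
    · exact h00 (by simpa using h.inv_left hu)
  have h01 : Gen R x y⁻¹ → Pt κ l m a b x y R := by
    intro h
    rcases van_or_unt h.right with hv | hu
    · exact .inftyY h hv ((van_or_unt h.left).resolve_left fun hx => n3 ⟨h, hx, hv⟩)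
    · exact h00 (by simpa using h.inv_right hu)
  rcases h with ((h | h) | h) | h
  · exact h00 h
  · exact h10 h
  · exact h01 h
  · rcases van_or_unt h.left with hv | hu
    · rcases van_or_unt h.right with hv' | hu'
      · exact .corner h hv hv'
      · exact h10 (by simpa using h.inv_right hu')
    · exact h01 (by simpa using h.inv_left hu)

/-- The blowups are peeled off from the last to the first. A point of an exceptional curve is
recorded in its chart, with the condition that it is not a centre of a later blowup; what survives
all eight cases is an old point of `ℙ¹ × ℙ¹`. -/
lemma pt_of_blow8 (hg : General κ l m a b x y) (h : Blow8 κ l m a b x y R) :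
    Pt κ l m a b x y R := by
  have hx0 := hg.x0; have hy0 := hg.y0
  have e3 : y⁻¹ / x = (x * y)⁻¹ := by field_simp
  have e3' : x / y⁻¹ = x * y := by field_simp
  have e4 : (x * y)⁻¹ / x = (x ^ 2 * y)⁻¹ := by field_simp
  have e4' : x / (x * y)⁻¹ = x ^ 2 * y := by field_simp
  have e6 : y / x⁻¹ = x * y := by field_simp
  have e6' : x⁻¹ / y = (x * y)⁻¹ := by field_simp
  have e7 : (x * y - 1 + con m) / x⁻¹ = x * (x * y - 1 + con m) := by field_simp
  have e7' : x⁻¹ / (x * y - 1 + con m) = (x * (x * y - 1 + con m))⁻¹ := by field_simp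
  have e8 : (y - con l) / x⁻¹ = x * (y - con l) := by field_simp
  have e8' : x⁻¹ / (y - con l) = (x * (y - con l))⁻¹ := by field_simp
  simp only [Blow8, Blow, e3, e3', e4, e4', e6, e6', e7, e7', e8, e8'] at h
  have key6 : ¬ (Gen R x⁻¹ (x * y - 1 + con m) ∧ Van R x⁻¹ ∧ Van R (x * y - 1 + con m)) →
      Gen R x⁻¹ (x * y) → Van R x⁻¹ → Pt κ l m a b x y R := by
    intro n h hx
    have := h.const
    obtain ⟨_, _⟩ := h.sub.mem h.right
    refine .e6 h hx ((van_or_unt Mem.mem).resolve_left fun hv => n ⟨?_, hx, hv⟩)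
    have := (h.swap.sub_const (1 - m)).swap
    rwa [con_sub, con_one, ← sub_add] at this
  have key4 : ¬ (Gen R x ((x ^ 2 * y)⁻¹ - con κ) ∧ Van R x ∧ Van R ((x ^ 2 * y)⁻¹ - con κ)) →
      Gen R x (x ^ 2 * y)⁻¹ → Van R x → Pt κ l m a b x y R := by
    intro n h hx
    have := h.const
    obtain ⟨_, _⟩ := h.sub.mem h.right
    exact .e4 h hx ((van_or_unt Mem.mem).resolve_left
      fun hv => n ⟨(h.swap.sub_const κ).swap, hx, hv⟩)
  obtain (⟨h, n8⟩ | h) | h := h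
  rotate_left
  · exact .e8 h.1 h.2
  · exact .e8' h.1 h.2
  obtain (⟨h, n7⟩ | h) | h := h
  rotate_left
  · exact .e7 h.1 h.2
  · exact .e7' h.1 h.2
  obtain (⟨h, n6⟩ | h) | h := h
  rotate_left
  · exact key6 n7 h.1 h.2
  · obtain ⟨h, hy⟩ := h
    rcases van_or_unt h.left with hv | hu
    · exact .e6' h hv hy
    · have e : x⁻¹ = (x * y)⁻¹ * y := by field_simp
      refine key6 n7 (h.change (fun T hT p q => ⟨?_, ?_⟩) (fun T hT p q => ⟨?_, ?_⟩)) ?_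
      · rw [e]
        exact mul_mem p q
      · simpa only [inv_inv] using hT.inv _ p hu.2.1
      · exact hT.inv _ q hu.mem
      · have : y = x⁻¹ * (x * y) := by field_simp
        rw [this]
        exact mul_mem p q
      · rw [e]
        exact hy.mul_mem' hu.mem
  obtain (⟨h, n5⟩ | h) | h := h
  rotate_left
  · exact .e5 h.1 h.2
  · exact .e5' h.1 h.2
  obtain (⟨h, n4⟩ | h) | h := h
  rotate_left
  · exact key4 n5 h.1 h.2
  · obtain ⟨h, hz⟩ := h
    rcases van_or_unt h.left with hv | hu
    · exact .e4' h hv hz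
    · have e : x = (x ^ 2 * y) * (x * y)⁻¹ := by field_simp
      refine key4 n5 (h.change (fun T hT p q => ⟨?_, ?_⟩) (fun T hT p q => ⟨?_, ?_⟩)) ?_
      · rw [e]
        exact mul_mem p q
      · exact hT.inv _ p hu.2.1
      · simpa using hT.inv _ q (by simpa using hu.mem)
      · have : (x * y)⁻¹ = x * (x ^ 2 * y)⁻¹ := by field_simp
        rw [this]
        exact mul_mem p q
      · rw [e]
        exact hz.mul_mem' hu.mem
  obtain (⟨h, n3⟩ | h) | h := h
  rotate_left
  · obtain ⟨h, hx⟩ := h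
    -- On the first exceptional curve over `(0, ∞)` the origin of the chart `(x, 1 / (x y))` is the
    -- next base point. Away from it `1 / (x y)` is invertible, and the point lies in the second
    -- chart.
    have hu := (van_or_unt h.right).resolve_left fun hv => n4 ⟨h, hx, hv⟩
    have e : y⁻¹ = x * (x * y)⁻¹ := by field_simp
    refine .e3 (h.change (fun T hT p q => ⟨?_, ?_⟩) (fun T hT p q => ⟨?_, ?_⟩)) ?_
    · simpa only [inv_inv] using hT.inv _ q hu.2.1
    · rw [e]
      exact mul_mem p q
    · have : x = (x * y) * y⁻¹ := by field_simp
      rw [this]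
      exact mul_mem p q
    · exact hT.inv _ p hu.mem
    · rw [e]
      exact hx.mul_mem hu.mem
  · exact .e3 h.1 h.2
  obtain (⟨h, n2⟩ | h) | h := h
  rotate_left
  · exact .e2 h.1 h.2
  · exact .e2' h.1 h.2
  obtain (⟨h, n1⟩ | h) | h := h
  rotate_left
  · exact .e1 h.1 h.2
  · exact .e1' h.1 h.2
  exact pt_of_prodPt h n1 n2 n3 n6 n8

end Blowup

/-! ### From the list of points back to iterated blowups -/

section Blowup
variable {F : Type} [Field F] [Algebra ℂ F] {R : LocalSubring F} {x y : F} {κ l m a b : ℂ}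

section
variable {X : LocalSubring F → Prop} {u v : F}
lemma Blow.old (h : X R) (n : ¬ (Gen R u v ∧ Van R u ∧ Van R v)) : Blow X u v R :=
  .inl (.inl ⟨h, n⟩)
lemma Blow.next {u' v' : F} (h : Blow X u v R) (n : ¬ (Gen R u' v' ∧ Van R u' ∧ Van R v')) :
    Blow (Blow X u v) u' v' R := .inl (.inl ⟨h, n⟩)
lemma Blow.left (h : Gen R u (v / u)) (hu : Van R u) : Blow X u v R := .inl (.inr ⟨h, hu⟩)
lemma Blow.right (h : Gen R (u / v) v) (hv : Van R v) : Blow X u v R := .inr ⟨h, hv⟩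
end

/-- A point with finite `x` is none of `q₆, q₇, q₈`. -/
lemma General.not_origin_of_x (hg : General κ l m a b x y) (hx : x ∈ R.toSubring) (v : F) :
    ¬ (Gen R x⁻¹ v ∧ Van R x⁻¹ ∧ Van R v) := fun h => h.2.1.not_mem hg.x0 hx

/-- A point with finite `y` is none of `q₃, q₄, q₅`. -/
lemma General.not_origin_of_y (hg : General κ l m a b x y) (hy : y ∈ R.toSubring) :
    ¬ (Gen R x y⁻¹ ∧ Van R x ∧ Van R y⁻¹) ∧
    ¬ (Gen R x (x * y)⁻¹ ∧ Van R x ∧ Van R (x * y)⁻¹) ∧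
    ¬ (Gen R x ((x ^ 2 * y)⁻¹ - con κ) ∧ Van R x ∧ Van R ((x ^ 2 * y)⁻¹ - con κ)) := by
  have hx0 := hg.x0; have hy0 := hg.y0
  refine ⟨fun h => h.2.2.not_mem hy0 hy, fun h => ?_, fun h => ?_⟩
  · exact h.2.2.not_mem (mul_ne_zero hx0 hy0) (mul_mem h.1.left hy)
  · have h1 := h.1.mem_of_sub'
    have e : y⁻¹ = x * (x * (x ^ 2 * y)⁻¹) := by field_simp
    have h2 : Van R y⁻¹ := by
      rw [e]
      exact h.2.1.mul_mem (mul_mem h.1.left h1)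
    exact h2.not_mem hy0 hy

/-- A point with infinite `y` is neither `(a, 1 / a)` nor over `(∞, 0)` or `(∞, l)`. -/
lemma General.not_origin_of_y_inv (hg : General κ l m a b x y) (hy : Van R y⁻¹) :
    (∀ a b : ℂ, ¬ (Gen R (x - con a) (y - con b) ∧ Van R (x - con a) ∧ Van R (y - con b))) ∧
    ¬ (Gen R x⁻¹ y ∧ Van R x⁻¹ ∧ Van R y) ∧
    ¬ (Gen R x⁻¹ (x * y - 1 + con m) ∧ Van R x⁻¹ ∧ Van R (x * y - 1 + con m)) ∧
    ¬ (Gen R x⁻¹ (y - con l) ∧ Van R x⁻¹ ∧ Van R (y - con l)) := by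
  have hx0 := hg.x0
  have h0 := hy.not_mem hg.y0
  refine ⟨fun a b h => h0 h.1.mem_of_sub', fun h => h0 h.1.right, fun h => h0 ?_,
    fun h => h0 h.1.mem_of_sub'⟩
  have h1 : x * y - 1 + con m = x * y - con (1 - m) := by rw [con_sub, con_one]; ring
  have h2 := h.1
  rw [h1] at h2
  have e : y = x⁻¹ * (x * y) := by field_simp
  rw [e]
  exact mul_mem h.1.left h2.mem_of_sub'

/-- A point with `x ≠ 0` is none of `q₃, q₄, q₅`. -/
lemma not_origin_of_x_inv (hx : ¬ Van R x) (v : F) : ¬ (Gen R x v ∧ Van R x ∧ Van R v) :=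
  fun h => hx h.2.1

lemma van_con_sub {c d : ℂ} {f : F} [HasConst R.toSubring] (h : Van R (f - con c))
    (h' : Van R (f - con d)) : c = d := by
  obtain h1 : Mem R.toSubring (f - con c) := ⟨h.mem⟩
  obtain h2 : Mem R.toSubring (f - con d) := ⟨h'.mem⟩
  have e : (con (c - d) : F) = (f - con d) - (f - con c) := by rw [con_sub]; ring
  have h3 : res R (con (c - d) : F) = 0 := by rw [e, res_sub, h.res, h'.res, sub_zero]
  exact sub_eq_zero.1 (res_con_eq_zero.1 h3)

/-- A point enters at the stage that creates it and stays unless it is a later centre. Whether `x`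
and `y` are finite or infinite at the point excludes most of the later centres; the others are
excluded by the side conditions of `Pt`, by `a ≠ b` and by `l ≠ 0`. -/
lemma blow8_of_pt (hg : General κ l m a b x y) (h : Pt κ l m a b x y R) :
    Blow8 κ l m a b x y R := by
  have hx0 := hg.x0; have hy0 := hg.y0
  have e3' : x / y⁻¹ = x * y := by field_simp
  have e4 : (x * y)⁻¹ / x = (x ^ 2 * y)⁻¹ := by field_simp
  have e4' : x / (x * y)⁻¹ = x ^ 2 * y := by field_simp
  have e6 : y / x⁻¹ = x * y := by field_simp
  have e6' : x⁻¹ / y = (x * y)⁻¹ := by field_simp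
  have e7 : (x * y - 1 + con m) / x⁻¹ = x * (x * y - 1 + con m) := by field_simp
  have e7' : x⁻¹ / (x * y - 1 + con m) = (x * (x * y - 1 + con m))⁻¹ := by field_simp
  have e8 : (y - con l) / x⁻¹ = x * (y - con l) := by field_simp
  have e8' : x⁻¹ / (y - con l) = (x * (y - con l))⁻¹ := by field_simp
  have over1 : ∀ {X : LocalSubring F → Prop}, X R → x ∈ R.toSubring → y ∈ R.toSubring →
      Blow (Blow (Blow (Blow (Blow (Blow X x y⁻¹) x (x * y)⁻¹)
        x ((x ^ 2 * y)⁻¹ - con κ)) x⁻¹ y) x⁻¹ (x * y - 1 + con m)) x⁻¹ (y - con l) R := by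
    intro X h hx hy
    obtain ⟨n3, n4, n5⟩ := hg.not_origin_of_y hy
    exact ((((((Blow.old h n3).next n4).next n5).next (hg.not_origin_of_x hx _)).next
      (hg.not_origin_of_x hx _)).next (hg.not_origin_of_x hx _))
  have prodInf : ProdPt x y R → ¬ Van R x →
      ¬ (Gen R (x - con a) (y - con a⁻¹) ∧ Van R (x - con a) ∧ Van R (y - con a⁻¹)) →
      ¬ (Gen R (x - con b) (y - con b⁻¹) ∧ Van R (x - con b) ∧ Van R (y - con b⁻¹)) →
      ¬ (Gen R x⁻¹ y ∧ Van R x⁻¹ ∧ Van R y) →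
      ¬ (Gen R x⁻¹ (x * y - 1 + con m) ∧ Van R x⁻¹ ∧ Van R (x * y - 1 + con m)) →
      ¬ (Gen R x⁻¹ (y - con l) ∧ Van R x⁻¹ ∧ Van R (y - con l)) → Blow8 κ l m a b x y R := by
    intro h hx n1 n2 n6 n7 n8
    have n := not_origin_of_x_inv hx
    exact (((((((Blow.old h n1).next n2).next (n _)).next (n _)).next (n _)).next n6).next n7).next n8
  -- Points over `(∞, 0)` are not over `(∞, l)`, because `l ≠ 0`.
  have vy8 : Van R y → [HasConst R.toSubring] →
      ¬ (Gen R x⁻¹ (y - con l) ∧ Van R x⁻¹ ∧ Van R (y - con l)) := by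
    intro hy _ h
    exact hg.l0 (van_con_sub (c := l) (d := 0) h.2.2 (by simpa using hy))
  cases h with
  | affine h ha hb =>
    refine over1 (((Blow.old (.inl (.inl (.inl h))) fun n => ?_).next fun n => ?_)) h.left h.right
    · exact n.2.2.not_unt (ha n.2.1)
    · exact n.2.2.not_unt (hb n.2.1)
  | inftyY h hy hx =>
    obtain ⟨n1, n6, n7, n8⟩ := hg.not_origin_of_y_inv hy
    exact prodInf (.inl (.inr h)) hx.not_van (n1 _ _) (n1 _ _) n6 n7 n8
  | inftyX h hx hy hy' =>
    have hx' := hx.not_mem hx0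
    have : ∀ a v, ¬ (Gen R (x - con a) v ∧ Van R (x - con a) ∧ Van R v) :=
      fun a v h => hx' h.1.mem_of_sub
    refine prodInf (.inl (.inl (.inr h))) (fun h => hx' h.mem) (this _ _) (this _ _)
      (fun h => hy.not_van h.2.2) (fun h => ?_) (fun h => hy'.not_van h.2.2)
    have h1 : x * y - 1 + con m = x * y - con (1 - m) := by rw [con_sub, con_one]; ring
    have h2 := h.1
    rw [h1] at h2
    have e : y = x⁻¹ * (x * y) := by field_simp
    refine hy.not_van ?_
    rw [e]
    exact hx.mul_mem h2.mem_of_sub'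
  | corner h hx hy =>
    obtain ⟨n1, n6, n7, n8⟩ := hg.not_origin_of_y_inv hy
    exact prodInf (.inr h) (fun h => hx.not_mem hx0 h.mem) (n1 _ _) (n1 _ _) n6 n7 n8
  | e1 h hx =>
    have hxR := h.mem_of_sub
    have := h.const
    have hy : y ∈ R.toSubring := by
      have hs := mul_mem h.right h.left
      rw [div_mul_cancel₀ _ hg.xa] at hs
      simpa using add_mem hs (h.const.mem a⁻¹)
    have := h.const
    exact over1 ((Blow.left h hx).next fun n => hg.hab (van_con_sub hx n.2.1)) hxR hy
  | e1' h hy =>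
    have hyR := h.mem_of_sub'
    have := h.const
    have e : x - con a = (x - con a) / (y - con a⁻¹) * (y - con a⁻¹) :=
      (div_mul_cancel₀ _ hg.ya).symm
    have hx : Van R (x - con a) := by
      rw [e]
      exact hy.mul_mem' h.left
    have hxR : x ∈ R.toSubring := by simpa using add_mem hx.mem (h.const.mem a)
    exact over1 ((Blow.right h hy).next fun n => hg.hab (van_con_sub hx n.2.1)) hxR hyR
  | e2 h hx =>
    have hxR := h.mem_of_sub
    have hy : y ∈ R.toSubring := by
      have hs := mul_mem h.right h.left
      rw [div_mul_cancel₀ _ hg.xb] at hs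
      simpa using add_mem hs (h.const.mem b⁻¹)
    exact over1 (Blow.left h hx) hxR hy
  | e2' h hy =>
    have hyR := h.mem_of_sub'
    have := h.const
    have e : x - con b = (x - con b) / (y - con b⁻¹) * (y - con b⁻¹) :=
      (div_mul_cancel₀ _ hg.yb).symm
    have hx : Van R (x - con b) := by
      rw [e]
      exact hy.mul_mem' h.left
    have hxR : x ∈ R.toSubring := by simpa using add_mem hx.mem (h.const.mem b)
    exact over1 (Blow.right h hy) hxR hyR
  | e3 h hy =>
    have e : x = x * y * y⁻¹ := by field_simp
    have hx : x ∈ R.toSubring := by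
      rw [e]
      exact mul_mem h.left h.right
    have hv : ¬ Van R (x * y)⁻¹ := fun hv => hv.not_mem (mul_ne_zero hx0 hy0) h.left
    refine (((((Blow.right (e3'.symm ▸ h) hy).next fun n => hv n.2.2).next fun n => hv ?_).next
      (hg.not_origin_of_x hx _)).next (hg.not_origin_of_x hx _)).next (hg.not_origin_of_x hx _)
    have e' : (x * y)⁻¹ = x * (x ^ 2 * y)⁻¹ := by field_simp
    rw [e']
    exact n.2.1.mul_mem n.1.mem_of_sub'
  | e4 h hx hs =>
    have n := hg.not_origin_of_x h.left
    exact ((((Blow.left (e4.symm ▸ h) hx).next fun n => n.2.2.not_unt hs).next (n _)).next (n _)).next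
      (n _)
  | e4' h ht hz =>
    have e : x = x ^ 2 * y * (x * y)⁻¹ := by field_simp
    have hx : x ∈ R.toSubring := by
      rw [e]
      exact mul_mem h.left h.right
    have n := hg.not_origin_of_x hx
    refine ((((Blow.right (e4'.symm ▸ h) hz).next fun n => ?_).next (n _)).next (n _)).next (n _)
    exact ht.inv_not_mem (mul_ne_zero (pow_ne_zero 2 hx0) hy0) n.1.mem_of_sub'
  | e5 h hx =>
    have n := hg.not_origin_of_x h.left
    exact (((Blow.left h hx).next (n _)).next (n _)).next (n _)
  | e5' h hs =>
    have hx : x ∈ R.toSubring := by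
      have := mul_mem h.left h.right
      rwa [div_mul_cancel₀ _ hg.s0] at this
    have n := hg.not_origin_of_x hx
    exact (((Blow.right h hs).next (n _)).next (n _)).next (n _)
  | e6 h hx hw =>
    have := h.const
    have e : y = x⁻¹ * (x * y) := by field_simp
    have hy : Van R y := by
      rw [e]
      exact hx.mul_mem h.right
    exact ((Blow.left (e6.symm ▸ h) hx).next fun n => n.2.2.not_unt hw).next (vy8 hy)
  | e6' h hz hy =>
    have := h.const
    refine ((Blow.right (e6'.symm ▸ h) hy).next fun n => ?_).next (vy8 hy)
    have h1 : x * y - 1 + con m = x * y - con (1 - m) := by rw [con_sub, con_one]; ring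
    have h2 := n.1
    rw [h1] at h2
    exact hz.not_mem (mul_ne_zero hx0 hy0) h2.mem_of_sub'
  | e7 h hx =>
    have := h.const
    obtain ⟨_, _⟩ := h.sub.mem h.left
    obtain ⟨_, _⟩ := h.sub.mem h.right
    have e : y = x⁻¹ * (x⁻¹ * (x * (x * y - 1 + con m)) + 1 - con m) := by field_simp; ring
    have hy : Van R y := by
      rw [e]
      exact hx.mul_mem Mem.mem
    exact (Blow.left (e7.symm ▸ h) hx).next (vy8 hy)
  | e7' h hw =>
    have := h.const
    obtain ⟨_, _⟩ := h.sub.mem h.left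
    obtain ⟨_, _⟩ := h.sub.mem h.right
    have hm0 := hg.m0
    have e : y = (x * y - 1 + con m) * ((x * (x * y - 1 + con m))⁻¹ *
        ((x * y - 1 + con m) + 1 - con m)) := by
      have : x * y - 1 + con m + 1 - con m = x * y := by ring
      rw [this]
      generalize x * y - 1 + con m = w at hm0
      field_simp
    have hy : Van R y := by
      rw [e]
      exact hw.mul_mem Mem.mem
    exact (Blow.right (e7'.symm ▸ h) hw).next (vy8 hy)
  | e8 h hx => exact Blow.left (e8.symm ▸ h) hx
  | e8' h hy => exact Blow.right (e8'.symm ▸ h) hy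

end Blowup

lemma one_div_eq {F : Type} [Field F] (f : F) : 1 / f = f⁻¹ := one_div f

section
variable {F : Type} [Field F] [Algebra ℂ F]
lemma con_one_inv : (con 1⁻¹ : F) = 1 := by simp
lemma sub_con_sub (f : F) (m : ℂ) : f - con (1 - m) = f - 1 + con m := by
  rw [con_sub, con_one]; ring
end

lemma coord_xy : Coord x y := by
  have h : ∀ p, ev x y p = algebraMap (MvPolynomial (Fin 2) ℂ) K p := by
    intro p
    have : ev x y = IsScalarTower.toAlgHom ℂ (MvPolynomial (Fin 2) ℂ) K := by
      apply MvPolynomial.algHom_ext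
      intro i
      fin_cases i
      · simp; rfl
      · simp; rfl
    rw [this]
    rfl
  refine ⟨fun p q hpq => ?_, fun f => ?_⟩
  · rw [h, h] at hpq
    exact IsFractionRing.injective _ K hpq
  · obtain ⟨p, q, hq, e⟩ := IsFractionRing.div_surjective (MvPolynomial (Fin 2) ℂ) f
    exact ⟨p, q, nonZeroDivisors.ne_zero hq, by rw [h, h]; exact e.symm⟩

/-- A polynomial function is not zero if the polynomial is nonzero at some point `s`; below the
point is chosen by hand in each case. -/
lemma coord_ne {F : Type} [Field F] [Algebra ℂ F] {u v : F} (h : Coord u v)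
    (p : MvPolynomial (Fin 2) ℂ) (f : F)
    (hp : ev u v p = f) (s : Fin 2 → ℂ) (hs : MvPolynomial.eval s p ≠ 0) : f ≠ 0 := by
  rw [← hp]
  refine h.ev_ne_zero ?_
  rintro rfl
  simp at hs

section General
open MvPolynomial
variable {F : Type} [Field F] [Algebra ℂ F] {u v : F} (h : Coord u v)
include h
lemma Coord.left_ne_zero : u ≠ 0 := coord_ne h (X 0) _ (by simp) ![1, 0] (by simp)
lemma Coord.right_ne_zero : v ≠ 0 := coord_ne h (X 1) _ (by simp) ![0, 1] (by simp)
lemma Coord.left_sub_ne_zero (a : ℂ) : u - con a ≠ 0 :=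
  coord_ne h (X 0 - C a) _ (by rw [map_sub, ev_C, ev_X_zero]) ![a + 1, 0] (by simp)
lemma Coord.right_sub_ne_zero (a : ℂ) : v - con a ≠ 0 :=
  coord_ne h (X 1 - C a) _ (by rw [map_sub, ev_C, ev_X_one]) ![0, a + 1] (by simp)
lemma Coord.mul_sub_ne_zero (a : ℂ) : u * v - 1 + con a ≠ 0 :=
  coord_ne h (X 0 * X 1 - 1 + C a) _ (by simp only [map_add, map_sub, map_mul, ev_C, ev_X_one,
    ev_X_zero, map_one]) ![2 - a, 1] (by simp; ring_nf; simp)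
lemma Coord.sq_mul_sub_ne_zero (a : ℂ) : (u ^ 2 * v)⁻¹ - con a ≠ 0 := by
  have h0 := h.left_ne_zero
  have h1 := h.right_ne_zero
  have h2 : 1 - con a * u ^ 2 * v ≠ 0 := coord_ne h (1 - C a * X 0 ^ 2 * X 1) _
    (by simp only [map_sub, map_mul, ev_C, ev_X_one, ev_X_zero, map_one, map_pow]) 0 (by simp)
  have e : (u ^ 2 * v)⁻¹ - con a = (1 - con a * u ^ 2 * v) / (u ^ 2 * v) := by
    rw [eq_div_iff (by positivity), sub_mul, inv_mul_cancel₀ (by positivity)]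
    ring
  rw [e]
  positivity

lemma Coord.general (κ m : ℂ) {l a b : ℂ} (hl : l ≠ 0) (hab : a ≠ b) : General κ l m a b u v where
  l0 := hl
  hab := hab
  x0 := h.left_ne_zero
  y0 := h.right_ne_zero
  s0 := h.sq_mul_sub_ne_zero κ
  m0 := h.mul_sub_ne_zero m
  xa := h.left_sub_ne_zero a
  xb := h.left_sub_ne_zero b
  ya := h.right_sub_ne_zero _
  yb := h.right_sub_ne_zero _
end General

section Center
variable {q Q T : ℂ} {n : ℤ}
-- The base points are brought to the normal form of `Blow8`, with `a = 1`, `b = T`, `l = q ^ n` and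
-- `m = q ^ n * Q`.
lemma center_one : center q Q T n 1 = (x - con 1, y - con 1⁻¹) := by
  rw [con_one_inv, con_one]; rfl
lemma center_two : center q Q T n 2 = (x - con T, y - con T⁻¹) := by
  rw [← one_div T]; rfl
lemma center_three : center q Q T n 3 = (x, y⁻¹) := by rw [← one_div_eq y]; rfl
lemma center_four : center q Q T n 4 = (x, (x * y)⁻¹) := by rw [← one_div_eq (x * y)]; rfl
lemma center_five :
    center q Q T n 5 = (x, (x ^ 2 * y)⁻¹ - con (q ^ (-2 * n - 1) / (Q * T))) := by
  rw [← one_div_eq (x ^ 2 * y)]; rfl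
lemma center_six : center q Q T n 6 = (x⁻¹, y) := by rw [← one_div_eq x]; rfl
lemma center_seven : center q Q T n 7 = (x⁻¹, x * y - 1 + con (q ^ n * Q)) := by
  rw [← one_div_eq x, ← sub_con_sub]; rfl
lemma center_eight : center q Q T n 8 = (x⁻¹, y - con (q ^ n)) := by
  rw [← one_div_eq x]; rfl
end Center

lemma mem_blowUp {X : Model} {u v : K} {R : LocalSubring K} :
    R ∈ blowUp X u v ↔ Blow (· ∈ X) u v R := by
  simp only [blowUp, Blow, Set.mem_union, Set.mem_ofPred_eq, IsOrigin, mem_chart_iff, vanishes_iff]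

lemma mem_stage_zero {q Q T : ℂ} {n : ℤ} : (· ∈ stage q Q T n 0) = ProdPt x y := by
  ext R
  simp only [stage, P1P1, ProdPt, Set.mem_union, mem_chart_iff]

lemma mem_stage_succ {q Q T : ℂ} {n : ℤ} (k : ℕ) : (· ∈ stage q Q T n (k + 1)) =
    Blow (· ∈ stage q Q T n k) (center q Q T n (k + 1)).1 (center q Q T n (k + 1)).2 := by
  ext R
  exact mem_blowUp

/-- The points of the surface, chart by chart. -/
theorem mem_surface_iff {q Q T : ℂ} (hq : q ≠ 0) (hT1 : T ≠ 1) {n : ℤ} {R : LocalSubring K} :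
    R ∈ surface q Q T n ↔
      Pt (q ^ (-2 * n - 1) / (Q * T)) (q ^ n) (q ^ n * Q) 1 T x y R := by
  have hg := coord_xy.general (q ^ (-2 * n - 1) / (Q * T)) (q ^ n * Q) (zpow_ne_zero n hq) hT1.symm
  have h : (· ∈ surface q Q T n) =
      Blow8 (q ^ (-2 * n - 1) / (Q * T)) (q ^ n) (q ^ n * Q) 1 T x y := by
    unfold surface Blow8
    rw [mem_stage_succ 7, mem_stage_succ 6, mem_stage_succ 5, mem_stage_succ 4, mem_stage_succ 3,
      mem_stage_succ 2, mem_stage_succ 1, mem_stage_succ 0, mem_stage_zero]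
    simp only [zero_add, Nat.reduceAdd, center_one, center_two, center_three, center_four,
      center_five, center_six, center_seven, center_eight]
  rw [show (R ∈ surface q Q T n) = _ from congrFun h R]
  exact ⟨pt_of_blow8 hg, blow8_of_pt hg⟩

/-! ### Orders of translates by constants -/

section Orders
variable {F : Type} [Field F] [Algebra ℂ F] {R : LocalSubring F}
  [IsDiscreteValuationRing R.toSubring] [IsFractionRing R.toSubring F] {f g : F} {c d : ℂ}

lemma vord_con_le [HasConst R.toSubring] (c : ℂ) : 0 ≤ vord R (con c : F) :=
  vord_nonneg (HasConst.mem c)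

lemma vord_sub_con_of_neg [HasConst R.toSubring] (h : vord R f < 0) (c : ℂ) :
    vord R (f - con c) = vord R f := by
  have h0 : f ≠ 0 := by
    rintro rfl
    simp [vord_zero] at h
  rw [sub_eq_add_neg, ← con_neg]
  exact vord_add_of_lt h0 (h.trans_le (vord_con_le _))

lemma vord_sub_con_of_ne [HasConst R.toSubring] (h : 0 < vord R (f - con c)) (hcd : c ≠ d) :
    vord R (f - con d) = 0 := by
  have e : f - con d = con (c - d) + (f - con c) := by rw [con_sub]; ring
  have hu : Unt R (con (c - d) : F) := Unt.con (sub_ne_zero.2 hcd)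
  rw [e, vord_add_of_lt hu.ne_zero (by rw [hu.vord]; exact h), hu.vord]

lemma vord_sub_con_of_pos [HasConst R.toSubring] (h : 0 < vord R f) (hd : d ≠ 0) :
    vord R (f - con d) = 0 := vord_sub_con_of_ne (c := 0) (by simpa using h) hd.symm

end Orders

/-! ### The ten special curves and the orders along them -/

section Special
variable {F : Type} [Field F] [Algebra ℂ F] {R : LocalSubring F} {x y : F} {κ l m a b : ℂ}

/-- The non-degeneracy of the parameters. -/
structure Params (κ l m a b : ℂ) : Prop where
  κ0 : κ ≠ 0
  l0 : l ≠ 0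
  m0 : m ≠ 0
  a0 : a ≠ 0
  b0 : b ≠ 0
  hab : a ≠ b

/-- Coordinates `u, v` such that the curves `u = 0` are the curves at infinity and the eight
exceptional curves. -/
def special (κ l m a b : ℂ) (x y : F) : Fin 10 → F × F
  | 0 => (x⁻¹, y)
  | 1 => (y⁻¹, x)
  | 2 => (x - con a, (y - con a⁻¹) / (x - con a))
  | 3 => (x - con b, (y - con b⁻¹) / (x - con b))
  | 4 => (y⁻¹, x * y)
  | 5 => (x, (x ^ 2 * y)⁻¹)
  | 6 => (x, ((x ^ 2 * y)⁻¹ - con κ) / x)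
  | 7 => (x⁻¹, x * y)
  | 8 => (x⁻¹, x * (x * y - 1 + con m))
  | 9 => (x⁻¹, x * (y - con l))

lemma Coord.special (h : Coord x y) (κ l m a b : ℂ) (j : Fin 10) :
    Coord (special κ l m a b x y j).1 (special κ l m a b x y j).2 := by
  have hx0 := h.left_ne_zero
  have hy0 := h.right_ne_zero
  have haux : ∀ (S : Subfield F) (f : F), f⁻¹ ∈ S → f ∈ S := fun S f hf => by
    simpa using S.inv_mem hf
  have he : ∀ a, Coord (x - con a) ((y - con a⁻¹) / (x - con a)) := by
    intro a
    refine h.change fun S hc hu hv => ?_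
    have h1 : x ∈ S := by simpa using add_mem hu (hc a)
    have h2 : y - con a⁻¹ ∈ S := by
      have := mul_mem hv hu
      rwa [div_mul_cancel₀ _ (h.left_sub_ne_zero a)] at this
    exact ⟨h1, by simpa using add_mem h2 (hc a⁻¹)⟩
  match j with
  | 0 => exact h.change fun S hc (hu : x⁻¹ ∈ S) (hv : y ∈ S) => ⟨haux S x hu, hv⟩
  | 1 => exact h.change fun S hc (hu : y⁻¹ ∈ S) (hv : x ∈ S) => ⟨hv, haux S y hu⟩
  | 2 => exact he a
  | 3 => exact he b
  | 4 =>
    refine h.change fun S hc (hu : y⁻¹ ∈ S) (hv : x * y ∈ S) => ⟨?_, haux S y hu⟩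
    have := mul_mem hv hu
    rwa [mul_inv_cancel_right₀ hy0] at this
  | 5 =>
    refine h.change fun S hc (hu : x ∈ S) (hv : (x ^ 2 * y)⁻¹ ∈ S) => ⟨hu, ?_⟩
    have := mul_mem (haux S _ hv) (inv_mem (pow_mem hu 2))
    rwa [mul_comm, inv_mul_cancel_left₀ (pow_ne_zero 2 hx0)] at this
  | 6 =>
    refine h.change fun S hc (hu : x ∈ S) (hv : ((x ^ 2 * y)⁻¹ - con κ) / x ∈ S) => ⟨hu, ?_⟩
    have h1 := mul_mem hv hu
    rw [div_mul_cancel₀ _ hx0] at h1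
    have h2 : (x ^ 2 * y)⁻¹ ∈ S := by simpa using add_mem h1 (hc κ)
    have := mul_mem (haux S _ h2) (inv_mem (pow_mem hu 2))
    rwa [mul_comm, inv_mul_cancel_left₀ (pow_ne_zero 2 hx0)] at this
  | 7 =>
    refine h.change fun S hc (hu : x⁻¹ ∈ S) (hv : x * y ∈ S) => ⟨haux S x hu, ?_⟩
    have := mul_mem hu hv
    rwa [inv_mul_cancel_left₀ hx0] at this
  | 8 =>
    refine h.change fun S hc (hu : x⁻¹ ∈ S) (hv : x * (x * y - 1 + con m) ∈ S) => ⟨haux S x hu, ?_⟩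
    have h1 := mul_mem hu hv
    rw [inv_mul_cancel_left₀ hx0] at h1
    have h2 := mul_mem hu (add_mem (sub_mem h1 (hc m)) (one_mem S))
    have e : y = x⁻¹ * (x * y - 1 + con m - con m + 1) := by
      rw [add_sub_cancel_right, sub_add_cancel, inv_mul_cancel_left₀ hx0]
    rwa [← e] at h2
  | 9 =>
    refine h.change fun S hc (hu : x⁻¹ ∈ S) (hv : x * (y - con l) ∈ S) => ⟨haux S x hu, ?_⟩
    have h1 := mul_mem hu hv
    rw [inv_mul_cancel_left₀ hx0] at h1
    simpa using add_mem h1 (hc l)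

/-- The multiplicities along a curve of the divisors that represent `H_x, H_y, F_1, …, F_8`. -/
def mult (κ l m a b : ℂ) (x y : F) (R : LocalSubring F) [IsDiscreteValuationRing R.toSubring]
    [IsFractionRing R.toSubring F] : Fin 10 → ℤ
  | 0 => max 0 (-vord R x)
  | 1 => max 0 (-vord R y)
  | 2 => max 0 (min (vord R (x - con a)) (vord R (y - con a⁻¹)))
  | 3 => max 0 (min (vord R (x - con b)) (vord R (y - con b⁻¹)))
  | 4 => max 0 (min (vord R x) (vord R y⁻¹))
  | 5 => max 0 (min (vord R x) (vord R (x * y)⁻¹))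
  | 6 => max 0 (min (vord R x) (vord R ((x ^ 2 * y)⁻¹ - con κ)))
  | 7 => max 0 (min (vord R x⁻¹) (vord R y))
  | 8 => max 0 (min (vord R x⁻¹) (vord R (x * y - 1 + con m)))
  | 9 => max 0 (min (vord R x⁻¹) (vord R (y - con l)))

/-- The multiplicities along the special curves of the divisors that represent
`H_x, H_y, F_1, …, F_8`. -/
def multTable : Fin 10 → Fin 10 → ℤ :=
  -- Rows are classes and columns are curves. A total transform contains all curves infinitely near
  -- to it, whence the ones to the right of the diagonal in the rows of `F_3`, `F_4` and `F_6`; the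
  -- entries 2 are the pole orders of `y` along the last two curves over `(0, ∞)`.
  ![![1, 0, 0, 0, 0, 0, 0, 1, 1, 1], ![0, 1, 0, 0, 1, 2, 2, 0, 0, 0],
    ![0, 0, 1, 0, 0, 0, 0, 0, 0, 0], ![0, 0, 0, 1, 0, 0, 0, 0, 0, 0],
    ![0, 0, 0, 0, 1, 1, 1, 0, 0, 0], ![0, 0, 0, 0, 0, 1, 1, 0, 0, 0],
    ![0, 0, 0, 0, 0, 0, 1, 0, 0, 0], ![0, 0, 0, 0, 0, 0, 0, 1, 1, 0],
    ![0, 0, 0, 0, 0, 0, 0, 0, 1, 0], ![0, 0, 0, 0, 0, 0, 0, 0, 0, 1]]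

/-- Equations of the curves on the intermediate surface that are the images of special curves. -/
def equation (l a b : ℂ) (x y : F) : Fin 8 → F
  | 0 => x
  | 1 => x - con a
  | 2 => x - con b
  | 3 => x * y - 1
  | 4 => y
  | 5 => y - con l
  | 6 => y - con a⁻¹
  | 7 => y - con b⁻¹

/-- The orders of the equations of these curves along the special curves. -/
def orderTable : Fin 8 → Fin 10 → ℤ :=
  ![![-1, 0, 0, 0, 1, 1, 1, -1, -1, -1], ![-1, 0, 1, 0, 0, 0, 0, -1, -1, -1],
    ![-1, 0, 0, 1, 0, 0, 0, -1, -1, -1], ![-1, -1, 1, 1, 0, -1, -1, 0, 0, -1],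
    ![0, -1, 0, 0, -1, -2, -2, 1, 1, 0], ![0, -1, 0, 0, -1, -2, -2, 0, 0, 1],
    ![0, -1, 1, 0, -1, -2, -2, 0, 0, 0], ![0, -1, 0, 1, -1, -2, -2, 0, 0, 0]]

section Table
variable [IsDiscreteValuationRing R.toSubring] [IsFractionRing R.toSubring F]

/-- The statement that the orders along the curve with local ring `R` are those that the tables list
for the `j`-th special curve. -/
structure Listed (κ l m a b : ℂ) (x y : F) (R : LocalSubring F)
    [IsDiscreteValuationRing R.toSubring] [IsFractionRing R.toSubring F] (j : Fin 10) : Prop where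
  mult : ∀ i, mult κ l m a b x y R i = multTable i j
  order : l * a ≠ 1 → l * b ≠ 1 → m ≠ 1 → ∀ i, vord R (equation l a b x y i) = orderTable i j

/-- Bookkeeping that reduces both tables to a few orders. The hypothesis `t'` alone depends on the
genericity of `l` and `m`: the multiplicities of the ten classes do not need it. -/
lemma listed_of (h : Coord x y) {j : Fin 10} {X A B W : ℤ} (hX : vord R x = X)
    (hA : vord R (x - con a) = A) (hB : vord R (x - con b) = B) (hW : vord R (x * y - 1) = W)
    (t0 : X = orderTable 0 j) (t1 : A = orderTable 1 j) (t2 : B = orderTable 2 j)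
    (t3 : W = orderTable 3 j)
    (t' : l * a ≠ 1 → l * b ≠ 1 → m ≠ 1 → vord R y = orderTable 4 j ∧
      vord R (y - con l) = orderTable 5 j ∧ vord R (y - con a⁻¹) = orderTable 6 j ∧
      vord R (y - con b⁻¹) = orderTable 7 j)
    (h0 : max 0 (-X) = multTable 0 j) (h1 : max 0 (-vord R y) = multTable 1 j)
    (h2 : max 0 (min A (vord R (y - con a⁻¹))) = multTable 2 j)
    (h3 : max 0 (min B (vord R (y - con b⁻¹))) = multTable 3 j)
    (h4 : max 0 (min X (-vord R y)) = multTable 4 j)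
    (h5 : max 0 (min X (-(X + vord R y))) = multTable 5 j)
    (h6 : max 0 (min X (vord R ((x ^ 2 * y)⁻¹ - con κ))) = multTable 6 j)
    (h7 : max 0 (min (-X) (vord R y)) = multTable 7 j)
    (h8 : max 0 (min (-X) (vord R (x * y - 1 + con m))) = multTable 8 j)
    (h9 : max 0 (min (-X) (vord R (y - con l))) = multTable 9 j) :
    Listed κ l m a b x y R j := by
  have hx0 := h.left_ne_zero
  have hy0 := h.right_ne_zero
  refine ⟨fun i => ?_, fun hla hlb hm i => ?_⟩
  · match i with
    | 0 => rw [← h0, ← hX]; rfl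
    | 1 => rw [← h1]; rfl
    | 2 => rw [← h2, ← hA]; rfl
    | 3 => rw [← h3, ← hB]; rfl
    | 4 => rw [← h4, ← hX, ← vord_inv hy0]; rfl
    | 5 => rw [← h5, ← hX, ← vord_mul hx0 hy0, ← vord_inv (mul_ne_zero hx0 hy0)]; rfl
    | 6 => rw [← h6, ← hX]; rfl
    | 7 => rw [← h7, ← hX, ← vord_inv hx0]; rfl
    | 8 => rw [← h8, ← hX, ← vord_inv hx0]; rfl
    | 9 => rw [← h9, ← hX, ← vord_inv hx0]; rfl
  · obtain ⟨t4, t5, t6, t7⟩ := t' hla hlb hm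
    match i with
    | 0 => exact hX.trans t0
    | 1 => exact hA.trans t1
    | 2 => exact hB.trans t2
    | 3 => exact hW.trans t3
    | 4 => exact t4
    | 5 => exact t5
    | 6 => exact t6
    | 7 => exact t7

lemma vord_of_curve {u v : F} (h : Curve u v R) (hc : Coord u v) :
    vord R u = 1 ∧ (∀ c, vord R (v - con c) = 0) ∧ vord R v = 0 :=
  ⟨(h.uniformizer hc).vord, fun c => (h.unt hc c).vord, (h.unt_self hc).vord⟩

lemma listed_zero (h : Coord x y) (hR : Curve x⁻¹ y R) : Listed κ l m a b x y R 0 := by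
  have hx0 := h.left_ne_zero
  have hy0 := h.right_ne_zero
  have := hR.gen.const
  obtain ⟨h1, h2, h3⟩ := vord_of_curve hR (h.special κ l m a b 0)
  rw [vord_inv hx0] at h1
  have hX : vord R x = -1 := by omega
  have hc : ∀ c, vord R (x - con c) = -1 := fun c => by rw [vord_sub_con_of_neg (by omega), hX]
  have hw : vord R (x * y) = -1 := by rw [vord_mul hx0 hy0, hX, h3]; rfl
  have hW : ∀ c, vord R (x * y - con c) = -1 := fun c => by
    rw [vord_sub_con_of_neg (by omega), hw]
  have hW1 := hW 1
  have hWm := hW (1 - m)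
  rw [con_sub, con_one, ← sub_add] at hWm
  rw [con_one] at hW1
  have ha := h2 a⁻¹
  have hb := h2 b⁻¹
  have hl := h2 l
  refine listed_of h hX (hc a) (hc b) hW1 rfl rfl rfl rfl (fun _ _ _ => ⟨h3, hl, ha, hb⟩)
    ?_ ?_ ?_ ?_ ?_ ?_ ?_ ?_ ?_ ?_ <;> simp [multTable, -mul_inv_rev, *]

lemma listed_one (h : Coord x y) (hR : Curve y⁻¹ x R) : Listed κ l m a b x y R 1 := by
  have hx0 := h.left_ne_zero
  have hy0 := h.right_ne_zero
  have := hR.gen.const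
  obtain ⟨h1, h2, hX⟩ := vord_of_curve hR (h.special κ l m a b 1)
  rw [vord_inv hy0] at h1
  have hY : vord R y = -1 := by omega
  have hc : ∀ c, vord R (y - con c) = -1 := fun c => by rw [vord_sub_con_of_neg (by omega), hY]
  have hw : vord R (x * y) = -1 := by rw [vord_mul hx0 hy0, hX, hY]; rfl
  have hW1 : vord R (x * y - con 1) = -1 := by rw [vord_sub_con_of_neg (by omega), hw]
  rw [con_one] at hW1
  refine listed_of h hX (h2 a) (h2 b) hW1 rfl rfl rfl rfl
    (fun _ _ _ => ⟨hY, hc _, hc _, hc _⟩) ?_ ?_ ?_ ?_ ?_ ?_ ?_ ?_ ?_ ?_ <;> simp [multTable, -mul_inv_rev, *]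

/-- The orders along the exceptional curve of the blowup of the point `(a, 1 / a)`. -/
lemma vord_of_curve_center (h : Coord x y) (ha : a ≠ 0)
    (hR : Curve (x - con a) ((y - con a⁻¹) / (x - con a)) R) :
    (vord R (x - con a) = 1 ∧ vord R (y - con a⁻¹) = 1 ∧ vord R (x * y - 1) = 1) ∧
      (∀ c, a ≠ c → vord R (x - con c) = 0) ∧ ∀ c, a⁻¹ ≠ c → vord R (y - con c) = 0 := by
  have hx := h.left_sub_ne_zero a
  have hy := h.right_sub_ne_zero a⁻¹
  have := hR.gen.const
  have hc := h.special a a a a a 2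
  obtain ⟨h1, h2, h3⟩ := vord_of_curve hR hc
  have hA := (vord_div hy hx (R := R)).symm.trans h3
  have hY : vord R (y - con a⁻¹) = 1 := by omega
  refine ⟨⟨h1, hY, ?_⟩, fun c hac => vord_sub_con_of_ne (by omega) hac,
    fun c hac => vord_sub_con_of_ne (by omega) hac⟩
  set v := (y - con a⁻¹) / (x - con a) with hv
  -- The curve `x y = 1` passes simply through the base point. The second factor is `a v + 1 / a` on
  -- the exceptional curve; it vanishes only at the tangent direction `v = -1 / a²`, hence not
  -- identically.
  have e : x * y - 1 = (x - con a) * ((x - con a) * v + con a⁻¹ + con a * v) := by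
    have : con a * con a⁻¹ = (1 : F) := by rw [← con_mul, mul_inv_cancel₀ ha, con_one]
    have hm : (x - con a) * v = y - con a⁻¹ := by rw [hv, mul_div_cancel₀ _ hx]
    linear_combination (-x) * hm + this
  have u : Unt R ((x - con a) * v + con a⁻¹ + con a * v) := by
    obtain ⟨_, _⟩ := hR.gen.sub.mem hR.gen.left
    obtain ⟨_, _⟩ := hR.gen.sub.mem hR.gen.right
    have u1 : Unt R (con a * (v - con (-(a⁻¹ * a⁻¹)))) := (Unt.con ha).mul (hR.unt hc _)
    have e1 : con a * (v - con (-(a⁻¹ * a⁻¹))) = con a⁻¹ + con a * v := by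
      have : con a * con (-(a⁻¹ * a⁻¹)) = (-con a⁻¹ : F) := by
        rw [← con_mul, ← con_neg]
        congr 1
        field_simp
      linear_combination -this
    rw [e1] at u1
    have := u1.res
    have hz := hR.van.res
    refine .of_res ?_
    rw [add_assoc, res_add, res_mul, hz, zero_mul, zero_add]
    exact this
  rw [e, vord_mul hx u.ne_zero, h1, u.vord]
  rfl

lemma listed_two (h : Coord x y) (hp : Params κ l m a b)
    (hR : Curve (x - con a) ((y - con a⁻¹) / (x - con a)) R) : Listed κ l m a b x y R 2 := by
  obtain ⟨⟨hA, hY, hW⟩, h1, h2⟩ := vord_of_curve_center h hp.a0 hR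
  have hX : vord R x = 0 := by simpa using h1 0 hp.a0
  have hy : vord R y = 0 := by simpa using h2 0 (inv_ne_zero hp.a0)
  have hB := h1 b hp.hab
  have hb := h2 b⁻¹ (by simpa using hp.hab)
  refine listed_of h hX hA hB hW rfl rfl rfl rfl
    (fun hla _ _ => ⟨hy, h2 l fun e => hla ?_, hY, hb⟩) ?_ ?_ ?_ ?_ ?_ ?_ ?_ ?_ ?_ ?_
  · rw [← e, inv_mul_cancel₀ hp.a0]
  all_goals simp [multTable, -mul_inv_rev, *]

lemma listed_three (h : Coord x y) (hp : Params κ l m a b)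
    (hR : Curve (x - con b) ((y - con b⁻¹) / (x - con b)) R) : Listed κ l m a b x y R 3 := by
  obtain ⟨⟨hB, hY, hW⟩, h1, h2⟩ := vord_of_curve_center h hp.b0 hR
  have hX : vord R x = 0 := by simpa using h1 0 hp.b0
  have hy : vord R y = 0 := by simpa using h2 0 (inv_ne_zero hp.b0)
  have hA := h1 a hp.hab.symm
  have ha := h2 a⁻¹ (by simpa using hp.hab.symm)
  refine listed_of h hX hA hB hW rfl rfl rfl rfl
    (fun _ hlb _ => ⟨hy, h2 l fun e => hlb ?_, ha, hY⟩) ?_ ?_ ?_ ?_ ?_ ?_ ?_ ?_ ?_ ?_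
  · rw [← e, inv_mul_cancel₀ hp.b0]
  all_goals simp [multTable, -mul_inv_rev, *]

lemma listed_four (h : Coord x y) (hp : Params κ l m a b) (hR : Curve y⁻¹ (x * y) R) :
    Listed κ l m a b x y R 4 := by
  have hx0 := h.left_ne_zero
  have hy0 := h.right_ne_zero
  have := hR.gen.const
  obtain ⟨h1, h2, h3⟩ := vord_of_curve hR (h.special κ l m a b 4)
  rw [vord_inv hy0] at h1
  have hY : vord R y = -1 := by omega
  rw [vord_mul hx0 hy0] at h3
  have hX : vord R x = 1 := by omega
  have hc : ∀ c, vord R (y - con c) = -1 := fun c => by rw [vord_sub_con_of_neg (by omega), hY]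
  have hW := h2 1
  rw [con_one] at hW
  have hS : vord R ((x ^ 2 * y)⁻¹ - con κ) = -1 := by
    have : vord R (x ^ 2 * y)⁻¹ = -1 := by
      rw [vord_inv (mul_ne_zero (pow_ne_zero 2 hx0) hy0), vord_mul (pow_ne_zero 2 hx0) hy0,
        vord_pow hx0, hX, hY]
      rfl
    rw [vord_sub_con_of_neg (by omega), this]
  refine listed_of h hX (vord_sub_con_of_pos (by omega) hp.a0)
    (vord_sub_con_of_pos (by omega) hp.b0) hW rfl rfl rfl rfl
    (fun _ _ _ => ⟨hY, hc _, hc _, hc _⟩) ?_ ?_ ?_ ?_ ?_ ?_ ?_ ?_ ?_ ?_ <;> simp [multTable, -mul_inv_rev, *]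

/-- The orders along the last two exceptional curves over `x = 0`. -/
lemma listed_of_order_two (h : Coord x y) (hp : Params κ l m a b) [HasConst R.toSubring]
    (hX : vord R x = 1) (hs : vord R (x ^ 2 * y)⁻¹ = 0) {j : Fin 10}
    (hj : j = 5 ∧ vord R ((x ^ 2 * y)⁻¹ - con κ) = 0 ∨
      j = 6 ∧ vord R ((x ^ 2 * y)⁻¹ - con κ) = 1) :
    Listed κ l m a b x y R j := by
  have hx0 := h.left_ne_zero
  have hy0 := h.right_ne_zero
  rw [vord_inv (mul_ne_zero (pow_ne_zero 2 hx0) hy0), vord_mul (pow_ne_zero 2 hx0) hy0,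
    vord_pow hx0, hX] at hs
  have hY : vord R y = -2 := by
    push_cast at hs
    omega
  have hc : ∀ c, vord R (y - con c) = -2 := fun c => by rw [vord_sub_con_of_neg (by omega), hY]
  have hw : vord R (x * y) = -1 := by rw [vord_mul hx0 hy0, hX, hY]; rfl
  have hW1 : vord R (x * y - con 1) = -1 := by rw [vord_sub_con_of_neg (by omega), hw]
  rw [con_one] at hW1
  rcases hj with ⟨rfl, hS⟩ | ⟨rfl, hS⟩
  all_goals
    refine listed_of h hX (vord_sub_con_of_pos (by omega) hp.a0)
      (vord_sub_con_of_pos (by omega) hp.b0) hW1 rfl rfl rfl rfl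
      (fun _ _ _ => ⟨hY, hc _, hc _, hc _⟩) ?_ ?_ ?_ ?_ ?_ ?_ ?_ ?_ ?_ ?_ <;> simp [multTable, -mul_inv_rev, *]

lemma listed_five (h : Coord x y) (hp : Params κ l m a b) (hR : Curve x (x ^ 2 * y)⁻¹ R) :
    Listed κ l m a b x y R 5 := by
  have := hR.gen.const
  obtain ⟨h1, h2, h3⟩ := vord_of_curve hR (h.special κ l m a b 5)
  exact listed_of_order_two h hp h1 h3 (.inl ⟨rfl, h2 κ⟩)

lemma listed_six (h : Coord x y) (hp : Params κ l m a b)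
    (hR : Curve x (((x ^ 2 * y)⁻¹ - con κ) / x) R) : Listed κ l m a b x y R 6 := by
  have := hR.gen.const
  obtain ⟨h1, h2, h3⟩ := vord_of_curve hR (h.special κ l m a b 6)
  rw [vord_div (h.sq_mul_sub_ne_zero κ) h.left_ne_zero] at h3
  have hS : vord R ((x ^ 2 * y)⁻¹ - con κ) = 1 := by omega
  have := vord_sub_con_of_ne (d := 0) (hS ▸ one_pos) hp.κ0
  rw [con_zero, sub_zero] at this
  exact listed_of_order_two h hp h1 this (.inr ⟨rfl, hS⟩)

lemma listed_seven (h : Coord x y) (hp : Params κ l m a b) (hR : Curve x⁻¹ (x * y) R) :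
    Listed κ l m a b x y R 7 := by
  have hx0 := h.left_ne_zero
  have hy0 := h.right_ne_zero
  have := hR.gen.const
  obtain ⟨h1, h2, h3⟩ := vord_of_curve hR (h.special κ l m a b 7)
  rw [vord_inv hx0] at h1
  have hX : vord R x = -1 := by omega
  have hc : ∀ c, vord R (x - con c) = -1 := fun c => by rw [vord_sub_con_of_neg (by omega), hX]
  rw [vord_mul hx0 hy0] at h3
  have hY : vord R y = 1 := by omega
  have hd : ∀ c, c ≠ 0 → vord R (y - con c) = 0 := fun c =>
    vord_sub_con_of_pos (by omega)
  have hW1 := h2 1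
  have hWm := h2 (1 - m)
  rw [con_sub, con_one, ← sub_add] at hWm
  rw [con_one] at hW1
  have ha := hd a⁻¹ (inv_ne_zero hp.a0)
  have hb := hd b⁻¹ (inv_ne_zero hp.b0)
  have hl := hd l hp.l0
  refine listed_of h hX (hc a) (hc b) hW1 rfl rfl rfl rfl (fun _ _ _ => ⟨hY, hl, ha, hb⟩)
    ?_ ?_ ?_ ?_ ?_ ?_ ?_ ?_ ?_ ?_ <;> simp [multTable, -mul_inv_rev, *]

lemma listed_eight (h : Coord x y) (hp : Params κ l m a b)
    (hR : Curve x⁻¹ (x * (x * y - 1 + con m)) R) : Listed κ l m a b x y R 8 := by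
  have hx0 := h.left_ne_zero
  have hy0 := h.right_ne_zero
  have := hR.gen.const
  obtain ⟨h1, h2, h3⟩ := vord_of_curve hR (h.special κ l m a b 8)
  rw [vord_inv hx0] at h1
  have hX : vord R x = -1 := by omega
  have hc : ∀ c, vord R (x - con c) = -1 := fun c => by rw [vord_sub_con_of_neg (by omega), hX]
  rw [vord_mul hx0 (h.mul_sub_ne_zero m)] at h3
  have hWm : vord R (x * y - 1 + con m) = 1 := by omega
  have hw : ∀ c, 1 - m ≠ c → vord R (x * y - con c) = 0 := fun c hmc =>
    vord_sub_con_of_ne (c := 1 - m) (by rw [con_sub, con_one, ← sub_add]; omega) hmc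
  have hW1 := hw 1 (by simpa using hp.m0)
  rw [con_one] at hW1
  have hm : x * y ∈ R.toSubring := by
    have h4 : x * y - 1 + con m ∈ R.toSubring := (mem_iff_vord (h.mul_sub_ne_zero m)).2 (by omega)
    have h5 := add_mem (sub_mem h4 (HasConst.mem m)) (one_mem R.toSubring)
    simpa using h5
  -- For `m = 1` the order of `y` may exceed one. The multiplicities only involve its minimum with
  -- the order of `1 / x`, which is one, so this inequality is enough for them.
  have hxy := (mem_iff_vord (mul_ne_zero hx0 hy0)).1 hm
  rw [vord_mul hx0 hy0] at hxy
  have hd : ∀ c, c ≠ 0 → vord R (y - con c) = 0 := fun c =>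
    vord_sub_con_of_pos (by omega)
  have ha := hd a⁻¹ (inv_ne_zero hp.a0)
  have hb := hd b⁻¹ (inv_ne_zero hp.b0)
  have hl := hd l hp.l0
  refine listed_of h hX (hc a) (hc b) hW1 rfl rfl rfl rfl
    (fun _ _ hm1 => ⟨?_, hl, ha, hb⟩) ?_ ?_ ?_ ?_ ?_ ?_ ?_ ?_ ?_ ?_
  · have := hw 0 fun e => hm1 (sub_eq_zero.1 e).symm
    rw [con_zero, sub_zero, vord_mul hx0 hy0] at this
    exact (by omega : vord R y = 1)
  all_goals simp [multTable, -mul_inv_rev, *]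
  all_goals omega

lemma listed_nine (h : Coord x y) (hp : Params κ l m a b) (hR : Curve x⁻¹ (x * (y - con l)) R) :
    Listed κ l m a b x y R 9 := by
  have hx0 := h.left_ne_zero
  have hy0 := h.right_ne_zero
  have := hR.gen.const
  obtain ⟨h1, h2, h3⟩ := vord_of_curve hR (h.special κ l m a b 9)
  rw [vord_inv hx0] at h1
  have hX : vord R x = -1 := by omega
  have hc : ∀ c, vord R (x - con c) = -1 := fun c => by rw [vord_sub_con_of_neg (by omega), hX]
  rw [vord_mul hx0 (h.right_sub_ne_zero l)] at h3
  have hl : vord R (y - con l) = 1 := by omega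
  have hd : ∀ c, l ≠ c → vord R (y - con c) = 0 := fun c => vord_sub_con_of_ne (by omega)
  have hY : vord R y = 0 := by simpa using hd 0 hp.l0
  have hw : vord R (x * y) = -1 := by rw [vord_mul hx0 hy0, hX, hY]; rfl
  have hW : ∀ c, vord R (x * y - con c) = -1 := fun c => by
    rw [vord_sub_con_of_neg (by omega), hw]
  have hW1 := hW 1
  have hWm := hW (1 - m)
  rw [con_sub, con_one, ← sub_add] at hWm
  rw [con_one] at hW1
  refine listed_of h hX (hc a) (hc b) hW1 rfl rfl rfl rfl
    (fun hla hlb _ => ⟨hY, hl, hd _ fun e => hla ?_, hd _ fun e => hlb ?_⟩)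
    ?_ ?_ ?_ ?_ ?_ ?_ ?_ ?_ ?_ ?_
  · rw [e, inv_mul_cancel₀ hp.a0]
  · rw [e, inv_mul_cancel₀ hp.b0]
  all_goals simp [multTable, -mul_inv_rev, *]

lemma listed (h : Coord x y) (hp : Params κ l m a b) (j : Fin 10)
    (hR : Curve (special κ l m a b x y j).1 (special κ l m a b x y j).2 R) :
    Listed κ l m a b x y R j :=
  match j with
  | 0 => listed_zero h hR
  | 1 => listed_one h hR
  | 2 => listed_two h hp hR
  | 3 => listed_three h hp hR
  | 4 => listed_four h hp hR
  | 5 => listed_five h hp hR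
  | 6 => listed_six h hp hR
  | 7 => listed_seven h hp hR
  | 8 => listed_eight h hp hR
  | 9 => listed_nine h hp hR

end Table
end Special

/-! ### Classification of the curves on the surface -/

section Classification
variable {F : Type} [Field F] [Algebra ℂ F] {R : LocalSubring F} {x y u v : F} {κ l m a b : ℂ}

/-- The generic point of a curve is not a closed point, so two coordinates do not vanish together
along it. -/
lemma Gen.not_van_of_van (hG : Gen R u v) (hc : Coord u v) (hR : ∃ ϖ, Unif R ϖ) (hu : Van R u) :
    ¬ Van R v :=
  (Curve.unt_self ⟨hG, hu, hR⟩ hc).not_van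

lemma Coord.div_left (h : Coord u (v / u)) (hv : v ≠ 0) : Coord (u / v) v :=
  h.change fun S _ h1 h2 => by
    have h3 := mul_mem h1 h2
    rw [div_mul_cancel₀ _ hv] at h3
    exact ⟨h3, div_mem h2 h3⟩

lemma Coord.inv_left (h : Coord u⁻¹ (u * v)) (hv : v ≠ 0) : Coord (u * v)⁻¹ v :=
  h.change fun S _ h1 h2 => by
    have h3 : u * v ∈ S := by simpa using inv_mem h1
    have h4 := div_mem h3 h2
    rw [mul_div_cancel_right₀ _ hv] at h4
    exact ⟨inv_mem h4, h3⟩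

lemma Gen.curve_of_div (hG : Gen R (u / v) v) (hc : Coord u (v / u)) (hR : ∃ ϖ, Unif R ϖ)
    (hv : Van R v) (hu0 : u ≠ 0) (hv0 : v ≠ 0) : Curve u (v / u) R :=
  (hG.div_van_or hv hu0 hv0).elim
    (fun h => (hG.not_van_of_van (hc.div_left hv0) hR h hv).elim)
    (fun ⟨h1, h2, _⟩ => ⟨h1, h2, hR⟩)

lemma Gen.curve_of_inv (hG : Gen R (u * v)⁻¹ v) (hc : Coord u⁻¹ (u * v)) (hR : ∃ ϖ, Unif R ϖ)
    (hv : Van R v) (hu0 : u ≠ 0) (hv0 : v ≠ 0) : Curve u⁻¹ (u * v) R :=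
  (hG.inv_van_or hv hu0 hv0).elim
    (fun h => (hG.not_van_of_van (hc.inv_left hv0) hR h hv).elim)
    (fun ⟨h1, h2, _⟩ => ⟨h1, h2, hR⟩)

/-- A curve meets the affine plane or is one of the special curves. -/
lemma Pt.gen_or_curve (hR : Pt κ l m a b x y R) (h : Coord x y) (hu : ∃ ϖ, Unif R ϖ) :
    Gen R x y ∨ ∃ j, Curve (special κ l m a b x y j).1 (special κ l m a b x y j).2 R := by
  have hx0 := h.left_ne_zero
  have hy0 := h.right_ne_zero
  have hs := h.special κ l m a b
  cases hR with
  | affine h => exact .inl h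
  | inftyY h hy hx => exact .inr ⟨1, h.swap, hy, hu⟩
  | inftyX h hx hy hy' => exact .inr ⟨0, h, hx, hu⟩
  -- This chart, like `e4'` and `e6'` below, contributes a single closed point and hence no curve.
  | corner hG hx hy =>
    refine absurd hy (hG.not_van_of_van (h.change fun S _ h1 h2 => ?_) hu hx)
    exact ⟨by simpa using inv_mem h1, by simpa using inv_mem h2⟩
  | e1 h hx => exact .inr ⟨2, h, hx, hu⟩
  | e1' hG hy =>
    exact .inr ⟨2, hG.curve_of_div (hs 2) hu hy (h.left_sub_ne_zero a) (h.right_sub_ne_zero _)⟩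
  | e2 h hx => exact .inr ⟨3, h, hx, hu⟩
  | e2' hG hy =>
    exact .inr ⟨3, hG.curve_of_div (hs 3) hu hy (h.left_sub_ne_zero b) (h.right_sub_ne_zero _)⟩
  | e3 h hy => exact .inr ⟨4, h.swap, hy, hu⟩
  | e4 h hx hs => exact .inr ⟨5, h, hx, hu⟩
  | e4' hG ht hz =>
    refine absurd hz (hG.not_van_of_van (h.change fun S _ h1 h2 => ?_) hu ht)
    have h3 := mul_mem h1 h2
    have e : x ^ 2 * y * (x * y)⁻¹ = x := by field_simp
    rw [e] at h3
    have h4 := div_mem h1 (pow_mem h3 2)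
    rw [mul_div_cancel_left₀ _ (pow_ne_zero 2 hx0)] at h4
    exact ⟨h3, h4⟩
  | e5 h hx => exact .inr ⟨6, h, hx, hu⟩
  | e5' hG hS => exact .inr ⟨6, hG.curve_of_div (hs 6) hu hS hx0 (h.sq_mul_sub_ne_zero κ)⟩
  | e6 h hx hw => exact .inr ⟨7, h, hx, hu⟩
  | e6' hG hz hy => exact absurd hy (hG.not_van_of_van ((hs 7).inv_left hy0) hu hz)
  | e7 h hx => exact .inr ⟨8, h, hx, hu⟩
  | e7' hG hw => exact .inr ⟨8, hG.curve_of_inv (hs 8) hu hw hx0 (h.mul_sub_ne_zero m)⟩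
  | e8 h hx => exact .inr ⟨9, h, hx, hu⟩
  | e8' hG hy => exact .inr ⟨9, hG.curve_of_inv (hs 9) hu hy hx0 (h.right_sub_ne_zero l)⟩

lemma Curve.pt (h : Coord x y) {j : Fin 10}
    (hR : Curve (special κ l m a b x y j).1 (special κ l m a b x y j).2 R) :
    Pt κ l m a b x y R := by
  have hu := hR.unt (h.special κ l m a b j)
  have hu' := hR.unt_self (h.special κ l m a b j)
  obtain ⟨hG, hv, -⟩ := hR
  match j with
  | 0 => exact .inftyX hG hv hu' (hu l)
  | 1 => exact .inftyY hG.swap hv hu'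
  | 2 => exact .e1 hG hv
  | 3 => exact .e2 hG hv
  | 4 => exact .e3 hG.swap hv
  | 5 => exact .e4 hG hv (hu κ)
  | 6 => exact .e5 hG hv
  | 7 =>
    refine .e6 hG hv ?_
    have := hu (1 - m)
    rwa [con_sub, con_one, ← sub_add] at this
  | 8 => exact .e7 hG hv
  | 9 => exact .e8 hG hv

/-- A curve in the affine plane does not pass through two given coordinates. -/
lemma Gen.unt_of_van (hG : Gen R x y) (h : Coord x y) (hu : ∃ ϖ, Unif R ϖ) {c : ℂ}
    (hv : Van R (x - con c)) (d : ℂ) : Unt R (y - con d) := by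
  refine Curve.unt (u := x - con c) ⟨hG.change (fun T hT h1 h2 => ?_) (fun T hT h1 h2 => ?_), hv, hu⟩
    (h.change fun S hc h1 h2 => ⟨?_, h2⟩) d
  · exact ⟨sub_mem h1 (hT.const _), h2⟩
  · exact ⟨by simpa using add_mem h1 (hT.const c), h2⟩
  · simpa using add_mem h1 (hc c)

lemma Gen.pt (hG : Gen R x y) (h : Coord x y) (hu : ∃ ϖ, Unif R ϖ) : Pt κ l m a b x y R :=
  .affine hG (fun v => hG.unt_of_van h hu v _) (fun v => hG.unt_of_van h hu v _)

section Mult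
variable [IsDiscreteValuationRing R.toSubring] [IsFractionRing R.toSubring F]

/-- The divisors that represent the ten classes are supported on the special curves. Along a curve
that meets the affine plane `x` and `y` have no poles, and the curve is not a single point such as
`(a, 1 / a)`. -/
lemma Gen.mult_eq_zero (hG : Gen R x y) (h : Coord x y) (i : Fin 10) :
    mult κ l m a b x y R i = 0 := by
  have hu := exists_unif R
  have hx0 := h.left_ne_zero
  have hy0 := h.right_ne_zero
  have := hG.const
  have hX := vord_nonneg hG.left
  have hY := vord_nonneg hG.right
  have hX' := vord_inv (R := R) hx0
  have hY' := vord_inv (R := R) hy0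
  have hxy := vord_inv (R := R) (mul_ne_zero hx0 hy0)
  rw [vord_mul hx0 hy0] at hxy
  have hc : ∀ c, max 0 (Min.min (vord R (x - con c)) (vord R (y - con c⁻¹))) = 0 := by
    intro c
    by_contra hne
    have h1 : 0 < vord R (x - con c) := by omega
    have h2 := (hG.unt_of_van h hu ((van_iff_vord (h.left_sub_ne_zero c)).2 h1) c⁻¹).vord
    omega
  have h6 : max 0 (Min.min (vord R x) (vord R ((x ^ 2 * y)⁻¹ - con κ))) = 0 := by
    by_contra hne
    have h1 : vord R (x ^ 2 * y)⁻¹ = -(2 * vord R x + vord R y) := by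
      rw [vord_inv (mul_ne_zero (pow_ne_zero 2 hx0) hy0), vord_mul (pow_ne_zero 2 hx0) hy0,
        vord_pow hx0]
      rfl
    have := vord_sub_con_of_neg (R := R) (f := (x ^ 2 * y)⁻¹) (by omega) κ
    omega
  match i with
  | 0 => exact max_eq_left (by omega)
  | 1 => exact max_eq_left (by omega)
  | 2 => exact hc a
  | 3 => exact hc b
  | 4 => exact max_eq_left (min_le_iff.2 (.inr (by omega)))
  | 5 => exact max_eq_left (min_le_iff.2 (.inr (by omega)))
  | 6 => exact h6
  | 7 => exact max_eq_left (min_le_iff.2 (.inl (by omega)))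
  | 8 => exact max_eq_left (min_le_iff.2 (.inl (by omega)))
  | 9 => exact max_eq_left (min_le_iff.2 (.inl (by omega)))

end Mult

/-- The curves are told apart by their multiplicities in the ten classes: the columns of `multTable`
are distinct. -/
lemma special_injective (h : Coord x y) (hp : Params κ l m a b) {i j : Fin 10}
    (hi : Curve (special κ l m a b x y i).1 (special κ l m a b x y i).2 R)
    (hj : Curve (special κ l m a b x y j).1 (special κ l m a b x y j).2 R) : i = j := by
  obtain ⟨ϖ, hu⟩ := hi.unif
  have := hu.isDiscreteValuationRing
  have := hu.isFractionRing
  have h1 : ∀ k, multTable k i = multTable k j := fun k =>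
    ((listed h hp i hi).mult k).symm.trans ((listed h hp j hj).mult k)
  clear hi hj
  revert h1
  revert i j
  decide

/-- No column of `multTable` is zero, whereas the multiplicities along a curve that meets the plane
all are. -/
lemma Curve.not_gen (h : Coord x y) (hp : Params κ l m a b) {j : Fin 10}
    (hj : Curve (special κ l m a b x y j).1 (special κ l m a b x y j).2 R) : ¬ Gen R x y := by
  intro hG
  obtain ⟨ϖ, hu⟩ := hj.unif
  have := hu.isDiscreteValuationRing
  have := hu.isFractionRing
  have h1 : ∀ k, multTable k j = 0 := fun k =>
    ((listed h hp j hj).mult k).symm.trans (hG.mult_eq_zero h k)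
  clear hj
  revert h1
  revert j
  decide

end Classification

/-! ### The Picard group is free on the special curves -/

section
variable {S : Model}

lemma PrimeDivisor.ext_ring {P P' : PrimeDivisor S} (h : P.ring = P'.ring) : P = P' := by
  obtain ⟨R, _, _, _⟩ := P
  obtain ⟨R', _, _, _⟩ := P'
  obtain rfl : R = R' := h
  rfl

lemma PrimeDivisor.exists_unif (P : PrimeDivisor S) : ∃ ϖ, Unif P.ring ϖ :=
  QLaguerre.exists_unif P.ring

/-- The prime divisor whose generic point has a given local ring. -/
def PrimeDivisor.of {R : LocalSubring K} (hR : R ∈ S) {ϖ : K} (h : Unif R ϖ) : PrimeDivisor S :=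
  ⟨R, hR, h.isDiscreteValuationRing, h.isFractionRing⟩

/-- Divisors of functions are already closed under sums and negatives, so passing to the generated
subgroup adds nothing. -/
lemma mem_principal {D : Div S} :
    D ∈ principal S ↔ ∃ f : K, f ≠ 0 ∧ ∀ P : PrimeDivisor S, D P = vord P.ring f := by
  constructor
  · intro h
    induction h using AddSubgroup.closure_induction with
    | mem D h => exact h
    | zero => exact ⟨1, one_ne_zero, fun P => by rw [Unt.one.vord]; rfl⟩
    | add D D' _ _ h h' =>
      obtain ⟨f, hf, h⟩ := h
      obtain ⟨g, hg, h'⟩ := h'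
      exact ⟨f * g, mul_ne_zero hf hg, fun P => by rw [vord_mul hf hg, ← h, ← h']; rfl⟩
    | neg D _ h =>
      obtain ⟨f, hf, h⟩ := h
      exact ⟨f⁻¹, inv_ne_zero hf, fun P => by rw [vord_inv hf, ← h]; rfl⟩
  · exact fun h => AddSubgroup.subset_closure h

lemma cls_eq_zero {D : Div S} : cls D = 0 ↔ D ∈ principal S :=
  QuotientAddGroup.eq_zero_iff D

lemma cls_sum {ι : Type} (s : Finset ι) (D : ι → Div S) :
    cls (∑ i ∈ s, D i) = ∑ i ∈ s, cls (D i) := map_sum (QuotientAddGroup.mk' (principal S)) D s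

/-- The class of a curve. -/
def curveClass (P : PrimeDivisor S) : Pic S := cls (Finsupp.single P 1)

/-- The points of the surface `S` are those of the blowup with the given parameters. -/
structure Surf (S : Model) (κ l m a b : ℂ) : Prop where
  params : Params κ l m a b
  mem_iff : ∀ R, R ∈ S ↔ Pt κ l m a b x y R

namespace Surf
variable {κ l m a b : ℂ} (h : Surf S κ l m a b)
include h

lemma exists_curve (j : Fin 10) : ∃ P : PrimeDivisor S,
    Curve (special κ l m a b x y j).1 (special κ l m a b x y j).2 P.ring := by
  obtain ⟨R, hR⟩ := (coord_xy.special κ l m a b j).exists_curve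
  obtain ⟨ϖ, hu⟩ := hR.unif
  exact ⟨.of ((h.mem_iff R).2 (hR.pt coord_xy)) hu, hR⟩

/-- The special curves. -/
def curve (j : Fin 10) : PrimeDivisor S := (h.exists_curve j).choose

lemma curve_spec (j : Fin 10) :
    Curve (special κ l m a b x y j).1 (special κ l m a b x y j).2 (h.curve j).ring :=
  (h.exists_curve j).choose_spec

lemma eq_curve {P : PrimeDivisor S} {j : Fin 10}
    (hP : Curve (special κ l m a b x y j).1 (special κ l m a b x y j).2 P.ring) :
    P = h.curve j :=
  PrimeDivisor.ext_ring (hP.eq (h.curve_spec j) (coord_xy.special κ l m a b j))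

lemma curve_injective : Function.Injective h.curve := fun i j e =>
  special_injective coord_xy h.params (h.curve_spec i) (e ▸ h.curve_spec j)

lemma not_gen_curve (j : Fin 10) : ¬ Gen (h.curve j).ring x y :=
  (h.curve_spec j).not_gen coord_xy h.params

lemma gen_or_curve (P : PrimeDivisor S) : Gen P.ring x y ∨ ∃ j, P = h.curve j :=
  (((h.mem_iff _).1 P.mem).gen_or_curve coord_xy P.exists_unif).imp_right
    fun ⟨j, hj⟩ => ⟨j, h.eq_curve hj⟩

lemma exists_prime {p : MvPolynomial (Fin 2) ℂ} (hp : Prime p) : ∃ P : PrimeDivisor S,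
    Gen P.ring x y ∧ Unif P.ring (ev x y p) ∧ ∀ g, Van P.ring (ev x y g) ↔ p ∣ g := by
  obtain ⟨R, h1, h2, h3⟩ := coord_xy.exists_unif hp
  exact ⟨.of ((h.mem_iff R).2 (h1.pt coord_xy ⟨_, h2⟩)) h2, h1, h2, h3⟩

omit h in
lemma _root_.QLaguerre.PrimeDivisor.eq_of_van {p : MvPolynomial (Fin 2) ℂ} (hp : Prime p)
    {P P' : PrimeDivisor S} (hP : Gen P.ring x y) (hP' : Gen P'.ring x y)
    (hv : Van P.ring (ev x y p)) (hv' : Van P'.ring (ev x y p)) : P = P' := by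
  obtain ⟨ϖ, hu⟩ := P.exists_unif
  obtain ⟨ϖ', hu'⟩ := P'.exists_unif
  exact PrimeDivisor.ext_ring (coord_xy.unique hp hP hu hv hP' hu' hv')

/-- A divisor that agrees with the divisor of a function on the affine plane is linearly equivalent
to a combination of special curves. -/
lemma cls_of_ord (D : Div S) {f : K} (hf : f ≠ 0)
    (hD : ∀ P : PrimeDivisor S, Gen P.ring x y → D P = vord P.ring f) :
    cls D = ∑ j, (D (h.curve j) - vord (h.curve j).ring f) • curveClass (h.curve j) := by
  classical
  have hs : cls (∑ j, (D (h.curve j) - vord (h.curve j).ring f) •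
      Finsupp.single (h.curve j) (1 : ℤ)) =
      ∑ j, (D (h.curve j) - vord (h.curve j).ring f) • curveClass (h.curve j) := cls_sum _ _
  rw [← hs]
  have : D - ∑ j, (D (h.curve j) - vord (h.curve j).ring f) •
      Finsupp.single (h.curve j) (1 : ℤ) ∈ principal S := by
    refine mem_principal.2 ⟨f, hf, fun P => ?_⟩
    rw [Finsupp.sub_apply, Finsupp.finsetSum_apply]
    simp only [Finsupp.smul_apply, Finsupp.single_apply, smul_eq_mul, mul_ite, mul_one, mul_zero]
    rcases h.gen_or_curve P with hG | ⟨i, rfl⟩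
    · rw [Finset.sum_eq_zero, sub_zero, hD P hG]
      rintro j -
      rw [if_neg]
      rintro rfl
      exact h.not_gen_curve j hG
    · rw [Finset.sum_eq_single i, if_pos rfl]
      · ring
      · intro j _ hj
        rw [if_neg fun e => hj (h.curve_injective e)]
      · simp
  exact (QuotientAddGroup.eq_iff_sub_mem).2 this

/-- The support lies in the ten special curves and is finite, so the fallback value of `divisorOf`
is not taken. -/
lemma cls_divisorOf {n : PrimeDivisor S → ℤ}
    (hn : ∀ P : PrimeDivisor S, Gen P.ring x y → n P = 0) :
    cls (divisorOf n) = ∑ j, n (h.curve j) • curveClass (h.curve j) := by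
  have hfin : (Function.support n).Finite := by
    refine (Set.finite_range h.curve).subset fun P hP => ?_
    exact (h.gen_or_curve P).elim (fun hG => (hP (hn P hG)).elim) fun ⟨j, e⟩ => ⟨j, e.symm⟩
  have hD : ∀ P, divisorOf n P = n P := fun P => by
    rw [divisorOf, dif_pos hfin]
    rfl
  have h1 := h.cls_of_ord (divisorOf n) one_ne_zero fun P hG => by
    rw [hD, hn P hG, Unt.one.vord]
  rw [h1]
  refine Finset.sum_congr rfl fun j _ => ?_
  rw [hD, Unt.one.vord, sub_zero]

/-- The class of a curve in the affine plane. -/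
lemma curveClass_eq {P : PrimeDivisor S} (hP : Gen P.ring x y) {f : K} (hf : Unif P.ring f)
    (hmem : ∀ P' : PrimeDivisor S, Gen P'.ring x y → f ∈ P'.ring.toSubring)
    (hv : ∀ P' : PrimeDivisor S, Gen P'.ring x y → Van P'.ring f → P' = P) :
    curveClass P = ∑ j, (-vord (h.curve j).ring f) • curveClass (h.curve j) := by
  classical
  rw [curveClass, h.cls_of_ord _ hf.ne_zero]
  · refine Finset.sum_congr rfl fun j _ => ?_
    rw [Finsupp.single_apply, if_neg, zero_sub]
    rintro rfl
    exact h.not_gen_curve j hP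
  · intro P' hG
    rw [Finsupp.single_apply]
    split_ifs with e
    · subst e
      exact hf.vord.symm
    · exact ((van_or_unt (hmem P' hG)).resolve_left fun v => e (hv P' hG v).symm).vord.symm

/-- A curve that meets the plane has a prime equation `p` there. The divisor of `p` is this curve
plus a combination of special curves, so the curve is equivalent to such a combination. -/
lemma span_curveClass : Submodule.span ℤ (Set.range fun j => curveClass (h.curve j)) = ⊤ := by
  rw [eq_top_iff]
  have h1 : ∀ P : PrimeDivisor S,
      curveClass P ∈ Submodule.span ℤ (Set.range fun j => curveClass (h.curve j)) := by
    intro P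
    rcases h.gen_or_curve P with hG | ⟨j, rfl⟩
    · obtain ⟨ϖ, hu⟩ := P.exists_unif
      obtain ⟨p, hp, hP⟩ := hu.van_ev_iff coord_xy hG
      obtain ⟨P', hG', hu', -⟩ := h.exists_prime hp
      obtain rfl : P = P' := PrimeDivisor.eq_of_van hp hG hG' ((hP p).2 dvd_rfl) hu'.van
      rw [h.curveClass_eq hG hu' (fun P' hG' => hG'.ev_mem p)
        fun P' hG' hv => PrimeDivisor.eq_of_van hp hG' hG hv hu'.van]
      exact Submodule.sum_mem _ fun j _ => Submodule.smul_mem _ _ (Submodule.subset_span ⟨j, rfl⟩)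
    · exact Submodule.subset_span ⟨j, rfl⟩
  rintro ⟨D⟩ -
  change cls D ∈ _
  induction D using Finsupp.induction_linear with
  | zero => exact zero_mem _
  | add D D' hD hD' => exact add_mem hD hD'
  | single P n =>
    have : Finsupp.single P n = n • Finsupp.single P (1 : ℤ) := by simp
    rw [this]
    exact Submodule.smul_mem _ n (h1 P)

/-- By induction on the prime factors of `p`: each of them defines a curve along which `q` vanishes
as well, so it divides `q` and can be cancelled. -/
lemma associated_of_ord {p : MvPolynomial (Fin 2) ℂ} (hp : p ≠ 0) :
    ∀ {q : MvPolynomial (Fin 2) ℂ}, q ≠ 0 → (∀ P : PrimeDivisor S, Gen P.ring x y →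
      vord P.ring (ev x y p) = vord P.ring (ev x y q)) → Associated p q := by
  revert hp
  induction p using UniqueFactorizationMonoid.induction_on_prime with
  | h₁ => exact fun h0 => absurd rfl h0
  | h₂ p hp =>
    intro _ q hq hpq
    refine (associated_one_iff_isUnit.2 hp).trans (associated_one_iff_isUnit.2 ?_).symm
    by_contra hq'
    obtain ⟨r, hr, hrq⟩ := WfDvdMonoid.exists_irreducible_factor hq' hq
    obtain ⟨P, hG, hu, hP⟩ := h.exists_prime hr.prime
    have h1 := (van_iff_vord (coord_xy.ev_ne_zero hq)).1 ((hP q).2 hrq)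
    rw [← hpq P hG, ← van_iff_vord (coord_xy.ev_ne_zero hp.ne_zero), hP] at h1
    exact hr.not_isUnit (isUnit_of_dvd_unit h1 hp)
  | h₃ p r hp hr ih =>
    intro _ q hq hpq
    obtain ⟨P, hG, hu, hP⟩ := h.exists_prime hr
    have h1 := (van_iff_vord (coord_xy.ev_ne_zero (mul_ne_zero hr.ne_zero hp))).1
      ((hP _).2 (dvd_mul_right r p))
    rw [hpq P hG, ← van_iff_vord (coord_xy.ev_ne_zero hq), hP] at h1
    obtain ⟨q, rfl⟩ := h1
    have hq' := right_ne_zero_of_mul hq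
    refine Associated.mul_left r (ih hp hq' fun P' hG' => ?_)
    have h2 := hpq P' hG'
    rw [map_mul, map_mul, vord_mul (coord_xy.ev_ne_zero hr.ne_zero) (coord_xy.ev_ne_zero hp),
      vord_mul (coord_xy.ev_ne_zero hr.ne_zero) (coord_xy.ev_ne_zero hq')] at h2
    exact add_left_cancel h2

/-- A function without zeros and poles in the affine plane is constant. -/
lemma eq_con_of_ord {f : K} (hf : f ≠ 0)
    (h0 : ∀ P : PrimeDivisor S, Gen P.ring x y → vord P.ring f = 0) : ∃ c ≠ 0, f = con c := by
  obtain ⟨p, q, hq, rfl⟩ := coord_xy.frac f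
  have hp : p ≠ 0 := by
    rintro rfl
    simp at hf
  obtain ⟨w, rfl⟩ := h.associated_of_ord hq hp fun P hG => by
    have := h0 P hG
    rw [vord_div (coord_xy.ev_ne_zero hp) (coord_xy.ev_ne_zero hq)] at this
    exact (sub_eq_zero.1 this).symm
  obtain ⟨c, hc, hw⟩ := MvPolynomial.isUnit_iff_eq_C_of_isReduced.1 w.isUnit
  refine ⟨c, hc.ne_zero, ?_⟩
  rw [hw, map_mul, ev_C, mul_div_cancel_left₀ _ (coord_xy.ev_ne_zero hq)]

/-- A relation is the divisor of a function without zeros or poles in the plane. Such a function is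
constant, so all coefficients are zero. -/
lemma linearIndependent_curveClass : LinearIndependent ℤ fun j => curveClass (h.curve j) := by
  classical
  rw [Fintype.linearIndependent_iff]
  intro n hn i
  have h1 : cls (∑ j, n j • Finsupp.single (h.curve j) (1 : ℤ)) = 0 := (cls_sum _ _).trans hn
  obtain ⟨f, hf, hP⟩ := mem_principal.1 (cls_eq_zero.1 h1)
  simp only [Finsupp.finsetSum_apply, Finsupp.smul_apply, Finsupp.single_apply, smul_eq_mul,
    mul_ite, mul_one, mul_zero] at hP
  obtain ⟨c, hc, rfl⟩ := h.eq_con_of_ord hf fun P hG => by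
    rw [← hP, Finset.sum_eq_zero]
    rintro j -
    rw [if_neg]
    rintro rfl
    exact h.not_gen_curve j hG
  have := (h.curve_spec i).gen.const
  have h2 := hP (h.curve i)
  rw [(Unt.con hc).vord, Finset.sum_eq_single i, if_pos rfl] at h2
  · exact h2
  · intro j _ hj
    rw [if_neg fun e => hj (h.curve_injective e)]
  · simp

end Surf

end

lemma mapRing_symm' {F : Type} [Field F] [Algebra ℂ F] {φ : F ≃ₐ[ℂ] F} (R : LocalSubring F) :
    mapRing φ.symm (mapRing φ R) = R := mapRing_symm (φ := φ.symm) R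

/-! ### Isomorphisms of surfaces and pushforward of divisor classes -/

section Push
variable {S S' S'' : Model} {φ : K ≃ₐ[ℂ] K}

lemma isIsomorphism_of (h : ∀ R ∈ S', mapRing φ R ∈ S) (h' : ∀ R ∈ S, mapRing φ.symm R ∈ S') :
    IsIsomorphism S S' φ := by
  ext R
  constructor
  · rintro ⟨R', hR', rfl⟩
    exact h R' hR'
  · exact fun hR => ⟨_, h' R hR, mapRing_symm R⟩

lemma IsIsomorphism.mapRing_mem (h : IsIsomorphism S S' φ) {R : LocalSubring K} (hR : R ∈ S') :
    mapRing φ R ∈ S := by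
  rw [← show _ = S from h]
  exact ⟨R, hR, rfl⟩

lemma IsIsomorphism.mapRing_symm_mem (h : IsIsomorphism S S' φ) {R : LocalSubring K}
    (hR : R ∈ S) : mapRing φ.symm R ∈ S' := by
  rw [← show _ = S from h] at hR
  obtain ⟨R', hR', rfl⟩ := hR
  change mapRing φ.symm (mapRing φ R') ∈ S'
  rwa [mapRing_symm']

/-- The bijection between the prime divisors of isomorphic surfaces. -/
def IsIsomorphism.equiv (h : IsIsomorphism S S' φ) : PrimeDivisor S ≃ PrimeDivisor S' where
  toFun P := .of (h.mapRing_symm_mem P.mem) P.exists_unif.choose_spec.map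
  invFun P := .of (h.mapRing_mem P.mem) P.exists_unif.choose_spec.map
  left_inv P := PrimeDivisor.ext_ring (mapRing_symm P.ring)
  right_inv P := PrimeDivisor.ext_ring (mapRing_symm' P.ring)

lemma IsIsomorphism.mapRing_equiv (h : IsIsomorphism S S' φ) (P : PrimeDivisor S) :
    mapRing φ (h.equiv P).ring = P.ring := mapRing_symm P.ring

lemma vord_of_mapRing {P : PrimeDivisor S} {P' : PrimeDivisor S'}
    (h : mapRing φ P'.ring = P.ring) (f : K) : vord P.ring (φ f) = vord P'.ring f := by
  obtain ⟨R, hR, h1, h2⟩ := P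
  obtain rfl : mapRing φ P'.ring = R := h
  exact vord_map f

/-- The isomorphism of divisor groups. -/
def IsIsomorphism.divEquiv (h : IsIsomorphism S S' φ) : Div S ≃+ Div S' :=
  Finsupp.domCongr h.equiv

lemma IsIsomorphism.divEquiv_apply (h : IsIsomorphism S S' φ) (D : Div S) (P : PrimeDivisor S) :
    h.divEquiv D (h.equiv P) = D P := by
  simp [divEquiv, Finsupp.domCongr, Finsupp.equivMapDomain_apply]

lemma IsIsomorphism.map_principal (h : IsIsomorphism S S' φ) :
    (principal S).map (h.divEquiv : Div S →+ Div S') = principal S' := by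
  ext D'
  obtain ⟨D, rfl⟩ := h.divEquiv.surjective D'
  have h1 : h.divEquiv D ∈ (principal S).map (h.divEquiv : Div S →+ Div S') ↔ D ∈ principal S :=
    AddSubgroup.mem_map_iff_mem (f := (h.divEquiv : Div S →+ Div S')) h.divEquiv.injective
  rw [h1, mem_principal, mem_principal]
  constructor
  · rintro ⟨f, hf, hD⟩
    refine ⟨φ.symm f, (map_ne_zero φ.symm).2 hf, fun P' => ?_⟩
    obtain ⟨P, rfl⟩ := h.equiv.surjective P'
    rw [h.divEquiv_apply, hD, ← vord_of_mapRing (h.mapRing_equiv P), φ.apply_symm_apply]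
  · rintro ⟨f, hf, hD⟩
    refine ⟨φ f, (map_ne_zero φ).2 hf, fun P => ?_⟩
    rw [← h.divEquiv_apply, hD, vord_of_mapRing (h.mapRing_equiv P)]

/-- The pushforward of divisor classes. -/
def IsIsomorphism.pic (h : IsIsomorphism S S' φ) : Pic S ≃ₗ[ℤ] Pic S' :=
  (QuotientAddGroup.congr _ _ h.divEquiv h.map_principal).toIntLinearEquiv

lemma IsIsomorphism.pic_curveClass (h : IsIsomorphism S S' φ) (P : PrimeDivisor S) :
    h.pic (curveClass P) = curveClass (h.equiv P) := by
  have : h.pic (curveClass P) = cls (h.divEquiv (Finsupp.single P 1)) := rfl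
  rw [this, curveClass]
  congr 1
  exact Finsupp.equivMapDomain_single _ _ _

lemma IsIsomorphism.isPushforward (h : IsIsomorphism S S' φ) : IsPushforward φ h.pic :=
  fun P => ⟨h.equiv P, h.mapRing_equiv P, h.pic_curveClass P⟩

lemma mapRing_injective : Function.Injective (mapRing φ) :=
  Function.LeftInverse.injective (g := mapRing φ.symm) fun R => mapRing_symm' R

/-- The image curve is determined by its local ring, so the curve provided by the definition is the
given one. -/
lemma IsPushforward.apply {Φ : Pic S ≃ₗ[ℤ] Pic S'} (h : IsPushforward φ Φ) {P : PrimeDivisor S}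
    {P' : PrimeDivisor S'} (hP : mapRing φ P'.ring = P.ring) :
    Φ (curveClass P) = curveClass P' := by
  obtain ⟨P'', h1, h2⟩ := h P
  obtain rfl : P'' = P' := PrimeDivisor.ext_ring (mapRing_injective (h1.trans hP.symm))
  exact h2

lemma IsPushforward.trans {ψ : K ≃ₐ[ℂ] K} {Φ : Pic S ≃ₗ[ℤ] Pic S'} {Ψ : Pic S' ≃ₗ[ℤ] Pic S''}
    (h : IsPushforward φ Φ) (h' : IsPushforward ψ Ψ) :
    IsPushforward (ψ.trans φ) (Φ.trans Ψ) := by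
  intro P
  obtain ⟨P', h1, h2⟩ := h P
  obtain ⟨P'', h3, h4⟩ := h' P'
  refine ⟨P'', ?_, ?_⟩
  · change mapRing (ψ.trans φ) P''.ring = P.ring
    rw [mapRing_trans, show mapRing ψ P''.ring = _ from h3]
    exact h1
  · rw [LinearEquiv.trans_apply, h2, h4]

lemma IsIsomorphism.symm (h : IsIsomorphism S S' φ) : IsIsomorphism S' S φ.symm :=
  isIsomorphism_of (fun _ => h.mapRing_symm_mem) fun _ => h.mapRing_mem

lemma IsIsomorphism.trans {ψ : K ≃ₐ[ℂ] K} (h : IsIsomorphism S S' φ)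
    (h' : IsIsomorphism S' S'' ψ) : IsIsomorphism S S'' (ψ.trans φ) :=
  isIsomorphism_of
    (fun R hR => by rw [mapRing_trans]; exact h.mapRing_mem (h'.mapRing_mem hR))
    (fun R hR => by
      rw [show (ψ.trans φ).symm = φ.symm.trans ψ.symm from rfl, mapRing_trans]
      exact h'.mapRing_symm_mem (h.mapRing_symm_mem hR))

lemma IsPushforward.symm {Φ : Pic S ≃ₗ[ℤ] Pic S'} (h : IsPushforward φ Φ)
    (hI : IsIsomorphism S S' φ) : IsPushforward φ.symm Φ.symm := by
  intro P'
  obtain ⟨P, rfl⟩ := hI.equiv.surjective P'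
  refine ⟨P, ?_, ?_⟩
  · rw [← hI.mapRing_equiv P]
    exact mapRing_symm' _
  · rw [LinearEquiv.symm_apply_eq]
    exact (h.apply (hI.mapRing_equiv P)).symm

end Push

section Automorphism

/-- The automorphism of `K` given by coordinates. -/
lemma Coord.exists_algEquiv {u v : K} (h : Coord u v) : ∃ φ : K ≃ₐ[ℂ] K, φ x = u ∧ φ y = v := by
  let φ : K →ₐ[ℂ] K := IsFractionRing.liftAlgHom (R := ℂ) (A := MvPolynomial (Fin 2) ℂ) h.inj
  have hφ : ∀ p, φ (algebraMap _ K p) = ev u v p := fun p => IsFractionRing.lift_algebraMap h.inj p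
  have hs : Function.Surjective φ := fun f => by
    obtain ⟨p, q, hq, rfl⟩ := h.frac f
    exact ⟨algebraMap _ K p / algebraMap _ K q, by rw [map_div₀, hφ, hφ]⟩
  refine ⟨AlgEquiv.ofBijective φ ⟨φ.injective, hs⟩, ?_, ?_⟩
  · exact (hφ _).trans ev_X_zero
  · exact (hφ _).trans ev_X_one

end Automorphism

/-! ### Images of the special curves under the half-steps -/

section Image
variable {F : Type} [Field F] [Algebra ℂ F] {R : LocalSubring F} {x X y Y : F}
  {C κ K l m L M a b : ℂ}

/-- `R` is the local ring of a special curve, or of the curve in the affine plane with one of the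
eight equations. -/
def OnCurve (κ l m a b : ℂ) (x y : F) (R : LocalSubring F) : Fin 10 ⊕ Fin 8 → Prop
  | .inl j => Curve (special κ l m a b x y j).1 (special κ l m a b x y j).2 R
  | .inr i => Gen R x y ∧ Van R (equation l a b x y i)

/-- The images of the special curves under the forward half-step. -/
def forwardImage : Fin 10 → Fin 10 ⊕ Fin 8 :=
  ![.inl 7, .inr 3, .inr 1, .inr 2, .inl 5, .inl 4, .inr 0, .inl 0, .inl 9, .inl 8]

/-- The images of the special curves under the backward half-step. -/
def backwardImage : Fin 10 → Fin 10 ⊕ Fin 8 :=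
  ![.inr 3, .inl 4, .inr 6, .inr 7, .inl 1, .inl 5, .inl 6, .inl 7, .inr 4, .inr 5]

/-- The generic point of the exceptional curve avoids two directions: the horizontal one, `v = 0`,
and the tangent of `x y = 1`, `v = -1 / a²`. -/
lemma Curve.unt_add (hc : Coord x y)
    (hR : Curve (x - con a) ((y - con a⁻¹) / (x - con a)) R) (ha : a ≠ 0) :
    Unt R ((y - con a⁻¹) / (x - con a)) ∧
      Unt R (con a * ((y - con a⁻¹) / (x - con a)) + con a⁻¹) := by
  have h := hc.special a a a a a 2
  refine ⟨hR.unt_self h, ?_⟩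
  have hk := hR.gen.const
  have u : Unt R (con a * ((y - con a⁻¹) / (x - con a) - con (-(a⁻¹ * a⁻¹)))) :=
    (Unt.con ha).mul (hR.unt h _)
  have e : con a * con (-(a⁻¹ * a⁻¹)) = (-con a⁻¹ : F) := by
    rw [← con_mul, ← con_neg]
    congr 1
    field_simp
  rwa [mul_sub, e, sub_neg_eq_add] at u

lemma Flip1.affine_of_curve (h : Flip1 C κ l m L M a b x y Y) (hc : Coord x y) (ha : a ≠ 0)
    (hR : Curve (x - con a) ((y - con a⁻¹) / (x - con a)) R) :
    Gen R x Y ∧ Van R (x - con a) := by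
  obtain ⟨-, u⟩ := hR.unt_add hc ha
  obtain ⟨hG, hv, hu⟩ := hR
  have hk := hG.const
  obtain ⟨_, _⟩ := hG.sub.mem hG.right
  obtain ⟨_, _⟩ := hG.sub.mem hG.left
  have u' : Unt R (x * ((y - con a⁻¹) / (x - con a)) + con a⁻¹) := by
    have e : x * ((y - con a⁻¹) / (x - con a)) + con a⁻¹ =
        (x - con a) * ((y - con a⁻¹) / (x - con a)) +
          (con a * ((y - con a⁻¹) / (x - con a)) + con a⁻¹) := by ring
    rw [e]
    refine .of_res ?_
    rw [res_add, res_mul, hv.res, zero_mul, zero_add]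
    exact u.res
  obtain ⟨-, -, h3⟩ := h.symm.affine_of_e1 hG.sub hG.left hG.right hv u'
  refine ⟨hG.change (fun T hT p q => ?_) (fun T hT p q => ⟨sub_mem p (hT.const a), ?_⟩), hv⟩
  · obtain ⟨h1, h2, h3⟩ := h.symm.affine_of_e1 hT p q hv u'
    exact ⟨h1, h2⟩
  · exact (h.e1_of_affine hT p q hv h3).1

/-- At the generic point of a special curve the second coordinate differs from every constant. All
side conditions of the changes of chart hold there, and the charts reveal the image curve. -/
lemma Flip1.onCurve (h : Flip1 C κ l m L M a b x y Y) (hc : Coord x y) (ha : a ≠ 0) (hb : b ≠ 0)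
    {j : Fin 10} (hR : Curve (special κ l m a b x y j).1 (special κ l m a b x y j).2 R) :
    OnCurve κ L M a b x Y R (forwardImage j) := by
  have hu := hR.unt (hc.special κ l m a b j)
  have hu' := hR.unt_self (hc.special κ l m a b j)
  match j with
  | 2 => exact h.affine_of_curve hc ha hR
  | 3 => exact h.swap.affine_of_curve hc hb hR
  | 0 =>
    obtain ⟨hG, hv, hU⟩ := hR
    exact ⟨(h.symm.e6_of_inftyX_gen hG hv hu' (hu l)).1, hv, hU⟩
  | 1 =>
    obtain ⟨hG, hv, hU⟩ := hR
    have hG' := hG.swap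
    have h1 := h.symm.affine_of_inftyY hG'.sub hG'.left hG'.right hu' hv
    exact ⟨hG'.change (fun T hT p q => ⟨p, (h.symm.affine_of_inftyY hT p q hu' hv).1⟩)
      (fun T hT p q => ⟨p, (h.inftyY_of_affine hT p q (hu a) (hu b) h1.2).1⟩), h1.2⟩
  | 4 =>
    obtain ⟨hG, hv, hU⟩ := hR
    obtain ⟨h1, h2, -⟩ := h.symm.e4_of_e3_gen hG.swap hv hu'
    exact ⟨h1, h2, hU⟩
  | 5 =>
    obtain ⟨hG, hv, hU⟩ := hR
    obtain ⟨h1, h2⟩ := h.symm.e3_of_e4_gen hG hv (hu κ)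
    exact ⟨h1.swap, h2, hU⟩
  | 6 =>
    obtain ⟨hG, hv, hU⟩ := hR
    exact ⟨h.symm.affine_of_e5_gen hG hv, hv⟩
  | 7 =>
    obtain ⟨hG, hv, hU⟩ := hR
    have h1 := hu 1
    have h2 := hu (1 - m)
    rw [con_sub, con_one, ← sub_add] at h2
    rw [con_one] at h1
    exact ⟨(h.symm.inftyX_of_e6_gen hG hv h1 h2).1, hv, hU⟩
  | 8 =>
    obtain ⟨hG, hv, hU⟩ := hR
    exact ⟨h.symm.e8_of_e7_gen hG hv, hv, hU⟩
  | 9 =>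
    obtain ⟨hG, hv, hU⟩ := hR
    exact ⟨h.symm.e7_of_e8_gen hG hv, hv, hU⟩

lemma Flip2.affine_of_curve (h : Flip2 κ K l m a b x X y) (hc : Coord x y) (ha : a ≠ 0)
    (hR : Curve (x - con a) ((y - con a⁻¹) / (x - con a)) R) :
    Gen R X y ∧ Van R (y - con a⁻¹) := by
  obtain ⟨uv, u⟩ := hR.unt_add hc ha
  obtain ⟨hG, hv, hu⟩ := hR
  have hk := hG.const
  obtain ⟨_, _⟩ := hG.sub.mem hG.right
  obtain ⟨_, _⟩ := hG.sub.mem hG.left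
  have hy : Van R (y - con a⁻¹) := by
    have := hv.mul_mem uv.mem
    rwa [mul_div_cancel₀ _ h.xa] at this
  have hG' : Gen R ((x - con a) / (y - con a⁻¹)) (y - con a⁻¹) := by
    refine hG.change (fun T hT p q => ?_) (fun T hT p q => ?_)
    · have h1 := mul_mem p q
      rw [mul_div_cancel₀ _ h.xa] at h1
      exact ⟨by simpa using hT.inv _ q uv.inv_mem, h1⟩
    · have h1 := mul_mem p q
      rw [div_mul_cancel₀ _ h.ya] at h1
      exact ⟨h1, by simpa using hT.inv _ p (by simpa using uv.mem)⟩
  have u' : Unt R (y * ((x - con a) / (y - con a⁻¹)) + con a) := by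
    have hz : (x - con a) / (y - con a⁻¹) * ((y - con a⁻¹) / (x - con a)) = 1 :=
      (div_mul_div_cancel₀ h.ya).trans (div_self h.xa)
    have hw : (x - con a) / (y - con a⁻¹) * (y - con a⁻¹) = x - con a := div_mul_cancel₀ _ h.ya
    have e : y * ((x - con a) / (y - con a⁻¹)) + con a = (x - con a) +
        (x - con a) / (y - con a⁻¹) *
          (con a * ((y - con a⁻¹) / (x - con a)) + con a⁻¹) := by
      linear_combination hw - con a * hz
    obtain ⟨_, _⟩ := hG'.sub.mem hG'.left
    rw [e]
    refine .of_res ?_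
    rw [res_add, hv.res, zero_add]
    have uv' : Unt R ((x - con a) / (y - con a⁻¹)) := by simpa using uv.inv
    exact (uv'.mul u).res
  exact ⟨(h.symm.affine_of_e1'_gen hG' hy u').1, hy⟩

lemma Flip2.onCurve (h : Flip2 κ K l m a b x X y) (hc : Coord x y) (ha : a ≠ 0) (hb : b ≠ 0)
    {j : Fin 10} (hR : Curve (special κ l m a b x y j).1 (special κ l m a b x y j).2 R) :
    OnCurve K l m a b X y R (backwardImage j) := by
  have hu := hR.unt (hc.special κ l m a b j)
  have hu' := hR.unt_self (hc.special κ l m a b j)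
  match j with
  | 2 => exact h.affine_of_curve hc ha hR
  | 3 => exact h.swap.affine_of_curve hc hb hR
  | 0 =>
    obtain ⟨hG, hv, hU⟩ := hR
    exact h.symm.affine_of_inftyX_gen hG hv hu' (hu l) (hu _) (hu _)
  | 1 =>
    obtain ⟨hG, hv, hU⟩ := hR
    exact ⟨(h.symm.e3_of_inftyY_gen hG.swap hv hu').swap, hv, hU⟩
  | 4 =>
    obtain ⟨hG, hv, hU⟩ := hR
    have h1 := hu 1
    rw [con_one] at h1
    exact ⟨(h.symm.inftyY_of_e3_gen hG.swap hv h1).1.swap, hv, hU⟩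
  | 5 =>
    obtain ⟨hG, hv, hU⟩ := hR
    obtain ⟨h1, h2, -⟩ := h.symm.e4_of_e4_gen hG hv hu' (hu κ)
    exact ⟨h1, h2, hU⟩
  | 6 =>
    obtain ⟨hG, hv, hU⟩ := hR
    obtain ⟨h1, h2⟩ := h.symm.e5_of_e5_gen hG hv
    exact ⟨h1, h2, hU⟩
  | 7 =>
    obtain ⟨hG, hv, hU⟩ := hR
    have h1 := hu 1
    have h2 := hu (1 - m)
    rw [con_sub, con_one, ← sub_add] at h2
    rw [con_one] at h1
    obtain ⟨h3, h4, -⟩ := h.symm.e6_of_e6_gen hG hv h1 h2 hu'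
    exact ⟨h3, h4, hU⟩
  | 8 =>
    obtain ⟨hG, hv, hU⟩ := hR
    exact h.symm.affine_of_e7_gen hG hv
  | 9 =>
    obtain ⟨hG, hv, hU⟩ := hR
    obtain ⟨h1, h2, -⟩ := h.symm.affine_of_e8_gen hG hv hu'
    exact ⟨h1, h2⟩

/-- The second coordinate in charts where the first is one of the eight equations. -/
def equation' (x y : F) : Fin 8 → F
  | 0 | 1 | 2 => y
  | 3 | 4 | 5 | 6 | 7 => x

lemma Coord.equation (h : Coord x y) (l a b : ℂ) (i : Fin 8) :
    Coord (equation l a b x y i) (equation' x y i) := by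
  have hx : ∀ c, Coord (x - con c) y := fun c =>
    h.change fun S hc h1 h2 => ⟨by simpa using add_mem h1 (hc c), h2⟩
  have hy : ∀ c, Coord (y - con c) x := fun c =>
    h.change fun S hc h1 h2 => ⟨h2, by simpa using add_mem h1 (hc c)⟩
  match i with
  | 0 => exact h
  | 1 => exact hx a
  | 2 => exact hx b
  | 3 =>
    refine h.change fun S hc (h1 : x * y - 1 ∈ S) (h2 : x ∈ S) => ⟨h2, ?_⟩
    have h3 : x * y ∈ S := by simpa using add_mem h1 (one_mem S)
    have := div_mem h3 h2
    rwa [mul_div_cancel_left₀ _ h.left_ne_zero] at this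
  | 4 =>
    have := hy 0
    rw [con_zero, sub_zero] at this
    exact this
  | 5 => exact hy l
  | 6 => exact hy a⁻¹
  | 7 => exact hy b⁻¹

lemma Gen.curve_equation (hG : Gen R x y) (hU : ∃ ϖ, Unif R ϖ) {i : Fin 8}
    (hv : Van R (equation l a b x y i)) : Curve (equation l a b x y i) (equation' x y i) R := by
  refine ⟨?_, hv, hU⟩
  have hx : ∀ c, Gen R (x - con c) y := fun c => hG.change
    (fun T hT h1 h2 => ⟨sub_mem h1 (hT.const c), h2⟩)
    (fun T hT h1 h2 => ⟨by simpa using add_mem h1 (hT.const c), h2⟩)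
  have hy : ∀ c, Gen R (y - con c) x := fun c => hG.change
    (fun T hT h1 h2 => ⟨sub_mem h2 (hT.const c), h1⟩)
    (fun T hT h1 h2 => ⟨h2, by simpa using add_mem h1 (hT.const c)⟩)
  match i with
  | 0 => exact hG
  | 1 => exact hx a
  | 2 => exact hx b
  | 3 =>
    obtain ⟨_, _⟩ := hG.sub.mem hG.left
    -- On `x y = 1` the function `x` is invertible, so `y` is recovered from `x y - 1` and `x`.
    obtain ⟨_, _⟩ := hG.sub.mem hG.right
    have ux : Unt R x := by
      have hv' : Van R (x * y - 1) := hv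
      refine .of_res fun h0 => ?_
      have := hv'.res
      simp [h0] at this
    refine hG.change (fun T hT h1 h2 => ⟨sub_mem (mul_mem h1 h2) (one_mem T), h1⟩)
      (fun T hT h1 h2 => ⟨h2, ?_⟩)
    have h3 : x * y ∈ T := by
      have h1' : x * y - 1 ∈ T := h1
      simpa using add_mem h1' (one_mem T)
    have := mul_mem (hT.inv x h2 ux.inv_mem) h3
    rwa [inv_mul_cancel_left₀ ux.ne_zero] at this
  | 4 =>
    have := hy 0
    rw [con_zero, sub_zero] at this
    exact this
  | 5 => exact hy l
  | 6 => exact hy a⁻¹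
  | 7 => exact hy b⁻¹

lemma Gen.equation_mem (hG : Gen R x y) (i : Fin 8) : equation l a b x y i ∈ R.toSubring := by
  have := hG.const
  obtain ⟨_, _⟩ := hG.sub.mem hG.left
  obtain ⟨_, _⟩ := hG.sub.mem hG.right
  match i with
  | 0 => exact hG.left
  | 1 => exact (Mem.mem : x - con a ∈ R.toSubring)
  | 2 => exact (Mem.mem : x - con b ∈ R.toSubring)
  | 3 => exact (Mem.mem : x * y - 1 ∈ R.toSubring)
  | 4 => exact hG.right
  | 5 => exact (Mem.mem : y - con l ∈ R.toSubring)
  | 6 => exact (Mem.mem : y - con a⁻¹ ∈ R.toSubring)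
  | 7 => exact (Mem.mem : y - con b⁻¹ ∈ R.toSubring)

variable {φ : F ≃ₐ[ℂ] F}

lemma map_special (j : Fin 10) :
    (φ (special κ l m a b x y j).1, φ (special κ l m a b x y j).2) =
      special κ l m a b (φ x) (φ y) j := by
  fin_cases j <;> simp [special, map_con]

lemma map_equation (i : Fin 8) : φ (equation l a b x y i) = equation l a b (φ x) (φ y) i := by
  fin_cases i <;> simp [equation, map_con]

lemma OnCurve.map (t : Fin 10 ⊕ Fin 8) (h : OnCurve κ l m a b x y R t) :
    OnCurve κ l m a b (φ x) (φ y) (mapRing φ R) t := by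
  match t with
  | .inl j =>
    have h1 := Curve.map (φ := φ) h
    have h2 := map_special (φ := φ) (κ := κ) (l := l) (m := m) (a := a) (b := b) (x := x) (y := y) j
    change Curve _ _ _
    rw [← h2]
    exact h1
  | .inr i =>
    refine ⟨h.1.map, ?_⟩
    rw [← map_equation, van_mapRing]
    exact h.2

end Image

/-! ### The formulas for the half-steps as symmetric relations -/

section HalfSteps
variable {F : Type} [Field F] [Algebra ℂ F] {x X y Y : F} {C κ K l m L M a b : ℂ}

/-- The right-hand side is a product of nonzero functions, so neither `x y - 1` nor `x Y - 1` is
zero. The relation can then be solved for `y`, which makes `x, Y` coordinates; the other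
inequalities hold for any coordinates. -/
lemma Flip1.of_coord (hc : Coord x y) (hκ : C * κ * a * b = 1) (hm : m * L = C) (hM : M * l = C)
    (hab : a ≠ b)
    (rel : x * (x * y - 1) * (x * Y - 1) = -con C * (x - con a) * (x - con b)) :
    Flip1 C κ l m L M a b x y Y ∧ Coord x Y := by
  have hC : C ≠ 0 := by
    rintro rfl
    simp at hκ
  have hx0 := hc.left_ne_zero
  have hne : x * (x * y - 1) * (x * Y - 1) ≠ 0 := by
    rw [rel]
    exact mul_ne_zero (mul_ne_zero (neg_ne_zero.2 (con_ne_zero hC)) (hc.left_sub_ne_zero a))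
      (hc.left_sub_ne_zero b)
  have hW := right_ne_zero_of_mul hne
  have hw := right_ne_zero_of_mul (left_ne_zero_of_mul hne)
  have hc' : Coord x Y := hc.change fun S hS hx hY => by
    refine ⟨hx, ?_⟩
    have e : y = (-con C * (x - con a) * (x - con b) / (x * (x * Y - 1)) + 1) / x := by
      rw [← rel]
      field_simp
      ring
    rw [e]
    exact div_mem (add_mem (div_mem (mul_mem (mul_mem (neg_mem (hS C)) (sub_mem hx (hS a)))
      (sub_mem hx (hS b))) (mul_mem hx (sub_mem (mul_mem hx hY) (one_mem S)))) (one_mem S)) hx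
  exact ⟨{
    hκ := hκ
    hm := hm
    hM := hM
    hab := hab
    x0 := hx0
    y0 := hc.right_ne_zero
    Y0 := hc'.right_ne_zero
    w0 := hw
    W0 := hW
    xa := hc.left_sub_ne_zero a
    xb := hc.left_sub_ne_zero b
    ya := hc.right_sub_ne_zero _
    Ya := hc'.right_sub_ne_zero _
    yb := hc.right_sub_ne_zero _
    Yb := hc'.right_sub_ne_zero _
    s0 := hc.sq_mul_sub_ne_zero κ
    S0 := hc'.sq_mul_sub_ne_zero κ
    m0 := hc.mul_sub_ne_zero m
    M0 := hc'.mul_sub_ne_zero M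
    l0 := hc.right_sub_ne_zero l
    L0 := hc'.right_sub_ne_zero L
    rel := rel }, hc'⟩

lemma Flip2.of_coord (hc : Coord x y) (hκ : κ * K * (l * m * a * b) ^ 2 = 1) (hab : a ≠ b)
    (hla : l * a ≠ 1) (hlb : l * b ≠ 1) (hm : m ≠ 1)
    (rel : (y - con l) * (x * y - 1) * (X * y - 1) =
      -con l * con m * (con a * con b * y ^ 2 - (con a + con b) * y + 1)) :
    Flip2 κ K l m a b x X y ∧ Coord X y := by
  have h0 : l ≠ 0 ∧ m ≠ 0 ∧ a ≠ 0 ∧ b ≠ 0 := by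
    refine ⟨?_, ?_, ?_, ?_⟩ <;>
    · rintro rfl
      simp at hκ
  obtain ⟨hl0, hm0, ha0, hb0⟩ := h0
  have hy0 := hc.right_ne_zero
  have hne : (y - con l) * (x * y - 1) * (X * y - 1) ≠ 0 := by
    have ha := con_mul a a⁻¹ (F := F)
    have hb := con_mul b b⁻¹ (F := F)
    rw [mul_inv_cancel₀ ha0, con_one] at ha
    rw [mul_inv_cancel₀ hb0, con_one] at hb
    have e : con a * con b * y ^ 2 - (con a + con b) * y + 1 =
        con a * (y - con a⁻¹) * (con b * (y - con b⁻¹)) := by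
      linear_combination (con b * con b⁻¹ - con b * y) * ha + (1 - y * con a) * hb
    rw [rel, e]
    exact mul_ne_zero (mul_ne_zero (neg_ne_zero.2 (con_ne_zero hl0)) (con_ne_zero hm0))
      (mul_ne_zero (mul_ne_zero (con_ne_zero ha0) (hc.right_sub_ne_zero _))
        (mul_ne_zero (con_ne_zero hb0) (hc.right_sub_ne_zero _)))
  have hW := right_ne_zero_of_mul hne
  have hw := right_ne_zero_of_mul (left_ne_zero_of_mul hne)
  have hl := hc.right_sub_ne_zero l
  have hc' : Coord X y := hc.change fun S hS hX hy => by
    refine ⟨?_, hy⟩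
    have e : x = (-con l * con m * (con a * con b * y ^ 2 - (con a + con b) * y + 1) /
        ((y - con l) * (X * y - 1)) + 1) / y := by
      rw [← rel, mul_right_comm, mul_div_cancel_left₀ _ (mul_ne_zero hl hW), sub_add_cancel,
        mul_div_cancel_right₀ _ hy0]
    rw [e]
    exact div_mem (add_mem (div_mem (mul_mem (mul_mem (neg_mem (hS l)) (hS m))
      (add_mem (sub_mem (mul_mem (mul_mem (hS a) (hS b)) (pow_mem hy 2))
        (mul_mem (add_mem (hS a) (hS b)) hy)) (one_mem S)))
      (mul_mem (sub_mem hy (hS l)) (sub_mem (mul_mem hX hy) (one_mem S)))) (one_mem S)) hy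
  exact ⟨{
    hκ := hκ
    hab := hab
    hla := hla
    hlb := hlb
    hm := hm
    x0 := hc.left_ne_zero
    X0 := hc'.left_ne_zero
    y0 := hy0
    w0 := hw
    W0 := hW
    xa := hc.left_sub_ne_zero a
    Xa := hc'.left_sub_ne_zero a
    xb := hc.left_sub_ne_zero b
    Xb := hc'.left_sub_ne_zero b
    ya := hc.right_sub_ne_zero _
    yb := hc.right_sub_ne_zero _
    s0 := hc.sq_mul_sub_ne_zero κ
    S0 := hc'.sq_mul_sub_ne_zero K
    m0 := hc.mul_sub_ne_zero m
    M0 := hc'.mul_sub_ne_zero m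
    l0 := hl
    rel := rel }, hc'⟩

/-- Clearing denominators turns the given formula into the relation that is symmetric in `y` and
`Y`. -/
lemma forward_rel (hx : x ≠ 0) (hw : x * y - 1 ≠ 0)
    (hY : Y = (con C * (con b - x) * (x - 1) + x * (x * y - 1)) / (x ^ 2 * (x * y - 1))) :
    x * (x * y - 1) * (x * Y - 1) = -con C * (x - con 1) * (x - con b) := by
  rw [hY, con_one]
  field_simp
  ring

lemma backward_rel (hy : y ≠ 0) (hw : x * y - 1 ≠ 0) (hl : y - con l ≠ 0)
    (hX : X = ((y - con l) * (x * y - 1) - con (l * m) * (con b * y - 1) * (y - 1)) /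
      (y * (y - con l) * (x * y - 1))) :
    (y - con l) * (x * y - 1) * (X * y - 1) =
      -con l * con m * (con 1 * con b * y ^ 2 - (con 1 + con b) * y + 1) := by
  rw [hX, con_one, con_mul]
  generalize x * y - 1 = w at *
  field_simp
  ring

end HalfSteps

section Isomorphisms
variable {S S' : Model} {φ : K ≃ₐ[ℂ] K} {C κ κ' l m L M a b : ℂ}

lemma Flip1.isIsomorphism (h : Flip1 C κ l m L M a b x y (φ y)) (hx : φ x = x)
    (hS : Surf S κ l m a b) (hS' : Surf S' κ L M a b) : IsIsomorphism S S' φ := by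
  refine isIsomorphism_of (fun R hR => ?_) (fun R hR => ?_)
  · have h1 := Pt.map (φ := φ) ((hS'.mem_iff R).1 hR)
    rw [hx] at h1
    exact (hS.mem_iff _).2 (h.pt h1)
  · have h1 := Pt.map (φ := φ.symm) (h.symm.pt ((hS.mem_iff R).1 hR))
    rw [φ.symm_apply_apply, (φ.symm_apply_eq).2 hx.symm] at h1
    exact (hS'.mem_iff _).2 h1

lemma Flip2.isIsomorphism (h : Flip2 κ κ' l m a b x (φ x) y) (hy : φ y = y)
    (hS : Surf S κ l m a b) (hS' : Surf S' κ' l m a b) : IsIsomorphism S S' φ := by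
  refine isIsomorphism_of (fun R hR => ?_) (fun R hR => ?_)
  · have h1 := Pt.map (φ := φ) ((hS'.mem_iff R).1 hR)
    rw [hy] at h1
    exact (hS.mem_iff _).2 (h.pt h1)
  · have h1 := Pt.map (φ := φ.symm) (h.symm.pt ((hS.mem_iff R).1 hR))
    rw [φ.symm_apply_apply, (φ.symm_apply_eq).2 hy.symm] at h1
    exact (hS'.mem_iff _).2 h1

end Isomorphisms

/-! ### The action on classes as integer matrices -/

section Classes
variable {S S' : Model} {φ : K ≃ₐ[ℂ] K} {C κ κ' l m L M a b : ℂ}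

/-- The coefficients of the class of a curve with respect to the special curves. -/
def row : Fin 10 ⊕ Fin 8 → Fin 10 → ℤ
  | .inl j => fun k => if k = j then 1 else 0
  | .inr i => fun k => -orderTable i k

/-- For a curve `f = 0` of the plane, the divisor of `f` is that curve plus the special curves with
the multiplicities of `orderTable`; being principal, it gives the class. -/
lemma Surf.curveClass_of_onCurve (h : Surf S κ l m a b) (hla : l * a ≠ 1) (hlb : l * b ≠ 1)
    (hm : m ≠ 1) {P : PrimeDivisor S} {t : Fin 10 ⊕ Fin 8} (hP : OnCurve κ l m a b x y P.ring t) :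
    curveClass P = ∑ k, row t k • curveClass (h.curve k) := by
  match t with
  | .inl j =>
    rw [h.eq_curve hP]
    simp [row]
  | .inr i =>
    obtain ⟨hG, hv⟩ := hP
    have hc := coord_xy.equation l a b i
    have h1 := hG.curve_equation P.exists_unif hv
    rw [h.curveClass_eq hG (h1.uniformizer hc) (fun P' hG' => hG'.equation_mem i)
      fun P' hG' hv' => PrimeDivisor.ext_ring ((hG'.curve_equation P'.exists_unif hv').eq h1 hc)]
    refine Finset.sum_congr rfl fun k _ => ?_
    rw [(listed coord_xy h.params k (h.curve_spec k)).order hla hlb hm i]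
    rfl

lemma Surf.pic_curveClass (h : Surf S' κ l m a b) (hI : IsIsomorphism S S' φ) (hla : l * a ≠ 1)
    (hlb : l * b ≠ 1) (hm : m ≠ 1) {P : PrimeDivisor S} {t : Fin 10 ⊕ Fin 8}
    (hP : OnCurve κ l m a b (φ x) (φ y) P.ring t) :
    hI.pic (curveClass P) = ∑ k, row t k • curveClass (h.curve k) := by
  rw [hI.pic_curveClass]
  refine h.curveClass_of_onCurve hla hlb hm ?_
  have := OnCurve.map (φ := φ.symm) t hP
  rw [φ.symm_apply_apply, φ.symm_apply_apply] at this
  exact this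

/-- The classes `H_x, H_y, F_1, …, F_8`. -/
def genClass (S : Model) (κ l m a b : ℂ) (i : Fin 10) : Pic S :=
  cls (divisorOf fun P => mult κ l m a b x y P.ring i)

lemma Surf.genClass_eq (h : Surf S κ l m a b) (i : Fin 10) :
    genClass S κ l m a b i = ∑ j, multTable i j • curveClass (h.curve j) := by
  rw [genClass, h.cls_divisorOf fun P hG => hG.mult_eq_zero coord_xy i]
  refine Finset.sum_congr rfl fun j _ => ?_
  rw [(listed coord_xy h.params j (h.curve_spec j)).mult i]

/-- The inverse of the table of multiplicities. -/
def multTableInv : Fin 10 → Fin 10 → ℤ :=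
  ![![1, 0, 0, 0, 0, 0, 0, -1, 0, -1], ![0, 1, 0, 0, -1, -1, 0, 0, 0, 0],
    ![0, 0, 1, 0, 0, 0, 0, 0, 0, 0], ![0, 0, 0, 1, 0, 0, 0, 0, 0, 0],
    ![0, 0, 0, 0, 1, -1, 0, 0, 0, 0], ![0, 0, 0, 0, 0, 1, -1, 0, 0, 0],
    ![0, 0, 0, 0, 0, 0, 1, 0, 0, 0], ![0, 0, 0, 0, 0, 0, 0, 1, -1, 0],
    ![0, 0, 0, 0, 0, 0, 0, 0, 1, 0], ![0, 0, 0, 0, 0, 0, 0, 0, 0, 1]]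

/-- The action of the full step on `H_x, H_y, F_1, …, F_8`. -/
def stepTable : Fin 10 → Fin 10 → ℤ :=
  ![![1, 3, -1, -1, -1, 0, 0, -1, -1, -1], ![3, 6, -2, -2, -2, -1, -1, -3, -2, -3],
    ![1, 2, 0, -1, -1, 0, 0, -1, -1, -1], ![1, 2, -1, 0, -1, 0, 0, -1, -1, -1],
    ![1, 3, -1, -1, -1, 0, -1, -1, -1, -1], ![1, 3, -1, -1, -1, -1, 0, -1, -1, -1],
    ![1, 2, -1, -1, 0, 0, 0, -1, -1, -1], ![1, 2, -1, -1, -1, 0, 0, -1, 0, -1],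
    ![0, 1, 0, 0, 0, 0, 0, 0, 0, -1], ![0, 1, 0, 0, 0, 0, 0, -1, 0, 0]]

lemma multTable_mul_inv : Matrix.of multTable * Matrix.of multTableInv = 1 := by decide +kernel
lemma multTable_inv_mul : Matrix.of multTableInv * Matrix.of multTable = 1 := by decide +kernel

/-- Both sides are expressed in the special curves of the intermediate surface: the images of the
classes with index `n`, and the claimed combinations of the images of those with index `n + 1`.
Comparing there avoids inverting the matrix of the backward half-step. -/
lemma stepTable_eq : Matrix.of multTable * Matrix.of (fun j => row (forwardImage j)) =
    Matrix.of stepTable * (Matrix.of multTable * Matrix.of fun j => row (backwardImage j)) := by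
  decide +kernel

end Classes

section Combination
variable {V W : Type} [AddCommGroup V] [AddCommGroup W] {e g : Fin 10 → V} {e' : Fin 10 → W}

lemma sum_smul_sum (A B : Matrix (Fin 10) (Fin 10) ℤ) (i : Fin 10) :
    ∑ j, A i j • ∑ k, B j k • e k = ∑ k, (A * B) i k • e k := by
  simp only [Finset.smul_sum, smul_smul]
  rw [Finset.sum_comm]
  refine Finset.sum_congr rfl fun k _ => ?_
  rw [← Finset.sum_smul, Matrix.mul_apply]

lemma map_combination (Φ : V ≃ₗ[ℤ] W) (A B : Matrix (Fin 10) (Fin 10) ℤ)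
    (hg : ∀ i, g i = ∑ j, A i j • e j) (h : ∀ j, Φ (e j) = ∑ k, B j k • e' k) (i : Fin 10) :
    Φ (g i) = ∑ k, (A * B) i k • e' k := by
  rw [hg, map_sum, ← sum_smul_sum]
  refine Finset.sum_congr rfl fun j _ => ?_
  rw [map_zsmul, h]

lemma basis_change {A B : Matrix (Fin 10) (Fin 10) ℤ} (hg : ∀ i, g i = ∑ j, A i j • e j)
    (hAB : A * B = 1) (hBA : B * A = 1) (hi : LinearIndependent ℤ e)
    (hs : Submodule.span ℤ (Set.range e) = ⊤) :
    LinearIndependent ℤ g ∧ Submodule.span ℤ (Set.range g) = ⊤ := by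
  constructor
  · rw [Fintype.linearIndependent_iff] at hi ⊢
    intro c hc
    have h1 : Matrix.vecMul c A = 0 := by
      ext k
      refine hi _ ?_ k
      rw [← hc]
      simp only [hg, Finset.smul_sum, smul_smul]
      rw [Finset.sum_comm]
      refine Finset.sum_congr rfl fun k _ => ?_
      rw [← Finset.sum_smul]
      rfl
    have h2 : c = 0 := by
      rw [← Matrix.vecMul_one c, ← hAB, ← Matrix.vecMul_vecMul, h1, Matrix.zero_vecMul]
    exact congrFun h2
  · rw [eq_top_iff, ← hs, Submodule.span_le]
    rintro _ ⟨j, rfl⟩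
    have h1 : e j = ∑ i, B j i • g i := by
      simp only [hg, sum_smul_sum, hBA, Matrix.one_apply]
      simp
    rw [h1]
    exact Submodule.sum_mem _ fun i _ => Submodule.smul_mem _ _ (Submodule.subset_span ⟨i, rfl⟩)

end Combination

section Basis
variable {S S' : Model} {κ l m a b : ℂ}

lemma Surf.basis (h : Surf S κ l m a b) : LinearIndependent ℤ (genClass S κ l m a b) ∧
    Submodule.span ℤ (Set.range (genClass S κ l m a b)) = ⊤ :=
  basis_change h.genClass_eq multTable_mul_inv multTable_inv_mul h.linearIndependent_curveClass
    h.span_curveClass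

end Basis

/-! ### The q-Laguerre surfaces and the full step -/

section Laguerre
variable {q Q T : ℂ} {n : ℤ}

lemma surf_surface (hq : q ≠ 0) (hQ : Q ≠ 0) (hT : T ≠ 0) (hT1 : T ≠ 1) (n : ℤ) :
    Surf (surface q Q T n) (q ^ (-2 * n - 1) / (Q * T)) (q ^ n) (q ^ n * Q) 1 T where
  params :=
    { κ0 := div_ne_zero (zpow_ne_zero _ hq) (mul_ne_zero hQ hT)
      l0 := zpow_ne_zero _ hq
      m0 := mul_ne_zero (zpow_ne_zero _ hq) hQ
      a0 := one_ne_zero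
      b0 := hT
      hab := hT1.symm }
  mem_iff _ := mem_surface_iff hq hT1

/-- The surface through which the map factors: the forward half-step is an isomorphism from the
surface with index `n` onto it, and the backward half-step one from the surface with index
`n + 1`. -/
def middle (q Q T : ℂ) (n : ℤ) : Model :=
  {R | Pt (q ^ (-2 * n - 1) / (Q * T)) (q ^ (n + 1)) (q ^ (n + 1) * Q) 1 T x y R}

lemma surf_middle (hq : q ≠ 0) (hQ : Q ≠ 0) (hT : T ≠ 0) (hT1 : T ≠ 1) (n : ℤ) :
    Surf (middle q Q T n) (q ^ (-2 * n - 1) / (Q * T)) (q ^ (n + 1)) (q ^ (n + 1) * Q) 1 T where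
  params :=
    { κ0 := div_ne_zero (zpow_ne_zero _ hq) (mul_ne_zero hQ hT)
      l0 := zpow_ne_zero _ hq
      m0 := mul_ne_zero (zpow_ne_zero _ hq) hQ
      a0 := one_ne_zero
      b0 := hT
      hab := hT1.symm }
  mem_iff _ := Iff.rfl

/-- The constant `C = q ^ (2 n + 1) Q` is the product of `q ^ n Q` and `q ^ (n + 1)`, and also of `q
^ (n + 1) Q` and `q ^ n`. This is why `l` and `m` move from index `n` to `n + 1` while `κ`, the
inverse of `C T`, stays. -/
lemma exists_forward (hq : q ≠ 0) (hQ : Q ≠ 0) (hT : T ≠ 0) (hT1 : T ≠ 1) (n : ℤ) :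
    ∃ φ : K ≃ₐ[ℂ] K, IsForwardHalfStep q Q T n φ ∧
      Flip1 (q ^ (2 * n + 1) * Q) (q ^ (-2 * n - 1) / (Q * T)) (q ^ n) (q ^ n * Q)
        (q ^ (n + 1)) (q ^ (n + 1) * Q) 1 T x y (φ y) := by
  have hx := coord_xy.left_ne_zero
  have hw : x * y - 1 ≠ 0 := by simpa using coord_xy.mul_sub_ne_zero 0
  obtain ⟨h1, h2⟩ := Flip1.of_coord (C := q ^ (2 * n + 1) * Q)
    (κ := q ^ (-2 * n - 1) / (Q * T)) (l := q ^ n) (m := q ^ n * Q) (L := q ^ (n + 1))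
    (M := q ^ (n + 1) * Q) (b := T) coord_xy
    (by
      have : q ^ (2 * n + 1) * q ^ (-2 * n - 1) = 1 := by
        rw [← zpow_add₀ hq, show 2 * n + 1 + (-2 * n - 1) = 0 by ring, zpow_zero]
      field_simp
      linear_combination this)
    (by
      rw [show 2 * n + 1 = n + (n + 1) by ring, zpow_add₀ hq n (n + 1)]
      ring)
    (by
      rw [show 2 * n + 1 = n + (n + 1) by ring, zpow_add₀ hq n (n + 1)]
      ring) hT1.symm (forward_rel hx hw rfl)
  obtain ⟨φ, h3, h4⟩ := h2.exists_algEquiv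
  refine ⟨φ, ⟨h3, h4⟩, ?_⟩
  rw [h4]
  exact h1

lemma exists_backward (hq : q ≠ 0) (hQ : Q ≠ 0) (hT : T ≠ 0) (hT1 : T ≠ 1) (h₁ : q ^ (n + 1) ≠ 1)
    (h₂ : q ^ (n + 1) * T ≠ 1) (h₃ : q ^ (n + 1) * Q ≠ 1) :
    ∃ φ : K ≃ₐ[ℂ] K, IsBackwardHalfStep q Q T (n + 1) φ ∧
      Flip2 (q ^ (-2 * (n + 1) - 1) / (Q * T)) (q ^ (-2 * n - 1) / (Q * T)) (q ^ (n + 1))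
        (q ^ (n + 1) * Q) 1 T x (φ x) y := by
  have hy := coord_xy.right_ne_zero
  have hw : x * y - 1 ≠ 0 := by simpa using coord_xy.mul_sub_ne_zero 0
  -- The coefficient of the half-step is `l m` for the parameters with index `n + 1`, as the
  -- relation requires.
  have hC : q ^ (2 * (n + 1)) * Q = q ^ (n + 1) * (q ^ (n + 1) * Q) := by
    rw [two_mul, zpow_add₀ hq]
    ring
  obtain ⟨h1, h2⟩ := Flip2.of_coord (κ := q ^ (-2 * (n + 1) - 1) / (Q * T))
    (K := q ^ (-2 * n - 1) / (Q * T)) (l := q ^ (n + 1)) (m := q ^ (n + 1) * Q) (b := T) coord_xy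
    (by
      have : q ^ (-2 * (n + 1) - 1) * q ^ (-2 * n - 1) * (q ^ (n + 1) * q ^ (n + 1)) ^ 2 = 1 := by
        rw [← zpow_natCast, ← zpow_add₀ hq, ← zpow_add₀ hq, ← zpow_mul, ← zpow_add₀ hq]
        convert zpow_zero q using 2
        push_cast
        ring
      rw [div_mul_div_comm, div_mul_eq_mul_div, div_eq_one_iff_eq (by positivity)]
      linear_combination Q ^ 2 * T ^ 2 * this)
    hT1.symm (by rwa [mul_one]) h₂ h₃
    (backward_rel hy hw (coord_xy.right_sub_ne_zero _) rfl)
  obtain ⟨φ, h3, h4⟩ := h2.exists_algEquiv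
  refine ⟨φ, ⟨?_, h4⟩, ?_⟩
  · rw [h3, hC]
    rfl
  · rw [h3]
    exact h1

/-- The classes `H_x, H_y, F_1, …, F_8` on the surface with index `n`. -/
def lagClass (q Q T : ℂ) (n : ℤ) : Fin 10 → Pic (surface q Q T n) :=
  genClass (surface q Q T n) (q ^ (-2 * n - 1) / (Q * T)) (q ^ n) (q ^ n * Q) 1 T

lemma Hx_eq : Hx q Q T n = lagClass q Q T n 0 := rfl
lemma Hy_eq : Hy q Q T n = lagClass q Q T n 1 := rfl
lemma F_one_eq : F q Q T n 1 = lagClass q Q T n 2 := by rw [F, center_one]; rfl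
lemma F_two_eq : F q Q T n 2 = lagClass q Q T n 3 := by rw [F, center_two]; rfl
lemma F_three_eq : F q Q T n 3 = lagClass q Q T n 4 := by rw [F, center_three]; rfl
lemma F_four_eq : F q Q T n 4 = lagClass q Q T n 5 := by rw [F, center_four]; rfl
lemma F_five_eq : F q Q T n 5 = lagClass q Q T n 6 := by rw [F, center_five]; rfl
lemma F_six_eq : F q Q T n 6 = lagClass q Q T n 7 := by rw [F, center_six]; rfl
lemma F_seven_eq : F q Q T n 7 = lagClass q Q T n 8 := by rw [F, center_seven]; rfl
lemma F_eight_eq : F q Q T n 8 = lagClass q Q T n 9 := by rw [F, center_eight]; rfl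

lemma generators_eq : generators q Q T n = lagClass q Q T n ∘ (finSumFinEquiv (m := 2) (n := 8)) := by
  ext i
  match i with
  | .inl 0 => exact Hx_eq
  | .inl 1 => exact Hy_eq
  | .inr 0 => exact F_one_eq
  | .inr 1 => exact F_two_eq
  | .inr 2 => exact F_three_eq
  | .inr 3 => exact F_four_eq
  | .inr 4 => exact F_five_eq
  | .inr 5 => exact F_six_eq
  | .inr 6 => exact F_seven_eq
  | .inr 7 => exact F_eight_eq

theorem generators_basis (hq : q ≠ 0) (hQ : Q ≠ 0) (hT : T ≠ 0) (hT1 : T ≠ 1) (n : ℤ) :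
    LinearIndependent ℤ (generators q Q T n) ∧
      Submodule.span ℤ (Set.range (generators q Q T n)) = ⊤ := by
  obtain ⟨h1, h2⟩ := (surf_surface hq hQ hT hT1 n).basis
  rw [generators_eq]
  refine ⟨(linearIndependent_equiv _).2 h1, ?_⟩
  rw [EquivLike.range_comp]
  exact h2

theorem exists_step (hq : q ≠ 0) (hQ : Q ≠ 0) (hT : T ≠ 0) (hT1 : T ≠ 1) (h₁ : q ^ (n + 1) ≠ 1)
    (h₂ : q ^ (n + 1) * T ≠ 1) (h₃ : q ^ (n + 1) * Q ≠ 1) :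
    ∃ φ : K ≃ₐ[ℂ] K, IsFullStep q Q T n φ ∧
      IsIsomorphism (surface q Q T n) (surface q Q T (n + 1)) φ ∧
      ∃ Φ : Pic (surface q Q T n) ≃ₗ[ℤ] Pic (surface q Q T (n + 1)), IsPushforward φ Φ ∧
        ∀ i, Φ (lagClass q Q T n i) = ∑ j, stepTable i j • lagClass q Q T (n + 1) j := by
  obtain ⟨φ₁, hφ₁, hf₁⟩ := exists_forward hq hQ hT hT1 n
  obtain ⟨φ₂, hφ₂, hf₂⟩ := exists_backward hq hQ hT hT1 h₁ h₂ h₃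
  have hS := surf_surface hq hQ hT hT1 n
  have hS' := surf_surface hq hQ hT hT1 (n + 1)
  have hM := surf_middle hq hQ hT hT1 n
  have hI₁ := hf₁.isIsomorphism hφ₁.1 hS hM
  have hI₂ := hf₂.isIsomorphism hφ₂.2 hS' hM
  have hla : q ^ (n + 1) * 1 ≠ 1 := by rwa [mul_one]
  have h1 : ∀ i, hI₁.pic (lagClass q Q T n i) =
      ∑ k, (Matrix.of multTable * Matrix.of fun j => row (forwardImage j)) i k •
        curveClass (hM.curve k) :=
    map_combination hI₁.pic (Matrix.of multTable) _ hS.genClass_eq fun j =>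
      hM.pic_curveClass hI₁ hla h₂ h₃ (by
        rw [hφ₁.1]
        exact hf₁.onCurve coord_xy one_ne_zero hT (hS.curve_spec j))
  have h2 : ∀ i, hI₂.pic (lagClass q Q T (n + 1) i) =
      ∑ k, (Matrix.of multTable * Matrix.of fun j => row (backwardImage j)) i k •
        curveClass (hM.curve k) :=
    map_combination hI₂.pic (Matrix.of multTable) _ hS'.genClass_eq fun j =>
      hM.pic_curveClass hI₂ hla h₂ h₃ (by
        rw [hφ₂.2]
        exact hf₂.onCurve coord_xy one_ne_zero hT (hS'.curve_spec j))
  refine ⟨φ₂.symm.trans φ₁, ⟨φ₁, φ₂, hφ₁, hφ₂, fun f => rfl⟩, hI₁.trans hI₂.symm,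
    hI₁.pic.trans hI₂.pic.symm, hI₁.isPushforward.trans (hI₂.isPushforward.symm hI₂), fun i => ?_⟩
  -- The claim is moved to the intermediate surface, where it is the matrix identity.
  rw [LinearEquiv.trans_apply, LinearEquiv.symm_apply_eq, h1, stepTable_eq, ← sum_smul_sum, map_sum]
  refine Finset.sum_congr rfl fun j _ => ?_
  rw [map_zsmul, h2]
  rfl

end Laguerre

end QLaguerre

end

theorem mainTheorem2 (q Q T : ℂ) (n : ℤ) (hq : q ≠ 0) (hQ : Q ≠ 0) (hT : T ≠ 0) (hT1 : T ≠ 1)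
    (h₁ : q ^ (n + 1) ≠ 1) (h₂ : q ^ (n + 1) * T ≠ 1) (h₃ : q ^ (n + 1) * Q ≠ 1) :
    (∀ m : ℤ, LinearIndependent ℤ (generators q Q T m) ∧
      Submodule.span ℤ (Set.range (generators q Q T m)) = ⊤) ∧
    ∃ φ : K ≃ₐ[ℂ] K, IsFullStep q Q T n φ ∧
      IsIsomorphism (surface q Q T n) (surface q Q T (n + 1)) φ ∧
      ∃ Φ : Pic (surface q Q T n) ≃ₗ[ℤ] Pic (surface q Q T (n + 1)),
        IsPushforward φ Φ ∧
        Φ (Hx q Q T n) =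
          Hx q Q T (n + 1) + 3 • Hy q Q T (n + 1) - FF q Q T (n + 1) {1, 2, 3, 6, 7, 8} ∧
        Φ (Hy q Q T n) =
          3 • Hx q Q T (n + 1) + 6 • Hy q Q T (n + 1) - 2 • FF q Q T (n + 1) {1, 2, 3, 7} -
            FF q Q T (n + 1) {4, 5} - 3 • FF q Q T (n + 1) {6, 8} ∧
        Φ (F q Q T n 1) =
          Hx q Q T (n + 1) + 2 • Hy q Q T (n + 1) - FF q Q T (n + 1) {2, 3, 6, 7, 8} ∧
        Φ (F q Q T n 2) =
          Hx q Q T (n + 1) + 2 • Hy q Q T (n + 1) - FF q Q T (n + 1) {1, 3, 6, 7, 8} ∧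
        Φ (F q Q T n 3) =
          Hx q Q T (n + 1) + 3 • Hy q Q T (n + 1) - FF q Q T (n + 1) {1, 2, 3, 5, 6, 7, 8} ∧
        Φ (F q Q T n 4) =
          Hx q Q T (n + 1) + 3 • Hy q Q T (n + 1) - FF q Q T (n + 1) {1, 2, 3, 4, 6, 7, 8} ∧
        Φ (F q Q T n 5) =
          Hx q Q T (n + 1) + 2 • Hy q Q T (n + 1) - FF q Q T (n + 1) {1, 2, 6, 7, 8} ∧
        Φ (F q Q T n 6) =
          Hx q Q T (n + 1) + 2 • Hy q Q T (n + 1) - FF q Q T (n + 1) {1, 2, 3, 6, 8} ∧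
        Φ (F q Q T n 7) = Hy q Q T (n + 1) - FF q Q T (n + 1) {8} ∧
        Φ (F q Q T n 8) = Hy q Q T (n + 1) - FF q Q T (n + 1) {6} := by
  refine ⟨generators_basis hq hQ hT hT1, ?_⟩
  obtain ⟨φ, h1, h2, Φ, h3, h4⟩ := exists_step hq hQ hT hT1 h₁ h₂ h₃
  refine ⟨φ, h1, h2, Φ, h3, ?_⟩
  simp only [FF, Hx_eq, Hy_eq, F_one_eq, F_two_eq, F_three_eq, F_four_eq, F_five_eq, F_six_eq,
    F_seven_eq, F_eight_eq, h4]
  refine ⟨?_, ?_, ?_, ?_, ?_, ?_, ?_, ?_, ?_, ?_⟩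
  all_goals
    simp [Fin.sum_univ_succ, stepTable, F_one_eq, F_two_eq, F_three_eq, F_four_eq,
      F_five_eq, F_six_eq, F_seven_eq, F_eight_eq]
    abel
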